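/- Conventions. Space is $\mathbb R^2$, $\hat f(\xi,\tau)=\int e^{-i(x\cdot\xi+t\tau)}f(x,t)\,dx\,dt$, and $|(\xi,\tau)|=(|\tau|+|\xi|^2)^{1/2}$. Frequency localization. Fix a nonnegative smooth $\varphi_0$ on $[0,\infty)$ with $\varphi_0=1$ on $[0,1]$ and $\varphi_0=0$ on $[2,\infty)$, and put $\varphi_i(x)=\varphi_0(2^{-i}x)-\varphi_0(2^{-i+1}x)$ for $i\ge1$. For $i\ge 0$ and $d\in I_i=\{2^{-i},2^{-i+1},\dots,2^{i+2}\}$ let $S_{i,d}$ be the Fourier multiplier with symbol $\varphi_{i,d}(\xi,\tau)=\varphi_i(|(\xi,\tau)|)\,\varphi_{i+\log_2 d}(|\tau-|\xi|^2|)$, and let $S_{i,\le d}=\sum_{d'\in I_i,\,d'\le d}S_{i,d'}$. Let $A_i$ be the support of $\varphi_i(|(\xi,\tau)|)$ and $A_{i,\le d}$ the support of the symbol of $S_{i,\le d}$. Wave packets. Let $\Xi\subset\mathbb R^2$ be the set of points with polar coordinates $r=n$, $\theta=\frac{\pi}{2}\frac kn$, where $n,k$ are positive integers. Fix a smooth nonnegative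 partition of unity $(\phi_\xi)_{\xi\in\Xi}$ of $\mathbb R^2$ such that $\phi_\xi$ is supported within a bounded distance of $\xi$ (uniformly in $\xi$) and each derivative of $\phi_\xi$ is bounded uniformly in $\xi$. Let $f_\xi$ be the result of applying to $f$ the Fourier multiplier in $x$ with symbol $\phi_\xi$. Let $Q_i^m$ be the half-open cube of side $2^i$ centered at $2^im$, $m\in\mathbb Z^2$, with sides parallel to the axes, let $Q^m=Q^m_0$, and let $T_\xi^{m,l}=\{(x,t): t\in[l,l+1],\ x+2t\xi\in Q^m\}$. Put $$\|f\|_{Y_\xi}^2=\sum_{(m,l)\in\mathbb Z^2\times\mathbb Z}\|f\|^2_{L^\infty_tL^2_x(T_\xi^{m,l})},\qquad \|f\|_{\mathcal Y_\xi}^2=\sum_{(m,l)}\|f\|^2_{L^1_tL^2_x(T_\xi^{m,l})},$$ $$\|f\|_Y^2=\sum_{\xi\in\Xi}\|f_\xi\|_{Y_\xi}^2,\qquad \|f\|_{\mathcal Y}^2=\sum_{\xi\in\Xi}\|f_\xi\|_{\mathcal Y_\xi}^2 .$$ Decay. For a line $L$ through the origin with unit normal $\bar n$ and $k\in\mathbb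 Z$ let $L_i^k=L+k2^i\bar n$. Put $$\|f\|_{\mathcal D_iL^2}=\sup_{L,k}\sum_{m:\,Q_i^m\cap L_i^k\ne\emptyset}\|f\|_{L^2(Q_i^m\times\mathbb R)},$$ $$\|f\|^2_{\mathcal DX^{0,\frac12,1}}=\sum_{i\ge0}\Big(\sum_{d\in I_i}(2^id)^{\frac12}\big(\|S_{i,d}f\|_{\mathcal D_iL^2}+\|S_{i,d}f\|_{L^2}\big)\Big)^2,$$ $$\|f\|_{\mathcal DY_j}=\sup_{L,k}\sum_{m:\,Q_j^m\cap L_j^k\ne\emptyset}\Big(\sum_{\xi\in\Xi}\|\chi_{Q_j^m\times\mathbb R}f_\xi\|^2_{Y_\xi}\Big)^{\frac12}+\|f\|_Y,$$ and define $\|f\|_{\mathcal D\mathcal Y_j}$ in the same way with $\mathcal Y_\xi,\mathcal Y$ in place of $Y_\xi,Y$. Proposition. There is a constant $C$, depending only on the choice of $\varphi_0$ and $(\phi_\xi)_{\xi\in\Xi}$, such that for all integers $i,j\ge0$ with $5i\le j$, all $u_i\in L^2(\mathbb R^2\times\mathbb R)$ with $\hat u_i$ supported in $A_i$, and all $v_{j,\le2^{-i}}\in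 L^2(\mathbb R^2\times\mathbb R)$ with Fourier transform supported in $A_{j,\le2^{-i}}$, $$\|S_{j,\le2^{-i}}(v_{j,\le2^{-i}}\cdot u_i)\|_{\mathcal Y}\le C\,2^{i-j}\,\|v_{j,\le2^{-i}}\|_{Y}\,\|u_i\|_{\mathcal DX^{0,\frac12,1}},$$ and also, with decay, $$\|S_{j,\le2^{-i}}(v_{j,\le2^{-i}}\cdot u_i)\|_{\mathcal D\mathcal Y_j}\le C\,2^{i-j}\,\|v_{j,\le2^{-i}}\|_{\mathcal DY_j}\,\|u_i\|_{\mathcal DX^{0,\frac12,1}}.$$ (The right-hand sides may be infinite.) -/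

import Mathlib

open MeasureTheory Set
open scoped ENNReal NNReal SchwartzMap ContDiff

/-- The plane, with its Euclidean norm (used both for `x` and for the dual variable `ξ`). -/
abbrev Plane : Type := EuclideanSpace ℝ (Fin 2)

/-- Space-time (points `(x, t)`) and also its dual (points `(ξ, τ)`). -/
abbrev SpaceTime : Type := Plane × ℝ

/-! ### Fourier transform, multipliers, Fourier support

The convention is `f̂(ξ, τ) = ∫ exp(-i (x·ξ + t τ)) f(x, t) dx dt`. -/

/-- The phase `x·ξ + t τ`. -/
noncomputable def stPhase (z ζ : SpaceTime) : ℝ := inner ℝ z.1 ζ.1 + z.2 * ζ.2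

/-- The space-time Fourier transform (given by an integral). -/
noncomputable def stFourier (ψ : SpaceTime → ℂ) (z : SpaceTime) : ℂ :=
  ∫ ζ, Complex.exp (-Complex.I * (stPhase z ζ : ℂ)) * ψ ζ

/-- The inverse Fourier transform of a (continuous, compactly supported) symbol. -/
noncomputable def stKernel (a : SpaceTime → ℝ) (z : SpaceTime) : ℂ :=
  (((2 * Real.pi) ^ 3)⁻¹ : ℝ) * ∫ ζ, Complex.exp (Complex.I * (stPhase z ζ : ℂ)) * (a ζ : ℂ)

/-- The Fourier multiplier with symbol `a`, that is, convolution with the inverse Fourier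
transform of `a`. -/
noncomputable def stMult (a : SpaceTime → ℝ) (f : SpaceTime → ℂ) (z : SpaceTime) : ℂ :=
  ∫ w, stKernel a (z - w) * f w

/-- The inverse Fourier transform, in `x` only, of a symbol on the plane. -/
noncomputable def xKernel (b : Plane → ℝ) (x : Plane) : ℂ :=
  (((2 * Real.pi) ^ 2)⁻¹ : ℝ) * ∫ ξ, Complex.exp (Complex.I * (inner ℝ x ξ : ℝ)) * (b ξ : ℂ)

/-- The Fourier multiplier with symbol `b(ξ)`: convolution in `x` only, at each fixed time. -/
noncomputable def xMult (b : Plane → ℝ) (f : SpaceTime → ℂ) (z : SpaceTime) : ℂ :=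
  ∫ y, xKernel b (z.1 - y) * f (y, z.2)

/-- The Fourier transform of `f`, as a tempered distribution, is supported in `A`:
`⟨f̂, ψ⟩ = ⟨f, ψ̂⟩ = 0` for every Schwartz function `ψ` with support disjoint from `A`. -/
def FourierSupportedIn (f : SpaceTime → ℂ) (A : Set SpaceTime) : Prop :=
  ∀ ψ : 𝓢(SpaceTime, ℂ), Disjoint (tsupport ψ) A → ∫ z, f z * stFourier ψ z = 0

/-! ### Dyadic localization -/

/-- A nonnegative smooth function on `[0, ∞)` equal to `1` on `[0, 1]` and to `0` on `[2, ∞)`.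
The values at negative arguments are irrelevant. -/
structure DyadicCutoff where
  toFun : ℝ → ℝ
  smooth : ContDiffOn ℝ ∞ toFun (Ici 0)
  nonneg : ∀ x, 0 ≤ x → 0 ≤ toFun x
  eq_one : ∀ x, 0 ≤ x → x ≤ 1 → toFun x = 1
  eq_zero : ∀ x, 2 ≤ x → toFun x = 0

/-- `φ₀`, and `φᵢ(x) = φ₀(2^{-i} x) - φ₀(2^{-i+1} x)` for `i ≥ 1`. -/
noncomputable def DyadicCutoff.piece (φ₀ : DyadicCutoff) : ℕ → ℝ → ℝ
  | 0, x => φ₀.toFun x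
  | i + 1, x => φ₀.toFun (x / 2 ^ (i + 1)) - φ₀.toFun (x / 2 ^ i)

/-- `|(ξ, τ)| = (|τ| + ξ²)^{1/2}`. -/
noncomputable def parNorm (ζ : SpaceTime) : ℝ := Real.sqrt (|ζ.2| + ‖ζ.1‖ ^ 2)

/-- `|τ - ξ²|`. -/
noncomputable def parDist (ζ : SpaceTime) : ℝ := |ζ.2 - ‖ζ.1‖ ^ 2|

/-- The symbol `φᵢ(|(ξ, τ)|)` of the operator `Sᵢ`. -/
noncomputable def symFreq (φ₀ : DyadicCutoff) (i : ℕ) (ζ : SpaceTime) : ℝ :=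
  φ₀.piece i (parNorm ζ)

/-- The symbol `φ_{i,d}` of `S_{i,d}`, for `d = 2^{k-i}`, so that `2^i d = 2^k`. The set
`{2^{-i}, …, 2^{i+2}}` of admissible `d` corresponds to `0 ≤ k ≤ 2 i + 2`. -/
noncomputable def symMod (φ₀ : DyadicCutoff) (i k : ℕ) (ζ : SpaceTime) : ℝ :=
  φ₀.piece i (parNorm ζ) * φ₀.piece k (parDist ζ)

/-- The symbol of `S_{i, ≤ d}` for `d = 2^e`: the sum of `φ_{i,d'}` over admissible
`d' = 2^{k-i} ≤ 2^e`. -/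
noncomputable def symModLe (φ₀ : DyadicCutoff) (i : ℕ) (e : ℤ) (ζ : SpaceTime) : ℝ :=
  ∑ k ∈ (Finset.range (2 * i + 3)).filter (fun k : ℕ => (k : ℤ) - (i : ℤ) ≤ e),
    symMod φ₀ i k ζ

/-- `Aᵢ`, the support of the symbol of `Sᵢ`. -/
noncomputable def freqRegion (φ₀ : DyadicCutoff) (i : ℕ) : Set SpaceTime :=
  tsupport (symFreq φ₀ i)

/-- `A_{i, ≤ d}` with `d = 2^e`, the support of the symbol of `S_{i, ≤ d}`. -/
noncomputable def modLeRegion (φ₀ : DyadicCutoff) (i : ℕ) (e : ℤ) : Set SpaceTime :=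
  tsupport (symModLe φ₀ i e)

/-! ### Wave packets -/

/-- The polar lattice: in polar coordinates `r = n` and `θ = (π/2)(k/n)`, with `n, k` positive
integers. -/
def polarLattice : Set Plane :=
  {ξ | ∃ n k : ℕ, 0 < n ∧ 0 < k ∧
    ξ = !₂[(n : ℝ) * Real.cos (Real.pi / 2 * ((k : ℝ) / n)),
           (n : ℝ) * Real.sin (Real.pi / 2 * ((k : ℝ) / n))]}

/-- A smooth nonnegative partition of unity on the plane adapted to the cells of bounded size
around the points of the polar lattice, with uniform bounds on all derivatives. -/
structure PacketPartition where
  toFun : polarLattice → Plane → ℝ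
  smooth : ∀ ξ, ContDiff ℝ ∞ (toFun ξ)
  nonneg : ∀ ξ x, 0 ≤ toFun ξ x
  localized : ∃ R : ℝ, ∀ ξ, tsupport (toFun ξ) ⊆ Metric.closedBall (ξ : Plane) R
  deriv_bound : ∀ n : ℕ, ∃ C : ℝ, ∀ ξ x, ‖iteratedFDeriv ℝ n (toFun ξ) x‖ ≤ C
  sum_eq_one : ∀ x, HasSum (fun ξ => toFun ξ x) 1

/-- The cube `Q_i^m` of side `2^i` centered at `2^i m`; the cubes with fixed `i` partition the
plane, and `i = 0` gives the unit cubes `Q^m`. -/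
def planeCube (i : ℕ) (m : Fin 2 → ℤ) : Set Plane :=
  {x | ∀ a, (2 : ℝ) ^ i * ((m a : ℝ) - 1 / 2) ≤ x a ∧ x a < (2 : ℝ) ^ i * ((m a : ℝ) + 1 / 2)}

/-- The `L²` norm in `x` of `f(·, t)` over the slice `Q^m - 2 t ξ` at time `t` of the tubes with
velocity `-2 ξ`. -/
noncomputable def tubeSlice (ξ : Plane) (m : Fin 2 → ℤ) (f : SpaceTime → ℂ) (t : ℝ) : ℝ≥0∞ :=
  eLpNorm (fun x : Plane => f (x, t)) 2 (volume.restrict {x | x + (2 * t) • ξ ∈ planeCube 0 m})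

/-- The norm of `Y_ξ`: the `ℓ²` sum over `(m, l)` of the norms in `L^∞_t L²_x(T_ξ^{m,l})`, where
`T_ξ^{m,l}` consists of the `(x, t)` with `t ∈ [l, l+1]` and `x ∈ Q^m - 2 t ξ`. -/
noncomputable def packetNormSup (ξ : Plane) (f : SpaceTime → ℂ) : ℝ≥0∞ :=
  (∑' p : (Fin 2 → ℤ) × ℤ,
    essSup (tubeSlice ξ p.1 f) (volume.restrict (Icc (p.2 : ℝ) ((p.2 : ℝ) + 1))) ^ 2)
    ^ (1 / 2 : ℝ)

/-- The norm of `𝒴_ξ`: the `ℓ²` sum over `(m, l)` of the norms in `L^1_t L²_x(T_ξ^{m,l})`. -/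
noncomputable def packetNormInt (ξ : Plane) (f : SpaceTime → ℂ) : ℝ≥0∞ :=
  (∑' p : (Fin 2 → ℤ) × ℤ,
    (∫⁻ t in Icc (p.2 : ℝ) ((p.2 : ℝ) + 1), tubeSlice ξ p.1 f t) ^ 2)
    ^ (1 / 2 : ℝ)

/-- The norm of `Y = Y⁰`. -/
noncomputable def normY (φ : PacketPartition) (f : SpaceTime → ℂ) : ℝ≥0∞ :=
  (∑' ξ : polarLattice, packetNormSup ξ (xMult (φ.toFun ξ) f) ^ 2) ^ (1 / 2 : ℝ)

/-- The norm of `𝒴 = 𝒴⁰`. -/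
noncomputable def normCalY (φ : PacketPartition) (f : SpaceTime → ℂ) : ℝ≥0∞ :=
  (∑' ξ : polarLattice, packetNormInt ξ (xMult (φ.toFun ξ) f) ^ 2) ^ (1 / 2 : ℝ)

/-! ### The decay structure -/

/-- For the line `L` through the origin with unit normal `n`, the line `L_i^k = L + k 2^i n`. -/
def shiftedLine (n : Plane) (i : ℕ) (k : ℤ) : Set Plane :=
  {x | ∃ y : Plane, inner ℝ n y = (0 : ℝ) ∧ x = y + ((k : ℝ) * 2 ^ i) • n}

/-- `sup_L sup_k ∑ a(m)`, the sum being over the `m` for which `Q_i^m` meets `L_i^k`. -/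
noncomputable def lineSum (i : ℕ) (a : (Fin 2 → ℤ) → ℝ≥0∞) : ℝ≥0∞ :=
  ⨆ n : {n : Plane // ‖n‖ = 1}, ⨆ k : ℤ,
    ∑' m : {m : Fin 2 → ℤ // (planeCube i m ∩ shiftedLine n i k).Nonempty}, a m

/-- The norm of `𝒟_i L²` for functions on space-time. -/
noncomputable def normDL2 (i : ℕ) (f : SpaceTime → ℂ) : ℝ≥0∞ :=
  lineSum i (fun m => eLpNorm f 2 (volume.restrict (planeCube i m ×ˢ (univ : Set ℝ))))

/-- The norm of `𝒟X^{0,1/2,1}`: the `ℓ²` sum over `i` of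
`∑_d (2^i d)^{1/2} (‖S_{i,d} f‖_{𝒟_i L²} + ‖S_{i,d} f‖_{L²})`, where `2^i d = 2^k`. -/
noncomputable def normDX (φ₀ : DyadicCutoff) (f : SpaceTime → ℂ) : ℝ≥0∞ :=
  (∑' i : ℕ, (∑ k ∈ Finset.range (2 * i + 3),
    ((2 : ℝ≥0∞) ^ k) ^ (1 / 2 : ℝ) *
      (normDL2 i (stMult (symMod φ₀ i k) f) + eLpNorm (stMult (symMod φ₀ i k) f) 2 volume)) ^ 2)
    ^ (1 / 2 : ℝ)

/-- The norm of `𝒟_j Y_j`. For `f` with Fourier transform supported in `A_{j, ≤ d}`, `d ≤ 1`, only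
`ξ` of size comparable to `2^j` contribute to the sum over `ξ`. -/
noncomputable def normDY (φ : PacketPartition) (j : ℕ) (f : SpaceTime → ℂ) : ℝ≥0∞ :=
  lineSum j (fun m => (∑' ξ : polarLattice,
    packetNormSup ξ
      ((planeCube j m ×ˢ (univ : Set ℝ)).indicator (xMult (φ.toFun ξ) f)) ^ 2) ^ (1 / 2 : ℝ))
    + normY φ f

/-- The norm of `𝒟_j 𝒴_j`, obtained from that of `𝒟_j Y_j` by putting `𝒴` for `Y`. -/
noncomputable def normDCalY (φ : PacketPartition) (j : ℕ) (f : SpaceTime → ℂ) : ℝ≥0∞ :=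
  lineSum j (fun m => (∑' ξ : polarLattice,
    packetNormInt ξ
      ((planeCube j m ×ˢ (univ : Set ℝ)).indicator (xMult (φ.toFun ξ) f)) ^ 2) ^ (1 / 2 : ℝ))
    + normCalY φ f

open ENNReal (ofReal ofReal_mul ofReal_ne_top ofReal_le_ofReal ofReal_pow ofReal_one
  ofReal_sum_of_nonneg ofReal_lt_top ofReal_add tsum_le_tsum mul_ne_top mul_lt_top rpow_mul
  rpow_natCast pow_le_pow_left_iff le_tsum pow_ne_top add_ne_top)
open Complex (exp I exp_add norm_real)
open Real (norm_eq_abs norm_of_nonneg)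
open Finset (mul_sum sum_mul sum_congr sum_le_sum)
open MeasureTheory.Measure (volume_eq_prod)
open scoped Real

local notation "ℤ²" => Fin 2 → ℤ
local notation "ℂˢᵗ" => SpaceTime → ℂ

noncomputable section
set_option linter.unusedSectionVars false

/-! ### Cauchy–Schwarz in `ℝ≥0∞` -/

lemma lintegral_mul_sq_le {α : Type*} [MeasurableSpace α] {μ : Measure α} {f g : α → ℝ≥0∞}
    (hf : AEMeasurable f μ) (hg : AEMeasurable g μ) :
    (∫⁻ x, f x * g x ∂μ) ^ 2 ≤ (∫⁻ x, f x ^ 2 ∂μ) * ∫⁻ x, g x ^ 2 ∂μ := by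
  have h := ENNReal.lintegral_mul_le_Lp_mul_Lq μ Real.HolderConjugate.two_two hf hg
  simp only [Pi.mul_apply, ENNReal.rpow_two] at h
  calc (∫⁻ x, f x * g x ∂μ) ^ 2
      ≤ ((∫⁻ x, f x ^ 2 ∂μ) ^ (1 / 2 : ℝ) * (∫⁻ x, g x ^ 2 ∂μ) ^ (1 / 2 : ℝ)) ^ 2 := by gcongr
    _ = _ := by
      rw [mul_pow, ← rpow_natCast, ← rpow_natCast, ← rpow_mul,
        ← rpow_mul]
      simp

/-- Cauchy–Schwarz with respect to a density. -/
lemma lintegral_mul_sq_le_weighted {α : Type*} [MeasurableSpace α] {μ : Measure α}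
    {k g : α → ℝ≥0∞} (hk : AEMeasurable k μ) (hg : AEMeasurable g μ) :
    (∫⁻ x, k x * g x ∂μ) ^ 2 ≤ (∫⁻ x, k x ∂μ) * ∫⁻ x, k x * g x ^ 2 ∂μ := by
  have hs : ∀ x, k x = k x ^ (1 / 2 : ℝ) * k x ^ (1 / 2 : ℝ) := by
    intro x
    rw [← ENNReal.rpow_add_of_nonneg _ _ (by norm_num) (by norm_num)]
    norm_num
  have h := lintegral_mul_sq_le (μ := μ) (f := fun x => k x ^ (1 / 2 : ℝ))
    (g := fun x => k x ^ (1 / 2 : ℝ) * g x) (hk.pow_const _) ((hk.pow_const _).mul hg)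
  simp only [mul_pow] at h
  calc (∫⁻ x, k x * g x ∂μ) ^ 2
      = (∫⁻ x, k x ^ (1 / 2 : ℝ) * (k x ^ (1 / 2 : ℝ) * g x) ∂μ) ^ 2 := by
        congr 1; refine lintegral_congr fun x => ?_
        rw [← mul_assoc, ← hs]
    _ ≤ _ := h
    _ = _ := by simp only [sq, ← mul_assoc, ← hs]

lemma tsum_mul_sq_le {α : Type*} (f g : α → ℝ≥0∞) :
    (∑' x, f x * g x) ^ 2 ≤ (∑' x, f x ^ 2) * ∑' x, g x ^ 2 := by
  let _ : MeasurableSpace α := ⊤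
  have h := lintegral_mul_sq_le (μ := Measure.count) (f := f) (g := g)
    measurable_from_top.aemeasurable measurable_from_top.aemeasurable
  simpa [lintegral_count] using h

lemma tsum_mul_sq_le_weighted {α : Type*} (k g : α → ℝ≥0∞) :
    (∑' x, k x * g x) ^ 2 ≤ (∑' x, k x) * ∑' x, k x * g x ^ 2 := by
  let _ : MeasurableSpace α := ⊤
  have h := lintegral_mul_sq_le_weighted (μ := Measure.count) (k := k) (g := g)
    measurable_from_top.aemeasurable measurable_from_top.aemeasurable
  simpa [lintegral_count] using h

/-! ### Fourier analysis on a Euclidean space -/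

section FourierEuclidean

open Module FourierTransform

variable {E : Type*} [NormedAddCommGroup E] [InnerProductSpace ℝ E] [FiniteDimensional ℝ E]
  [MeasurableSpace E] [BorelSpace E]

/-- The inverse Fourier transform with kernel `exp(i⟨x, ξ⟩)`, normalized by `(2π)^{-d}`. -/
def gker (m : E → ℂ) (x : E) : ℂ :=
  (((2 * π) ^ finrank ℝ E)⁻¹ : ℝ) *
    ∫ ξ, exp (I * (inner ℝ x ξ : ℝ)) * m ξ

/-- The Fourier transform with kernel `exp(-i⟨y, ξ⟩)`. -/
def gft (h : E → ℂ) (ξ : E) : ℂ :=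
  ∫ y, exp (-I * (inner ℝ y ξ : ℝ)) * h y

/-- The Fourier multiplier with symbol `m`, as a convolution. -/
def gconv (m h : E → ℂ) (x : E) : ℂ := ∫ y, gker m (x - y) * h y

lemma norm_cexp_I_mul (t : ℝ) : ‖exp (I * (t : ℂ))‖ = 1 := by
  rw [mul_comm]; exact Complex.norm_exp_ofReal_mul_I t

lemma norm_cexp_neg_I_mul (t : ℝ) : ‖exp (-I * (t : ℂ))‖ = 1 := by
  rw [show -I * (t : ℂ) = ((-t : ℝ) : ℂ) * I by push_cast; ring]
  exact Complex.norm_exp_ofReal_mul_I _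

lemma gker_eq_fourierInv (m : E → ℂ) (x : E) :
    gker m x = (((2 * π) ^ finrank ℝ E)⁻¹ : ℝ) * 𝓕⁻ m ((2 * π)⁻¹ • x) := by
  rw [gker, Real.fourierInv_eq']
  congr 1
  refine integral_congr_ae (ae_of_all _ fun ξ => ?_)
  simp only [smul_eq_mul]
  congr 2
  rw [inner_smul_right, real_inner_comm x ξ]
  have : (π : ℂ) ≠ 0 := by exact_mod_cast Real.pi_ne_zero
  push_cast
  field_simp

lemma gft_eq_fourier (h : E → ℂ) (ξ : E) : gft h ξ = 𝓕 h ((2 * π)⁻¹ • ξ) := by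
  rw [gft, Real.fourier_eq']
  refine integral_congr_ae (ae_of_all _ fun y => ?_)
  simp only [smul_eq_mul]
  congr 2
  rw [inner_smul_right]
  have : (π : ℂ) ≠ 0 := by exact_mod_cast Real.pi_ne_zero
  push_cast
  field_simp

lemma lintegral_comp_smul_two_pi (F : E → ℝ≥0∞) :
    ∫⁻ x, F ((2 * π)⁻¹ • x) = ofReal ((2 * π) ^ finrank ℝ E) * ∫⁻ x, F x := by
  have hr : (2 * π)⁻¹ ≠ 0 := by positivity
  have h1 := Measure.map_addHaar_smul (volume : Measure E) hr
  have e : MeasurableEmbedding (fun x : E => (2 * π)⁻¹ • x) :=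
    (Homeomorph.smulOfNeZero _ hr).measurableEmbedding
  rw [← e.lintegral_map (μ := volume), h1, lintegral_smul_measure]
  rw [smul_eq_mul]
  congr 2
  rw [abs_of_pos (by positivity), inv_pow, inv_inv]

lemma fourier_memLp_two {a : E → ℂ} (ha : Integrable a) (ha2 : MemLp a 2) :
    ∫⁻ x, ‖𝓕 a x‖ₑ ^ 2 = ∫⁻ x, ‖a x‖ₑ ^ 2 := by
  have key : ((𝓕 (ha2.toLp a) : Lp ℂ 2 (volume : Measure E)) : E → ℂ) =ᵐ[volume] 𝓕 a := by
    have hc : Continuous (𝓕 a) := by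
      have := VectorFourier.fourierIntegral_continuous (μ := (volume : Measure E))
        (L := innerₗ E) Real.continuous_fourierChar continuous_inner ha
      exact this
    have hl1 : LocallyIntegrable ((𝓕 (ha2.toLp a) : Lp ℂ 2 (volume : Measure E)) : E → ℂ) :=
      (Lp.memLp _).locallyIntegrable (by norm_num)
    refine ae_eq_of_integral_contDiff_smul_eq hl1 hc.locallyIntegrable fun g hg hgs => ?_
    have hgC : ContDiff ℝ ∞ (fun x => (g x : ℂ)) := Complex.ofRealCLM.contDiff.comp hg
    have hgsC : HasCompactSupport (fun x => (g x : ℂ)) :=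
      hgs.comp_left (g := fun x : ℝ => (x : ℂ)) (by simp)
    set G : 𝓢(E, ℂ) := hgsC.toSchwartzMap hgC
    have hGv : ∀ x, G x = (g x : ℂ) := fun x => rfl
    have h1 := Lp.toTemperedDistribution_apply
      (𝓕 (ha2.toLp a) : Lp ℂ 2 (volume : Measure E)) G
    have h2 : ((𝓕 (ha2.toLp a) : Lp ℂ 2 (volume : Measure E)) : TemperedDistribution E ℂ) G
        = ∫ x, (𝓕 G) x • (ha2.toLp a) x := by
      rw [← Lp.fourier_toTemperedDistribution_eq, TemperedDistribution.fourier_apply,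
        Lp.toTemperedDistribution_apply]
    have h3 : ∫ x, (𝓕 G) x • (ha2.toLp a) x = ∫ x, (𝓕 G) x • a x := by
      refine integral_congr_ae ?_
      filter_upwards [ha2.coeFn_toLp] with x hx
      rw [hx]
    have h4 : ∫ x, (𝓕 G) x • a x = ∫ x, G x • 𝓕 a x := by
      have := VectorFourier.integral_fourierIntegral_smul_eq_flip (L := innerₗ E)
        (μ := (volume : Measure E)) (ν := (volume : Measure E))
        Real.continuous_fourierChar continuous_inner G.integrable ha
      simpa using! this
    calc ∫ x, g x • ((𝓕 (ha2.toLp a) : Lp ℂ 2 (volume : Measure E)) : E → ℂ) x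
        = ∫ x, G x • ((𝓕 (ha2.toLp a) : Lp ℂ 2 (volume : Measure E)) : E → ℂ) x := by
          simp [hGv]
      _ = ∫ x, G x • 𝓕 a x := by rw [← h1, h2, h3, h4]
      _ = ∫ x, g x • 𝓕 a x := by simp [hGv]
  have h5 : eLpNorm (𝓕 a) 2 volume = eLpNorm a 2 volume := by
    rw [← eLpNorm_congr_ae key, ← eLpNorm_congr_ae ha2.coeFn_toLp]
    have := Lp.norm_fourier_eq (ha2.toLp a)
    rw [Lp.norm_def, Lp.norm_def, ENNReal.toReal_eq_toReal_iff' (Lp.eLpNorm_ne_top _)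
      (Lp.eLpNorm_ne_top _)] at this
    exact this
  have h6 : ∀ f : E → ℂ, eLpNorm f 2 volume ^ 2 = ∫⁻ x, ‖f x‖ₑ ^ 2 := by
    intro f
    rw [eLpNorm_eq_lintegral_rpow_enorm_toReal (by norm_num) (by norm_num)]
    simp only [ENNReal.toReal_ofNat]
    rw [← rpow_natCast, ← rpow_mul]
    simp
  rw [← h6, ← h6, h5]

lemma gker_continuous {m : E → ℂ} (hm : Integrable m) : Continuous (gker m) := by
  have h : Continuous (𝓕⁻ m) := by
    have := VectorFourier.fourierIntegral_continuous (μ := (volume : Measure E))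
        (L := -innerₗ E) Real.continuous_fourierChar
        (continuous_inner (𝕜 := ℝ) (E := E)).neg hm
    exact this
  have : gker m = fun x => ((((2 * π) ^ finrank ℝ E)⁻¹ : ℝ) : ℂ)
      * 𝓕⁻ m ((2 * π)⁻¹ • x) := funext (gker_eq_fourierInv m)
  rw [this]
  fun_prop

lemma norm_gker_le (m : E → ℂ) (x : E) :
    ‖gker m x‖ ≤ ((2 * π) ^ finrank ℝ E)⁻¹ * ∫ ξ, ‖m ξ‖ := by
  rw [gker, norm_mul, norm_real, norm_of_nonneg (by positivity)]
  refine mul_le_mul_of_nonneg_left ((norm_integral_le_integral_norm _).trans_eq ?_) (by positivity)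
  simp only [norm_mul, norm_cexp_I_mul, one_mul]

lemma lintegral_gker_sq {a : E → ℂ} (ha : Integrable a) (ha2 : MemLp a 2) :
    ∫⁻ x, ‖gker a x‖ₑ ^ 2 =
      ofReal (((2 * π) ^ finrank ℝ E)⁻¹) * ∫⁻ x, ‖a x‖ₑ ^ 2 := by
  set c : ℝ := ((2 * π) ^ finrank ℝ E)⁻¹ with hc
  have hc0 : 0 < c := by positivity
  have h1 : ∀ x, ‖gker a x‖ₑ ^ 2
      = ofReal c ^ 2 * ‖𝓕 a ((2 * π)⁻¹ • (-x))‖ₑ ^ 2 := by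
    intro x
    rw [gker_eq_fourierInv, enorm_mul, mul_pow, Real.fourierInv_eq_fourier_neg, smul_neg]
    congr 2
    rw [← ofReal_norm, norm_real, norm_of_nonneg hc0.le]
  simp_rw [h1]
  rw [lintegral_const_mul' _ _ (by simp)]
  rw [lintegral_neg_eq_self (μ := (volume : Measure E))
    (fun x => ‖𝓕 a ((2 * π)⁻¹ • x)‖ₑ ^ 2)]
  rw [lintegral_comp_smul_two_pi (fun x => ‖𝓕 a x‖ₑ ^ 2), fourier_memLp_two ha ha2, ← mul_assoc]
  congr 1
  rw [← ofReal_pow hc0.le, ← ofReal_mul (by positivity)]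
  congr 1
  rw [hc]
  field_simp

lemma lintegral_gft_sq {h : E → ℂ} (hh : Integrable h) (hh2 : MemLp h 2) :
    ∫⁻ x, ‖gft h x‖ₑ ^ 2 = ofReal ((2 * π) ^ finrank ℝ E) * ∫⁻ x, ‖h x‖ₑ ^ 2 := by
  simp_rw [gft_eq_fourier]
  rw [lintegral_comp_smul_two_pi (fun x => ‖𝓕 h x‖ₑ ^ 2), fourier_memLp_two hh hh2]

lemma memLp_two_iff_lintegral {α : Type*} [MeasurableSpace α] {μ : Measure α} {f : α → ℂ}
    (hf : AEStronglyMeasurable f μ) : MemLp f 2 μ ↔ ∫⁻ x, ‖f x‖ₑ ^ 2 ∂μ < ⊤ := by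
  rw [MemLp, and_iff_right hf, eLpNorm_lt_top_iff_lintegral_rpow_enorm_lt_top (by norm_num)
    (by norm_num)]
  simp

lemma memLp_gker {a : E → ℂ} (ha : Integrable a) (ha2 : MemLp a 2) : MemLp (gker a) 2 := by
  rw [memLp_two_iff_lintegral (gker_continuous ha).aestronglyMeasurable, lintegral_gker_sq ha ha2]
  exact mul_lt_top (by simp) ((memLp_two_iff_lintegral ha2.1).1 ha2)

lemma gft_continuous {h : E → ℂ} (hh : Integrable h) : Continuous (gft h) := by
  have hc : Continuous (𝓕 h) := by
    have := VectorFourier.fourierIntegral_continuous (μ := (volume : Measure E))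
        (L := innerₗ E) Real.continuous_fourierChar continuous_inner hh
    exact this
  have : gft h = fun ξ => 𝓕 h ((2 * π)⁻¹ • ξ) := funext (gft_eq_fourier h)
  rw [this]
  fun_prop

lemma norm_gft_le (h : E → ℂ) (ξ : E) : ‖gft h ξ‖ ≤ ∫ y, ‖h y‖ := by
  refine (norm_integral_le_integral_norm _).trans_eq ?_
  simp only [norm_mul, norm_cexp_neg_I_mul, one_mul]

lemma integrable_mul_gft {m h : E → ℂ} (hm : Integrable m) (hh : Integrable h) :
    Integrable (fun ξ => m ξ * gft h ξ) :=
  hm.mul_bdd (c := ∫ y, ‖h y‖) (gft_continuous hh).aestronglyMeasurable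
    (ae_of_all _ (norm_gft_le h))

lemma gconv_eq_gker {m h : E → ℂ} (hm : Integrable m) (hh : Integrable h) (x : E) :
    gconv m h x = gker (fun ξ => m ξ * gft h ξ) x := by
  have hint : Integrable (fun p : E × E =>
      exp (I * (inner ℝ (x - p.1) p.2 : ℝ)) * (h p.1 * m p.2))
      (volume.prod volume) := by
    refine (hh.mul_prod hm).bdd_mul (c := 1) ?_ (ae_of_all _ fun p => ?_)
    · exact Continuous.aestronglyMeasurable (by fun_prop)
    · rw [norm_cexp_I_mul]
  have h1 : ∀ y, gker m (x - y) * h y = (((2 * π) ^ finrank ℝ E)⁻¹ : ℝ) *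
      ∫ ξ, exp (I * (inner ℝ (x - y) ξ : ℝ)) * (h y * m ξ) := by
    intro y
    rw [gker, mul_assoc, ← integral_mul_const]
    congr 2; ext ξ; ring
  rw [gconv]
  simp_rw [h1]
  rw [integral_const_mul, gker]
  congr 1
  rw [integral_integral_swap hint]
  refine integral_congr_ae (ae_of_all _ fun ξ => ?_)
  simp only [gft]
  rw [← integral_const_mul, ← integral_const_mul]
  refine integral_congr_ae (ae_of_all _ fun y => ?_)
  simp only
  rw [inner_sub_left, show I * (((inner ℝ x ξ - inner ℝ y ξ : ℝ)) : ℂ)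
    = I * ((inner ℝ x ξ : ℝ) : ℂ) + -I * ((inner ℝ y ξ : ℝ) : ℂ) by
      push_cast; ring, exp_add]
  ring

lemma gker_finset_sum {β : Type*} (s : Finset β) {m : β → E → ℂ} (hm : ∀ b ∈ s, Integrable (m b))
    (x : E) : ∑ b ∈ s, gker (m b) x = gker (fun ξ => ∑ b ∈ s, m b ξ) x := by
  simp only [gker]
  rw [← mul_sum, ← integral_finsetSum]
  · simp_rw [mul_sum]
  · intro b hb
    refine (hm b hb).bdd_mul (c := 1) ?_ (ae_of_all _ fun p => ?_)
    · exact Continuous.aestronglyMeasurable (by fun_prop)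
    · rw [norm_cexp_I_mul]

lemma enorm_sq_eq_ofReal (z : ℂ) : ‖z‖ₑ ^ 2 = ofReal (‖z‖ ^ 2) := by
  rw [← ofReal_norm, ofReal_pow (norm_nonneg _)]

lemma lintegral_gconv_matrix_of_integrable {α β : Type*} [Fintype α] [Fintype β]
    {m : α → β → E → ℂ} {A : ℝ} (hA : 0 ≤ A)
    (hm : ∀ a b, Integrable (m a b)) (hm2 : ∀ a b, ∃ B : ℝ, ∀ ξ, ‖m a b ξ‖ ≤ B)
    (hop : ∀ ξ (z : β → ℂ), ∑ a, ‖∑ b, m a b ξ * z b‖ ^ 2 ≤ A * ∑ b, ‖z b‖ ^ 2)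
    {h : β → E → ℂ} (hh : ∀ b, Integrable (h b)) (hh2 : ∀ b, MemLp (h b) 2) :
    ∑ a, ∫⁻ x, ‖∑ b, gconv (m a b) (h b) x‖ₑ ^ 2 ≤
      ofReal A * ∑ b, ∫⁻ x, ‖h b x‖ₑ ^ 2 := by
  have hgm : ∀ b, MemLp (gft (h b)) 2 := by
    intro b
    rw [memLp_two_iff_lintegral (gft_continuous (hh b)).aestronglyMeasurable,
      lintegral_gft_sq (hh b) (hh2 b)]
    exact mul_lt_top (by simp) ((memLp_two_iff_lintegral (hh2 b).1).1 (hh2 b))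
  have hi : ∀ a b, Integrable (fun ξ => m a b ξ * gft (h b) ξ) := fun a b =>
    integrable_mul_gft (hm a b) (hh b)
  have hi2 : ∀ a b, MemLp (fun ξ => m a b ξ * gft (h b) ξ) 2 := by
    intro a b
    obtain ⟨B, hB⟩ := hm2 a b
    exact (hgm b).mul' (p := ⊤) (memLp_top_of_bound (hm a b).1 B (ae_of_all _ hB))
  have h1 : ∀ a, ∫⁻ x, ‖∑ b, gconv (m a b) (h b) x‖ₑ ^ 2 =
      ofReal (((2 * π) ^ finrank ℝ E)⁻¹) *
        ∫⁻ ξ, ‖∑ b, m a b ξ * gft (h b) ξ‖ₑ ^ 2 := by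
    intro a
    rw [← lintegral_gker_sq (integrable_finsetSum _ fun b _ => hi a b)
      (memLp_finsetSum _ fun b _ => hi2 a b)]
    refine lintegral_congr fun x => ?_
    rw [← gker_finset_sum _ (fun b _ => hi a b)]
    simp_rw [gconv_eq_gker (hm a _) (hh _)]
  simp_rw [h1]
  rw [← mul_sum, ← lintegral_finsetSum']
  swap
  · intro a _
    exact ((Finset.aestronglyMeasurable_fun_sum _ fun b _ => (hi a b).1).enorm).pow_const 2
  have h2 : ∀ ξ, ∑ a, ‖∑ b, m a b ξ * gft (h b) ξ‖ₑ ^ 2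
      ≤ ofReal A * ∑ b, ‖gft (h b) ξ‖ₑ ^ 2 := by
    intro ξ
    simp_rw [enorm_sq_eq_ofReal]
    rw [← ofReal_sum_of_nonneg (fun _ _ => by positivity),
      ← ofReal_sum_of_nonneg (fun _ _ => by positivity), ← ofReal_mul hA]
    exact ofReal_le_ofReal (hop ξ _)
  calc ofReal (((2 * π) ^ finrank ℝ E)⁻¹) *
        ∫⁻ ξ, ∑ a, ‖∑ b, m a b ξ * gft (h b) ξ‖ₑ ^ 2
      ≤ ofReal (((2 * π) ^ finrank ℝ E)⁻¹) *
        ∫⁻ ξ, ofReal A * ∑ b, ‖gft (h b) ξ‖ₑ ^ 2 := by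
        gcongr with ξ; exact h2 ξ
    _ = ofReal A * ∑ b, ∫⁻ x, ‖h b x‖ₑ ^ 2 := by
        rw [lintegral_const_mul' _ _ ofReal_ne_top, lintegral_finsetSum']
        · simp_rw [lintegral_gft_sq (hh _) (hh2 _)]
          rw [← mul_sum, mul_left_comm, ← mul_assoc (ofReal (_)⁻¹),
            ← ofReal_mul (by positivity), inv_mul_cancel₀ (by positivity)]
          simp
        · intro b _
          exact ((gft_continuous (hh b)).aestronglyMeasurable.enorm).pow_const 2

lemma lintegral_sub_left_sq (k : E → ℂ) (x : E) :
    ∫⁻ y, ‖k (x - y)‖ₑ ^ 2 = ∫⁻ y, ‖k y‖ₑ ^ 2 :=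
  lintegral_sub_left_eq_self (fun y => ‖k y‖ₑ ^ 2) x

lemma enorm_gconv_sq_le {k h : E → ℂ} (hk : AEStronglyMeasurable (gker k))
    (hh : AEStronglyMeasurable h) (x : E) :
    ‖gconv k h x‖ₑ ^ 2 ≤ (∫⁻ y, ‖gker k y‖ₑ ^ 2) * ∫⁻ y, ‖h y‖ₑ ^ 2 := by
  have hk' : AEStronglyMeasurable (fun y => gker k (x - y)) :=
    hk.comp_measurePreserving (Measure.measurePreserving_sub_left volume x)
  rw [← lintegral_sub_left_sq (gker k) x]
  calc ‖gconv k h x‖ₑ ^ 2 ≤ (∫⁻ y, ‖gker k (x - y)‖ₑ * ‖h y‖ₑ) ^ 2 := by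
        gcongr
        simp_rw [← enorm_mul]
        exact enorm_integral_le_lintegral_enorm _
    _ ≤ _ := lintegral_mul_sq_le hk'.enorm hh.enorm

lemma measurable_gconv {k h : E → ℂ} (hk : Integrable k) (hh : AEStronglyMeasurable h) :
    Measurable (gconv k h) := by
  have h1 : gconv k h = gconv k (hh.mk h) := by
    funext x
    refine integral_congr_ae ?_
    filter_upwards [hh.ae_eq_mk] with y hy
    rw [hy]
  rw [h1]
  have h2 : StronglyMeasurable (fun p : E × E => gker k (p.1 - p.2) * hh.mk h p.2) :=
    ((gker_continuous hk).comp (continuous_fst.sub continuous_snd)).stronglyMeasurable.mul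
      (hh.stronglyMeasurable_mk.comp_measurable measurable_snd)
  exact (h2.integral_prod_right (ν := volume)).measurable

lemma integrable_gker_mul {k h : E → ℂ} (hk : MemLp (gker k) 2) (hh : MemLp h 2) (x : E) :
    Integrable (fun y => gker k (x - y) * h y) :=
  (hk.comp_measurePreserving (Measure.measurePreserving_sub_left volume x)).integrable_mul hh

lemma memLp_two_of_bounded {a : E → ℂ} (ha : Integrable a) (hb : ∃ B : ℝ, ∀ ξ, ‖a ξ‖ ≤ B) :
    MemLp a 2 := by
  obtain ⟨B, hB⟩ := hb
  rw [memLp_two_iff_lintegral ha.1]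
  calc ∫⁻ x, ‖a x‖ₑ ^ 2 ≤ ∫⁻ x, ofReal B * ‖a x‖ₑ := by
        gcongr with x
        rw [sq]
        gcongr
        rw [← ofReal_norm]
        exact ofReal_le_ofReal (hB x)
    _ = ofReal B * ∫⁻ x, ‖a x‖ₑ := lintegral_const_mul' _ _ ofReal_ne_top
    _ < ⊤ := mul_lt_top ofReal_lt_top ha.2

/-- **Plancherel bound for matrices of multipliers.** -/
lemma lintegral_gconv_matrix {α β : Type*} [Fintype α] [Fintype β]
    {m : α → β → E → ℂ} {A : ℝ} (hA : 0 ≤ A)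
    (hm : ∀ a b, Integrable (m a b)) (hm2 : ∀ a b, ∃ B : ℝ, ∀ ξ, ‖m a b ξ‖ ≤ B)
    (hop : ∀ ξ (z : β → ℂ), ∑ a, ‖∑ b, m a b ξ * z b‖ ^ 2 ≤ A * ∑ b, ‖z b‖ ^ 2)
    {h : β → E → ℂ} (hh2 : ∀ b, MemLp (h b) 2) :
    ∑ a, ∫⁻ x, ‖∑ b, gconv (m a b) (h b) x‖ₑ ^ 2 ≤
      ofReal A * ∑ b, ∫⁻ x, ‖h b x‖ₑ ^ 2 := by
  classical
  have hmk : ∀ a b, MemLp (gker (m a b)) 2 := fun a b =>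
    memLp_gker (hm a b) (memLp_two_of_bounded (hm a b) (hm2 a b))
  have hex : ∀ b (n : ℕ), ∃ g : E → ℂ, HasCompactSupport g ∧ ContDiff ℝ ∞ g ∧
      eLpNorm (h b - g) 2 volume ≤ ofReal (1 / ((n : ℝ) + 1)) := fun b n =>
    MemLp.exist_eLpNorm_sub_le (by norm_num) (by norm_num) (hh2 b) (by positivity)
  choose g hgs hgc hgn using hex
  have hg1 : ∀ b n, Integrable (g b n) := fun b n =>
    (hgc b n).continuous.integrable_of_hasCompactSupport (hgs b n)
  have hg2 : ∀ b n, MemLp (g b n) 2 := fun b n =>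
    (hgc b n).continuous.memLp_of_hasCompactSupport (hgs b n)
  have h6 : ∀ f : E → ℂ, ∫⁻ x, ‖f x‖ₑ ^ 2 = eLpNorm f 2 volume ^ 2 := by
    intro f
    rw [eLpNorm_eq_lintegral_rpow_enorm_toReal (by norm_num) (by norm_num)]
    simp only [ENNReal.toReal_ofNat]
    rw [← rpow_natCast, ← rpow_mul]
    simp
  have heps : Filter.Tendsto (fun n : ℕ => ofReal (1 / ((n : ℝ) + 1))) Filter.atTop
      (nhds 0) := by
    rw [← ENNReal.ofReal_zero]
    exact ENNReal.tendsto_ofReal tendsto_one_div_add_atTop_nhds_zero_nat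
  have hlim : ∀ a b x, Filter.Tendsto (fun n => gconv (m a b) (g b n) x) Filter.atTop
      (nhds (gconv (m a b) (h b) x)) := by
    intro a b x
    have hd : ∀ n, gconv (m a b) (h b) x - gconv (m a b) (g b n) x
        = gconv (m a b) (h b - g b n) x := by
      intro n
      simp only [gconv]
      rw [← integral_sub (integrable_gker_mul (hmk a b) (hh2 b) x)
        (integrable_gker_mul (hmk a b) (hg2 b n) x)]
      simp only [Pi.sub_apply, mul_sub]
    have hz : Filter.Tendsto (fun n => ‖gconv (m a b) (h b) x - gconv (m a b) (g b n) x‖ₑ ^ 2)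
        Filter.atTop (nhds 0) := by
      refine tendsto_of_tendsto_of_tendsto_of_le_of_le (g := fun _ => 0) tendsto_const_nhds
        (?_ : Filter.Tendsto (fun n : ℕ => (∫⁻ y, ‖gker (m a b) y‖ₑ ^ 2) *
          (ofReal (1 / ((n : ℝ) + 1))) ^ 2) Filter.atTop (nhds 0))
        (fun n => zero_le) (fun n => ?_)
      · have : (∫⁻ y, ‖gker (m a b) y‖ₑ ^ 2) ≠ ⊤ :=
          ((memLp_two_iff_lintegral (hmk a b).1).1 (hmk a b)).ne
        have h2 := ENNReal.Tendsto.const_mul (a := ∫⁻ y, ‖gker (m a b) y‖ₑ ^ 2)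
          (((ENNReal.continuous_pow 2).tendsto 0).comp heps) (Or.inr this)
        simpa using h2
      · simp only
        rw [hd n]
        refine (enorm_gconv_sq_le (hmk a b).1 ((hh2 b).1.sub (hg2 b n).1) x).trans ?_
        rw [h6 (h b - g b n)]
        gcongr
        exact hgn b n
    have hz2 : Filter.Tendsto (fun n => ‖gconv (m a b) (h b) x - gconv (m a b) (g b n) x‖)
        Filter.atTop (nhds 0) := by
      have h3 := (ENNReal.tendsto_toReal (by simp : (0 : ℝ≥0∞) ≠ ⊤)).comp hz
      have h4 := (Real.continuous_sqrt.tendsto 0).comp (by simpa using h3)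
      simpa [Function.comp_def, Real.sqrt_sq (norm_nonneg _)] using h4
    have := tendsto_zero_iff_norm_tendsto_zero.2 hz2
    have h5 := (tendsto_const_nhds (x := gconv (m a b) (h b) x)).sub this
    simpa using h5
  have hmeas : ∀ a n, Measurable (fun x => ‖∑ b, gconv (m a b) (g b n) x‖ₑ ^ 2) := by
    intro a n
    have : ∀ b, Continuous (gconv (m a b) (g b n)) := by
      intro b
      rw [funext (gconv_eq_gker (hm a b) (hg1 b n))]
      exact gker_continuous (integrable_mul_gft (hm a b) (hg1 b n))
    exact (continuous_finsetSum _ fun b _ => this b).measurable.enorm.pow_const 2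
  have hmeas' : ∀ a, Measurable (fun x => ‖∑ b, gconv (m a b) (h b) x‖ₑ ^ 2) := fun a =>
    ((Finset.measurable_sum _ fun b _ => measurable_gconv (hm a b) (hh2 b).1).enorm).pow_const 2
  have hbound : ∀ n, ∫⁻ x, ∑ a, ‖∑ b, gconv (m a b) (g b n) x‖ₑ ^ 2 ≤
      ofReal A *
        ∑ b, (eLpNorm (h b) 2 volume + ofReal (1 / ((n : ℝ) + 1))) ^ 2 := by
    intro n
    rw [lintegral_finsetSum _ fun a _ => hmeas a n]
    refine (lintegral_gconv_matrix_of_integrable hA hm hm2 hop (hg1 · n) (hg2 · n)).trans ?_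
    gcongr with b
    rw [h6]
    gcongr
    calc eLpNorm (g b n) 2 volume = eLpNorm (h b - (h b - g b n)) 2 volume := by
          rw [sub_sub_cancel]
      _ ≤ eLpNorm (h b) 2 volume + eLpNorm (h b - g b n) 2 volume :=
          eLpNorm_sub_le (hh2 b).1 ((hh2 b).1.sub (hg2 b n).1) (by norm_num)
      _ ≤ _ := by gcongr; exact hgn b n
  have hR : Filter.Tendsto (fun n : ℕ => ofReal A *
        ∑ b, (eLpNorm (h b) 2 volume + ofReal (1 / ((n : ℝ) + 1))) ^ 2) Filter.atTop
      (nhds (ofReal A * ∑ b, ∫⁻ x, ‖h b x‖ₑ ^ 2)) := by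
    refine ENNReal.Tendsto.const_mul (tendsto_finsetSum _ fun b _ => ?_)
      (Or.inr ofReal_ne_top)
    rw [h6]
    have h7 := (tendsto_const_nhds (x := eLpNorm (h b) 2 (volume : Measure E))).add heps
    rw [add_zero] at h7
    exact ((ENNReal.continuous_pow 2).tendsto _).comp h7
  calc ∑ a, ∫⁻ x, ‖∑ b, gconv (m a b) (h b) x‖ₑ ^ 2
      ≤ ∫⁻ x, ∑ a, ‖∑ b, gconv (m a b) (h b) x‖ₑ ^ 2 :=
        (lintegral_finsetSum _ fun a _ => (hmeas' a)).ge
    _ = ∫⁻ x, Filter.liminf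
        (fun n => ∑ a, ‖∑ b, gconv (m a b) (g b n) x‖ₑ ^ 2) Filter.atTop := by
        refine lintegral_congr fun x => (Filter.Tendsto.liminf_eq ?_).symm
        refine tendsto_finsetSum _ fun a _ => ?_
        have := tendsto_finsetSum Finset.univ fun b _ => hlim a b x
        exact ((ENNReal.continuous_pow 2).tendsto _).comp
          ((continuous_enorm.tendsto _).comp this)
    _ ≤ Filter.liminf (fun n => ∫⁻ x, ∑ a, ‖∑ b, gconv (m a b) (g b n) x‖ₑ ^ 2) Filter.atTop :=
        lintegral_liminf_le fun n => Finset.measurable_sum _ fun a _ => hmeas a n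
    _ ≤ Filter.liminf (fun n : ℕ => ofReal A *
        ∑ b, (eLpNorm (h b) 2 volume + ofReal (1 / ((n : ℝ) + 1))) ^ 2) Filter.atTop :=
        Filter.liminf_le_liminf (Filter.Eventually.of_forall hbound)
    _ = _ := hR.liminf_eq

/-- `i` times the derivative in the direction `v`. -/
def dI (v : E) (m : E → ℂ) (ξ : E) : ℂ := I * fderiv ℝ m ξ v

/-- Smooth functions with compact support. -/
def IsTest (m : E → ℂ) : Prop := ContDiff ℝ ∞ m ∧ HasCompactSupport m

lemma IsTest.integrable {m : E → ℂ} (hm : IsTest m) : Integrable m :=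
  hm.1.continuous.integrable_of_hasCompactSupport hm.2

lemma IsTest.bounded {m : E → ℂ} (hm : IsTest m) : ∃ B : ℝ, ∀ ξ, ‖m ξ‖ ≤ B :=
  hm.1.continuous.bounded_above_of_compact_support hm.2

lemma IsTest.memLp_two {m : E → ℂ} (hm : IsTest m) : MemLp m 2 :=
  memLp_two_of_bounded hm.integrable hm.bounded

lemma tsupport_dI_subset (v : E) (m : E → ℂ) : tsupport (dI v m) ⊆ tsupport m := by
  refine (closure_minimal ?_ (isClosed_tsupport m))
  intro x hx
  refine support_fderiv_subset ℝ (f := m) ?_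
  intro h0
  apply hx
  simp [dI, h0]

lemma IsTest.deriv {m : E → ℂ} (hm : IsTest m) (v : E) : IsTest (dI v m) := by
  refine ⟨?_, hm.2.mono' (subset_tsupport _ |>.trans (tsupport_dI_subset v m))⟩
  have : ContDiff ℝ ∞ (fun ξ => fderiv ℝ m ξ v) :=
    (hm.1.fderiv_right (m := ∞) (by simp)).clm_apply contDiff_const
  exact contDiff_const.mul this

lemma IsTest.deriv_iterate {m : E → ℂ} (hm : IsTest m) (v : E) (n : ℕ) :
    IsTest ((dI v)^[n] m) := by
  induction n with
  | zero => exact hm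
  | succ n ih => rw [Function.iterate_succ_apply']; exact ih.deriv v

lemma integrable_gker {m : E → ℂ} (hm : IsTest m) : Integrable (gker m) := by
  set M : 𝓢(E, ℂ) := hm.2.toSchwartzMap hm.1
  have h1 : gker m = fun x => ((((2 * π) ^ finrank ℝ E)⁻¹ : ℝ) : ℂ)
      * (𝓕⁻ M) ((2 * π)⁻¹ • x) := by
    funext x
    rw [gker_eq_fourierInv, SchwartzMap.fourierInv_coe]; rfl
  rw [h1]
  exact ((𝓕⁻ M).integrable.comp_smul (by positivity)).const_mul _

lemma gft_gker {m : E → ℂ} (hm : IsTest m) (ξ : E) : gft (gker m) ξ = m ξ := by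
  set M : 𝓢(E, ℂ) := hm.2.toSchwartzMap hm.1
  have h1 : ∀ x, gker m x = ((((2 * π) ^ finrank ℝ E)⁻¹ : ℝ) : ℂ)
      * (𝓕⁻ M) ((2 * π)⁻¹ • x) := by
    intro x
    rw [gker_eq_fourierInv, SchwartzMap.fourierInv_coe]; rfl
  have h2 : m ξ = 𝓕 ((𝓕⁻ M : 𝓢(E, ℂ)) : E → ℂ) ξ := by
    rw [← SchwartzMap.fourier_coe, FourierTransform.fourier_fourierInv_eq]; rfl
  rw [h2, gft, Real.fourier_eq']
  simp_rw [h1]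
  have h3 := Measure.integral_comp_smul (volume : Measure E)
    (fun z => exp (((-2 * π * inner ℝ z ξ : ℝ) : ℂ) * I) • (𝓕⁻ M) z)
    (2 * π)⁻¹
  rw [inv_pow, inv_inv, abs_of_pos (by positivity)] at h3
  have h4 : ∫ z, exp (((-2 * π * inner ℝ z ξ : ℝ) : ℂ) * I) • (𝓕⁻ M) z
      = ((2 * π) ^ finrank ℝ E)⁻¹ • ∫ x, exp (((-2 * π *
        inner ℝ ((2 * π)⁻¹ • x) ξ : ℝ) : ℂ) * I) • (𝓕⁻ M) ((2 * π)⁻¹ • x) := by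
    rw [h3, smul_smul, inv_mul_cancel₀ (by positivity), one_smul]
  rw [h4, ← integral_smul]
  refine integral_congr_ae (ae_of_all _ fun x => ?_)
  simp only [Complex.real_smul, smul_eq_mul]
  rw [← mul_assoc, mul_comm (exp _), mul_assoc]
  congr 3
  rw [real_inner_smul_left]
  have : (π : ℂ) ≠ 0 := by exact_mod_cast Real.pi_ne_zero
  push_cast
  field_simp

lemma gker_dI {m : E → ℂ} (hm : IsTest m) (v x : E) :
    gker (dI v m) x = (inner ℝ x v : ℝ) * gker m x := by
  have hcont : Continuous fun ξ => fderiv ℝ m ξ v :=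
    (hm.1.continuous_fderiv (by simp)).clm_apply continuous_const
  have hdiff : Differentiable ℝ (fun ξ : E => exp (I * (inner ℝ x ξ : ℝ))) := by
    have : Differentiable ℝ fun ξ : E => ((inner ℝ x ξ : ℝ) : ℂ) :=
      Complex.ofRealCLM.differentiable.comp (differentiable_const x |>.inner ℝ differentiable_id)
    exact (this.const_mul _).cexp
  have hfd : ∀ ξ, fderiv ℝ (fun ξ : E => exp (I * (inner ℝ x ξ : ℝ))) ξ v
      = exp (I * (inner ℝ x ξ : ℝ)) * (I * (inner ℝ x v : ℝ)) := by
    intro ξ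
    have h1 : HasFDerivAt (fun ξ : E => (inner ℝ x ξ : ℝ)) (innerSL ℝ x) ξ :=
      (innerSL ℝ x).hasFDerivAt
    have h2 : HasFDerivAt (fun ξ : E => ((inner ℝ x ξ : ℝ) : ℂ))
        (Complex.ofRealCLM.comp (innerSL ℝ x)) ξ :=
      Complex.ofRealCLM.hasFDerivAt.comp ξ h1
    have h3 := (h2.const_mul I).cexp
    rw [h3.fderiv]
    simp
  have hexp : Continuous (fun ξ : E => exp (I * (inner ℝ x ξ : ℝ))) :=
    hdiff.continuous
  have hmi := hm.integrable
  have hbp := integral_mul_fderiv_eq_neg_fderiv_mul_of_integrable (μ := (volume : Measure E))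
    (f := fun ξ : E => exp (I * (inner ℝ x ξ : ℝ))) (g := m) (v := v) ?_ ?_ ?_
    (fun ξ _ => hdiff ξ) (fun ξ _ => hm.1.differentiable (by simp) ξ)
  · rw [gker, gker, mul_left_comm]
    congr 1
    have h5 : ∀ ξ, exp (I * (inner ℝ x ξ : ℝ)) * dI v m ξ
        = I * (exp (I * (inner ℝ x ξ : ℝ)) * fderiv ℝ m ξ v) := by
      intro ξ; rw [dI]; ring
    simp_rw [h5]
    rw [integral_const_mul, hbp]
    simp_rw [hfd]
    rw [← integral_neg, ← integral_const_mul, ← integral_const_mul]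
    refine integral_congr_ae (ae_of_all _ fun ξ => ?_)
    simp only
    linear_combination (-(exp (I * (inner ℝ x ξ : ℝ)) *
      ((inner ℝ x v : ℝ) : ℂ) * m ξ)) * Complex.I_mul_I
  · simp_rw [hfd]
    refine hmi.bdd_mul (c := ‖I * ((inner ℝ x v : ℝ) : ℂ)‖)
      (hexp.mul continuous_const).aestronglyMeasurable (ae_of_all _ fun ξ => ?_)
    rw [norm_mul, norm_cexp_I_mul, one_mul]
  · have hdi : Integrable fun ξ => fderiv ℝ m ξ v := by
      have h7 := (hm.deriv v).integrable.const_mul (-I)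
      refine h7.congr (ae_of_all _ fun ξ => ?_)
      simp only [dI]
      linear_combination (-(fderiv ℝ m ξ v)) * Complex.I_mul_I
    exact hdi.bdd_mul (c := 1) hexp.aestronglyMeasurable
      (ae_of_all _ fun ξ => (norm_cexp_I_mul _).le)
  · exact hmi.bdd_mul (c := 1) hexp.aestronglyMeasurable
      (ae_of_all _ fun ξ => (norm_cexp_I_mul _).le)

lemma gker_dI_iterate {m : E → ℂ} (hm : IsTest m) (v x : E) (n : ℕ) :
    gker ((dI v)^[n] m) x = ((inner ℝ x v : ℝ) : ℂ) ^ n * gker m x := by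
  induction n with
  | zero => simp
  | succ n ih =>
    rw [Function.iterate_succ_apply', gker_dI (hm.deriv_iterate v n), ih]
    ring

end FourierEuclidean

/-! ### Polynomial weights on the integer lattice -/

/-- The weight `(1 + ‖q‖)^{-n}`. -/
def wt (n : ℕ) (q : ℤ²) : ℝ≥0∞ := ofReal (((1 + ‖q‖) ^ n)⁻¹)

lemma one_le_one_add_norm (q : ℤ²) : 1 ≤ 1 + ‖q‖ := by linarith [norm_nonneg q]

lemma wt_ne_top (n : ℕ) (q : ℤ²) : wt n q ≠ ⊤ := ofReal_ne_top

lemma wt_ne_zero (n : ℕ) (q : ℤ²) : wt n q ≠ 0 := by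
  have := one_le_one_add_norm q
  simp only [wt, ne_eq, ENNReal.ofReal_eq_zero, not_le]
  positivity

lemma wt_anti {m n : ℕ} (h : m ≤ n) (q : ℤ²) : wt n q ≤ wt m q := by
  have := one_le_one_add_norm q
  refine ofReal_le_ofReal (inv_anti₀ (by positivity) (pow_le_pow_right₀ this h))

lemma wt_add (m n : ℕ) (q : ℤ²) : wt (m + n) q = wt m q * wt n q := by
  have := one_le_one_add_norm q
  rw [wt, wt, wt, ← ofReal_mul (by positivity), pow_add, mul_inv]

lemma wt_neg (n : ℕ) (q : ℤ²) : wt n (-q) = wt n q := by rw [wt, wt, norm_neg]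

lemma wt_mul_le (n : ℕ) (p q : ℤ²) : wt n p * wt n q ≤ wt n (p + q) := by
  have h1 := one_le_one_add_norm p
  have h2 := one_le_one_add_norm q
  have h3 := one_le_one_add_norm (p + q)
  have h4 := norm_add_le p q
  rw [wt, wt, wt, ← ofReal_mul (by positivity), ← mul_inv, ← mul_pow]
  refine ofReal_le_ofReal (inv_anti₀ (by positivity) ?_)
  refine pow_le_pow_left₀ (by positivity) ?_ n
  nlinarith [norm_nonneg p, norm_nonneg q]

lemma tsum_wt_lt_top {n : ℕ} (hn : 3 ≤ n) : ∑' q, wt n q < ⊤ := by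
  refine lt_of_le_of_lt (tsum_le_tsum fun q => wt_anti hn q) ?_
  have h1 : Summable fun q : ℤ² => ‖q‖ ^ (-3 : ℝ) :=
    EisensteinSeries.summable_one_div_norm_rpow (by norm_num)
  have h2 : Summable fun q : ℤ² => ((1 + ‖q‖) ^ 3)⁻¹ := by
    have h3 : Summable fun q : ℤ² => (if q = 0 then 1 else 0 : ℝ) + ‖q‖ ^ (-3 : ℝ) :=
      (summable_of_ne_finset_zero (s := {0}) (by intro b hb; simp at hb; simp [hb])).add h1
    refine h3.of_nonneg_of_le (fun q => by positivity) fun q => ?_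
    by_cases hq : q = 0
    · subst hq; simp
    · have hq0 : 0 < ‖q‖ := norm_pos_iff.2 hq
      simp only [hq, if_false, zero_add]
      rw [Real.rpow_neg hq0.le]
      refine inv_anti₀ (by positivity) ?_
      norm_cast
      refine pow_le_pow_left₀ (by positivity) (by linarith) 3
  have h4 := h2.tsum_ofReal_lt_top
  exact h4

/-- The total mass of `wt 3`. -/
def wtMass : ℝ≥0∞ := ∑' q, wt 3 q

lemma wtMass_ne_top : wtMass ≠ ⊤ := (tsum_wt_lt_top le_rfl).ne

lemma wt_conv_le {n : ℕ} (hn : 3 ≤ n) (p : ℤ²) :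
    ∑' q, wt n q * wt n (p - q) ≤ (2 ^ (n + 1) * wtMass) * wt n p := by
  have key : ∀ q, wt n q * wt n (p - q) ≤ 2 ^ n * wt n p * (wt n q + wt n (p - q)) := by
    intro q
    have h1 := one_le_one_add_norm q
    have h2 := one_le_one_add_norm (p - q)
    have h3 := one_le_one_add_norm p
    have h4 : ‖p‖ ≤ ‖q‖ + ‖p - q‖ := by simpa using norm_add_le q (p - q)
    have aux : ∀ a b c : ℝ, 1 ≤ a → 1 ≤ b → 1 ≤ c → c ≤ 2 * a →
        ofReal ((a ^ n)⁻¹) ≤ 2 ^ n * ofReal ((c ^ n)⁻¹) := by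
      intro a b c ha hb hc hca
      rw [show (2 : ℝ≥0∞) ^ n = ofReal (2 ^ n) by
        rw [ofReal_pow (by norm_num)]; simp, ← ofReal_mul (by positivity)]
      refine ofReal_le_ofReal ?_
      rw [← div_eq_mul_inv, inv_eq_one_div, div_le_div_iff₀ (by positivity) (by positivity),
        one_mul, ← mul_pow]
      exact pow_le_pow_left₀ (by positivity) hca n
    rcases le_total (1 + ‖q‖) (1 + ‖p - q‖) with h | h
    · calc wt n q * wt n (p - q) ≤ wt n q * (2 ^ n * wt n p) := by
            gcongr
            exact aux _ _ _ h2 h1 h3 (by linarith)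
        _ = 2 ^ n * wt n p * wt n q := by ring
        _ ≤ _ := by gcongr; exact le_self_add
    · calc wt n q * wt n (p - q) ≤ (2 ^ n * wt n p) * wt n (p - q) := by
            gcongr
            exact aux _ _ _ h1 h2 h3 (by linarith)
        _ ≤ _ := by gcongr; exact le_add_self
  have hM : ∑' q, wt n q ≤ wtMass := tsum_le_tsum fun q => wt_anti hn q
  have hM2 : ∑' q, wt n (p - q) = ∑' q, wt n q := (Equiv.subLeft p).tsum_eq (wt n)
  calc ∑' q, wt n q * wt n (p - q)
      ≤ ∑' q, 2 ^ n * wt n p * (wt n q + wt n (p - q)) := tsum_le_tsum key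
    _ = 2 ^ n * wt n p * (∑' q, wt n q + ∑' q, wt n q) := by
        rw [ENNReal.tsum_mul_left, ENNReal.tsum_add, hM2]
    _ ≤ 2 ^ n * wt n p * (wtMass + wtMass) := by gcongr
    _ = _ := by rw [pow_succ]; ring

/-- Iterating the averaging with weights `wt n`. -/
lemma tsum_wt_tsum_wt_le {n : ℕ} (hn : 3 ≤ n) (a : ℤ² → ℝ≥0∞) (p : ℤ²) :
    ∑' q, wt n q * ∑' q', wt n q' * a (p - q - q') ≤
      (2 ^ (n + 1) * wtMass) * ∑' q, wt n q * a (p - q) := by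
  calc ∑' q, wt n q * ∑' q', wt n q' * a (p - q - q')
      = ∑' q, ∑' r, wt n q * wt n (r - q) * a (p - r) := by
        refine tsum_congr fun q => ?_
        rw [← ENNReal.tsum_mul_left, ← (Equiv.subRight q).tsum_eq]
        refine tsum_congr fun r => ?_
        simp only [Equiv.subRight_apply]
        rw [mul_assoc, show p - q - (r - q) = p - r by abel]
    _ = ∑' r, (∑' q, wt n q * wt n (r - q)) * a (p - r) := by
        rw [ENNReal.tsum_comm]
        simp_rw [ENNReal.tsum_mul_right]
    _ ≤ ∑' r, (2 ^ (n + 1) * wtMass) * wt n r * a (p - r) := by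
        gcongr with r; exact wt_conv_le hn r
    _ = _ := by simp_rw [mul_assoc, ENNReal.tsum_mul_left]

/-! ### Cubes -/

/-- The index of the cube of side `2^i` containing `x`. -/
def cubeIdx (i : ℕ) (x : Plane) : ℤ² := fun a => ⌊x a / 2 ^ i + 1 / 2⌋

lemma mem_planeCube_iff {i : ℕ} {m : ℤ²} {x : Plane} :
    x ∈ planeCube i m ↔ cubeIdx i x = m := by
  have h2 : (0 : ℝ) < 2 ^ i := by positivity
  simp only [planeCube, mem_ofPred_eq, funext_iff, cubeIdx, Int.floor_eq_iff]
  refine forall_congr' fun a => and_congr ?_ ?_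
  · rw [mul_comm, ← le_div_iff₀ h2]
    constructor <;> intro h <;> linarith
  · rw [mul_comm, ← div_lt_iff₀ h2]
    constructor <;> intro h <;> linarith

lemma measurableSet_planeCube (i : ℕ) (m : ℤ²) : MeasurableSet (planeCube i m) := by
  have : planeCube i m = ⋂ a, {x : Plane | (2 : ℝ) ^ i * ((m a : ℝ) - 1 / 2) ≤ x a ∧
      x a < (2 : ℝ) ^ i * ((m a : ℝ) + 1 / 2)} := by
    ext x; simp [planeCube]
  rw [this]
  refine MeasurableSet.iInter fun a => ?_
  have hm : Measurable fun x : Plane => x a := by fun_prop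
  exact (measurableSet_le measurable_const hm).inter (measurableSet_lt hm measurable_const)

lemma iUnion_planeCube (i : ℕ) : ⋃ m, planeCube i m = univ := by
  ext x; simp [mem_planeCube_iff]

lemma pairwise_disjoint_planeCube (i : ℕ) :
    Pairwise (Function.onFun Disjoint (planeCube i)) := by
  intro m m' h
  refine Set.disjoint_left.2 fun x hx hx' => h ?_
  rw [← mem_planeCube_iff.1 hx, ← mem_planeCube_iff.1 hx']

lemma tsum_lintegral_planeCube (i : ℕ) (F : Plane → ℝ≥0∞) :
    ∑' m, ∫⁻ x in planeCube i m, F x = ∫⁻ x, F x := by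
  rw [← lintegral_iUnion (measurableSet_planeCube i) (pairwise_disjoint_planeCube i),
    iUnion_planeCube, Measure.restrict_univ]

/-- The coordinate directions. -/
noncomputable abbrev dir (d : Fin 2) : Plane := EuclideanSpace.single d (1 : ℝ)

lemma inner_dir (x : Plane) (d : Fin 2) : (inner ℝ x (dir d) : ℝ) = x d := by
  simp [dir, EuclideanSpace.inner_single_right]

lemma abs_sub_center_le {i : ℕ} {p : ℤ²} {y : Plane} (hy : y ∈ planeCube i p) (d : Fin 2) :
    |y d - 2 ^ i * p d| ≤ 2 ^ i := by
  have h := hy d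
  have h2 : (0 : ℝ) < 2 ^ i := by positivity
  rw [abs_le]; constructor <;> nlinarith [h.1, h.2]

lemma exists_coord_norm (q : ℤ²) : ∃ d, ‖q‖ = |(q d : ℝ)| := by
  obtain ⟨d, -, hd⟩ := Finset.exists_mem_eq_sup (Finset.univ : Finset (Fin 2))
    Finset.univ_nonempty (fun b => ‖q b‖₊)
  refine ⟨d, ?_⟩
  have : ‖q‖₊ = ‖q d‖₊ := by rw [Pi.nnnorm_def, hd]
  have h2 := congrArg (fun r : ℝ≥0 => (r : ℝ)) this
  simpa [Int.norm_eq_abs] using h2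

lemma le_abs_sub_center {i : ℕ} {p p' : ℤ²} {x : Plane} (hx : x ∈ planeCube i p) {d : Fin 2}
    (hd : ‖p - p'‖ = |((p - p') d : ℝ)|) (hne : p ≠ p') :
    2 ^ i * (1 + ‖p - p'‖) / 4 ≤ |x d - 2 ^ i * p' d| := by
  have h := hx d
  have h2 : (0 : ℝ) < 2 ^ i := by positivity
  have h1 : 1 ≤ ‖p - p'‖ := by
    rw [hd]
    have hn : (p - p') d ≠ 0 := by
      intro h0
      rw [h0] at hd
      simp only [Int.cast_zero, abs_zero, norm_eq_zero, sub_eq_zero] at hd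
      exact hne hd
    exact_mod_cast Int.one_le_abs hn
  have h3 : |x d - 2 ^ i * (p d : ℝ)| ≤ 2 ^ i * (1 / 2) := by
    rw [abs_le]; constructor <;> nlinarith [h.1, h.2]
  have h4 : |(2 : ℝ) ^ i * ((p - p') d : ℝ)| = 2 ^ i * ‖p - p'‖ := by
    rw [abs_mul, abs_of_pos h2, hd]
  have h5 : |(2 : ℝ) ^ i * ((p - p') d : ℝ)| ≤ |x d - 2 ^ i * p' d| + |x d - 2 ^ i * (p d : ℝ)| := by
    have : (2 : ℝ) ^ i * (((p - p') d : ℤ) : ℝ)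
        = (x d - 2 ^ i * p' d) - (x d - 2 ^ i * (p d : ℝ)) := by
      simp only [Pi.sub_apply]; push_cast; ring
    rw [this]
    exact abs_sub _ _
  nlinarith

/-! ### Off-diagonal decay of multipliers -/

lemma IsTest.memLp_gker {m : Plane → ℂ} (hm : IsTest m) : MemLp (gker m) 2 :=
  _root_.memLp_gker hm.integrable hm.memLp_two

lemma pow_mul_gconv {m h : Plane → ℂ} (hm : IsTest m) (d : Fin 2) (c : ℝ) (n : ℕ)
    (hh : ∀ k ≤ n, MemLp (fun y : Plane => (((y d - c : ℝ) : ℂ)) ^ k * h y) 2) (x : Plane) :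
    (((x d - c : ℝ) : ℂ)) ^ n * gconv m h x = ∑ k ∈ Finset.range (n + 1), (n.choose k : ℂ) *
      gconv ((dI (dir d))^[k] m) (fun y => (((y d - c : ℝ) : ℂ)) ^ (n - k) * h y) x := by
  simp only [gconv]
  simp_rw [← integral_const_mul]
  rw [← integral_finsetSum]
  · refine integral_congr_ae (ae_of_all _ fun y => ?_)
    simp only
    have h1 : ((x d - c : ℝ) : ℂ) = ((x - y) d : ℝ) + ((y d - c : ℝ) : ℂ) := by
      simp only [PiLp.sub_apply]; push_cast; ring
    rw [h1, add_pow, sum_mul]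
    refine sum_congr rfl fun k _ => ?_
    rw [gker_dI_iterate hm, inner_dir]
    ring
  · intro k hk
    exact (integrable_gker_mul (hm.deriv_iterate _ k).memLp_gker (hh _ (by omega)) x).const_mul _

lemma norm_sum_mul_sq_le {ι : Type*} (s : Finset ι) (w : ι → ℝ) (hw : ∀ k ∈ s, 0 ≤ w k)
    (X : ι → ℂ) : ‖∑ k ∈ s, (w k : ℂ) * X k‖ ^ 2 ≤ (∑ k ∈ s, w k) * ∑ k ∈ s, w k * ‖X k‖ ^ 2 := by
  have h1 : ‖∑ k ∈ s, (w k : ℂ) * X k‖ ≤ ∑ k ∈ s, w k * ‖X k‖ := by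
    refine (norm_sum_le _ _).trans (sum_le_sum fun k hk => ?_)
    rw [norm_mul, norm_real, norm_of_nonneg (hw k hk)]
  have h2 := Finset.sum_sq_le_sum_mul_sum_of_sq_le_mul s (r := fun k => w k * ‖X k‖) (f := w)
    (g := fun k => w k * ‖X k‖ ^ 2) hw (fun k hk => mul_nonneg (hw k hk) (by positivity))
    (fun k _ => le_of_eq (by ring))
  exact (pow_le_pow_left₀ (norm_nonneg _) h1 2).trans h2

lemma lintegral_gconv_offdiag {α β : Type*} [Fintype α] [Fintype β]
    {m : α → β → Plane → ℂ} {A μ : ℝ} (hA : 0 ≤ A) (hμ : 1 ≤ μ) (i n : ℕ)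
    (hm : ∀ a b, IsTest (m a b))
    (hop : ∀ d, ∀ k ≤ n, ∀ ξ (z : β → ℂ), ∑ a, ‖∑ b, (dI (dir d))^[k] (m a b) ξ * z b‖ ^ 2
      ≤ A * (2 ^ i * μ) ^ (2 * k) * ∑ b, ‖z b‖ ^ 2)
    {p p' : ℤ²} {h : β → Plane → ℂ} (hh : ∀ b, MemLp (h b) 2)
    (hs : ∀ b, ∀ y ∉ planeCube i p', h b y = 0) :
    ∑ a, ∫⁻ x in planeCube i p, ‖∑ b, gconv (m a b) (h b) x‖ₑ ^ 2 ≤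
      ofReal (64 ^ n * A * μ ^ (2 * n)) * wt (2 * n) (p - p')
        * ∑ b, ∫⁻ x, ‖h b x‖ₑ ^ 2 := by
  have hint : ∀ a b d k, Integrable ((dI (dir d))^[k] (m a b)) := fun a b d k =>
    ((hm a b).deriv_iterate _ k).integrable
  have hbd : ∀ a b d k, ∃ B : ℝ, ∀ ξ, ‖((dI (dir d))^[k] (m a b)) ξ‖ ≤ B := fun a b d k =>
    ((hm a b).deriv_iterate _ k).bounded
  by_cases hne : p = p'
  · subst hne
    have h0 := lintegral_gconv_matrix (A := A) hA (fun a b => hint a b 0 0)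
      (fun a b => hbd a b 0 0) (fun ξ z => by simpa using hop 0 0 (Nat.zero_le _) ξ z) hh
    simp only [Function.iterate_zero, id] at h0
    have hw : wt (2 * n) (p - p) = 1 := by simp [wt]
    rw [hw, mul_one]
    calc ∑ a, ∫⁻ x in planeCube i p, ‖∑ b, gconv (m a b) (h b) x‖ₑ ^ 2
        ≤ ∑ a, ∫⁻ x, ‖∑ b, gconv (m a b) (h b) x‖ₑ ^ 2 := by
          gcongr; exact Measure.restrict_le_self
      _ ≤ _ := h0
      _ ≤ _ := by
          gcongr
          have : (1 : ℝ) ≤ 64 ^ n := one_le_pow₀ (by norm_num)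
          have h2 : (1 : ℝ) ≤ μ ^ (2 * n) := one_le_pow₀ hμ
          calc A = 1 * A * 1 := by ring
            _ ≤ 64 ^ n * A * μ ^ (2 * n) := by gcongr
  · obtain ⟨d, hd⟩ := exists_coord_norm (p - p')
    set c : ℝ := 2 ^ i * p' d
    have hL : (0 : ℝ) < 2 ^ i := by positivity
    set D : ℝ := 1 + ‖p - p'‖ with hD
    have hD1 : 1 ≤ D := one_le_one_add_norm _
    have hpt : ∀ b k (y : Plane), ‖(((y d - c : ℝ) : ℂ)) ^ k * h b y‖
        ≤ (2 ^ i) ^ k * ‖h b y‖ := by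
      intro b k y
      by_cases hy : y ∈ planeCube i p'
      · rw [norm_mul, norm_pow, norm_real, norm_eq_abs]
        gcongr
        exact abs_sub_center_le hy d
      · simp [hs b y hy]
    have hmom : ∀ b k, MemLp (fun y : Plane => (((y d - c : ℝ) : ℂ)) ^ k * h b y) 2 := by
      intro b k
      refine ((hh b).const_mul (((2 ^ i) ^ k : ℝ) : ℂ)).of_le ?_ (ae_of_all _ ?_)
      · exact (Continuous.aestronglyMeasurable (by fun_prop)).mul (hh b).1
      · intro y
        refine (hpt b k y).trans_eq ?_
        rw [norm_mul, norm_real, norm_of_nonneg (by positivity)]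
    have hmomE : ∀ b k, ∫⁻ y : Plane, ‖(((y d - c : ℝ) : ℂ)) ^ k * h b y‖ₑ ^ 2
        ≤ ofReal ((2 ^ i) ^ (2 * k)) * ∫⁻ y, ‖h b y‖ₑ ^ 2 := by
      intro b k
      rw [← lintegral_const_mul' _ _ ofReal_ne_top]
      refine lintegral_mono fun y => ?_
      simp only [enorm_sq_eq_ofReal]
      rw [← ofReal_mul (by positivity)]
      refine ofReal_le_ofReal ?_
      calc _ ≤ ((2 ^ i) ^ k * ‖h b y‖) ^ 2 := pow_le_pow_left₀ (norm_nonneg _) (hpt b k y) 2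
        _ = _ := by ring
    set X : ℕ → α → Plane → ℂ := fun k a x => ∑ b, gconv ((dI (dir d))^[k] (m a b))
      (fun y => (((y d - c : ℝ) : ℂ)) ^ (n - k) * h b y) x with hX
    have hXE : ∀ k ≤ n, ∑ a, ∫⁻ x, ‖X k a x‖ₑ ^ 2 ≤
        ofReal (A * μ ^ (2 * n) * (2 ^ i) ^ (2 * n)) * ∑ b, ∫⁻ x, ‖h b x‖ₑ ^ 2 := by
      intro k hk
      refine (lintegral_gconv_matrix (A := A * (2 ^ i * μ) ^ (2 * k)) (by positivity)
        (fun a b => hint a b d k) (fun a b => hbd a b d k) (hop d k hk)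
        (fun b => hmom b (n - k))).trans ?_
      calc _ ≤ ofReal (A * (2 ^ i * μ) ^ (2 * k)) *
            ∑ b, ofReal ((2 ^ i) ^ (2 * (n - k))) * ∫⁻ y, ‖h b y‖ₑ ^ 2 := by
            gcongr with b; exact hmomE b _
        _ = ofReal (A * (2 ^ i * μ) ^ (2 * k) * (2 ^ i) ^ (2 * (n - k))) *
            ∑ b, ∫⁻ y, ‖h b y‖ₑ ^ 2 := by
            rw [← mul_sum, ← mul_assoc, ← ofReal_mul (by positivity)]
        _ ≤ _ := by
            refine mul_le_mul_left (ofReal_le_ofReal ?_) _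
            calc A * (2 ^ i * μ) ^ (2 * k) * (2 ^ i) ^ (2 * (n - k))
                = A * μ ^ (2 * k) * ((2 ^ i) ^ (2 * k) * (2 ^ i) ^ (2 * (n - k))) := by ring
              _ = A * μ ^ (2 * k) * (2 ^ i) ^ (2 * n) := by
                  rw [← pow_add]; congr 2; omega
              _ ≤ _ := by gcongr
    have hid : ∀ a x, (((x d - c : ℝ) : ℂ)) ^ n * ∑ b, gconv (m a b) (h b) x =
        ∑ k ∈ Finset.range (n + 1), ((n.choose k : ℝ) : ℂ) * X k a x := by
      intro a x
      rw [mul_sum]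
      simp_rw [pow_mul_gconv (hm a _) d c n (fun k _ => hmom _ k) x, hX, mul_sum]
      rw [Finset.sum_comm]
      simp
    have hptw : ∀ a, ∀ x ∈ planeCube i p, ‖∑ b, gconv (m a b) (h b) x‖ₑ ^ 2 ≤
        ∑ k ∈ Finset.range (n + 1), ofReal ((4 / (2 ^ i * D)) ^ (2 * n) * 2 ^ n *
          n.choose k) * ‖X k a x‖ₑ ^ 2 := by
      intro a x hx
      have hlow := le_abs_sub_center hx hd hne
      have h1 := norm_sum_mul_sq_le (Finset.range (n + 1)) (fun k => (n.choose k : ℝ))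
        (fun _ _ => by positivity) (fun k => X k a x)
      rw [← hid] at h1
      have hch : ∑ k ∈ Finset.range (n + 1), (n.choose k : ℝ) = 2 ^ n := by
        exact_mod_cast Nat.sum_range_choose n
      rw [hch, norm_mul, norm_pow, norm_real, norm_eq_abs] at h1
      simp_rw [enorm_sq_eq_ofReal]
      simp_rw [← ofReal_mul (show (0 : ℝ) ≤ (4 / (2 ^ i * D)) ^ (2 * n) * 2 ^ n *
          (n.choose _ : ℝ) by positivity)]
      rw [← ofReal_sum_of_nonneg (fun _ _ => by positivity)]
      refine ofReal_le_ofReal ?_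
      set S := ‖∑ b, gconv (m a b) (h b) x‖
      have h3 : 1 ≤ (4 / (2 ^ i * D)) ^ (2 * n) * (|x d - c| ^ n) ^ 2 := by
        rw [← pow_mul, mul_comm n 2, ← mul_pow]
        refine one_le_pow₀ ?_
        rw [div_mul_eq_mul_div, le_div_iff₀ (by positivity)]
        linarith
      calc S ^ 2 ≤ ((4 / (2 ^ i * D)) ^ (2 * n) * (|x d - c| ^ n) ^ 2) * S ^ 2 :=
            le_mul_of_one_le_left (by positivity) h3
        _ = (4 / (2 ^ i * D)) ^ (2 * n) * (|x d - c| ^ n * S) ^ 2 := by ring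
        _ ≤ (4 / (2 ^ i * D)) ^ (2 * n) * (2 ^ n * ∑ k ∈ Finset.range (n + 1),
              (n.choose k : ℝ) * ‖X k a x‖ ^ 2) := by gcongr
        _ = _ := by
            rw [mul_sum, mul_sum]
            refine sum_congr rfl fun k _ => by ring
    have hXm : ∀ k a, Measurable (fun x => ‖X k a x‖ₑ ^ 2) := by
      intro k a
      exact ((Finset.measurable_sum _ fun b _ =>
        measurable_gconv (hint a b d k) (hmom b (n - k)).1).enorm).pow_const 2
    calc ∑ a, ∫⁻ x in planeCube i p, ‖∑ b, gconv (m a b) (h b) x‖ₑ ^ 2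
        ≤ ∑ a, ∫⁻ x in planeCube i p, ∑ k ∈ Finset.range (n + 1),
            ofReal ((4 / (2 ^ i * D)) ^ (2 * n) * 2 ^ n * n.choose k) *
              ‖X k a x‖ₑ ^ 2 := by
          refine sum_le_sum fun a _ => ?_
          exact setLIntegral_mono' (measurableSet_planeCube i p) (hptw a)
      _ ≤ ∑ a, ∫⁻ x, ∑ k ∈ Finset.range (n + 1),
            ofReal ((4 / (2 ^ i * D)) ^ (2 * n) * 2 ^ n * n.choose k) *
              ‖X k a x‖ₑ ^ 2 := by
          gcongr; exact Measure.restrict_le_self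
      _ = ∑ k ∈ Finset.range (n + 1),
            ofReal ((4 / (2 ^ i * D)) ^ (2 * n) * 2 ^ n * n.choose k) *
              ∑ a, ∫⁻ x, ‖X k a x‖ₑ ^ 2 := by
          simp_rw [mul_sum]
          rw [Finset.sum_comm]
          refine sum_congr rfl fun a _ => ?_
          rw [lintegral_finsetSum _ fun k _ => (hXm k a).const_mul _]
          simp_rw [lintegral_const_mul' _ _ ofReal_ne_top]
      _ ≤ ∑ k ∈ Finset.range (n + 1),
            ofReal ((4 / (2 ^ i * D)) ^ (2 * n) * 2 ^ n * n.choose k) *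
              (ofReal (A * μ ^ (2 * n) * (2 ^ i) ^ (2 * n)) *
                ∑ b, ∫⁻ x, ‖h b x‖ₑ ^ 2) := by
          gcongr with k hk
          exact hXE k (by simpa [Nat.lt_succ_iff] using hk)
      _ = ofReal (∑ k ∈ Finset.range (n + 1),
            ((4 / (2 ^ i * D)) ^ (2 * n) * 2 ^ n * n.choose k) *
              (A * μ ^ (2 * n) * (2 ^ i) ^ (2 * n))) * ∑ b, ∫⁻ x, ‖h b x‖ₑ ^ 2 := by
          rw [ofReal_sum_of_nonneg (fun _ _ => by positivity), sum_mul]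
          refine sum_congr rfl fun k _ => ?_
          rw [← mul_assoc, ← ofReal_mul (by positivity)]
      _ = _ := by
          rw [wt, ← ofReal_mul (by positivity)]
          congr 2
          have hch : ∑ k ∈ Finset.range (n + 1), (n.choose k : ℝ) = 2 ^ n := by
            exact_mod_cast Nat.sum_range_choose n
          rw [← sum_mul, ← mul_sum, hch, ← hD, div_pow, mul_pow, pow_mul 4 2 n,
            show (64 : ℝ) ^ n = (4 ^ 2) ^ n * 2 ^ n * 2 ^ n by
              rw [← mul_pow, ← mul_pow]; norm_num]
          field_simp

/-- Off-diagonal decay summed over cubes. -/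
lemma lintegral_gconv_cubes {α β : Type*} [Fintype α] [Fintype β]
    {m : α → β → Plane → ℂ} {A μ : ℝ} (hA : 0 ≤ A) (hμ : 1 ≤ μ) (i n e : ℕ) (hne : e + 3 ≤ 2 * n)
    (hm : ∀ a b, IsTest (m a b))
    (hop : ∀ d, ∀ k ≤ n, ∀ ξ (z : β → ℂ), ∑ a, ‖∑ b, (dI (dir d))^[k] (m a b) ξ * z b‖ ^ 2
      ≤ A * (2 ^ i * μ) ^ (2 * k) * ∑ b, ‖z b‖ ^ 2)
    (p : ℤ²) {g : β → Plane → ℂ} (hg : ∀ b, MemLp (g b) 2) :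
    ∑ a, ∫⁻ x in planeCube i p, ‖∑ b, gconv (m a b) (g b) x‖ₑ ^ 2 ≤
      wtMass * ofReal (64 ^ n * A * μ ^ (2 * n)) *
        ∑' q, wt e q * ∑ b, ∫⁻ x in planeCube i (p - q), ‖g b x‖ₑ ^ 2 := by
  classical
  set h : ℤ² → β → Plane → ℂ := fun q b => (planeCube i (p - q)).indicator (g b) with hh
  have hhm : ∀ q b, MemLp (h q b) 2 := fun q b => (hg b).indicator (measurableSet_planeCube _ _)
  have hhs : ∀ q b, ∀ y ∉ planeCube i (p - q), h q b y = 0 := fun q b y hy =>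
    indicator_of_notMem hy _
  have hhE : ∀ q b, ∫⁻ x, ‖h q b x‖ₑ ^ 2 = ∫⁻ x in planeCube i (p - q), ‖g b x‖ₑ ^ 2 := by
    intro q b
    rw [← lintegral_indicator (measurableSet_planeCube _ _)]
    refine lintegral_congr fun x => ?_
    by_cases hx : x ∈ planeCube i (p - q) <;> simp [hh, hx]
  have hsum : ∀ a b x, HasSum (fun q => gconv (m a b) (h q b) x) (gconv (m a b) (g b) x) := by
    intro a b x
    have h1 := hasSum_integral_iUnion (f := fun y => gker (m a b) (x - y) * g b y)
      (μ := (volume : Measure Plane)) (s := fun q => planeCube i (p - q))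
      (fun q => measurableSet_planeCube _ _)
      ((pairwise_disjoint_planeCube i).comp_of_injective (sub_right_injective))
      (integrable_gker_mul (hm a b).memLp_gker (hg b) x).integrableOn
    have h2 : ⋃ q, planeCube i (p - q) = univ := by
      rw [← iUnion_planeCube i]
      exact (Equiv.subLeft p).surjective.iUnion_comp (planeCube i)
    rw [h2, Measure.restrict_univ] at h1
    refine h1.congr_fun ?_
    intro q
    simp only [gconv, hh]
    rw [← integral_indicator (measurableSet_planeCube _ _)]
    congr 1
    ext y
    by_cases hy : y ∈ planeCube i (p - q) <;> simp [hy]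
  have hpt : ∀ a x, ‖∑ b, gconv (m a b) (g b) x‖ₑ ^ 2 ≤
      wtMass * ∑' q, (wt 3 q)⁻¹ * ‖∑ b, gconv (m a b) (h q b) x‖ₑ ^ 2 := by
    intro a x
    have h1 : HasSum (fun q => ∑ b, gconv (m a b) (h q b) x) (∑ b, gconv (m a b) (g b) x) :=
      hasSum_sum fun b _ => hsum a b x
    have h2 : ‖∑ b, gconv (m a b) (g b) x‖ₑ ≤ ∑' q, ‖∑ b, gconv (m a b) (h q b) x‖ₑ := by
      rw [← h1.tsum_eq]; exact enorm_tsum_le_tsum_enorm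
    have h3 := tsum_mul_sq_le_weighted (wt 3)
      (fun q => (wt 3 q)⁻¹ * ‖∑ b, gconv (m a b) (h q b) x‖ₑ)
    have h4 : ∀ q (y : ℝ≥0∞), wt 3 q * ((wt 3 q)⁻¹ * y) = y := fun q y => by
      rw [← mul_assoc, ENNReal.mul_inv_cancel (wt_ne_zero 3 q) (wt_ne_top 3 q), one_mul]
    simp_rw [mul_pow, sq (wt 3 _)⁻¹, mul_assoc, h4] at h3
    calc _ ≤ (∑' q, ‖∑ b, gconv (m a b) (h q b) x‖ₑ) ^ 2 := by gcongr
      _ ≤ _ := h3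
  have hmeas : ∀ a q, Measurable fun x => ‖∑ b, gconv (m a b) (h q b) x‖ₑ ^ 2 := fun a q =>
    ((Finset.measurable_sum _ fun b _ =>
      measurable_gconv (hm a b).integrable (hhm q b).1).enorm).pow_const 2
  calc ∑ a, ∫⁻ x in planeCube i p, ‖∑ b, gconv (m a b) (g b) x‖ₑ ^ 2
      ≤ ∑ a, ∫⁻ x in planeCube i p,
          wtMass * ∑' q, (wt 3 q)⁻¹ * ‖∑ b, gconv (m a b) (h q b) x‖ₑ ^ 2 := by
        gcongr with a _ x; exact hpt a x
    _ = wtMass * ∑' q, (wt 3 q)⁻¹ * ∑ a, ∫⁻ x in planeCube i p,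
          ‖∑ b, gconv (m a b) (h q b) x‖ₑ ^ 2 := by
        simp_rw [lintegral_const_mul' _ _ wtMass_ne_top]
        rw [← mul_sum]
        congr 1
        simp_rw [mul_sum]
        rw [Summable.tsum_finsetSum fun _ _ => ENNReal.summable]
        refine sum_congr rfl fun a _ => ?_
        rw [lintegral_tsum fun q => ((hmeas a q).const_mul _).aemeasurable]
        refine tsum_congr fun q => ?_
        rw [lintegral_const_mul' _ _ (ENNReal.inv_ne_top.2 (wt_ne_zero 3 q))]
    _ ≤ wtMass * ∑' q, (wt 3 q)⁻¹ * (ofReal (64 ^ n * A * μ ^ (2 * n)) *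
          wt (e + 3) q * ∑ b, ∫⁻ x in planeCube i (p - q), ‖g b x‖ₑ ^ 2) := by
        gcongr with q
        refine (lintegral_gconv_offdiag hA hμ i n hm hop (hhm q) (hhs q)).trans ?_
        simp_rw [hhE]
        rw [sub_sub_cancel]
        gcongr
        exact wt_anti hne q
    _ = _ := by
        rw [mul_assoc wtMass]
        congr 1
        rw [← ENNReal.tsum_mul_left]
        refine tsum_congr fun q => ?_
        rw [wt_add]
        have : (wt 3 q)⁻¹ * wt 3 q = 1 := ENNReal.inv_mul_cancel (wt_ne_zero 3 q) (wt_ne_top 3 q)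
        calc _ = ((wt 3 q)⁻¹ * wt 3 q) * (ofReal (64 ^ n * A * μ ^ (2 * n)) *
              (wt e q * ∑ b, ∫⁻ x in planeCube i (p - q), ‖g b x‖ₑ ^ 2)) := by ring
          _ = _ := by rw [this, one_mul]

/-- Smooth symbols of compact support with `|∂^k m| ≤ A Λ^k` for `k ≤ n`, for coordinate
derivatives. -/
def SymB (n : ℕ) (A Λ : ℝ) (m : Plane → ℂ) : Prop :=
  IsTest m ∧ ∀ d, ∀ k ≤ n, ∀ ξ, ‖(dI (dir d))^[k] m ξ‖ ≤ A * Λ ^ k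

lemma dI_iterate_eq_zero {m : Plane → ℂ} {ξ : Plane} (h : ξ ∉ tsupport m) (v : Plane) (k : ℕ) :
    (dI v)^[k] m ξ = 0 := by
  have : tsupport ((dI v)^[k] m) ⊆ tsupport m := by
    induction k with
    | zero => exact le_rfl
    | succ k ih => rw [Function.iterate_succ_apply']; exact (tsupport_dI_subset _ _).trans ih
  exact image_eq_zero_of_notMem_tsupport (f := (dI v)^[k] m) fun h' => h (this h')

lemma sum_norm_sq_le_of_overlap {α : Type*} [Fintype α] {n K : ℕ} {A Λ : ℝ}
    {m : α → Plane → ℂ} (hm : ∀ a, SymB n A Λ (m a))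
    (hK : ∀ (ξ : Plane) (s : Finset α), (∀ a ∈ s, ξ ∈ tsupport (m a)) → s.card ≤ K)
    (d : Fin 2) {k : ℕ} (hk : k ≤ n) (ξ : Plane) :
    ∑ a, ‖(dI (dir d))^[k] (m a) ξ‖ ^ 2 ≤ K * A ^ 2 * Λ ^ (2 * k) := by
  classical
  rw [← Finset.sum_filter_add_sum_filter_not Finset.univ (fun a => ξ ∈ tsupport (m a))]
  have h2 : ∑ a with ¬ ξ ∈ tsupport (m a), ‖(dI (dir d))^[k] (m a) ξ‖ ^ 2 = 0 := by
    refine Finset.sum_eq_zero fun a ha => ?_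
    rw [dI_iterate_eq_zero (Finset.mem_filter.1 ha).2]; simp
  rw [h2, add_zero]
  have h3 : (0 : ℝ) ≤ A ^ 2 * Λ ^ (2 * k) := by
    rw [mul_comm 2 k, pow_mul]; positivity
  calc _ ≤ ∑ a with ξ ∈ tsupport (m a), (A * Λ ^ k) ^ 2 := by
        refine sum_le_sum fun a _ => ?_
        exact pow_le_pow_left₀ (norm_nonneg _) ((hm a).2 d k hk ξ) 2
    _ = (Finset.univ.filter fun a => ξ ∈ tsupport (m a)).card * (A ^ 2 * Λ ^ (2 * k)) := by
        rw [Finset.sum_const, nsmul_eq_mul]; ring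
    _ ≤ K * (A ^ 2 * Λ ^ (2 * k)) := by
        gcongr
        exact hK ξ _ fun a ha => (Finset.mem_filter.1 ha).2
    _ = _ := by ring

lemma lintegral_gconv_analysis {α : Type*} [Fintype α] {A μ : ℝ} (hμ : 1 ≤ μ)
    (i n e K : ℕ) (hne : e + 3 ≤ 2 * n) {m : α → Plane → ℂ} (hm : ∀ a, SymB n A (2 ^ i * μ) (m a))
    (hK : ∀ (ξ : Plane) (s : Finset α), (∀ a ∈ s, ξ ∈ tsupport (m a)) → s.card ≤ K)
    (p : ℤ²) {g : Plane → ℂ} (hg : MemLp g 2) :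
    ∑ a, ∫⁻ x in planeCube i p, ‖gconv (m a) g x‖ₑ ^ 2 ≤
      wtMass * ofReal (64 ^ n * (K * A ^ 2) * μ ^ (2 * n)) *
        ∑' q, wt e q * ∫⁻ x in planeCube i (p - q), ‖g x‖ₑ ^ 2 := by
  have := lintegral_gconv_cubes (α := α) (β := Unit) (m := fun a _ => m a) (A := K * A ^ 2)
    (by positivity) hμ i n e hne (fun a _ => (hm a).1) ?_ p (g := fun _ => g) (fun _ => hg)
  · simpa using this
  · intro d k hk ξ z
    simp only [Finset.univ_unique, Finset.sum_singleton, norm_mul, mul_pow]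
    rw [← sum_mul]
    gcongr
    have := sum_norm_sq_le_of_overlap hm hK d hk ξ
    simpa [mul_pow] using this

lemma lintegral_gconv_synthesis {β : Type*} [Fintype β] {A μ : ℝ} (hμ : 1 ≤ μ)
    (i n e K : ℕ) (hne : e + 3 ≤ 2 * n) {m : β → Plane → ℂ} (hm : ∀ b, SymB n A (2 ^ i * μ) (m b))
    (hK : ∀ (ξ : Plane) (s : Finset β), (∀ b ∈ s, ξ ∈ tsupport (m b)) → s.card ≤ K)
    (p : ℤ²) {g : β → Plane → ℂ} (hg : ∀ b, MemLp (g b) 2) :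
    ∫⁻ x in planeCube i p, ‖∑ b, gconv (m b) (g b) x‖ₑ ^ 2 ≤
      wtMass * ofReal (64 ^ n * (K * A ^ 2) * μ ^ (2 * n)) *
        ∑' q, wt e q * ∑ b, ∫⁻ x in planeCube i (p - q), ‖g b x‖ₑ ^ 2 := by
  have := lintegral_gconv_cubes (α := Unit) (β := β) (m := fun _ b => m b) (A := K * A ^ 2)
    (by positivity) hμ i n e hne (fun _ b => (hm b).1) ?_ p (g := g) hg
  · simpa using this
  · intro d k hk ξ z
    simp only [Finset.univ_unique, Finset.sum_singleton]
    have h1 : ‖∑ b, (dI (dir d))^[k] (m b) ξ * z b‖ ≤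
        ∑ b, ‖(dI (dir d))^[k] (m b) ξ‖ * ‖z b‖ := by
      refine (norm_sum_le _ _).trans_eq ?_
      simp
    have h2 := Finset.sum_mul_sq_le_sq_mul_sq Finset.univ
      (fun b => ‖(dI (dir d))^[k] (m b) ξ‖) (fun b => ‖z b‖)
    have h3 := sum_norm_sq_le_of_overlap hm hK d hk ξ
    calc _ ≤ (∑ b, ‖(dI (dir d))^[k] (m b) ξ‖ * ‖z b‖) ^ 2 :=
          pow_le_pow_left₀ (norm_nonneg _) h1 2
      _ ≤ _ := h2
      _ ≤ _ := by gcongr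

/-! ### Estimates for symbols -/

section Leibniz

variable {E : Type*} [NormedAddCommGroup E] [InnerProductSpace ℝ E]

lemma contDiff_dI {f : E → ℂ} (hf : ContDiff ℝ ∞ f) (v : E) : ContDiff ℝ ∞ (dI v f) :=
  contDiff_const.mul ((hf.fderiv_right (m := ∞) (by simp)).clm_apply contDiff_const)

lemma dI_add {f g : E → ℂ} (hf : ContDiff ℝ ∞ f) (hg : ContDiff ℝ ∞ g) (v : E) :
    dI v (fun ξ => f ξ + g ξ) = fun ξ => dI v f ξ + dI v g ξ := by
  funext ξ
  have h1 := (hf.differentiable (by simp)) ξ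
  have h2 := (hg.differentiable (by simp)) ξ
  simp only [dI]
  rw [fderiv_fun_add h1 h2]
  simp [mul_add]

lemma dI_mul {f g : E → ℂ} (hf : ContDiff ℝ ∞ f) (hg : ContDiff ℝ ∞ g) (v : E) :
    dI v (fun ξ => f ξ * g ξ) = fun ξ => dI v f ξ * g ξ + f ξ * dI v g ξ := by
  funext ξ
  have h1 := (hf.differentiable (by simp)) ξ
  have h2 := (hg.differentiable (by simp)) ξ
  simp only [dI]
  rw [fderiv_fun_mul h1 h2]
  simp
  ring

lemma dI_iterate_add (v : E) (k : ℕ) : ∀ {f g : E → ℂ}, ContDiff ℝ ∞ f → ContDiff ℝ ∞ g →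
    (dI v)^[k] (fun ξ => f ξ + g ξ) = fun ξ => (dI v)^[k] f ξ + (dI v)^[k] g ξ := by
  induction k with
  | zero => intro f g _ _; rfl
  | succ k ih =>
    intro f g hf hg
    rw [Function.iterate_succ_apply, dI_add hf hg, ih (contDiff_dI hf v) (contDiff_dI hg v)]
    rfl

/-- A pointwise consequence of the Leibniz rule. -/
lemma norm_dI_iterate_mul_le (v ξ : E) {Λ : ℝ} (k : ℕ) :
    ∀ {f g : E → ℂ} {A B : ℝ}, ContDiff ℝ ∞ f → ContDiff ℝ ∞ g →
      (∀ j ≤ k, ‖(dI v)^[j] f ξ‖ ≤ A * Λ ^ j) → (∀ j ≤ k, ‖(dI v)^[j] g ξ‖ ≤ B * Λ ^ j) →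
      ‖(dI v)^[k] (fun ξ => f ξ * g ξ) ξ‖ ≤ A * B * (2 * Λ) ^ k := by
  induction k with
  | zero =>
    intro f g A B _ _ h1 h2
    have h1' := h1 0 le_rfl
    have h2' := h2 0 le_rfl
    simp only [Function.iterate_zero, id, pow_zero, mul_one, norm_mul] at h1' h2' ⊢
    exact mul_le_mul h1' h2' (norm_nonneg _) ((norm_nonneg _).trans h1')
  | succ k ih =>
    intro f g A B hf hg h1 h2
    rw [Function.iterate_succ_apply, dI_mul hf hg, dI_iterate_add v k
      ((contDiff_dI hf v).mul hg) (hf.mul (contDiff_dI hg v))]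
    have e1 := ih (A := A * Λ) (B := B) (contDiff_dI hf v) hg
      (fun j hj => by
        have := h1 (j + 1) (by omega)
        rw [Function.iterate_succ_apply] at this
        refine this.trans_eq (by ring)) (fun j hj => h2 j (by omega))
    have e2 := ih (A := A) (B := B * Λ) hf (contDiff_dI hg v)
      (fun j hj => h1 j (by omega)) (fun j hj => by
        have := h2 (j + 1) (by omega)
        rw [Function.iterate_succ_apply] at this
        refine this.trans_eq (by ring))
    calc _ ≤ _ := norm_add_le _ _
      _ ≤ A * Λ * B * (2 * Λ) ^ k + A * (B * Λ) * (2 * Λ) ^ k := add_le_add e1 e2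
      _ = _ := by ring

lemma dI_comp_affine {f : E → ℂ} (v a : E) (c : ℝ) :
    dI v (fun ξ => f (c • (ξ - a))) = fun ξ => (c : ℂ) * dI v f (c • (ξ - a)) := by
  funext ξ
  simp only [dI]
  have h1 : fderiv ℝ (fun ξ => f (c • (ξ - a))) ξ = fderiv ℝ (fun ζ => f (c • ζ)) (ξ - a) :=
    fderiv_comp_sub (f := fun ζ => f (c • ζ)) a
  rw [h1, fderiv_comp_smul]
  simp
  ring

lemma dI_const_mul {f : E → ℂ} (v : E) (c : ℂ) (hf : ContDiff ℝ ∞ f) :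
    dI v (fun ξ => c * f ξ) = fun ξ => c * dI v f ξ := by
  funext ξ
  simp only [dI]
  rw [fderiv_const_mul ((hf.differentiable (by simp)) ξ)]
  simp
  ring

lemma dI_iterate_comp_affine (v a : E) (c : ℝ) (k : ℕ) :
    ∀ {f : E → ℂ}, ContDiff ℝ ∞ f → ∀ ξ, (dI v)^[k] (fun ξ => f (c • (ξ - a))) ξ =
      (c : ℂ) ^ k * (dI v)^[k] f (c • (ξ - a)) := by
  have hcm : ∀ (k : ℕ) {f : E → ℂ}, ContDiff ℝ ∞ f →
      (dI v)^[k] (fun ξ => (c : ℂ) * f ξ) = fun ξ => (c : ℂ) * (dI v)^[k] f ξ := by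
    intro k
    induction k with
    | zero => intro f _; rfl
    | succ k ih =>
      intro f hf
      rw [Function.iterate_succ_apply, dI_const_mul v _ hf, ih (contDiff_dI hf v)]
      rfl
  induction k with
  | zero => intro f _ ξ; simp
  | succ k ih =>
    intro f hf ξ
    have hf2 : ContDiff ℝ ∞ fun ξ => dI v f (c • (ξ - a)) :=
      (contDiff_dI hf v).comp (contDiff_const.smul (contDiff_id.sub contDiff_const))
    rw [Function.iterate_succ_apply, dI_comp_affine, hcm k hf2]
    show (c : ℂ) * (dI v)^[k] (fun ξ => dI v f (c • (ξ - a))) ξ = _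
    rw [ih (contDiff_dI hf v), ← Function.iterate_succ_apply]
    ring

lemma dI_iterate_eq_iteratedFDeriv (v : E) (k : ℕ) {f : E → ℂ} (hf : ContDiff ℝ ∞ f) (ξ : E) :
    (dI v)^[k] f ξ = I ^ k * iteratedFDeriv ℝ k f ξ (fun _ => v) := by
  induction k generalizing ξ with
  | zero => simp
  | succ k ih =>
    rw [Function.iterate_succ_apply', dI]
    have h1 : (dI v)^[k] f = fun ξ => I ^ k * iteratedFDeriv ℝ k f ξ (fun _ => v) :=
      funext ih
    have h2 : DifferentiableAt ℝ (iteratedFDeriv ℝ k f) ξ :=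
      (hf.differentiable_iteratedFDeriv (by exact_mod_cast WithTop.coe_lt_top _)) ξ
    rw [h1, fderiv_const_mul (h2.continuousMultilinear_apply_const _)]
    rw [iteratedFDeriv_succ_apply_left, fderiv_continuousMultilinear_apply_const h2]
    simp only [smul_apply, smul_eq_mul,
      ContinuousLinearMap.flipMultilinear_apply_apply]
    rw [pow_succ]
    have : Fin.tail (fun _ : Fin (k + 1) => v) = fun _ => v := rfl
    rw [this]
    ring

end Leibniz

lemma SymB.mono {n : ℕ} {A A' Λ Λ' : ℝ} {m : Plane → ℂ} (h : SymB n A Λ m) (hA : A ≤ A')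
    (hA0 : 0 ≤ A') (hΛ0 : 0 ≤ Λ) (hΛ : Λ ≤ Λ') : SymB n A' Λ' m := by
  refine ⟨h.1, fun d k hk ξ => (h.2 d k hk ξ).trans ?_⟩
  gcongr

lemma SymB.mul {n : ℕ} {A B Λ : ℝ} {f g : Plane → ℂ} (hΛ : 0 ≤ Λ) (hA : 0 ≤ A) (hB : 0 ≤ B)
    (hf : SymB n A Λ f) (hg : SymB n B Λ g) : SymB n (2 ^ n * A * B) Λ (fun ξ => f ξ * g ξ) := by
  refine ⟨⟨hf.1.1.mul hg.1.1, hf.1.2.mul_right⟩, fun d k hk ξ => ?_⟩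
  refine (norm_dI_iterate_mul_le (dir d) ξ (Λ := Λ) k hf.1.1 hg.1.1
    (fun j hj => hf.2 d j (hj.trans hk) ξ) (fun j hj => hg.2 d j (hj.trans hk) ξ)).trans ?_
  rw [mul_pow]
  have : (2 : ℝ) ^ k ≤ 2 ^ n := pow_le_pow_right₀ (by norm_num) hk
  calc A * B * (2 ^ k * Λ ^ k) ≤ A * B * (2 ^ n * Λ ^ k) := by gcongr
    _ = _ := by ring

lemma contDiff_cexp_norm_sq (z : ℂ) :
    ContDiff ℝ ∞ fun ξ : Plane => exp (z * ((‖ξ‖ ^ 2 : ℝ) : ℂ)) :=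
  (contDiff_const.mul (Complex.ofRealCLM.contDiff.comp (contDiff_norm_sq ℝ))).cexp

lemma dI_cexp_norm_sq (z : ℂ) (d : Fin 2) :
    dI (dir d) (fun ξ : Plane => exp (z * ((‖ξ‖ ^ 2 : ℝ) : ℂ))) =
      fun ξ => (I * 2 * z * ((ξ d : ℝ) : ℂ)) *
        exp (z * ((‖ξ‖ ^ 2 : ℝ) : ℂ)) := by
  funext ξ
  simp only [dI]
  have h1 : HasFDerivAt (fun ξ : Plane => ‖ξ‖ ^ 2) (2 • innerSL ℝ ξ) ξ :=
    (hasStrictFDerivAt_norm_sq ξ).hasFDerivAt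
  have h2 : HasFDerivAt (fun ξ : Plane => ((‖ξ‖ ^ 2 : ℝ) : ℂ))
      (Complex.ofRealCLM.comp (2 • innerSL ℝ ξ)) ξ := Complex.ofRealCLM.hasFDerivAt.comp ξ h1
  rw [(h2.const_mul z).cexp.fderiv]
  simp [inner_dir]
  ring

lemma norm_dI_iterate_cexp_le {z : ℂ} {Λ R : ℝ} (hz : z.re ≤ 0) (hΛ : 0 ≤ Λ)
    (h1 : 2 * ‖z‖ * R ≤ Λ) (h2 : 2 * ‖z‖ ≤ Λ ^ 2) (d : Fin 2) {ξ : Plane} (hξ : |ξ d| ≤ R)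
    (k : ℕ) : ∀ j ≤ k, ‖(dI (dir d))^[j] (fun ξ : Plane =>
      exp (z * ((‖ξ‖ ^ 2 : ℝ) : ℂ))) ξ‖ ≤ 2 ^ (k ^ 2) * Λ ^ j := by
  have hg : ContDiff ℝ ∞ fun ξ : Plane => I * 2 * z * ((ξ d : ℝ) : ℂ) := by
    have : ContDiff ℝ ∞ fun ξ : Plane => ((ξ d : ℝ) : ℂ) :=
      Complex.ofRealCLM.contDiff.comp (by fun_prop)
    exact contDiff_const.mul this
  have hd1 : dI (dir d) (fun ξ : Plane => I * 2 * z * ((ξ d : ℝ) : ℂ)) =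
      fun _ => I * (I * 2 * z) := by
    funext ζ
    simp only [dI]
    have e1 : HasFDerivAt (fun ξ : Plane => ((ξ d : ℝ) : ℂ))
        (Complex.ofRealCLM.comp (EuclideanSpace.proj d : Plane →L[ℝ] ℝ)) ζ :=
      Complex.ofRealCLM.hasFDerivAt.comp ζ (EuclideanSpace.proj d : Plane →L[ℝ] ℝ).hasFDerivAt
    rw [(e1.const_mul _).fderiv]
    simp
  have hd2 : ∀ j, (dI (dir d))^[j + 2] (fun ξ : Plane => I * 2 * z * ((ξ d : ℝ) : ℂ)) =
      fun _ => 0 := by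
    intro j
    induction j with
    | zero =>
      rw [Function.iterate_succ_apply', Function.iterate_succ_apply', Function.iterate_zero, id,
        hd1]
      funext ζ; simp [dI]
    | succ j ih =>
      rw [Function.iterate_succ_apply', ih]
      funext ζ; simp [dI]
  have hgb : ∀ j, ‖(dI (dir d))^[j] (fun ξ : Plane => I * 2 * z * ((ξ d : ℝ) : ℂ)) ξ‖
      ≤ Λ * Λ ^ j := by
    intro j
    match j with
    | 0 =>
      simp only [Function.iterate_zero, id, pow_zero, mul_one, norm_mul, Complex.norm_I, one_mul,
        norm_real, norm_eq_abs, Complex.norm_ofNat]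
      calc 2 * ‖z‖ * |ξ d| ≤ 2 * ‖z‖ * R := by gcongr
        _ ≤ Λ := h1
    | 1 =>
      simp only [Function.iterate_one, hd1]
      simp only [norm_mul, Complex.norm_I, one_mul, Complex.norm_ofNat]
      nlinarith
    | j + 2 => rw [hd2]; simp; positivity
  induction k with
  | zero =>
    intro j hj
    obtain rfl : j = 0 := by omega
    simp only [Function.iterate_zero, id, pow_zero, mul_one]
    rw [Complex.norm_exp]
    simp only [ne_eq, OfNat.ofNat_ne_zero, not_false_eq_true, zero_pow, pow_zero]
    rw [Real.exp_le_one_iff, Complex.re_mul_ofReal]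
    exact mul_nonpos_of_nonpos_of_nonneg hz (by positivity)
  | succ k ih =>
    intro j hj
    have hmono : (2 : ℝ) ^ (k ^ 2) ≤ 2 ^ ((k + 1) ^ 2) :=
      pow_le_pow_right₀ (by norm_num) (by nlinarith)
    rcases Nat.lt_or_ge j (k + 1) with hj' | hj'
    · exact (ih j (by omega)).trans (by gcongr)
    · obtain rfl : j = k + 1 := by omega
      rw [Function.iterate_succ_apply, dI_cexp_norm_sq]
      refine (norm_dI_iterate_mul_le (dir d) ξ (Λ := Λ) k hg (contDiff_cexp_norm_sq z)
        (fun j _ => hgb j) ih).trans ?_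
      calc Λ * 2 ^ (k ^ 2) * (2 * Λ) ^ k = 2 ^ (k ^ 2 + k) * Λ ^ (k + 1) := by
            rw [mul_pow, pow_add]; ring
        _ ≤ _ := by gcongr <;> [norm_num; nlinarith]

lemma SymB.mul_cexp {n : ℕ} {A Λ R : ℝ} {b : Plane → ℂ} {z : ℂ} (hΛ : 0 ≤ Λ) (hA : 0 ≤ A)
    (hb : SymB n A Λ b) (hs : ∀ ξ ∈ tsupport b, ∀ d, |ξ d| ≤ R) (hz : z.re ≤ 0)
    (h1 : 2 * ‖z‖ * R ≤ Λ) (h2 : 2 * ‖z‖ ≤ Λ ^ 2) :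
    SymB n (2 ^ (n ^ 2 + n) * A) Λ
      (fun ξ => b ξ * exp (z * ((‖ξ‖ ^ 2 : ℝ) : ℂ))) := by
  refine ⟨⟨hb.1.1.mul (contDiff_cexp_norm_sq z), hb.1.2.mul_right⟩, fun d k hk ξ => ?_⟩
  by_cases hξ : ξ ∈ tsupport b
  · refine (norm_dI_iterate_mul_le (dir d) ξ (Λ := Λ) k hb.1.1 (contDiff_cexp_norm_sq z)
      (fun j hj => hb.2 d j (hj.trans hk) ξ) (fun j hj =>
        norm_dI_iterate_cexp_le hz hΛ h1 h2 d (hs ξ hξ d) n j (hj.trans hk))).trans ?_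
    rw [mul_pow]
    have : (2 : ℝ) ^ k ≤ 2 ^ n := pow_le_pow_right₀ (by norm_num) hk
    calc A * 2 ^ (n ^ 2) * (2 ^ k * Λ ^ k) ≤ A * 2 ^ (n ^ 2) * (2 ^ n * Λ ^ k) := by gcongr
      _ = _ := by rw [pow_add]; ring
  · rw [dI_iterate_eq_zero (fun h => hξ (closure_mono (Function.support_mul_subset_left _ _) h))]
    simp; positivity

lemma IsTest.exists_symB {m : Plane → ℂ} (hm : IsTest m) (n : ℕ) :
    ∃ A : ℝ, 0 ≤ A ∧ SymB n A 1 m := by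
  have h : ∀ d k, ∃ B : ℝ, ∀ ξ, ‖(dI (dir d))^[k] m ξ‖ ≤ B := fun d k =>
    (hm.deriv_iterate (dir d) k).bounded
  choose B hB using h
  have hB0 : ∀ d k, 0 ≤ B d k := fun d k => (norm_nonneg _).trans (hB d k 0)
  refine ⟨∑ d, ∑ k ∈ Finset.range (n + 1), B d k, ?_, hm, fun d k hk ξ => ?_⟩
  · exact Finset.sum_nonneg fun d _ => Finset.sum_nonneg fun k _ => hB0 d k
  · rw [one_pow, mul_one]
    refine (hB d k ξ).trans ?_
    refine (Finset.single_le_sum (f := fun k => B d k) (fun k _ => hB0 d k)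
      (Finset.mem_range.2 (Nat.lt_succ_of_le hk))).trans ?_
    exact Finset.single_le_sum (f := fun d => ∑ k ∈ Finset.range (n + 1), B d k)
      (fun d _ => Finset.sum_nonneg fun k _ => hB0 d k) (Finset.mem_univ d)

lemma SymB.affine {n : ℕ} {A : ℝ} {m : Plane → ℂ} (hm : SymB n A 1 m) {c : ℝ} (hc : 0 < c)
    (a : Plane) : SymB n A c (fun ξ => m (c • (ξ - a))) := by
  have ha : ContDiff ℝ ∞ fun ξ : Plane => c • (ξ - a) := by fun_prop
  refine ⟨⟨hm.1.1.comp ha, ?_⟩, fun d k hk ξ => ?_⟩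
  · have : (fun ξ => m (c • (ξ - a))) = m ∘ ((Homeomorph.subRight a).trans
      (Homeomorph.smulOfNeZero c hc.ne')) := by ext ξ; simp
    rw [this]
    exact hm.1.2.comp_homeomorph _
  · rw [dI_iterate_comp_affine (dir d) a c k hm.1.1, norm_mul, norm_pow, norm_real,
      norm_of_nonneg hc.le, mul_comm]
    have := hm.2 d k hk (c • (ξ - a))
    rw [one_pow, mul_one] at this
    gcongr

/-! ### Standard cutoffs -/

/-- A smooth cutoff on the plane. -/
def planeBump : ContDiffBump (0 : Plane) := ⟨1, 2, one_pos, one_lt_two⟩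

/-- The cutoff to the ball of radius `λ` (and `2 λ`) around `a`. -/
def cellSym (a : Plane) (r : ℝ) (ξ : Plane) : ℝ := planeBump (r⁻¹ • (ξ - a))

lemma cellSym_eq_one {a ξ : Plane} {r : ℝ} (hr : 0 < r) (h : ‖ξ - a‖ ≤ r) :
    cellSym a r ξ = 1 := by
  refine planeBump.one_of_mem_closedBall ?_
  rw [mem_closedBall_zero_iff, norm_smul, norm_of_nonneg (by positivity)]
  show _ ≤ (1 : ℝ)
  rw [inv_mul_le_iff₀ hr]; simpa using h

lemma cellSym_eq_zero {a ξ : Plane} {r : ℝ} (hr : 0 < r) (h : 2 * r ≤ ‖ξ - a‖) :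
    cellSym a r ξ = 0 := by
  refine planeBump.zero_of_le_dist ?_
  rw [dist_zero_right, norm_smul, norm_of_nonneg (by positivity)]
  show (2 : ℝ) ≤ _
  rw [le_inv_mul_iff₀ hr]; linarith

lemma tsupport_subset_of_zero {f : Plane → ℂ} {a : Plane} {R : ℝ}
    (h : ∀ ξ, R < ‖ξ - a‖ → f ξ = 0) : tsupport f ⊆ Metric.closedBall a R := by
  refine closure_minimal (fun ξ hξ => ?_) Metric.isClosed_closedBall
  rw [Metric.mem_closedBall, dist_eq_norm]
  by_contra! hlt
  exact hξ (h ξ hlt)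

lemma tsupport_cellSym_subset {a : Plane} {r : ℝ} (hr : 0 < r) :
    tsupport (fun ξ => (cellSym a r ξ : ℂ)) ⊆ Metric.closedBall a (2 * r) :=
  tsupport_subset_of_zero fun ξ hξ => by rw [cellSym_eq_zero hr hξ.le]; simp

lemma isTest_ofReal {b : Plane → ℝ} (hb : ContDiff ℝ ∞ b) (hs : HasCompactSupport b) :
    IsTest (fun ξ => (b ξ : ℂ)) :=
  ⟨Complex.ofRealCLM.contDiff.comp hb, hs.comp_left (g := fun x : ℝ => (x : ℂ)) (by simp)⟩

lemma exists_symB_cellSym (n : ℕ) : ∃ A : ℝ, 0 ≤ A ∧ ∀ (a : Plane) {r : ℝ}, 0 < r →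
    SymB n A r⁻¹ (fun ξ => (cellSym a r ξ : ℂ)) := by
  have h0 : IsTest (fun ξ => ((planeBump ξ : ℝ) : ℂ)) :=
    isTest_ofReal planeBump.contDiff planeBump.hasCompactSupport
  obtain ⟨A, hA, h⟩ := h0.exists_symB n
  exact ⟨A, hA, fun a r hr => h.affine (inv_pos.2 hr) a⟩

lemma abs_coord_le (x : Plane) (d : Fin 2) : |x d| ≤ ‖x‖ := by
  have := PiLp.norm_apply_le x d
  simpa using this

lemma norm_le_two_mul_of_coord {x : Plane} {R : ℝ} (h : ∀ d, |x d| ≤ R) : ‖x‖ ≤ 2 * R := by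
  have hR : 0 ≤ R := (abs_nonneg _).trans (h 0)
  rw [EuclideanSpace.norm_eq, Real.sqrt_le_left (by positivity)]
  simp only [Fin.sum_univ_two, norm_eq_abs]
  have h0 := h 0
  have h1 := h 1
  nlinarith [abs_nonneg (x 0), abs_nonneg (x 1)]

/-! ### The packet partition -/

lemma PacketPartition.exists_symB (φ : PacketPartition) (n : ℕ) : ∃ A : ℝ, 0 ≤ A ∧
    ∀ ξ, SymB n A 1 (fun η => (φ.toFun ξ η : ℂ)) := by
  choose C hC using φ.deriv_bound
  obtain ⟨R, hR⟩ := φ.localized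
  refine ⟨∑ k ∈ Finset.range (n + 1), |C k|, Finset.sum_nonneg fun _ _ => abs_nonneg _,
    fun ξ => ?_⟩
  have ht : IsTest (fun η => (φ.toFun ξ η : ℂ)) := isTest_ofReal (φ.smooth ξ)
    (HasCompactSupport.of_support_subset_isCompact (isCompact_closedBall (ξ : Plane) R)
      ((subset_tsupport _).trans (hR ξ)))
  refine ⟨ht, fun d k hk η => ?_⟩
  rw [dI_iterate_eq_iteratedFDeriv _ _ ht.1, norm_mul, norm_pow, Complex.norm_I, one_pow, one_mul,
    mul_one]
  refine (ContinuousMultilinearMap.le_opNorm _ _).trans ?_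
  have h1 : ∏ _i : Fin k, ‖dir d‖ = 1 := by simp [dir]
  rw [h1, mul_one]
  have h2 : ‖iteratedFDeriv ℝ k (fun η => (φ.toFun ξ η : ℂ)) η‖
      = ‖iteratedFDeriv ℝ k (φ.toFun ξ) η‖ := by
    have := Complex.ofRealLI.norm_iteratedFDeriv_comp_left (f := φ.toFun ξ) (x := η)
      ((φ.smooth ξ).contDiffAt) (i := k) (by exact_mod_cast le_top)
    exact this
  rw [h2]
  refine ((hC k ξ η).trans (le_abs_self _)).trans ?_
  exact Finset.single_le_sum (f := fun k => |C k|) (fun _ _ => abs_nonneg _)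
    (Finset.mem_range.2 (Nat.lt_succ_of_le hk))

lemma one_le_dist_polarLattice {ξ ξ' : Plane} (h : ξ ∈ polarLattice) (h' : ξ' ∈ polarLattice)
    (hne : ξ ≠ ξ') : 1 ≤ ‖ξ - ξ'‖ := by
  obtain ⟨n, k, hn, hk, rfl⟩ := h
  obtain ⟨n', k', hn', hk', rfl⟩ := h'
  set α : ℝ := π / 2 * (k / n) with hα
  set β : ℝ := π / 2 * (k' / n') with hβ
  have hn0 : (0 : ℝ) < n := by exact_mod_cast hn
  have hn0' : (0 : ℝ) < n' := by exact_mod_cast hn'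
  have hsq : ‖(!₂[(n : ℝ) * Real.cos α, (n : ℝ) * Real.sin α] : Plane)
      - !₂[(n' : ℝ) * Real.cos β, (n' : ℝ) * Real.sin β]‖ ^ 2
      = (n - n') ^ 2 + 2 * n * n' * (1 - Real.cos (α - β)) := by
    rw [EuclideanSpace.norm_sq_eq, Fin.sum_univ_two, Real.cos_sub]
    simp only [PiLp.sub_apply, norm_eq_abs, sq_abs]
    simp
    linear_combination (n : ℝ) ^ 2 * Real.sin_sq_add_cos_sq α
      + (n' : ℝ) ^ 2 * Real.sin_sq_add_cos_sq β
  have key : 1 ≤ (n - n' : ℝ) ^ 2 + 2 * n * n' * (1 - Real.cos (α - β)) := by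
    have hc := Real.cos_le_one (α - β)
    by_cases hnn : n = n'
    · subst hnn
      obtain ⟨m, hm1, hm2⟩ : ∃ m : ℤ, |m| ≤ 2 * n ∧
          ∃ r : ℤ, α - β = π / 2 * (m / n) + r * (2 * π) := by
        have h4n : (0 : ℤ) < 4 * n := by omega
        refine ⟨Int.bmod (k - k') (4 * n), ?_, (k - k' - Int.bmod (k - k') (4 * n)) / (4 * n), ?_⟩
        · have e1 := Int.le_bmod (x := (k : ℤ) - k') (m := 4 * n) (by omega)
          have e2 := Int.bmod_lt (x := (k : ℤ) - k') (m := 4 * n) (by omega)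
          rw [abs_le]; push_cast at *; omega
        · have hdvd : (4 * (n : ℤ)) ∣ ((k : ℤ) - k' - Int.bmod (k - k') (4 * n)) := by
            have := Int.dvd_bmod_sub_self (x := (k : ℤ) - k') (m := 4 * n)
            rw [← Int.dvd_neg]; push_cast at this; simpa using this
          obtain ⟨r, hr⟩ := hdvd
          rw [hr, Int.mul_ediv_cancel_left _ h4n.ne']
          have hr' : (k : ℝ) - k' - (Int.bmod ((k : ℤ) - k') (4 * n) : ℤ) = 4 * n * r := by
            exact_mod_cast hr
          rw [hα, hβ]
          field_simp
          linear_combination hr'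
      obtain ⟨r, hr⟩ := hm2
      have hcos : Real.cos (α - β) = Real.cos (π / 2 * (m / n)) := by
        rw [hr, Real.cos_add_int_mul_two_pi]
      have hm0 : m ≠ 0 := by
        rintro rfl
        apply hne
        have e1 : Real.cos α = Real.cos β := by
          have : α = β + r * (2 * π) := by linear_combination hr + (by simp : (π / 2 * (((0 : ℤ) : ℝ) / n) : ℝ) = 0)
          rw [this, Real.cos_add_int_mul_two_pi]
        have e2 : Real.sin α = Real.sin β := by
          have : α = β + r * (2 * π) := by linear_combination hr + (by simp : (π / 2 * (((0 : ℤ) : ℝ) / n) : ℝ) = 0)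
          rw [this, Real.sin_add_int_mul_two_pi]
        rw [e1, e2]
      have hmabs : (1 : ℝ) ≤ |(m : ℝ)| := by exact_mod_cast Int.one_le_abs hm0
      have hle : |π / 2 * (m / n)| ≤ π := by
        rw [abs_mul, abs_of_pos (by positivity : (0 : ℝ) < π / 2), abs_div, abs_of_pos hn0]
        have : |(m : ℝ)| ≤ 2 * n := by exact_mod_cast hm1
        have h2 : |(m : ℝ)| / n ≤ 2 := by rw [div_le_iff₀ hn0]; exact this
        nlinarith [Real.pi_pos]
      have hq := Real.cos_le_one_sub_mul_cos_sq hle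
      rw [hcos]
      have hq2 : 2 / π ^ 2 * (π / 2 * (m / n)) ^ 2 = (m : ℝ) ^ 2 / (2 * n ^ 2) := by
        field_simp; try ring
      rw [hq2] at hq
      have hm2 : (1 : ℝ) ≤ (m : ℝ) ^ 2 := by rw [← sq_abs]; nlinarith
      have h3 : 2 * (n : ℝ) * n * ((m : ℝ) ^ 2 / (2 * n ^ 2)) = (m : ℝ) ^ 2 := by field_simp
      have h4 : 0 ≤ 2 * (n : ℝ) * n := by positivity
      nlinarith
    · have h1 : (1 : ℝ) ≤ (n - n' : ℝ) ^ 2 := by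
        have h2 : (n : ℤ) - n' ≠ 0 := by omega
        have h3 : (1 : ℤ) ≤ ((n : ℤ) - n') ^ 2 := by
          have := Int.one_le_abs h2
          rw [← sq_abs]; nlinarith
        exact_mod_cast h3
      have h2 : 0 ≤ 2 * (n : ℝ) * n' * (1 - Real.cos (α - β)) :=
        mul_nonneg (by positivity) (by linarith)
      linarith
  rw [← hsq] at key
  nlinarith [norm_nonneg ((!₂[(n : ℝ) * Real.cos α, (n : ℝ) * Real.sin α] : Plane)
      - !₂[(n' : ℝ) * Real.cos β, (n' : ℝ) * Real.sin β])]

/-- Bounded overlap: balls of fixed radius contain boundedly many points of the polar lattice. -/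
lemma exists_card_polarLattice_le (R : ℝ) : ∃ K : ℕ, ∀ (η : Plane) (s : Finset polarLattice),
    (∀ ξ ∈ s, ‖(ξ : Plane) - η‖ ≤ R) → s.card ≤ K := by
  classical
  set M : ℤ := ⌈2 * |R|⌉ + 1
  refine ⟨(Fintype.piFinset fun _ : Fin 2 => Finset.Icc (-M) M).card, fun η s hs => ?_⟩
  set c : ℤ² := fun a => ⌊2 * η a⌋
  refine Finset.card_le_card_of_injOn
    (fun ξ => fun a => ⌊2 * (ξ : Plane) a⌋ - c a) (fun ξ hξ => ?_) ?_
  · simp only [Fintype.coe_piFinset, Finset.coe_Icc, Set.mem_pi, Set.mem_univ, forall_const,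
      Set.mem_Icc]
    intro a
    have h1 := (abs_coord_le ((ξ : Plane) - η) a).trans (hs ξ hξ)
    rw [PiLp.sub_apply, abs_le] at h1
    have h2 := Int.floor_le (2 * (ξ : Plane) a)
    have h3 := Int.lt_floor_add_one (2 * (ξ : Plane) a)
    have h4 := Int.floor_le (2 * η a)
    have h5 := Int.lt_floor_add_one (2 * η a)
    have h6 := Int.le_ceil (2 * |R|)
    have h7 := le_abs_self R
    constructor
    · have : (-M : ℝ) - 1 < ((⌊2 * (ξ : Plane) a⌋ - ⌊2 * η a⌋ : ℤ) : ℝ) := by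
        push_cast [M]; linarith
      have h8 : (-M - 1 : ℤ) < ⌊2 * (ξ : Plane) a⌋ - ⌊2 * η a⌋ := by exact_mod_cast this
      show -M ≤ ⌊2 * (ξ : Plane) a⌋ - ⌊2 * η a⌋
      omega
    · have : ((⌊2 * (ξ : Plane) a⌋ - ⌊2 * η a⌋ : ℤ) : ℝ) < (M : ℝ) + 1 := by
        push_cast [M]; linarith
      have h8 : ⌊2 * (ξ : Plane) a⌋ - ⌊2 * η a⌋ < M + 1 := by exact_mod_cast this
      show ⌊2 * (ξ : Plane) a⌋ - ⌊2 * η a⌋ ≤ M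
      omega
  · intro ξ _ ξ' _ he
    by_contra hne
    have h1 := one_le_dist_polarLattice ξ.2 ξ'.2 (fun h => hne (Subtype.ext h))
    have h2 : ∀ a, |((ξ : Plane) - ξ') a| ≤ 1 / 2 := by
      intro a
      have h3 := congrFun he a
      simp only [sub_left_inj] at h3
      have := Int.abs_sub_lt_one_of_floor_eq_floor h3
      rw [PiLp.sub_apply]
      rw [← mul_sub, abs_mul, abs_of_pos (by norm_num : (0 : ℝ) < 2)] at this
      linarith
    have h3 : ‖(ξ : Plane) - ξ'‖ ^ 2 ≤ 1 / 2 := by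
      rw [EuclideanSpace.norm_sq_eq, Fin.sum_univ_two]
      simp only [norm_eq_abs]
      nlinarith [h2 0, h2 1, abs_nonneg (((ξ : Plane) - ξ') 0),
        abs_nonneg (((ξ : Plane) - ξ') 1)]
    nlinarith

/-! ### Composition of multipliers -/

section Compose

open Module

variable {E : Type*} [NormedAddCommGroup E] [InnerProductSpace ℝ E] [FiniteDimensional ℝ E]
  [MeasurableSpace E] [BorelSpace E]

lemma integral_gker_sub_left_mul_cexp {m : E → ℂ} (hm : IsTest m) (x ξ : E) :
    ∫ y, gker m (x - y) * exp (I * (inner ℝ y ξ : ℝ)) =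
      exp (I * (inner ℝ x ξ : ℝ)) * m ξ := by
  rw [← integral_sub_left_eq_self _ volume x, ← gft_gker hm ξ, gft, ← integral_const_mul]
  congr 1; ext y
  rw [sub_sub_cancel, inner_sub_left, show I * ((inner ℝ x ξ - inner ℝ y ξ : ℝ) : ℂ) =
    I * (inner ℝ x ξ : ℝ) + -I * (inner ℝ y ξ : ℝ) by push_cast; ring,
    exp_add]
  ring

lemma integral_gker_sub_right_mul_cexp {m : E → ℂ} (hm : IsTest m) (x ξ : E) :
    ∫ y, gker m (y - x) * exp (-I * (inner ℝ y ξ : ℝ)) =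
      exp (-I * (inner ℝ x ξ : ℝ)) * m ξ := by
  rw [← integral_add_right_eq_self _ x, ← gft_gker hm ξ, gft, ← integral_const_mul]
  congr 1; ext y
  rw [add_sub_cancel_right, inner_add_left, show -I * ((inner ℝ y ξ + inner ℝ x ξ : ℝ) : ℂ)
    = -I * (inner ℝ x ξ : ℝ) + -I * (inner ℝ y ξ : ℝ) by push_cast; ring,
    exp_add]
  ring

lemma gconv_gker {m m' : E → ℂ} (hm : IsTest m) (hm' : Integrable m') (x : E) :
    gconv m (gker m') x = gker (fun ξ => m ξ * m' ξ) x := by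
  have hk : Integrable (fun y => gker m (x - y)) := (integrable_gker hm).comp_sub_left x
  have hint : Integrable (fun p : E × E =>
      exp (I * (inner ℝ p.1 p.2 : ℝ)) * (gker m (x - p.1) * m' p.2))
      (volume.prod volume) := by
    refine (hk.mul_prod hm').bdd_mul (c := 1) ?_ (ae_of_all _ fun p => ?_)
    · exact Continuous.aestronglyMeasurable (by fun_prop)
    · rw [norm_cexp_I_mul]
  have h1 : ∀ y, gker m (x - y) * gker m' y = (((2 * π) ^ finrank ℝ E)⁻¹ : ℝ) *
      ∫ ξ, exp (I * (inner ℝ y ξ : ℝ)) * (gker m (x - y) * m' ξ) := by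
    intro y
    rw [gker.eq_1 m' y, ← mul_assoc, mul_comm (gker m (x - y)), mul_assoc, ← integral_const_mul]
    congr 2; ext ξ; ring
  rw [gconv]
  simp_rw [h1]
  rw [integral_const_mul, gker]
  congr 1
  rw [integral_integral_swap hint]
  refine integral_congr_ae (ae_of_all _ fun ξ => ?_)
  simp only
  rw [← mul_assoc, ← integral_gker_sub_left_mul_cexp hm, ← integral_mul_const]
  congr 1; ext y; ring

lemma integrable_prod_mul {α β : Type*} [MeasurableSpace α] [MeasurableSpace β] {μ : Measure α}
    {ν : Measure β} [SFinite μ] [SFinite ν] {k : α → ℂ} {F : α × β → ℂ} (hk : Integrable k μ)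
    (hF : AEStronglyMeasurable F (μ.prod ν)) {B : ℝ≥0∞} (hB : B ≠ ⊤)
    (hb : ∀ y, ∫⁻ z, ‖F (y, z)‖ₑ ∂ν ≤ B) : Integrable (fun p => k p.1 * F p) (μ.prod ν) := by
  have hm : AEStronglyMeasurable (fun p => k p.1 * F p) (μ.prod ν) := hk.1.comp_fst.mul hF
  refine ⟨hm, ?_⟩
  rw [HasFiniteIntegral, lintegral_prod _ hm.enorm]
  calc _ ≤ ∫⁻ y, ‖k y‖ₑ * B ∂μ := by
        refine lintegral_mono fun y => ?_
        simp only [enorm_mul]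
        rw [lintegral_const_mul' _ _ enorm_ne_top]
        gcongr
        exact hb y
    _ = (∫⁻ y, ‖k y‖ₑ ∂μ) * B := lintegral_mul_const' _ _ hB
    _ < ⊤ := mul_lt_top hk.2 hB.lt_top

lemma gconv_gconv_left {m m' f : E → ℂ} (hm : IsTest m) (hm' : Integrable m')
    (hf : AEStronglyMeasurable f) {B : ℝ≥0∞} (hB : B ≠ ⊤)
    (hb : ∀ y, ∫⁻ z, ‖gker m' (y - z)‖ₑ * ‖f z‖ₑ ≤ B) (x : E) :
    gconv m (gconv m' f) x = gconv (fun ξ => m ξ * m' ξ) f x := by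
  have hk : Integrable (fun y => gker m (x - y)) := (integrable_gker hm).comp_sub_left x
  have hint : Integrable (fun p : E × E => gker m (x - p.1) * (gker m' (p.1 - p.2) * f p.2))
      (volume.prod volume) :=
    integrable_prod_mul hk (((gker_continuous hm').comp (by fun_prop)).aestronglyMeasurable.mul
      hf.comp_snd) hB (by simpa only [enorm_mul] using hb)
  have h1 : gconv m (gconv m' f) x =
      ∫ y, ∫ z, gker m (x - y) * (gker m' (y - z) * f z) := by
    simp only [gconv, integral_const_mul]
  rw [h1, integral_integral_swap hint]
  refine integral_congr_ae (ae_of_all _ fun z => ?_)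
  simp only
  rw [← gconv_gker hm hm', gconv, ← integral_mul_const,
    ← integral_sub_right_eq_self (fun y => gker m (x - z - y) * gker m' y * f z) z]
  congr 1; ext y
  rw [show x - z - (y - z) = x - y by abel]; ring

lemma lintegral_enorm_mul_le_sqrt {α : Type*} [MeasurableSpace α] {μ : Measure α} {f g : α → ℂ}
    (hf : MemLp f 2 μ) (hg : MemLp g 2 μ) :
    ∫⁻ y, ‖f y‖ₑ * ‖g y‖ₑ ∂μ ≤
      ((∫⁻ y, ‖f y‖ₑ ^ 2 ∂μ) * ∫⁻ y, ‖g y‖ₑ ^ 2 ∂μ) ^ (1 / 2 : ℝ) := by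
  rw [← ENNReal.rpow_le_rpow_iff (z := 2) (by norm_num), ← rpow_mul]
  norm_num
  exact lintegral_mul_sq_le hf.1.enorm hg.1.enorm

lemma sqrt_mul_lintegral_ne_top {α : Type*} [MeasurableSpace α] {μ : Measure α} {f g : α → ℂ}
    (hf : MemLp f 2 μ) (hg : MemLp g 2 μ) :
    ((∫⁻ y, ‖f y‖ₑ ^ 2 ∂μ) * ∫⁻ y, ‖g y‖ₑ ^ 2 ∂μ) ^ (1 / 2 : ℝ) ≠ ⊤ :=
  ENNReal.rpow_ne_top_of_nonneg (by norm_num) (mul_ne_top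
    ((memLp_two_iff_lintegral hf.1).1 hf).ne ((memLp_two_iff_lintegral hg.1).1 hg).ne)

lemma lintegral_gker_sub_mul_le {m f : E → ℂ} (hm : MemLp (gker m) 2) (hf : MemLp f 2) (y : E) :
    ∫⁻ z, ‖gker m (y - z)‖ₑ * ‖f z‖ₑ ≤
      ((∫⁻ z, ‖gker m z‖ₑ ^ 2) * ∫⁻ z, ‖f z‖ₑ ^ 2) ^ (1 / 2 : ℝ) := by
  rw [← lintegral_sub_left_sq (gker m) y]
  exact lintegral_enorm_mul_le_sqrt
    (hm.comp_measurePreserving (Measure.measurePreserving_sub_left volume y)) hf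

lemma gconv_gconv_right {m m' f : E → ℂ} (hm : IsTest m) (hm' : Integrable m')
    (hm2 : MemLp (gker m') 2) (hf : MemLp f 2) (x : E) :
    gconv m' (gconv m f) x = gconv (fun ξ => m ξ * m' ξ) f x := by
  have hmeas : AEStronglyMeasurable (fun p : E × E =>
      gker m' (x - p.1) * (gker m (p.1 - p.2) * f p.2)) (volume.prod volume) := by
    refine AEStronglyMeasurable.mul ?_ (AEStronglyMeasurable.mul ?_ hf.1.comp_snd)
    · exact ((gker_continuous hm').comp (by fun_prop)).aestronglyMeasurable
    · exact ((gker_continuous hm.integrable).comp (by fun_prop)).aestronglyMeasurable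
  have hmeas2 : AEStronglyMeasurable (fun p : E × E =>
      gker m' (x - p.1) * (gker m p.2 * f (p.1 - p.2))) (volume.prod volume) := by
    refine AEStronglyMeasurable.mul ?_ (AEStronglyMeasurable.mul ?_ ?_)
    · exact ((gker_continuous hm').comp (by fun_prop)).aestronglyMeasurable
    · exact ((gker_continuous hm.integrable).comp (by fun_prop)).aestronglyMeasurable
    · exact hf.1.comp_quasiMeasurePreserving (quasiMeasurePreserving_sub volume volume)
  set B := ((∫⁻ y, ‖gker m' y‖ₑ ^ 2) * ∫⁻ y, ‖f y‖ₑ ^ 2) ^ (1 / 2 : ℝ)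
  have hB : B ≠ ⊤ := sqrt_mul_lintegral_ne_top hm2 hf
  have hint : Integrable (fun p : E × E => gker m' (x - p.1) * (gker m (p.1 - p.2) * f p.2))
      (volume.prod volume) := by
    refine ⟨hmeas, ?_⟩
    rw [HasFiniteIntegral, lintegral_prod _ hmeas.enorm]
    have h1 : ∀ y, ∫⁻ z, ‖gker m' (x - y) * (gker m (y - z) * f z)‖ₑ =
        ∫⁻ z, ‖gker m' (x - y) * (gker m z * f (y - z))‖ₑ := by
      intro y
      rw [← lintegral_sub_left_eq_self _ y]
      simp only [sub_sub_cancel]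
    simp only [h1]
    rw [lintegral_lintegral_swap hmeas2.enorm]
    calc _ ≤ ∫⁻ z, ‖gker m z‖ₑ * B := by
          refine lintegral_mono fun z => ?_
          simp only [enorm_mul]
          have h2 : ∀ y, ‖gker m' (x - y)‖ₑ * (‖gker m z‖ₑ * ‖f (y - z)‖ₑ) =
              ‖gker m z‖ₑ * (‖gker m' (x - y)‖ₑ * ‖f (y - z)‖ₑ) := fun y => by ring
          simp only [h2]
          rw [lintegral_const_mul' _ _ enorm_ne_top]
          gcongr
          have h3 : MemLp (fun y => f (y - z)) 2 :=
            hf.comp_measurePreserving (measurePreserving_sub_right volume z)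
          refine (lintegral_gker_sub_mul_le hm2 h3 x).trans_eq ?_
          rw [lintegral_sub_right_eq_self (fun y => ‖f y‖ₑ ^ 2) z]
      _ = (∫⁻ y, ‖gker m y‖ₑ) * B := lintegral_mul_const' _ _ hB
      _ < ⊤ := mul_lt_top (integrable_gker hm).2 hB.lt_top
  have h1 : gconv m' (gconv m f) x =
      ∫ y, ∫ z, gker m' (x - y) * (gker m (y - z) * f z) := by
    simp only [gconv, integral_const_mul]
  rw [h1, integral_integral_swap hint]
  refine integral_congr_ae (ae_of_all _ fun z => ?_)
  simp only
  rw [← gconv_gker hm hm', gconv, ← integral_mul_const,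
    ← integral_sub_left_eq_self (fun y => gker m (x - z - y) * gker m' y * f z) volume x]
  congr 1; ext y
  rw [show x - z - (x - y) = y - z by abel]; ring

lemma integral_gker_mul_gker_mul_gker {m ρ χ : E → ℂ} (hm : Integrable m) (hρ : Integrable ρ)
    (hχ : IsTest χ) (h : ∀ η ζ, m η ≠ 0 → ρ ζ ≠ 0 → χ (η - ζ) = 1) (x y' z : E) :
    ∫ y, gker m (x - y) * gker ρ (y - z) * gker χ (y - y') =
      gker m (x - y') * gker ρ (y' - z) := by
  set c : ℂ := ((((2 * π) ^ finrank ℝ E)⁻¹ : ℝ) : ℂ) with hc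
  set F : E × E → ℂ := fun p => (exp (I * (inner ℝ x p.1 : ℝ)) * m p.1) *
    (exp (-I * (inner ℝ z p.2 : ℝ)) * ρ p.2) with hF
  have hFi : Integrable F (volume.prod volume) := by
    refine Integrable.mul_prod (f := fun p => exp (I * (inner ℝ x p : ℝ)) * m p)
      (g := fun p => exp (-I * (inner ℝ z p : ℝ)) * ρ p) ?_ ?_
    · refine hm.bdd_mul (c := 1) (Continuous.aestronglyMeasurable (by fun_prop))
        (ae_of_all _ fun p => ?_)
      rw [norm_cexp_I_mul]
    · refine hρ.bdd_mul (c := 1) (Continuous.aestronglyMeasurable (by fun_prop))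
        (ae_of_all _ fun p => ?_)
      rw [norm_cexp_neg_I_mul]
  have hprod : ∀ y, gker m (x - y) * gker ρ (y - z) =
      c * c * ∫ p : E × E, exp (-I * (inner ℝ y (p.1 - p.2) : ℝ)) * F p := by
    intro y
    have h1 := integral_prod_mul (μ := (volume : Measure E)) (ν := (volume : Measure E))
      (fun η => exp (I * (inner ℝ (x - y) η : ℝ)) * m η)
      (fun ζ => exp (I * (inner ℝ (y - z) ζ : ℝ)) * ρ ζ)
    have h2 : gker m (x - y) * gker ρ (y - z) = c * c *
        ((∫ η, exp (I * (inner ℝ (x - y) η : ℝ)) * m η) *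
        ∫ ζ, exp (I * (inner ℝ (y - z) ζ : ℝ)) * ρ ζ) := by
      simp only [gker, hc]; ring
    rw [h2, ← h1, volume_eq_prod]
    congr 2; ext p
    simp only [hF]
    have h3 : exp (I * (inner ℝ (x - y) p.1 : ℝ)) *
        exp (I * (inner ℝ (y - z) p.2 : ℝ)) =
        exp (-I * (inner ℝ y (p.1 - p.2) : ℝ)) *
        (exp (I * (inner ℝ x p.1 : ℝ)) *
        exp (-I * (inner ℝ z p.2 : ℝ))) := by
      rw [← exp_add, ← exp_add, ← exp_add, inner_sub_left, inner_sub_left,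
        inner_sub_right]
      congr 1; push_cast; ring
    linear_combination (m p.1 * ρ p.2) * h3
  have hint : Integrable (fun q : E × (E × E) =>
      exp (-I * (inner ℝ q.1 (q.2.1 - q.2.2) : ℝ)) * (gker χ (q.1 - y') * F q.2))
      (volume.prod (volume.prod volume)) := by
    have hk : Integrable (fun y => gker χ (y - y')) := (integrable_gker hχ).comp_sub_right y'
    refine (hk.mul_prod hFi).bdd_mul (c := 1) ?_ (ae_of_all _ fun p => ?_)
    · exact Continuous.aestronglyMeasurable (by fun_prop)
    · rw [norm_cexp_neg_I_mul]
  have h1 : ∀ y, gker m (x - y) * gker ρ (y - z) * gker χ (y - y') = c * c * ∫ p : E × E,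
      exp (-I * (inner ℝ y (p.1 - p.2) : ℝ)) * (gker χ (y - y') * F p) := by
    intro y
    rw [hprod, mul_assoc, ← integral_mul_const]
    congr 2; ext p; ring
  simp_rw [h1]
  rw [integral_const_mul, hprod, volume_eq_prod, integral_integral_swap hint]
  congr 1
  refine integral_congr_ae (ae_of_all _ fun p => ?_)
  simp only
  have h2 : ∀ y, exp (-I * (inner ℝ y (p.1 - p.2) : ℝ)) * (gker χ (y - y') * F p) =
      gker χ (y - y') * exp (-I * (inner ℝ y (p.1 - p.2) : ℝ)) * F p :=
    fun y => by ring
  simp_rw [h2]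
  rw [integral_mul_const, integral_gker_sub_right_mul_cexp hχ]
  by_cases h3 : m p.1 = 0
  · simp [hF, h3]
  by_cases h4 : ρ p.2 = 0
  · simp [hF, h4]
  rw [h _ _ h3 h4]; ring

/-- In a product with a band-limited factor, only the nearby frequencies of the other factor are
seen by a localized multiplier. -/
lemma gconv_mul_gconv_eq {m ρ χ v w : E → ℂ} (hm : Integrable m) (hm2 : MemLp (gker m) 2)
    (hρ : Integrable ρ) (hρ2 : MemLp (gker ρ) 2) (hχ : IsTest χ)
    (h : ∀ η ζ, m η ≠ 0 → ρ ζ ≠ 0 → χ (η - ζ) = 1) (hv : MemLp v 2) (hw : MemLp w 2) (x : E) :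
    gconv m (fun y => v y * gconv ρ w y) x = gconv m (fun y => gconv χ v y * gconv ρ w y) x := by
  set W := gconv ρ w with hW
  have hWm : Measurable W := measurable_gconv hρ hw.1
  set B := ((∫⁻ y, ‖gker ρ y‖ₑ ^ 2) * ∫⁻ y, ‖w y‖ₑ ^ 2) ^ (1 / 2 : ℝ)
  have hB : B ≠ ⊤ := sqrt_mul_lintegral_ne_top hρ2 hw
  have hWB : ∀ y, ‖W y‖ₑ ≤ B := fun y => by
    refine (enorm_integral_le_lintegral_enorm _).trans ?_
    simp_rw [enorm_mul]
    exact lintegral_gker_sub_mul_le hρ2 hw y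
  have hkχ := integrable_gker hχ
  -- reproduction of the product of two kernels
  have hrep : ∀ y', ∫ y, gker m (x - y) * W y * gker χ (y - y') = gker m (x - y') * W y' := by
    intro y'
    have hfin : Integrable (fun y => gker m (x - y) * gker χ (y - y')) := by
      refine (hkχ.comp_sub_right y').bdd_mul (c := _) ?_
        (ae_of_all _ fun p => norm_gker_le m _)
      exact ((gker_continuous hm).comp (by fun_prop)).aestronglyMeasurable
    have hint : Integrable (fun p : E × E =>
        (gker m (x - p.1) * gker χ (p.1 - y')) * (gker ρ (p.1 - p.2) * w p.2))
        (volume.prod volume) :=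
      integrable_prod_mul hfin (((gker_continuous hρ).comp (by fun_prop)).aestronglyMeasurable.mul
        hw.1.comp_snd) hB (by simpa only [enorm_mul] using lintegral_gker_sub_mul_le hρ2 hw)
    have h1 : ∫ y, gker m (x - y) * W y * gker χ (y - y') =
        ∫ y, ∫ z, (gker m (x - y) * gker χ (y - y')) * (gker ρ (y - z) * w z) := by
      congr 1; ext y
      rw [integral_const_mul, hW, gconv]; ring
    rw [h1, integral_integral_swap hint, hW, gconv, ← integral_const_mul]
    refine integral_congr_ae (ae_of_all _ fun z => ?_)
    simp only
    rw [← mul_assoc (gker m (x - y')), ← integral_gker_mul_gker_mul_gker hm hρ hχ h x y' z,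
      ← integral_mul_const]
    congr 1; ext y; ring
  set D := ((∫⁻ y, ‖gker m y‖ₑ ^ 2) * ∫⁻ y, ‖v y‖ₑ ^ 2) ^ (1 / 2 : ℝ)
  have hD : D ≠ ⊤ := sqrt_mul_lintegral_ne_top hm2 hv
  have hmeas : AEStronglyMeasurable (fun p : E × E =>
      (gker m (x - p.1) * W p.1) * (gker χ (p.1 - p.2) * v p.2)) (volume.prod volume) := by
    refine AEStronglyMeasurable.mul (AEStronglyMeasurable.mul ?_ ?_)
      (AEStronglyMeasurable.mul ?_ hv.1.comp_snd)
    · exact ((gker_continuous hm).comp (by fun_prop)).aestronglyMeasurable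
    · exact (hWm.comp measurable_fst).aestronglyMeasurable
    · exact ((gker_continuous hχ.integrable).comp (by fun_prop)).aestronglyMeasurable
  have hmeas2 : AEStronglyMeasurable (fun p : E × E =>
      (gker m (x - p.1) * W p.1) * (gker χ p.2 * v (p.1 - p.2))) (volume.prod volume) := by
    refine AEStronglyMeasurable.mul (AEStronglyMeasurable.mul ?_ ?_)
      (AEStronglyMeasurable.mul ?_ ?_)
    · exact ((gker_continuous hm).comp (by fun_prop)).aestronglyMeasurable
    · exact (hWm.comp measurable_fst).aestronglyMeasurable
    · exact ((gker_continuous hχ.integrable).comp (by fun_prop)).aestronglyMeasurable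
    · exact hv.1.comp_quasiMeasurePreserving (quasiMeasurePreserving_sub volume volume)
  have hint : Integrable (fun p : E × E =>
      (gker m (x - p.1) * W p.1) * (gker χ (p.1 - p.2) * v p.2)) (volume.prod volume) := by
    refine ⟨hmeas, ?_⟩
    rw [HasFiniteIntegral, lintegral_prod _ hmeas.enorm]
    have h1 : ∀ y, ∫⁻ z, ‖(gker m (x - y) * W y) * (gker χ (y - z) * v z)‖ₑ =
        ∫⁻ z, ‖(gker m (x - y) * W y) * (gker χ z * v (y - z))‖ₑ := by
      intro y
      rw [← lintegral_sub_left_eq_self _ y]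
      simp only [sub_sub_cancel]
    simp only [h1]
    rw [lintegral_lintegral_swap hmeas2.enorm]
    calc _ ≤ ∫⁻ z, ‖gker χ z‖ₑ * (B * D) := by
          refine lintegral_mono fun z => ?_
          calc _ ≤ ∫⁻ y, ‖gker χ z‖ₑ * B * (‖gker m (x - y)‖ₑ * ‖v (y - z)‖ₑ) := by
                refine lintegral_mono fun y => ?_
                simp only [enorm_mul]
                calc _ = ‖gker χ z‖ₑ * ‖W y‖ₑ * (‖gker m (x - y)‖ₑ * ‖v (y - z)‖ₑ) := by ring
                  _ ≤ _ := by gcongr; exact hWB y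
            _ ≤ _ := by
              rw [lintegral_const_mul' _ _ (mul_ne_top enorm_ne_top hB), mul_assoc]
              gcongr
              have h3 : MemLp (fun y => v (y - z)) 2 :=
                hv.comp_measurePreserving (measurePreserving_sub_right volume z)
              refine (lintegral_gker_sub_mul_le hm2 h3 x).trans_eq ?_
              rw [lintegral_sub_right_eq_self (fun y => ‖v y‖ₑ ^ 2) z]
      _ = (∫⁻ y, ‖gker χ y‖ₑ) * (B * D) := lintegral_mul_const' _ _ (mul_ne_top hB hD)
      _ < ⊤ := mul_lt_top hkχ.2 (mul_lt_top hB.lt_top hD.lt_top)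
  have h1 : gconv m (fun y => gconv χ v y * W y) x =
      ∫ y, ∫ z, (gker m (x - y) * W y) * (gker χ (y - z) * v z) := by
    simp only [gconv, integral_const_mul]
    congr 1; ext y; ring
  rw [h1, integral_integral_swap hint, gconv]
  refine integral_congr_ae (ae_of_all _ fun z => ?_)
  simp only
  rw [show gker m (x - z) * (v z * W z) = (gker m (x - z) * W z) * v z by ring, ← hrep z,
    ← integral_mul_const]
  congr 1; ext y; ring

end Compose

/-! ### Multipliers on space-time -/

/-- Space-time with its Euclidean structure. -/
abbrev EuclSpaceTime : Type := WithLp 2 (Plane × ℝ)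

/-- A symbol on space-time, as a complex function on the Euclidean space-time. -/
def liftSym (a : SpaceTime → ℝ) (ζ : EuclSpaceTime) : ℂ := (a ζ.ofLp : ℂ)

lemma finrank_euclSpaceTime : Module.finrank ℝ EuclSpaceTime = 3 := by
  simp [(WithLp.linearEquiv 2 ℝ (Plane × ℝ)).finrank_eq]

lemma measurePreserving_ofLp :
    MeasurePreserving (fun ζ : EuclSpaceTime => (ζ.ofLp : SpaceTime)) volume volume :=
  WithLp.volume_preserving_ofLp Plane ℝ

lemma measurePreserving_toLp :
    MeasurePreserving (fun z : SpaceTime => (WithLp.toLp 2 z : EuclSpaceTime)) volume volume :=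
  WithLp.volume_preserving_toLp Plane ℝ

lemma measurableEmbedding_ofLp :
    MeasurableEmbedding (fun ζ : EuclSpaceTime => (ζ.ofLp : SpaceTime)) :=
  (MeasurableEquiv.toLp 2 (Plane × ℝ)).symm.measurableEmbedding

lemma integral_ofLp (f : ℂˢᵗ) :
    ∫ ζ : EuclSpaceTime, f ζ.ofLp = ∫ z, f z :=
  measurePreserving_ofLp.integral_comp measurableEmbedding_ofLp f

lemma lintegral_ofLp (f : SpaceTime → ℝ≥0∞) :
    ∫⁻ ζ : EuclSpaceTime, f ζ.ofLp = ∫⁻ z, f z :=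
  measurePreserving_ofLp.lintegral_comp_emb measurableEmbedding_ofLp f

lemma inner_toLp (z : SpaceTime) (ζ : EuclSpaceTime) :
    (inner ℝ (WithLp.toLp 2 z : EuclSpaceTime) ζ : ℝ) = stPhase z ζ.ofLp := by
  rw [WithLp.prod_inner_apply, stPhase]
  simp [mul_comm]

lemma stKernel_eq (a : SpaceTime → ℝ) (z : SpaceTime) :
    stKernel a z = gker (liftSym a) (WithLp.toLp 2 z) := by
  rw [stKernel, gker, finrank_euclSpaceTime,
    ← integral_ofLp fun ζ => exp (I * (stPhase z ζ : ℂ)) * (a ζ : ℂ)]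
  simp only [inner_toLp, liftSym]

lemma stMult_eq (a : SpaceTime → ℝ) (f : ℂˢᵗ) (z : SpaceTime) :
    stMult a f z = gconv (liftSym a) (fun ζ : EuclSpaceTime => f ζ.ofLp) (WithLp.toLp 2 z) := by
  rw [stMult, gconv, ← integral_ofLp fun w => stKernel a (z - w) * f w]
  simp only [stKernel_eq]
  rfl

lemma gconv_liftSym (a : SpaceTime → ℝ) (f : ℂˢᵗ) :
    gconv (liftSym a) (fun ζ : EuclSpaceTime => f ζ.ofLp) = fun ζ => stMult a f ζ.ofLp := by
  funext ζ; rw [stMult_eq]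

lemma memLp_ofLp {f : ℂˢᵗ} (hf : MemLp f 2) :
    MemLp (fun ζ : EuclSpaceTime => f ζ.ofLp) 2 :=
  hf.comp_measurePreserving measurePreserving_ofLp

lemma aestronglyMeasurable_ofLp {f : ℂˢᵗ} (hf : AEStronglyMeasurable f) :
    AEStronglyMeasurable (fun ζ : EuclSpaceTime => f ζ.ofLp) :=
  hf.comp_measurePreserving measurePreserving_ofLp

/-- Continuous symbols with compact support. -/
def StSym (a : SpaceTime → ℝ) : Prop := Continuous a ∧ HasCompactSupport a

/-- Smooth symbols with compact support. -/
def StTest (a : SpaceTime → ℝ) : Prop := ContDiff ℝ ∞ a ∧ HasCompactSupport a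

lemma StTest.stSym {a : SpaceTime → ℝ} (h : StTest a) : StSym a := ⟨h.1.continuous, h.2⟩

lemma hasCompactSupport_liftSym {a : SpaceTime → ℝ} (h : HasCompactSupport a) :
    HasCompactSupport (liftSym a) :=
  (h.comp_homeomorph (WithLp.prodContinuousLinearEquiv 2 ℝ Plane ℝ).toHomeomorph).comp_left
    (g := fun x : ℝ => (x : ℂ)) (by simp)

lemma StTest.isTest {a : SpaceTime → ℝ} (h : StTest a) : IsTest (liftSym a) :=
  ⟨Complex.ofRealCLM.contDiff.comp
    (h.1.comp (WithLp.prodContinuousLinearEquiv 2 ℝ Plane ℝ).contDiff),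
    hasCompactSupport_liftSym h.2⟩

lemma StSym.continuous_lift {a : SpaceTime → ℝ} (h : StSym a) : Continuous (liftSym a) :=
  Complex.continuous_ofReal.comp
    (h.1.comp (WithLp.prodContinuousLinearEquiv 2 ℝ Plane ℝ).continuous)

lemma StSym.integrable {a : SpaceTime → ℝ} (h : StSym a) : Integrable (liftSym a) :=
  h.continuous_lift.integrable_of_hasCompactSupport (hasCompactSupport_liftSym h.2)

lemma StSym.memLp_gker {a : SpaceTime → ℝ} (h : StSym a) : MemLp (gker (liftSym a)) 2 :=
  _root_.memLp_gker h.integrable (memLp_two_of_bounded h.integrable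
    (h.continuous_lift.bounded_above_of_compact_support (hasCompactSupport_liftSym h.2)))

lemma StSym.mul {a b : SpaceTime → ℝ} (ha : StSym a) (hb : Continuous b) :
    StSym fun ζ => a ζ * b ζ := ⟨ha.1.mul hb, ha.2.mul_right⟩

lemma StSym.fst_mul {a : SpaceTime → ℝ} (ha : StSym a) {b : Plane → ℝ} (hb : Continuous b) :
    StSym fun ζ => b ζ.1 * a ζ := ⟨(hb.comp continuous_fst).mul ha.1, ha.2.mul_left⟩

lemma StSym.continuous_stKernel {a : SpaceTime → ℝ} (h : StSym a) : Continuous (stKernel a) := by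
  have : stKernel a = fun z => gker (liftSym a) (WithLp.toLp 2 z) := funext (stKernel_eq a)
  rw [this]
  exact (gker_continuous h.integrable).comp
    (WithLp.prodContinuousLinearEquiv 2 ℝ Plane ℝ).symm.continuous

lemma exists_norm_stKernel_le (a : SpaceTime → ℝ) : ∃ B : ℝ≥0∞, B ≠ ⊤ ∧
    ∀ z, ‖stKernel a z‖ₑ ≤ B := by
  obtain ⟨B, hB⟩ : ∃ B : ℝ, ∀ x, ‖gker (liftSym a) x‖ ≤ B := ⟨_, norm_gker_le _⟩
  refine ⟨ofReal B, ofReal_ne_top, fun z => ?_⟩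
  rw [← ofReal_norm, stKernel_eq]
  exact ofReal_le_ofReal (hB _)

lemma StSym.measurable_stMult {a : SpaceTime → ℝ} (h : StSym a) {f : ℂˢᵗ}
    (hf : AEStronglyMeasurable f) : Measurable (stMult a f) := by
  have : stMult a f = fun z => gconv (liftSym a) (fun ζ : EuclSpaceTime => f ζ.ofLp)
    (WithLp.toLp 2 z) := funext (stMult_eq a f)
  rw [this]
  exact (measurable_gconv h.integrable (aestronglyMeasurable_ofLp hf)).comp
    measurePreserving_toLp.measurable

lemma StSym.lintegral_stMult_sq_le {a : SpaceTime → ℝ} (h : StSym a) {B : ℝ}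
    (hB : ∀ ζ, |a ζ| ≤ B) {f : ℂˢᵗ} (hf : MemLp f 2) :
    ∫⁻ z, ‖stMult a f z‖ₑ ^ 2 ≤ ofReal (B ^ 2) * ∫⁻ z, ‖f z‖ₑ ^ 2 := by
  have h1 := lintegral_gconv_matrix (α := Unit) (β := Unit) (m := fun _ _ => liftSym a)
    (A := B ^ 2) (by positivity) (fun _ _ => h.integrable)
    (fun _ _ => h.continuous_lift.bounded_above_of_compact_support (hasCompactSupport_liftSym h.2))
    (fun ξ z => by
      simp only [Finset.univ_unique, Finset.sum_singleton, norm_mul, mul_pow]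
      gcongr
      rw [liftSym, norm_real]; exact hB _)
    (h := fun _ ζ => f ζ.ofLp) (fun _ => memLp_ofLp hf)
  simp only [Finset.univ_unique, Finset.sum_singleton, gconv_liftSym] at h1
  rwa [lintegral_ofLp fun z => ‖stMult a f z‖ₑ ^ 2, lintegral_ofLp fun z => ‖f z‖ₑ ^ 2] at h1

lemma StSym.memLp_stMult {a : SpaceTime → ℝ} (h : StSym a) {f : ℂˢᵗ}
    (hf : MemLp f 2) : MemLp (stMult a f) 2 := by
  obtain ⟨B, hB⟩ := h.1.bounded_above_of_compact_support h.2
  rw [memLp_two_iff_lintegral (h.measurable_stMult hf.1).aestronglyMeasurable]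
  exact (h.lintegral_stMult_sq_le hB hf).trans_lt (mul_lt_top ofReal_lt_top
    ((memLp_two_iff_lintegral hf.1).1 hf))

lemma stMult_stMult_left {a b : SpaceTime → ℝ} (ha : StTest a) (hb : StSym b)
    {f : ℂˢᵗ} (hf : MemLp f 2) :
    stMult a (stMult b f) = stMult (fun ζ => a ζ * b ζ) f := by
  funext z
  rw [stMult_eq, stMult_eq, ← gconv_liftSym, gconv_gconv_left ha.isTest hb.integrable
    (memLp_ofLp hf).1 (sqrt_mul_lintegral_ne_top hb.memLp_gker (memLp_ofLp hf))
    (lintegral_gker_sub_mul_le hb.memLp_gker (memLp_ofLp hf))]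
  congr 1
  funext ζ; simp [liftSym]

lemma stMult_stMult_right {a b : SpaceTime → ℝ} (ha : StTest a) (hb : StSym b)
    {f : ℂˢᵗ} (hf : MemLp f 2) :
    stMult b (stMult a f) = stMult (fun ζ => a ζ * b ζ) f := by
  funext z
  rw [stMult_eq, stMult_eq, ← gconv_liftSym, gconv_gconv_right ha.isTest hb.integrable
    hb.memLp_gker (memLp_ofLp hf)]
  congr 1
  funext ζ; simp [liftSym]

lemma stMult_mul_stMult_eq {m ρ χ : SpaceTime → ℝ} {v w : ℂˢᵗ} (hm : StSym m)
    (hρ : StSym ρ) (hχ : StTest χ) (h : ∀ η ζ, m η ≠ 0 → ρ ζ ≠ 0 → χ (η - ζ) = 1)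
    (hv : MemLp v 2) (hw : MemLp w 2) :
    stMult m (fun z => v z * stMult ρ w z) = stMult m (fun z => stMult χ v z * stMult ρ w z) := by
  funext z
  have := gconv_mul_gconv_eq hm.integrable hm.memLp_gker hρ.integrable hρ.memLp_gker hχ.isTest
    (fun η ζ hη hζ => by
      have := h η.ofLp ζ.ofLp (by simpa [liftSym] using hη) (by simpa [liftSym] using hζ)
      simp only [liftSym, WithLp.ofLp_sub, this, Complex.ofReal_one])
    (memLp_ofLp hv) (memLp_ofLp hw) (WithLp.toLp 2 z)
  rw [stMult_eq, stMult_eq]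
  simpa only [gconv_liftSym] using this

lemma stMult_congr_ae {a : SpaceTime → ℝ} {f g : ℂˢᵗ} (h : f =ᵐ[volume] g) :
    stMult a f = stMult a g := by
  funext z
  refine integral_congr_ae ?_
  filter_upwards [h] with w hw
  rw [hw]

/-- The convolution integral of `f` with the kernel of the symbol `a` converges absolutely and
uniformly. -/
def StAdm (a : SpaceTime → ℝ) (f : ℂˢᵗ) : Prop :=
  AEStronglyMeasurable f ∧ ∃ B : ℝ≥0∞, B ≠ ⊤ ∧ ∀ z, ∫⁻ w, ‖stKernel a (z - w)‖ₑ * ‖f w‖ₑ ≤ B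

lemma StSym.stAdm_of_memLp {a : SpaceTime → ℝ} (h : StSym a) {f : ℂˢᵗ}
    (hf : MemLp f 2) : StAdm a f := by
  refine ⟨hf.1, _, sqrt_mul_lintegral_ne_top h.memLp_gker (memLp_ofLp hf), fun z => ?_⟩
  have := lintegral_gker_sub_mul_le h.memLp_gker (memLp_ofLp hf) (WithLp.toLp 2 z)
  refine le_trans (le_of_eq ?_) this
  rw [← lintegral_ofLp fun w => ‖stKernel a (z - w)‖ₑ * ‖f w‖ₑ]
  simp only [stKernel_eq]
  rfl

lemma stAdm_of_integrable (a : SpaceTime → ℝ) {f : ℂˢᵗ}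
    (hf : Integrable f) : StAdm a f := by
  obtain ⟨B, hB, h⟩ := exists_norm_stKernel_le a
  refine ⟨hf.1, B * ∫⁻ w, ‖f w‖ₑ, mul_ne_top hB hf.2.ne, fun z => ?_⟩
  rw [← lintegral_const_mul' _ _ hB]
  gcongr
  exact h _

lemma StAdm.integrable {a : SpaceTime → ℝ} (ha : StSym a) {f : ℂˢᵗ} (h : StAdm a f)
    (z : SpaceTime) : Integrable (fun w => stKernel a (z - w) * f w) := by
  obtain ⟨hf, B, hB, hb⟩ := h
  refine ⟨((ha.continuous_stKernel.comp (continuous_const.sub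
    continuous_id)).aestronglyMeasurable).mul hf, ?_⟩
  rw [HasFiniteIntegral]
  simp only [enorm_mul]
  exact (hb z).trans_lt hB.lt_top

lemma stMult_finset_sum_symbol {β : Type*} (s : Finset β) {a : β → SpaceTime → ℝ}
    (ha : ∀ b ∈ s, StSym (a b)) {f : ℂˢᵗ} (hf : ∀ b ∈ s, StAdm (a b) f) (z : SpaceTime) :
    stMult (fun ζ => ∑ b ∈ s, a b ζ) f z = ∑ b ∈ s, stMult (a b) f z := by
  simp only [stMult]
  rw [← integral_finsetSum _ fun b hb => (hf b hb).integrable (ha b hb) z]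
  congr 1; ext w
  rw [← sum_mul]
  congr 1
  simp only [stKernel_eq]
  rw [gker_finset_sum s fun b hb => (ha b hb).integrable]
  congr 1; funext ζ; simp [liftSym]

lemma stMult_finset_sum {β : Type*} (s : Finset β) {a : SpaceTime → ℝ}
    (ha : StSym a) {f : β → ℂˢᵗ} (hf : ∀ b ∈ s, StAdm a (f b)) (z : SpaceTime) :
    stMult a (fun w => ∑ b ∈ s, f b w) z = ∑ b ∈ s, stMult a (f b) z := by
  simp only [stMult]
  rw [← integral_finsetSum _ fun b hb => (hf b hb).integrable ha z]
  congr 1; ext w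
  rw [mul_sum]

/-! ### Multipliers in `x` -/

lemma xKernel_eq (b : Plane → ℝ) (x : Plane) : xKernel b x = gker (fun ξ => (b ξ : ℂ)) x := by
  rw [xKernel, gker, finrank_euclideanSpace_fin]

lemma xMult_eq (b : Plane → ℝ) (f : ℂˢᵗ) (x : Plane) (t : ℝ) :
    xMult b f (x, t) = gconv (fun ξ => (b ξ : ℂ)) (fun y => f (y, t)) x := by
  simp only [xMult, gconv, xKernel_eq]

lemma integral_gker_mul_stKernel {b : Plane → ℝ} (hb : IsTest fun ξ => (b ξ : ℂ))
    {a : SpaceTime → ℝ} (ha : StSym a) (x : Plane) (t : ℝ) :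
    ∫ y, gker (fun ξ => (b ξ : ℂ)) (x - y) * stKernel a (y, t) =
      stKernel (fun ζ => b ζ.1 * a ζ) (x, t) := by
  have hk : Integrable (fun y => gker (fun ξ => (b ξ : ℂ)) (x - y)) :=
    (integrable_gker hb).comp_sub_left x
  have hai : Integrable (fun ζ => (a ζ : ℂ)) :=
    (Complex.continuous_ofReal.comp ha.1).integrable_of_hasCompactSupport
      (ha.2.comp_left (g := fun x : ℝ => (x : ℂ)) (by simp))
  have hint : Integrable (fun p : Plane × SpaceTime =>
      exp (I * (stPhase (p.1, t) p.2 : ℝ)) *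
        (gker (fun ξ => (b ξ : ℂ)) (x - p.1) * a p.2)) (volume.prod volume) := by
    refine (hk.mul_prod hai).bdd_mul (c := 1) ?_ (ae_of_all _ fun p => ?_)
    · unfold stPhase
      exact Continuous.aestronglyMeasurable (by fun_prop)
    · rw [norm_cexp_I_mul]
  have h1 : ∀ y, gker (fun ξ => (b ξ : ℂ)) (x - y) * stKernel a (y, t) =
      (((2 * π) ^ 3)⁻¹ : ℝ) * ∫ ζ, exp (I * (stPhase (y, t) ζ : ℝ)) *
        (gker (fun ξ => (b ξ : ℂ)) (x - y) * a ζ) := by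
    intro y
    rw [stKernel, ← mul_assoc, mul_comm (gker _ _), mul_assoc, ← integral_const_mul]
    congr 2; ext ξ; ring
  simp_rw [h1]
  rw [integral_const_mul, stKernel]
  congr 1
  rw [integral_integral_swap hint]
  refine integral_congr_ae (ae_of_all _ fun ζ => ?_)
  simp only
  have h2 : ∀ y, exp (I * (stPhase (y, t) ζ : ℝ)) *
      (gker (fun ξ => (b ξ : ℂ)) (x - y) * a ζ) =
      (gker (fun ξ => (b ξ : ℂ)) (x - y) * exp (I * (inner ℝ y ζ.1 : ℝ))) *
      (exp (I * ((t * ζ.2 : ℝ) : ℂ)) * a ζ) := by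
    intro y
    rw [stPhase, show I * ((inner ℝ (y, t).1 ζ.1 + (y, t).2 * ζ.2 : ℝ) : ℂ) =
      I * (inner ℝ y ζ.1 : ℝ) + I * ((t * ζ.2 : ℝ) : ℂ) by push_cast; ring,
      exp_add]
    ring
  simp_rw [h2]
  rw [integral_mul_const, integral_gker_sub_left_mul_cexp hb, stPhase,
    show I * ((inner ℝ (x, t).1 ζ.1 + (x, t).2 * ζ.2 : ℝ) : ℂ) =
      I * (inner ℝ x ζ.1 : ℝ) + I * ((t * ζ.2 : ℝ) : ℂ) by push_cast; ring,
      exp_add]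
  push_cast; ring

lemma xMult_stMult {b : Plane → ℝ} (hb : IsTest fun ξ => (b ξ : ℂ)) {a : SpaceTime → ℝ}
    (ha : StSym a) {f : ℂˢᵗ} (hf : StAdm a f) :
    xMult b (stMult a f) = stMult (fun ζ => b ζ.1 * a ζ) f := by
  obtain ⟨hfm, B, hB, hbd⟩ := hf
  funext z
  obtain ⟨x, t⟩ := z
  have hk : Integrable (fun y => gker (fun ξ => (b ξ : ℂ)) (x - y)) :=
    (integrable_gker hb).comp_sub_left x
  have hint : Integrable (fun p : Plane × SpaceTime =>
      gker (fun ξ => (b ξ : ℂ)) (x - p.1) * (stKernel a ((p.1, t) - p.2) * f p.2))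
      (volume.prod volume) :=
    integrable_prod_mul hk ((ha.continuous_stKernel.comp (by fun_prop)).aestronglyMeasurable.mul
      hfm.comp_snd) hB (by simpa only [enorm_mul] using fun y => hbd (y, t))
  have h1 : xMult b (stMult a f) (x, t) = ∫ y, ∫ w,
      gker (fun ξ => (b ξ : ℂ)) (x - y) * (stKernel a ((y, t) - w) * f w) := by
    rw [xMult_eq, gconv]
    simp only [stMult, integral_const_mul]
  rw [h1, integral_integral_swap hint, stMult]
  refine integral_congr_ae (ae_of_all _ fun w => ?_)
  simp only
  have h2 := integral_gker_mul_stKernel hb ha (x - w.1) (t - w.2)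
  rw [show (x, t) - w = (x - w.1, t - w.2) from rfl, ← h2, ← integral_mul_const,
    ← integral_sub_right_eq_self (fun y => gker (fun ξ => (b ξ : ℂ)) (x - w.1 - y) *
      stKernel a (y, t - w.2) * f w) w.1]
  congr 1; ext y
  rw [show x - w.1 - (y - w.1) = x - y by abel, show (y, t) - w = (y - w.1, t - w.2) from rfl]
  ring

/-! ### Product symbols -/

/-- The symbol `χ(η) θ((τ - η²) / K)`. -/
def prodSym (χ : Plane → ℝ) (θ : ℝ → ℝ) (K : ℝ) (ζ : SpaceTime) : ℝ :=
  χ ζ.1 * θ ((ζ.2 - ‖ζ.1‖ ^ 2) / K)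

lemma hasCompactSupport_prodSym {χ : Plane → ℝ} {θ : ℝ → ℝ} {K : ℝ} (hK : 0 < K)
    (hχ : HasCompactSupport χ) (hθ : HasCompactSupport θ) : HasCompactSupport (prodSym χ θ K) := by
  have hc : Continuous fun p : Plane × ℝ => ((p.1, ‖p.1‖ ^ 2 + K * p.2) : SpaceTime) := by fun_prop
  refine HasCompactSupport.intro ((hχ.isCompact.prod hθ.isCompact).image hc) fun ζ hζ => ?_
  by_contra hne
  apply hζ
  rw [prodSym] at hne
  refine ⟨(ζ.1, (ζ.2 - ‖ζ.1‖ ^ 2) / K), ⟨subset_tsupport _ (left_ne_zero_of_mul hne),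
    subset_tsupport _ (right_ne_zero_of_mul hne)⟩, ?_⟩
  ext1
  · rfl
  · simp only; field_simp; ring

lemma stTest_prodSym {χ : Plane → ℝ} {θ : ℝ → ℝ} {K : ℝ} (hK : 0 < K)
    (hχ : ContDiff ℝ ∞ χ) (hχs : HasCompactSupport χ) (hθ : ContDiff ℝ ∞ θ)
    (hθs : HasCompactSupport θ) : StTest (prodSym χ θ K) := by
  refine ⟨?_, hasCompactSupport_prodSym hK hχs hθs⟩
  have h2 : ContDiff ℝ ∞ fun ζ : SpaceTime => ‖ζ.1‖ ^ 2 := contDiff_fst.norm_sq ℝ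
  exact (hχ.comp contDiff_fst).mul (hθ.comp ((contDiff_snd.sub h2).div_const K))

lemma stKernel_prodSym {χ : Plane → ℝ} {θ : ℝ → ℝ} {K : ℝ} (hK : 0 < K)
    (hχ : Continuous χ) (hχs : HasCompactSupport χ) (hθ : Continuous θ)
    (hθs : HasCompactSupport θ) (x : Plane) (t : ℝ) :
    stKernel (prodSym χ θ K) (x, t) =
      gker (fun η => (χ η : ℂ) * exp (I * t * ((‖η‖ ^ 2 : ℝ) : ℂ))) x *
        (K * gker (fun σ : ℝ => (θ σ : ℂ)) (K * t)) := by
  have hcont : Continuous (prodSym χ θ K) := by unfold prodSym; fun_prop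
  have hi : Integrable (fun ζ : SpaceTime => exp (I * (stPhase (x, t) ζ : ℝ)) *
      (prodSym χ θ K ζ : ℂ)) (volume.prod volume) := by
    have h1 : Integrable (fun ζ => (prodSym χ θ K ζ : ℂ)) (volume.prod volume) :=
      (Complex.continuous_ofReal.comp hcont).integrable_of_hasCompactSupport
      ((hasCompactSupport_prodSym hK hχs hθs).comp_left (g := fun x : ℝ => (x : ℂ)) (by simp))
    refine h1.bdd_mul (c := 1) ?_ (ae_of_all _ fun p => ?_)
    · unfold stPhase
      exact Continuous.aestronglyMeasurable (by fun_prop)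
    · rw [norm_cexp_I_mul]
  have h2 : ∀ η : Plane, ∫ τ : ℝ, exp (I * (stPhase (x, t) (η, τ) : ℝ)) *
      (prodSym χ θ K (η, τ) : ℂ) = (exp (I * (inner ℝ x η : ℝ)) *
      ((χ η : ℂ) * exp (I * t * ((‖η‖ ^ 2 : ℝ) : ℂ)))) * (K *
        ∫ σ : ℝ, exp (I * (inner ℝ (K * t) σ : ℝ)) * (θ σ : ℂ)) := by
    intro η
    have h3 : ∀ F : ℝ → ℂ, ∫ τ, F τ = K * ∫ σ, F (‖η‖ ^ 2 + K * σ) := by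
      intro F
      have h4 := Measure.integral_comp_mul_left (fun y => F (‖η‖ ^ 2 + y)) K
      rw [h4, integral_add_left_eq_self F, abs_of_pos (inv_pos.2 hK), Complex.real_smul]
      push_cast
      rw [← mul_assoc, mul_inv_cancel₀ (by exact_mod_cast hK.ne'), one_mul]
    rw [h3, mul_left_comm _ (K : ℂ)]
    congr 1
    rw [← integral_const_mul]
    congr 1; ext σ
    have h5 : (‖η‖ ^ 2 + K * σ - ‖η‖ ^ 2) / K = σ := by field_simp; ring
    simp only [prodSym, stPhase, h5]
    have h6 : exp (I * ((inner ℝ x η + t * (‖η‖ ^ 2 + K * σ) : ℝ) : ℂ)) =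
        exp (I * (inner ℝ x η : ℝ)) *
        exp (I * t * ((‖η‖ ^ 2 : ℝ) : ℂ)) *
        exp (I * (inner ℝ (K * t) σ : ℝ)) := by
      rw [← exp_add, ← exp_add]
      congr 1
      simp only [RCLike.inner_apply, conj_trivial]
      push_cast; ring
    rw [h6]; push_cast; ring
  rw [stKernel, volume_eq_prod, integral_prod _ hi]
  simp_rw [h2]
  rw [integral_mul_const, gker, gker, finrank_euclideanSpace_fin, Module.finrank_self]
  push_cast
  ring

lemma exists_norm_gker_real_le {θ : ℝ → ℂ} (hθ : IsTest θ) (n : ℕ) :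
    ∃ C : ℝ, 0 ≤ C ∧ ∀ t, ‖gker θ t‖ ≤ C * ((1 + |t|) ^ n)⁻¹ := by
  set B0 := ‖((((2 * π) ^ Module.finrank ℝ ℝ)⁻¹ : ℝ) : ℂ)‖
  have h0 : ∀ k : ℕ, ∃ C : ℝ, 0 ≤ C ∧ ∀ t, |t| ^ k * ‖gker θ t‖ ≤ C := by
    intro k
    obtain ⟨B, hB⟩ : ∃ B : ℝ, ∀ t, ‖gker ((dI (1 : ℝ))^[k] θ) t‖ ≤ B := ⟨_, norm_gker_le _⟩
    refine ⟨B, (norm_nonneg _).trans (hB 0), fun t => ?_⟩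
    have := hB t
    rw [gker_dI_iterate hθ, norm_mul, norm_pow, norm_real] at this
    simpa using this
  obtain ⟨C0, hC0, h0'⟩ := h0 0
  obtain ⟨Cn, hCn, hn'⟩ := h0 n
  refine ⟨2 ^ n * (C0 + Cn), by positivity, fun t => ?_⟩
  rw [← div_eq_mul_inv, le_div_iff₀ (by positivity)]
  have h1 : (1 + |t|) ^ n ≤ 2 ^ n * (1 + |t| ^ n) := by
    rcases le_total |t| 1 with h | h
    · calc (1 + |t|) ^ n ≤ (2 : ℝ) ^ n := by
            apply pow_le_pow_left₀ (by positivity); linarith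
        _ ≤ _ := by nlinarith [pow_pos (two_pos : (0 : ℝ) < 2) n, pow_nonneg (abs_nonneg t) n]
    · calc (1 + |t|) ^ n ≤ (2 * |t|) ^ n := by
            apply pow_le_pow_left₀ (by positivity); linarith
        _ = 2 ^ n * |t| ^ n := mul_pow _ _ _
        _ ≤ _ := by nlinarith [pow_pos (two_pos : (0 : ℝ) < 2) n]
  have h2 := h0' t
  have h3 := hn' t
  rw [pow_zero, one_mul] at h2
  calc ‖gker θ t‖ * (1 + |t|) ^ n ≤ ‖gker θ t‖ * (2 ^ n * (1 + |t| ^ n)) := by gcongr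
    _ = 2 ^ n * (‖gker θ t‖ + |t| ^ n * ‖gker θ t‖) := by ring
    _ ≤ _ := by gcongr

/-- Slicing of a multiplier with product symbol into multipliers in `x`. -/
lemma stMult_prodSym {χ : Plane → ℝ} {θ : ℝ → ℝ} {K : ℝ} (hK : 0 < K)
    (hχ : Continuous χ) (hχs : HasCompactSupport χ) (hθ : Continuous θ)
    (hθs : HasCompactSupport θ) {f : ℂˢᵗ} (hf : StAdm (prodSym χ θ K) f)
    (x : Plane) (t : ℝ) :
    stMult (prodSym χ θ K) f (x, t) = ∫ s, (K * gker (fun σ : ℝ => (θ σ : ℂ)) (K * (t - s))) *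
      gconv (fun η => (χ η : ℂ) * exp (I * ((t - s : ℝ) : ℂ) * ((‖η‖ ^ 2 : ℝ) : ℂ)))
        (fun y => f (y, s)) x := by
  have hsym : StSym (prodSym χ θ K) :=
    ⟨by unfold prodSym; fun_prop, hasCompactSupport_prodSym hK hχs hθs⟩
  have hi := hf.integrable hsym (x, t)
  rw [stMult, volume_eq_prod, integral_prod_symm _ (by rwa [← volume_eq_prod])]
  congr 1; ext s
  rw [gconv, ← integral_const_mul]
  congr 1; ext y
  rw [show (x, t) - (y, s) = (x - y, t - s) from rfl, stKernel_prodSym hK hχ hχs hθ hθs]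
  ring

/-! ### Functions with restricted Fourier support -/

section FourierSupport

open Module FourierTransform

variable {E : Type*} [NormedAddCommGroup E] [InnerProductSpace ℝ E] [FiniteDimensional ℝ E]
  [MeasurableSpace E] [BorelSpace E]

lemma integral_gker_sub_mul_gft {m h : E → ℂ} (hm : IsTest m) (hh : Integrable h) (w : E) :
    ∫ z, gker m (z - w) * gft h z = gft (fun ζ => m ζ * h ζ) w := by
  have hk : Integrable (fun y => gker m (y - w)) := (integrable_gker hm).comp_sub_right w
  have hint : Integrable (fun p : E × E =>
      exp (-I * (inner ℝ p.1 p.2 : ℝ)) * (gker m (p.1 - w) * h p.2))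
      (volume.prod volume) := by
    refine (hk.mul_prod hh).bdd_mul (c := 1) ?_ (ae_of_all _ fun p => ?_)
    · exact Continuous.aestronglyMeasurable (by fun_prop)
    · rw [norm_cexp_neg_I_mul]
  have h1 : ∀ z, gker m (z - w) * gft h z =
      ∫ ζ, exp (-I * (inner ℝ z ζ : ℝ)) * (gker m (z - w) * h ζ) := by
    intro z
    have h2 : gft h z = ∫ ζ, exp (-I * (inner ℝ z ζ : ℝ)) * h ζ := by
      simp only [gft]
      congr 1; ext ζ; rw [real_inner_comm]
    rw [h2, ← integral_const_mul]
    congr 1; ext ζ; ring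
  simp_rw [h1]
  rw [integral_integral_swap hint, gft]
  refine integral_congr_ae (ae_of_all _ fun ζ => ?_)
  simp only
  have h2 : ∀ z, exp (-I * (inner ℝ z ζ : ℝ)) * (gker m (z - w) * h ζ) =
      gker m (z - w) * exp (-I * (inner ℝ z ζ : ℝ)) * h ζ := fun z => by ring
  simp_rw [h2]
  rw [integral_mul_const, integral_gker_sub_right_mul_cexp hm, real_inner_comm]
  ring

end FourierSupport

lemma stFourier_eq (ψ : ℂˢᵗ) (z : SpaceTime) :
    stFourier ψ z = gft (fun ζ : EuclSpaceTime => ψ ζ.ofLp) (WithLp.toLp 2 z) := by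
  rw [stFourier, gft, ← integral_ofLp fun ζ => exp (-I * (stPhase z ζ : ℂ)) * ψ ζ]
  simp only [← inner_toLp]
  congr 1; ext ζ; rw [real_inner_comm]

open FourierTransform in
lemma exists_schwartz_stFourier_eq {g : SpaceTime → ℝ} (hg : StTest g) :
    ∃ ψ : 𝓢(SpaceTime, ℂ), ∀ z, stFourier ψ z = g z := by
  set M : 𝓢(EuclSpaceTime, ℂ) := hg.isTest.2.toSchwartzMap hg.isTest.1
  set u : ℝˣ := Units.mk0 (2 * π)⁻¹ (by positivity)
  set e : SpaceTime ≃L[ℝ] EuclSpaceTime :=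
    (WithLp.prodContinuousLinearEquiv 2 ℝ Plane ℝ).symm.trans
      (ContinuousLinearEquiv.smulLeft (R₁ := ℝ) (M₁ := EuclSpaceTime) u)
  refine ⟨(((((2 * π) ^ Module.finrank ℝ EuclSpaceTime)⁻¹ : ℝ) : ℂ)) •
    SchwartzMap.compCLMOfContinuousLinearEquiv ℂ e (𝓕⁻ M), fun z => ?_⟩
  have h1 : (fun ζ : EuclSpaceTime =>
      ((((((2 * π) ^ Module.finrank ℝ EuclSpaceTime)⁻¹ : ℝ) : ℂ)) •
      SchwartzMap.compCLMOfContinuousLinearEquiv ℂ e (𝓕⁻ M)) ζ.ofLp) = gker (liftSym g) := by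
    funext x
    rw [gker_eq_fourierInv]
    simp only [smul_apply, smul_eq_mul,
      SchwartzMap.compCLMOfContinuousLinearEquiv_apply, Function.comp_apply,
      SchwartzMap.fourierInv_coe]
    rfl
  rw [stFourier_eq, h1, gft_gker hg.isTest]
  rfl

lemma integral_stKernel_mul_stFourier {b : SpaceTime → ℝ} (hb : StTest b) {ψ : ℂˢᵗ}
    (hψ : Integrable ψ) (w : SpaceTime) :
    ∫ z, stKernel b (z - w) * stFourier ψ z = stFourier (fun ζ => b ζ * ψ ζ) w := by
  have h1 := integral_gker_sub_mul_gft hb.isTest (h := fun ζ : EuclSpaceTime => ψ ζ.ofLp)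
    (measurePreserving_ofLp.integrable_comp_of_integrable hψ) (WithLp.toLp 2 w)
  rw [stFourier_eq, ← integral_ofLp]
  simp only [stKernel_eq, stFourier_eq]
  exact h1

instance isAddHaarMeasure_spaceTime : (volume : Measure SpaceTime).IsAddHaarMeasure :=
  inferInstanceAs ((volume : Measure Plane).prod (volume : Measure ℝ)).IsAddHaarMeasure

lemma memLp_stFourier {h : ℂˢᵗ} (hh : Integrable h) (hh2 : MemLp h 2) :
    MemLp (stFourier h) 2 := by
  have h1 : Integrable (fun ζ : EuclSpaceTime => h ζ.ofLp) :=
    measurePreserving_ofLp.integrable_comp_of_integrable hh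
  have h2 : MemLp (gft fun ζ : EuclSpaceTime => h ζ.ofLp) 2 := by
    rw [memLp_two_iff_lintegral (gft_continuous h1).aestronglyMeasurable,
      lintegral_gft_sq h1 (memLp_ofLp hh2)]
    exact mul_lt_top ofReal_lt_top
      ((memLp_two_iff_lintegral (memLp_ofLp hh2).1).1 (memLp_ofLp hh2))
  have h3 : stFourier h = fun z => gft (fun ζ : EuclSpaceTime => h ζ.ofLp) (WithLp.toLp 2 z) :=
    funext (stFourier_eq h)
  rw [h3]
  exact h2.comp_measurePreserving measurePreserving_toLp

/-- A function with Fourier support in `A` is reproduced by a multiplier with symbol equal to `1`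
in a neighbourhood of `A`. -/
lemma FourierSupportedIn.ae_eq_stMult {f : ℂˢᵗ} {A U : Set SpaceTime}
    (hA : FourierSupportedIn f A) (hf : MemLp f 2) {b : SpaceTime → ℝ} (hb : StTest b)
    (hU : IsOpen U) (hAU : A ⊆ U) (h1 : ∀ ζ ∈ U, b ζ = 1) : f =ᵐ[volume] stMult b f := by
  have hF : MemLp (fun z => f z - stMult b f z) 2 := hf.sub (hb.stSym.memLp_stMult hf)
  have hmain : ∀ g : SpaceTime → ℝ, ContDiff ℝ ∞ g → HasCompactSupport g →
      ∫ z, g z • (f z - stMult b f z) = 0 := by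
    intro g hg hgs
    obtain ⟨ψ, hψ⟩ := exists_schwartz_stFourier_eq (g := g) ⟨hg, hgs⟩
    have hg2 : MemLp (fun z => (g z : ℂ)) 2 :=
      (Complex.continuous_ofReal.comp hg.continuous).memLp_of_hasCompactSupport
        (hgs.comp_left (g := fun x : ℝ => (x : ℂ)) (by simp))
    have hg1 : Integrable (fun z => (g z : ℂ)) :=
      (Complex.continuous_ofReal.comp hg.continuous).integrable_of_hasCompactSupport
        (hgs.comp_left (g := fun x : ℝ => (x : ℂ)) (by simp))
    -- the Schwartz function `(1 - b) ψ`
    have hbψ : ContDiff ℝ ∞ fun ζ => (b ζ : ℂ) * ψ ζ :=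
      (Complex.ofRealCLM.contDiff.comp hb.1).mul (ψ.smooth ⊤)
    have hbψs : HasCompactSupport fun ζ => (b ζ : ℂ) * ψ ζ :=
      (hb.2.comp_left (g := fun x : ℝ => (x : ℂ)) (by simp)).mul_right
    set ψ' : 𝓢(SpaceTime, ℂ) := ψ - hbψs.toSchwartzMap hbψ
    have hψ' : ∀ ζ, ψ' ζ = ψ ζ - b ζ * ψ ζ := fun ζ => rfl
    have hdisj : Disjoint (tsupport ψ') A := by
      refine Set.disjoint_left.2 fun ζ hζ hζA => ?_
      have : tsupport ψ' ⊆ Uᶜ := by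
        refine closure_minimal (fun ζ hζ hζU => hζ ?_) hU.isClosed_compl
        rw [hψ', h1 ζ hζU]; simp
      exact this hζ (hAU hζA)
    have hz := hA ψ' hdisj
    have hbi : Integrable fun ζ => (b ζ : ℂ) * ψ ζ :=
      hbψ.continuous.integrable_of_hasCompactSupport hbψs
    have hsub : ∀ z, stFourier ψ' z = g z - stFourier (fun ζ => b ζ * ψ ζ) z := by
      intro z
      rw [← hψ]
      simp only [stFourier]
      rw [← integral_sub]
      · congr 1; ext ζ; rw [hψ']; ring
      · refine ψ.integrable.bdd_mul (c := 1) ?_ (ae_of_all _ fun p => ?_)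
        · unfold stPhase
          exact Continuous.aestronglyMeasurable (by fun_prop)
        · rw [norm_cexp_neg_I_mul]
      · refine hbi.bdd_mul (c := 1) ?_ (ae_of_all _ fun p => ?_)
        · unfold stPhase
          exact Continuous.aestronglyMeasurable (by fun_prop)
        · rw [norm_cexp_neg_I_mul]
    have hswap : ∫ z, (g z : ℂ) * stMult b f z =
        ∫ w, f w * stFourier (fun ζ => b ζ * ψ ζ) w := by
      obtain ⟨_, B, hB, hbd⟩ := hb.stSym.stAdm_of_memLp hf
      have hint : Integrable (fun p : SpaceTime × SpaceTime =>
          (g p.1 : ℂ) * (stKernel b (p.1 - p.2) * f p.2)) (volume.prod volume) :=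
        integrable_prod_mul hg1 ((hb.stSym.continuous_stKernel.comp
          (by fun_prop)).aestronglyMeasurable.mul hf.1.comp_snd) hB
          (by simpa only [enorm_mul] using hbd)
      have h2 : ∫ z, (g z : ℂ) * stMult b f z =
          ∫ z, ∫ w, (g z : ℂ) * (stKernel b (z - w) * f w) := by
        simp only [stMult, integral_const_mul]
      rw [h2, integral_integral_swap hint]
      refine integral_congr_ae (ae_of_all _ fun w => ?_)
      simp only
      rw [← integral_stKernel_mul_stFourier hb ψ.integrable, ← integral_const_mul]
      congr 1; ext z
      rw [hψ]; ring
    have hi1 : Integrable fun z => (g z : ℂ) * f z := hg2.integrable_mul hf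
    have hi2 : Integrable fun z => (g z : ℂ) * stMult b f z :=
      hg2.integrable_mul (hb.stSym.memLp_stMult hf)
    have hi3 : Integrable fun w => f w * stFourier (fun ζ => b ζ * ψ ζ) w :=
      hf.integrable_mul (memLp_stFourier hbi (hbψ.continuous.memLp_of_hasCompactSupport hbψs))
    calc ∫ z, g z • (f z - stMult b f z) = ∫ z, ((g z : ℂ) * f z - (g z : ℂ) * stMult b f z) := by
          congr 1; ext z; rw [Complex.real_smul]; ring
      _ = (∫ z, (g z : ℂ) * f z) - ∫ z, (g z : ℂ) * stMult b f z := integral_sub hi1 hi2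
      _ = (∫ z, f z * g z) - ∫ w, f w * stFourier (fun ζ => b ζ * ψ ζ) w := by
          rw [hswap]; congr 2; ext z; ring
      _ = ∫ z, (f z * g z - f z * stFourier (fun ζ => b ζ * ψ ζ) z) := by
          rw [integral_sub _ hi3]
          exact hi1.congr (ae_of_all _ fun z => mul_comm _ _)
      _ = ∫ z, f z * stFourier ψ' z := by
          congr 1; ext z; rw [hsub]; ring
      _ = 0 := hz
  have := ae_eq_zero_of_integral_contDiff_smul_eq_zero
    (hF.locallyIntegrable (by norm_num)) hmain
  filter_upwards [this] with z hz
  exact sub_eq_zero.1 hz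

/-! ### The dyadic symbols -/

namespace DyadicCutoff

variable (φ₀ : DyadicCutoff)

lemma continuous_comp {X : Type*} [TopologicalSpace X] {f : X → ℝ} (hf : Continuous f)
    (h0 : ∀ x, 0 ≤ f x) : Continuous fun x => φ₀.toFun (f x) :=
  φ₀.smooth.continuousOn.comp_continuous hf h0

lemma continuous_piece_comp {X : Type*} [TopologicalSpace X] {f : X → ℝ} (hf : Continuous f)
    (h0 : ∀ x, 0 ≤ f x) (k : ℕ) : Continuous fun x => φ₀.piece k (f x) := by
  cases k with
  | zero => exact φ₀.continuous_comp hf h0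
  | succ k =>
    exact (φ₀.continuous_comp (hf.div_const _) fun x => div_nonneg (h0 x) (by positivity)).sub
      (φ₀.continuous_comp (hf.div_const _) fun x => div_nonneg (h0 x) (by positivity))

lemma sum_piece (n : ℕ) (x : ℝ) :
    ∑ k ∈ Finset.range (n + 1), φ₀.piece k x = φ₀.toFun (x / 2 ^ n) := by
  induction n with
  | zero => simp [piece]
  | succ n ih => rw [Finset.sum_range_succ, ih, piece]; ring

lemma piece_eq_zero {k : ℕ} {x : ℝ} (h : 2 ^ (k + 1) ≤ x) : φ₀.piece k x = 0 := by
  cases k with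
  | zero => exact φ₀.eq_zero x (by simpa using h)
  | succ k =>
    rw [piece, φ₀.eq_zero, φ₀.eq_zero, sub_zero]
    · rw [le_div_iff₀ (by positivity)]
      calc (2 : ℝ) * 2 ^ k = 2 ^ (k + 1) := by ring
        _ ≤ 2 ^ (k + 1 + 1) := pow_le_pow_right₀ (by norm_num) (by omega)
        _ ≤ x := h
    · rw [le_div_iff₀ (by positivity)]
      calc (2 : ℝ) * 2 ^ (k + 1) = 2 ^ (k + 1 + 1) := by ring
        _ ≤ x := h

lemma piece_succ_eq_zero {k : ℕ} {x : ℝ} (h0 : 0 ≤ x) (h : x ≤ 2 ^ k) :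
    φ₀.piece (k + 1) x = 0 := by
  rw [piece, φ₀.eq_one, φ₀.eq_one, sub_self]
  · positivity
  · rw [div_le_one (by positivity)]; exact h
  · positivity
  · rw [div_le_one (by positivity)]
    exact h.trans (pow_le_pow_right₀ (by norm_num) (by omega))

end DyadicCutoff

lemma parNorm_nonneg (ζ : SpaceTime) : 0 ≤ parNorm ζ := Real.sqrt_nonneg _

lemma parNorm_sq (ζ : SpaceTime) : parNorm ζ ^ 2 = |ζ.2| + ‖ζ.1‖ ^ 2 :=
  Real.sq_sqrt (by positivity)

lemma norm_fst_le_parNorm (ζ : SpaceTime) : ‖ζ.1‖ ≤ parNorm ζ :=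
  Real.le_sqrt_of_sq_le (by linarith [abs_nonneg ζ.2])

lemma parDist_le_parNorm_sq (ζ : SpaceTime) : parDist ζ ≤ parNorm ζ ^ 2 := by
  rw [parNorm_sq, parDist]
  exact (abs_sub _ _).trans (by rw [abs_of_nonneg (by positivity : 0 ≤ ‖ζ.1‖ ^ 2)])

lemma continuous_parNorm : Continuous parNorm := by unfold parNorm; fun_prop

lemma continuous_parDist : Continuous parDist := by unfold parDist; fun_prop

lemma hasCompactSupport_of_parNorm {a : SpaceTime → ℝ} {R : ℝ}
    (h : ∀ ζ, R < parNorm ζ → a ζ = 0) : HasCompactSupport a := by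
  refine HasCompactSupport.intro (isCompact_closedBall (0 : SpaceTime) (max R (R ^ 2)))
    fun ζ hζ => h ζ ?_
  by_contra! hle
  apply hζ
  have h0 := parNorm_nonneg ζ
  rw [mem_closedBall_zero_iff, Prod.norm_def]
  refine max_le_max ((norm_fst_le_parNorm ζ).trans hle) ?_
  have := parNorm_sq ζ
  rw [norm_eq_abs]
  nlinarith [sq_nonneg ‖ζ.1‖]

lemma stSym_symMod (φ₀ : DyadicCutoff) (ι k : ℕ) : StSym (symMod φ₀ ι k) :=
  ⟨(φ₀.continuous_piece_comp continuous_parNorm parNorm_nonneg ι).mul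
    (φ₀.continuous_piece_comp continuous_parDist (fun _ => abs_nonneg _) k),
    hasCompactSupport_of_parNorm (R := 2 ^ (ι + 1)) fun ζ hζ => by
      rw [symMod, φ₀.piece_eq_zero hζ.le, zero_mul]⟩

lemma sum_symMod (φ₀ : DyadicCutoff) (ι : ℕ) (ζ : SpaceTime) :
    ∑ k ∈ Finset.range (2 * ι + 3), symMod φ₀ ι k ζ = φ₀.piece ι (parNorm ζ) := by
  simp only [symMod]
  rw [← mul_sum, φ₀.sum_piece (2 * ι + 2)]
  by_cases h : 2 ^ (ι + 1) ≤ parNorm ζ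
  · rw [φ₀.piece_eq_zero h, zero_mul]
  · push Not at h
    rw [φ₀.eq_one, mul_one]
    · exact div_nonneg (abs_nonneg _) (by positivity)
    · rw [div_le_one (by positivity)]
      refine (parDist_le_parNorm_sq ζ).trans ?_
      calc parNorm ζ ^ 2 ≤ (2 ^ (ι + 1)) ^ 2 :=
            pow_le_pow_left₀ (parNorm_nonneg ζ) h.le 2
        _ = 2 ^ (2 * ι + 2) := by rw [← pow_mul]; congr 1; ring

lemma sum_piece_Icc (φ₀ : DyadicCutoff) (i : ℕ) {x : ℝ} (h0 : 0 ≤ x) (h1 : x ≤ 2 ^ (i + 2))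
    (h2 : 2 < i → 2 ^ (i - 2) ≤ x) :
    ∑ ι ∈ Finset.Icc (i - 2) (i + 2), φ₀.piece ι x = 1 := by
  have h3 : ∑ ι ∈ Finset.range (i + 2 + 1), φ₀.piece ι x = 1 := by
    rw [φ₀.sum_piece, φ₀.eq_one _ (by positivity) (by rwa [div_le_one (by positivity)])]
  rw [← h3]
  refine Finset.sum_subset (fun ι hι => ?_) fun ι hι hι' => ?_
  · simp only [Finset.mem_Icc, Finset.mem_range] at hι ⊢; omega
  · simp only [Finset.mem_Icc, Finset.mem_range, not_and, not_le] at hι hι'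
    refine φ₀.piece_eq_zero ?_
    have : 2 < i := by by_contra; omega
    exact (pow_le_pow_right₀ (by norm_num) (by omega)).trans (h2 this)

lemma parNorm_of_mem_freqRegion (φ₀ : DyadicCutoff) {i : ℕ} {ζ : SpaceTime}
    (h : ζ ∈ freqRegion φ₀ i) : parNorm ζ ≤ 2 ^ (i + 1) ∧ (0 < i → 2 ^ (i - 1) ≤ parNorm ζ) := by
  have hcl : IsClosed {ζ : SpaceTime | parNorm ζ ≤ 2 ^ (i + 1) ∧ (0 < i → 2 ^ (i - 1) ≤ parNorm ζ)} := by
    have h1 : IsClosed {ζ : SpaceTime | parNorm ζ ≤ 2 ^ (i + 1)} :=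
      isClosed_le continuous_parNorm continuous_const
    have h2 : IsClosed {ζ : SpaceTime | 0 < i → 2 ^ (i - 1) ≤ parNorm ζ} := by
      by_cases hi : 0 < i
      · simp only [hi, forall_const]; exact isClosed_le continuous_const continuous_parNorm
      · simp only [hi, false_imp_iff, Set.ofPred_true, isClosed_univ]
    exact h1.inter h2
  refine closure_minimal (fun ζ hζ => ?_) hcl h
  constructor
  · by_contra! hlt
    exact hζ (φ₀.piece_eq_zero hlt.le)
  · intro hi
    by_contra! hlt
    obtain ⟨k, rfl⟩ : ∃ k, i = k + 1 := ⟨i - 1, by omega⟩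
    exact hζ (φ₀.piece_succ_eq_zero (parNorm_nonneg ζ) hlt.le)

/-- The decomposition of a function of frequency about `2^i`. -/
lemma FourierSupportedIn.ae_eq_sum_symMod {φ₀ : DyadicCutoff} {i : ℕ} {u : ℂˢᵗ}
    (h : FourierSupportedIn u (freqRegion φ₀ i)) (hu : MemLp u 2) :
    u =ᵐ[volume] fun z => ∑ ι ∈ Finset.Icc (i - 2) (i + 2), ∑ k ∈ Finset.range (2 * ι + 3),
      stMult (symMod φ₀ ι k) u z := by
  set U : Set SpaceTime := {ζ | parNorm ζ < 2 ^ (i + 2) ∧ (2 < i → 2 ^ (i - 2) < parNorm ζ)}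
  have hUo : IsOpen U := by
    have h1 : IsOpen {ζ : SpaceTime | parNorm ζ < 2 ^ (i + 2)} :=
      isOpen_lt continuous_parNorm continuous_const
    have h2 : IsOpen {ζ : SpaceTime | 2 < i → 2 ^ (i - 2) < parNorm ζ} := by
      by_cases hi : 2 < i
      · simp only [hi, forall_const]; exact isOpen_lt continuous_const continuous_parNorm
      · simp only [hi, false_imp_iff, Set.ofPred_true, isOpen_univ]
    exact h1.inter h2
  have hAU : freqRegion φ₀ i ⊆ U := by
    intro ζ hζ
    obtain ⟨h1, h2⟩ := parNorm_of_mem_freqRegion φ₀ hζ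
    refine ⟨h1.trans_lt (pow_lt_pow_right₀ (by norm_num) (by omega)), fun hi => ?_⟩
    exact (pow_lt_pow_right₀ (by norm_num) (by omega)).trans_le (h2 (by omega))
  obtain ⟨g, hgc, hg1, hg0⟩ : ∃ g : SpaceTime → ℝ, ContDiff ℝ ∞ g ∧
      (∀ᶠ ζ in nhdsSet (freqRegion φ₀ i), g ζ = 1) ∧ ∀ ζ ∉ U, g ζ = 0 := by
    obtain ⟨g, hg1, hg0, -⟩ := exists_contMDiffMap_one_nhds_of_subset_interior (n := ⊤)
      (modelWithCornersSelf ℝ SpaceTime) (s := freqRegion φ₀ i) (t := U) (isClosed_tsupport _)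
      (by rwa [hUo.interior_eq])
    exact ⟨g, g.contMDiff.contDiff, hg1, hg0⟩
  have hgs : StTest g := by
    refine ⟨hgc, hasCompactSupport_of_parNorm (R := 2 ^ (i + 2)) fun ζ hζ => ?_⟩
    exact hg0 ζ fun hU => hU.1.not_ge hζ.le
  obtain ⟨V, hVo, hAV, hV⟩ := eventually_nhdsSet_iff_exists.1 hg1
  have hu' := h.ae_eq_stMult hu hgs hVo hAV hV
  have hprod : ∀ ι k, StSym fun ζ => g ζ * symMod φ₀ ι k ζ := fun ι k =>
    hgs.stSym.mul (stSym_symMod φ₀ ι k).1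
  have h3 : ∀ z, stMult g u z = ∑ ι ∈ Finset.Icc (i - 2) (i + 2),
      ∑ k ∈ Finset.range (2 * ι + 3), stMult (symMod φ₀ ι k) u z := by
    intro z
    have h4 : (g : SpaceTime → ℝ) = fun ζ => ∑ p ∈ (Finset.Icc (i - 2) (i + 2)).sigma
        fun ι => Finset.range (2 * ι + 3), g ζ * symMod φ₀ p.1 p.2 ζ := by
      funext ζ
      rw [Finset.sum_sigma]
      simp only [← mul_sum, sum_symMod]
      by_cases hζ : ζ ∈ U
      · rw [sum_piece_Icc φ₀ i (parNorm_nonneg ζ) hζ.1.le fun hi => (hζ.2 hi).le, mul_one]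
      · rw [hg0 ζ hζ, zero_mul]
    have h5 := stMult_finset_sum_symbol ((Finset.Icc (i - 2) (i + 2)).sigma
      fun ι => Finset.range (2 * ι + 3)) (a := fun (p : Σ _ : ℕ, ℕ) ζ => g ζ * symMod φ₀ p.1 p.2 ζ)
      (f := u) (fun p _ => hprod p.1 p.2) (fun p _ => (hprod p.1 p.2).stAdm_of_memLp hu) z
    rw [Finset.sum_sigma] at h5
    refine (congrArg (fun a => stMult a u z) h4).trans (h5.trans ?_)
    refine sum_congr rfl fun ι _ => sum_congr rfl fun k _ => ?_
    simp only
    rw [← stMult_stMult_right hgs (stSym_symMod φ₀ ι k) hu, ← stMult_congr_ae hu']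
  filter_upwards [hu'] with z hz
  exact hz.trans (h3 z)

/-! ### Standard product symbols -/

/-- A smooth cutoff on the line. -/
def timeBump : ContDiffBump (0 : ℝ) := ⟨3, 4, by norm_num, by norm_num⟩

/-- The standard symbol localizing to `|η - a| ≲ r` and `|τ - η²| ≲ K`. -/
def packetSym (a : Plane) (r K : ℝ) : SpaceTime → ℝ := prodSym (cellSym a r) timeBump K

lemma contDiff_cellSym (a : Plane) (r : ℝ) : ContDiff ℝ ∞ (cellSym a r) :=
  planeBump.contDiff.comp (by fun_prop)

lemma hasCompactSupport_cellSym (a : Plane) {r : ℝ} (hr : 0 < r) :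
    HasCompactSupport (cellSym a r) :=
  HasCompactSupport.intro (isCompact_closedBall a (2 * r)) fun ξ hξ => by
    rw [Metric.mem_closedBall, dist_eq_norm, not_le] at hξ
    exact cellSym_eq_zero hr hξ.le

lemma isTest_cellSym (a : Plane) {r : ℝ} (hr : 0 < r) : IsTest fun ξ => (cellSym a r ξ : ℂ) :=
  isTest_ofReal (contDiff_cellSym a r) (hasCompactSupport_cellSym a hr)

lemma timeBump_eq_one {σ : ℝ} (h : |σ| ≤ 3) : timeBump σ = 1 :=
  timeBump.one_of_mem_closedBall (by rwa [mem_closedBall_zero_iff])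

lemma timeBump_eq_zero {σ : ℝ} (h : 4 ≤ |σ|) : timeBump σ = 0 :=
  timeBump.zero_of_le_dist (by rwa [dist_zero_right])

lemma isTest_timeBump : IsTest fun σ => (timeBump σ : ℂ) :=
  ⟨Complex.ofRealCLM.contDiff.comp timeBump.contDiff,
    timeBump.hasCompactSupport.comp_left (g := fun x : ℝ => (x : ℂ)) (by simp)⟩

lemma stTest_packetSym (a : Plane) {r K : ℝ} (hr : 0 < r) (hK : 0 < K) :
    StTest (packetSym a r K) :=
  stTest_prodSym hK (contDiff_cellSym a r) (hasCompactSupport_cellSym a hr)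
    timeBump.contDiff timeBump.hasCompactSupport

lemma packetSym_eq_one {a : Plane} {r K : ℝ} (hr : 0 < r) (hK : 0 < K) {ζ : SpaceTime}
    (h1 : ‖ζ.1 - a‖ ≤ r) (h2 : parDist ζ ≤ 3 * K) : packetSym a r K ζ = 1 := by
  rw [packetSym, prodSym, cellSym_eq_one hr h1, timeBump_eq_one, one_mul]
  rw [abs_div, abs_of_pos hK, div_le_iff₀ hK]
  exact h2

lemma symMod_ne_zero {φ₀ : DyadicCutoff} {ι k : ℕ} {ζ : SpaceTime} (h : symMod φ₀ ι k ζ ≠ 0) :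
    parNorm ζ < 2 ^ (ι + 1) ∧ parDist ζ < 2 ^ (k + 1) := by
  constructor
  · by_contra! h1
    exact h (by rw [symMod, φ₀.piece_eq_zero h1, zero_mul])
  · by_contra! h1
    exact h (by rw [symMod, φ₀.piece_eq_zero h1, mul_zero])

lemma stMult_packetSym_symMod (φ₀ : DyadicCutoff) (ι k : ℕ) {K : ℝ} (hK : 2 ^ k ≤ K)
    {u : ℂˢᵗ} (hu : MemLp u 2) :
    stMult (packetSym 0 (2 * 2 ^ ι) K) (stMult (symMod φ₀ ι k) u) = stMult (symMod φ₀ ι k) u := by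
  have hK0 : 0 < K := lt_of_lt_of_le (by positivity) hK
  rw [stMult_stMult_left (stTest_packetSym 0 (by positivity) hK0)
    (stSym_symMod φ₀ ι k) hu]
  congr 1; funext ζ
  by_cases h : symMod φ₀ ι k ζ = 0
  · rw [h, mul_zero]
  obtain ⟨h1, h2⟩ := symMod_ne_zero h
  rw [packetSym_eq_one (by positivity) hK0, one_mul]
  · rw [sub_zero]
    refine (norm_fst_le_parNorm ζ).trans (h1.le.trans_eq ?_)
    ring
  · refine h2.le.trans ?_
    rw [pow_succ]
    linarith

lemma symModLe_eq (φ₀ : DyadicCutoff) {i j : ℕ} (hij : i ≤ j) (ζ : SpaceTime) :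
    symModLe φ₀ j (-(i : ℤ)) ζ =
      φ₀.piece j (parNorm ζ) * φ₀.toFun (parDist ζ / 2 ^ (j - i)) := by
  have h1 : (Finset.range (2 * j + 3)).filter (fun k : ℕ => (k : ℤ) - (j : ℤ) ≤ -(i : ℤ)) =
      Finset.range (j - i + 1) := by
    ext k; simp only [Finset.mem_filter, Finset.mem_range]; omega
  rw [symModLe, h1]
  simp only [symMod]
  rw [← mul_sum, φ₀.sum_piece]

lemma stSym_symModLe (φ₀ : DyadicCutoff) {i j : ℕ} (hij : i ≤ j) :
    StSym (symModLe φ₀ j (-(i : ℤ))) := by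
  have : symModLe φ₀ j (-(i : ℤ)) = fun ζ =>
      φ₀.piece j (parNorm ζ) * φ₀.toFun (parDist ζ / 2 ^ (j - i)) :=
    funext (symModLe_eq φ₀ hij)
  rw [this]
  exact ⟨(φ₀.continuous_piece_comp continuous_parNorm parNorm_nonneg j).mul
    (φ₀.continuous_comp (continuous_parDist.div_const _) fun ζ =>
      div_nonneg (abs_nonneg _) (by positivity)),
    hasCompactSupport_of_parNorm (R := 2 ^ (j + 1)) fun ζ hζ => by
      rw [φ₀.piece_eq_zero hζ.le, zero_mul]⟩

lemma symModLe_ne_zero {φ₀ : DyadicCutoff} {i j : ℕ} (hij : i ≤ j) {ζ : SpaceTime}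
    (h : symModLe φ₀ j (-(i : ℤ)) ζ ≠ 0) :
    parNorm ζ < 2 ^ (j + 1) ∧ (0 < j → 2 ^ (j - 1) < parNorm ζ) ∧
      parDist ζ < 2 * 2 ^ (j - i) := by
  rw [symModLe_eq φ₀ hij] at h
  refine ⟨?_, ?_, ?_⟩
  · by_contra! h1
    exact h (by rw [φ₀.piece_eq_zero h1, zero_mul])
  · intro hj
    obtain ⟨k, rfl⟩ : ∃ k, j = k + 1 := ⟨j - 1, by omega⟩
    by_contra! h1
    exact h (by rw [φ₀.piece_succ_eq_zero (parNorm_nonneg ζ) (by simpa using h1), zero_mul])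
  · by_contra! h1
    refine h ?_
    rw [φ₀.eq_zero (parDist ζ / _), mul_zero]
    rwa [le_div_iff₀ (by positivity)]

lemma FourierSupportedIn.ae_eq_packetSym {φ₀ : DyadicCutoff} {i j : ℕ} (hij : i ≤ j)
    {v : ℂˢᵗ} (h : FourierSupportedIn v (modLeRegion φ₀ j (-(i : ℤ))))
    (hv : MemLp v 2) : v =ᵐ[volume] stMult (packetSym 0 (4 * 2 ^ j) (2 ^ (j - i))) v := by
  refine h.ae_eq_stMult hv (stTest_packetSym 0 (by positivity) (by positivity))
    (U := {ζ | parNorm ζ < 4 * 2 ^ j ∧ parDist ζ < 3 * 2 ^ (j - i)}) ?_ ?_ ?_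
  · exact (isOpen_lt continuous_parNorm continuous_const).inter
      (isOpen_lt continuous_parDist continuous_const)
  · have hcl : IsClosed {ζ | parNorm ζ ≤ 2 ^ (j + 1) ∧ parDist ζ ≤ 2 * 2 ^ (j - i)} :=
      (isClosed_le continuous_parNorm continuous_const).inter
        (isClosed_le continuous_parDist continuous_const)
    have hsub : modLeRegion φ₀ j (-(i : ℤ)) ⊆
        {ζ | parNorm ζ ≤ 2 ^ (j + 1) ∧ parDist ζ ≤ 2 * 2 ^ (j - i)} := by
      refine closure_minimal (fun ζ hζ => ?_) hcl
      obtain ⟨h1, -, h2⟩ := symModLe_ne_zero hij hζ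
      exact ⟨h1.le, h2.le⟩
    refine hsub.trans fun ζ hζ => ⟨hζ.1.trans_lt ?_, hζ.2.trans_lt ?_⟩
    · rw [pow_succ]; linarith [pow_pos (two_pos : (0 : ℝ) < 2) j]
    · linarith [pow_pos (two_pos : (0 : ℝ) < 2) (j - i)]
  · rintro ζ ⟨h1, h2⟩
    refine packetSym_eq_one (by positivity) (by positivity) ?_ h2.le
    rw [sub_zero]
    exact (norm_fst_le_parNorm ζ).trans h1.le

/-! ### Pointwise bounds for the kernels of the standard symbols -/

lemma one_add_pow_le (n : ℕ) {s : ℝ} (hs : 0 ≤ s) : (1 + s) ^ n ≤ 2 ^ n * (1 + s ^ n) := by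
  rcases le_total s 1 with h | h
  · calc (1 + s) ^ n ≤ (2 : ℝ) ^ n := by
          apply pow_le_pow_left₀ (by positivity); linarith
      _ ≤ _ := by nlinarith [pow_pos (two_pos : (0 : ℝ) < 2) n, pow_nonneg hs n]
  · calc (1 + s) ^ n ≤ (2 * s) ^ n := by
          apply pow_le_pow_left₀ (by positivity); linarith
      _ = 2 ^ n * s ^ n := mul_pow _ _ _
      _ ≤ _ := by nlinarith [pow_pos (two_pos : (0 : ℝ) < 2) n]

lemma norm_le_of_subset_ball {m : Plane → ℂ} {A R : ℝ} (hR : 0 ≤ R)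
    (hs : ∀ ξ, R < ‖ξ‖ → m ξ = 0) (hb : ∀ ξ, ‖m ξ‖ ≤ A) (x : Plane) :
    ‖gker m x‖ ≤ volume.real (Metric.closedBall (0 : Plane) 1) * (A * R ^ 2) := by
  have h1 : ∫ ξ, ‖m ξ‖ ≤ A * volume.real (Metric.closedBall (0 : Plane) R) := by
    rw [← setIntegral_eq_integral_of_forall_compl_eq_zero
      (s := Metric.closedBall (0 : Plane) R) (fun ξ hξ => by
        rw [hs ξ (by simpa using hξ), norm_zero])]
    have h := norm_setIntegral_le_of_norm_le_const (μ := volume) (f := fun ξ => ‖m ξ‖)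
      (s := Metric.closedBall (0 : Plane) R) (C := A) (measure_closedBall_lt_top)
      (fun ξ _ => by simpa using hb ξ)
    exact (le_abs_self _).trans h
  have h2 : volume.real (Metric.closedBall (0 : Plane) R) =
      R ^ 2 * volume.real (Metric.closedBall (0 : Plane) 1) := by
    rw [Measure.real, Measure.addHaar_closedBall' _ _ hR, finrank_euclideanSpace_fin,
      ENNReal.toReal_mul, ENNReal.toReal_ofReal (by positivity), Measure.real]
  have h3 : ((2 * π) ^ Module.finrank ℝ Plane)⁻¹ ≤ 1 := by
    refine inv_le_one_of_one_le₀ (one_le_pow₀ ?_)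
    linarith [Real.pi_gt_three]
  calc ‖gker m x‖ ≤ _ := norm_gker_le m x
    _ ≤ 1 * (A * volume.real (Metric.closedBall (0 : Plane) R)) := by gcongr
    _ = _ := by rw [h2]; ring

lemma SymB.norm_gker_le {n : ℕ} {A Λ R : ℝ} {m : Plane → ℂ} (hm : SymB n A Λ m) (hA : 0 ≤ A)
    (hΛ : 0 < Λ) (hR : 0 ≤ R) (hs : tsupport m ⊆ Metric.closedBall 0 R) (x : Plane) :
    ‖gker m x‖ ≤ 2 * 4 ^ n * volume.real (Metric.closedBall (0 : Plane) 1) * (A * R ^ 2) *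
      ((1 + ‖x‖ / Λ) ^ n)⁻¹ := by
  set c := volume.real (Metric.closedBall (0 : Plane) 1)
  have hc : 0 ≤ c := measureReal_nonneg
  have hzero : ∀ ξ, R < ‖ξ‖ → ξ ∉ tsupport m := fun ξ hξ h => by
    have := hs h
    rw [mem_closedBall_zero_iff] at this
    linarith
  have hk : ∀ d, ∀ k ≤ n, |x d| ^ k * ‖gker m x‖ ≤ c * (A * Λ ^ k * R ^ 2) := by
    intro d k hk
    have h1 := norm_le_of_subset_ball (m := (dI (dir d))^[k] m) (A := A * Λ ^ k)
      hR (fun ξ hξ => dI_iterate_eq_zero (hzero ξ hξ) _ k) (hm.2 d k hk) x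
    rwa [gker_dI_iterate hm.1, norm_mul, norm_pow, norm_real, inner_dir,
      norm_eq_abs] at h1
  rw [← div_eq_mul_inv, le_div_iff₀ (by positivity)]
  obtain ⟨d, hd⟩ : ∃ d, ‖x‖ ≤ 2 * |x d| := by
    by_contra! h
    have := norm_le_two_mul_of_coord (x := x) (R := max |x 0| |x 1|) (fun d => by
      fin_cases d
      · exact le_max_left _ _
      · exact le_max_right _ _)
    rcases max_choice |x 0| |x 1| with h' | h'
    · rw [h'] at this; exact absurd this (not_le.2 (h 0))
    · rw [h'] at this; exact absurd this (not_le.2 (h 1))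
  have h0 := hk d 0 (Nat.zero_le _)
  have hn := hk d n le_rfl
  rw [pow_zero, one_mul, pow_zero, mul_one] at h0
  have h2 : (‖x‖ / Λ) ^ n * ‖gker m x‖ ≤ 2 ^ n * (c * (A * R ^ 2)) := by
    calc (‖x‖ / Λ) ^ n * ‖gker m x‖ ≤ (2 * |x d| / Λ) ^ n * ‖gker m x‖ := by gcongr
      _ = 2 ^ n * (Λ ^ n)⁻¹ * (|x d| ^ n * ‖gker m x‖) := by
          rw [div_pow, mul_pow]; ring
      _ ≤ 2 ^ n * (Λ ^ n)⁻¹ * (c * (A * Λ ^ n * R ^ 2)) := by gcongr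
      _ = _ := by field_simp
  have h3 : (1 : ℝ) ≤ 2 ^ n := one_le_pow₀ (by norm_num)
  have h4 : 0 ≤ c * (A * R ^ 2) := by positivity
  calc ‖gker m x‖ * (1 + ‖x‖ / Λ) ^ n ≤ ‖gker m x‖ * (2 ^ n * (1 + (‖x‖ / Λ) ^ n)) := by
        gcongr; exact one_add_pow_le n (by positivity)
    _ = 2 ^ n * (‖gker m x‖ + (‖x‖ / Λ) ^ n * ‖gker m x‖) := by ring
    _ ≤ 2 ^ n * (c * (A * R ^ 2) + 2 ^ n * (c * (A * R ^ 2))) := by gcongr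
    _ ≤ 2 ^ n * (2 ^ n * (c * (A * R ^ 2)) + 2 ^ n * (c * (A * R ^ 2))) := by
        refine mul_le_mul_of_nonneg_left (add_le_add (le_mul_of_one_le_left h4 h3) le_rfl) ?_
        positivity
    _ = _ := by rw [show (4 : ℝ) ^ n = 2 ^ n * 2 ^ n by rw [← mul_pow]; norm_num]; ring

lemma gker_cellSym_shift (a : Plane) (r t : ℝ) (x : Plane) :
    ‖gker (fun η => (cellSym a r η : ℂ) * exp (I * t * ((‖η‖ ^ 2 : ℝ) : ℂ))) x‖ =
    ‖gker (fun η => (cellSym 0 r η : ℂ) * exp (I * t * ((‖η‖ ^ 2 : ℝ) : ℂ)))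
      (x + (2 * t) • a)‖ := by
  have h : gker (fun η => (cellSym a r η : ℂ) *
      exp (I * t * ((‖η‖ ^ 2 : ℝ) : ℂ))) x =
      exp (I * ((inner ℝ x a + t * ‖a‖ ^ 2 : ℝ) : ℂ)) *
      gker (fun η => (cellSym 0 r η : ℂ) * exp (I * t * ((‖η‖ ^ 2 : ℝ) : ℂ)))
      (x + (2 * t) • a) := by
    rw [gker, gker, mul_left_comm]
    congr 1
    rw [← integral_const_mul, ← integral_add_right_eq_self _ a]
    congr 1; ext η
    have h1 : cellSym a r (η + a) = cellSym 0 r η := by simp [cellSym]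
    have h2 : exp (I * (inner ℝ x (η + a) : ℝ)) *
        exp (I * t * ((‖η + a‖ ^ 2 : ℝ) : ℂ)) =
        exp (I * ((inner ℝ x a + t * ‖a‖ ^ 2 : ℝ) : ℂ)) *
        (exp (I * (inner ℝ (x + (2 * t) • a) η : ℝ)) *
        exp (I * t * ((‖η‖ ^ 2 : ℝ) : ℂ))) := by
      rw [← exp_add, ← exp_add, ← exp_add, norm_add_sq_real,
        inner_add_right, inner_add_left, real_inner_smul_left, real_inner_comm η a]
      congr 1; push_cast; ring
    rw [h1]
    linear_combination (cellSym 0 r η : ℂ) * h2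
  rw [h, norm_mul, norm_cexp_I_mul, one_mul]

/-- Bound for the kernels of the standard symbols. -/
lemma exists_norm_stKernel_packetSym_le (n : ℕ) {C₀ : ℝ} (hC₀ : 0 ≤ C₀) : ∃ C : ℝ, 0 ≤ C ∧
    ∀ (a : Plane) {r K : ℝ}, 0 < r → 0 < K → r ^ 2 ≤ C₀ * K → ∀ (x : Plane) (t : ℝ),
      ‖stKernel (packetSym a r K) (x, t)‖ ≤ C * r ^ 2 * K * ((1 + K * |t|) ^ n)⁻¹ *
        ((1 + r * ‖x + (2 * t) • a‖) ^ n)⁻¹ := by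
  obtain ⟨A, hA, hsym⟩ := exists_symB_cellSym n
  obtain ⟨D, hD, htime⟩ := exists_norm_gker_real_le isTest_timeBump (n + n)
  set c := volume.real (Metric.closedBall (0 : Plane) 1)
  have hc : 0 ≤ c := measureReal_nonneg
  set A' := 2 ^ (n ^ 2 + n) * A
  refine ⟨2 * 4 ^ n * c * (A' * 4) * (8 * (1 + C₀)) ^ n * D, by positivity,
    fun a r K hr hK hrK x t => ?_⟩
  rw [packetSym, stKernel_prodSym hK (contDiff_cellSym a r).continuous
    (hasCompactSupport_cellSym a hr) timeBump.continuous timeBump.hasCompactSupport,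
    norm_mul, gker_cellSym_shift, norm_mul, norm_real, norm_of_nonneg hK.le]
  set y := x + (2 * t) • a
  set μ := 8 * (1 + r ^ 2 * |t|) with hμ
  have hμ1 : 1 ≤ μ := by
    have : 0 ≤ r ^ 2 * |t| := by positivity
    linarith
  have hz : ‖I * (t : ℂ)‖ = |t| := by simp
  have hb : SymB n A' (r⁻¹ * μ) (fun η => (cellSym 0 r η : ℂ) *
      exp (I * t * ((‖η‖ ^ 2 : ℝ) : ℂ))) := by
    refine SymB.mul_cexp (R := 2 * r) (by positivity) hA
      ((hsym 0 hr).mono le_rfl hA (by positivity) (le_mul_of_one_le_right (by positivity) hμ1))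
      (fun ξ hξ d => ?_) (by simp) ?_ ?_
    · have := tsupport_cellSym_subset hr hξ
      rw [mem_closedBall_zero_iff] at this
      exact (abs_coord_le ξ d).trans this
    · rw [hz, hμ, inv_mul_eq_div, le_div_iff₀ hr]
      nlinarith [abs_nonneg t, sq_nonneg r, mul_nonneg (sq_nonneg r) (abs_nonneg t)]
    · rw [hz, mul_pow, inv_pow, inv_mul_eq_div, le_div_iff₀ (by positivity), hμ]
      have : 0 ≤ r ^ 2 * |t| := by positivity
      nlinarith
  have hx := hb.norm_gker_le (by positivity) (by positivity) (by positivity : (0 : ℝ) ≤ 2 * r)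
    ((closure_mono (Function.support_mul_subset_left _ _)).trans (tsupport_cellSym_subset hr)) y
  have ht := htime (K * t)
  rw [abs_mul, abs_of_pos hK] at ht
  have hμK : μ ≤ 8 * (1 + C₀) * (1 + K * |t|) := by
    have h1 : r ^ 2 * |t| ≤ C₀ * K * |t| := by gcongr
    have h2 : 0 ≤ K * |t| := by positivity
    nlinarith
  have h5 : ((1 + ‖y‖ / (r⁻¹ * μ)) ^ n)⁻¹ ≤
      (8 * (1 + C₀)) ^ n * (1 + K * |t|) ^ n * ((1 + r * ‖y‖) ^ n)⁻¹ := by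
    have h6 : (1 + r * ‖y‖) ≤ μ * (1 + ‖y‖ / (r⁻¹ * μ)) := by
      have : μ * (1 + ‖y‖ / (r⁻¹ * μ)) = μ + r * ‖y‖ := by field_simp
      rw [this]; linarith
    have h7 : (1 + r * ‖y‖) ^ n ≤ (8 * (1 + C₀)) ^ n * (1 + K * |t|) ^ n *
        (1 + ‖y‖ / (r⁻¹ * μ)) ^ n := by
      rw [← mul_pow, ← mul_pow]
      refine pow_le_pow_left₀ (by positivity) (h6.trans ?_) n
      gcongr
    rw [inv_le_iff_one_le_mul₀ (by positivity), mul_assoc, inv_mul_eq_div, ← mul_div_assoc,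
      one_le_div (by positivity)]
    exact h7
  calc _ ≤ (2 * 4 ^ n * c * (A' * (2 * r) ^ 2) *
        ((8 * (1 + C₀)) ^ n * (1 + K * |t|) ^ n * ((1 + r * ‖y‖) ^ n)⁻¹)) *
        (K * (D * ((1 + K * |t|) ^ (n + n))⁻¹)) := by gcongr; exact hx.trans (by gcongr)
    _ = _ := by
        have : (1 + K * |t|) ≠ 0 := by positivity
        rw [pow_add]
        field_simp
        ring

/-! ### Superposition in time -/

lemma lintegral_superposition_le {Ω β : Type*} [MeasurableSpace Ω] [Fintype β]
    {ν : Measure Ω} [SFinite ν] {k : Ω → ℂ} (hk : Measurable k) {G : β → Ω × Plane → ℂ}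
    (hG : ∀ b, Measurable (G b)) (S : Set Plane) :
    ∑ b, ∫⁻ x in S, ‖∫ o, k o * G b (o, x) ∂ν‖ₑ ^ 2 ≤
      (∫⁻ o, ‖k o‖ₑ ∂ν) * ∫⁻ o, (‖k o‖ₑ * ∑ b, ∫⁻ x in S, ‖G b (o, x)‖ₑ ^ 2) ∂ν := by
  have h1 : ∀ b x, ‖∫ o, k o * G b (o, x) ∂ν‖ₑ ^ 2 ≤
      (∫⁻ o, ‖k o‖ₑ ∂ν) * ∫⁻ o, ‖k o‖ₑ * ‖G b (o, x)‖ₑ ^ 2 ∂ν := by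
    intro b x
    calc _ ≤ (∫⁻ o, ‖k o‖ₑ * ‖G b (o, x)‖ₑ ∂ν) ^ 2 := by
          gcongr
          simp_rw [← enorm_mul]
          exact enorm_integral_le_lintegral_enorm _
      _ ≤ _ := lintegral_mul_sq_le_weighted hk.enorm.aemeasurable
          ((hG b).comp (measurable_id.prodMk measurable_const)).enorm.aemeasurable
  have hm : ∀ b, Measurable fun p : Plane × Ω => ‖k p.2‖ₑ * ‖G b (p.2, p.1)‖ₑ ^ 2 := fun b =>
    (hk.comp measurable_snd).enorm.mul (((hG b).comp measurable_swap).enorm.pow_const 2)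
  calc _ ≤ ∑ b, ∫⁻ x in S, (∫⁻ o, ‖k o‖ₑ ∂ν) * ∫⁻ o, ‖k o‖ₑ * ‖G b (o, x)‖ₑ ^ 2 ∂ν := by
        gcongr with b _ x; exact h1 b x
    _ = (∫⁻ o, ‖k o‖ₑ ∂ν) * ∑ b, ∫⁻ x in S, ∫⁻ o, ‖k o‖ₑ * ‖G b (o, x)‖ₑ ^ 2 ∂ν := by
        rw [mul_sum]
        refine sum_congr rfl fun b _ => ?_
        rw [lintegral_const_mul _ (hm b).lintegral_prod_right']
    _ = _ := by
        congr 1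
        have h2 : ∀ o, ‖k o‖ₑ * ∑ b, ∫⁻ x in S, ‖G b (o, x)‖ₑ ^ 2 =
            ∑ b, ∫⁻ x in S, ‖k o‖ₑ * ‖G b (o, x)‖ₑ ^ 2 := by
          intro o
          rw [mul_sum]
          refine sum_congr rfl fun b _ => ?_
          rw [lintegral_const_mul' _ _ enorm_ne_top]
        simp_rw [h2]
        rw [lintegral_finsetSum _ fun b _ => ?_]
        · refine sum_congr rfl fun b _ => ?_
          rw [lintegral_lintegral_swap]
          exact (hm b).aemeasurable
        · exact ((hm b).comp measurable_swap).lintegral_prod_right'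

lemma continuous_gker_cexp {X : Type*} [TopologicalSpace X] [FirstCountableTopology X]
    {χ : Plane → ℂ} (hχ : Continuous χ) (hχi : Integrable χ) {z : X → ℂ} (hz : Continuous z)
    (hre : ∀ a, (z a).re ≤ 0) : Continuous fun p : X × Plane =>
      gker (fun η => χ η * exp (z p.1 * ((‖η‖ ^ 2 : ℝ) : ℂ))) p.2 := by
  unfold gker
  refine continuous_const.mul (continuous_of_dominated (bound := fun η => ‖χ η‖)
    (fun p => Continuous.aestronglyMeasurable (by fun_prop))
    (fun p => ae_of_all _ fun η => ?_) hχi.norm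
    (ae_of_all _ fun η => by fun_prop))
  rw [norm_mul, norm_cexp_I_mul, one_mul, norm_mul]
  refine mul_le_of_le_one_right (norm_nonneg _) ?_
  rw [Complex.norm_exp, Real.exp_le_one_iff, Complex.re_mul_ofReal]
  exact mul_nonpos_of_nonpos_of_nonneg (hre p.1) (by positivity)

lemma measurable_gconv_cexp {X : Type*} [TopologicalSpace X] [SecondCountableTopology X]
    [MeasurableSpace X] [OpensMeasurableSpace X] {χ : Plane → ℂ} (hχ : Continuous χ)
    (hχi : Integrable χ) {z : X → ℂ} (hz : Continuous z) (hre : ∀ a, (z a).re ≤ 0)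
    {f : ℂˢᵗ} (hf : Measurable f) {s : X → ℝ} (hs : Measurable s) :
    Measurable fun p : X × Plane =>
      gconv (fun η => χ η * exp (z p.1 * ((‖η‖ ^ 2 : ℝ) : ℂ))) (fun y => f (y, s p.1)) p.2 := by
  unfold gconv
  have h1 : Measurable fun q : (X × Plane) × Plane =>
      gker (fun η => χ η * exp (z q.1.1 * ((‖η‖ ^ 2 : ℝ) : ℂ))) (q.1.2 - q.2) :=
    Measurable.comp (g := fun p : X × Plane =>
      gker (fun η => χ η * exp (z p.1 * ((‖η‖ ^ 2 : ℝ) : ℂ))) p.2)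
      (f := fun q : (X × Plane) × Plane => ((q.1.1, q.1.2 - q.2) : X × Plane))
      (continuous_gker_cexp hχ hχi hz hre).measurable
      (Measurable.prodMk (measurable_fst.comp measurable_fst)
        ((measurable_snd.comp measurable_fst).sub measurable_snd))
  have h2 : Measurable fun q : (X × Plane) × Plane => f (q.2, s q.1.1) :=
    hf.comp (Measurable.prodMk measurable_snd (hs.comp (measurable_fst.comp measurable_fst)))
  exact ((h1.mul h2).stronglyMeasurable.integral_prod_right (ν := volume)).measurable

lemma ae_memLp_slice {f : ℂˢᵗ} (hf : Measurable f) (hf2 : MemLp f 2) :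
    ∀ᵐ s : ℝ, MemLp (fun y => f (y, s)) 2 := by
  have h1 := (memLp_two_iff_lintegral hf2.1).1 hf2
  rw [volume_eq_prod, lintegral_prod_symm _ (hf.enorm.pow_const 2).aemeasurable] at h1
  filter_upwards [ae_lt_top (by
    exact (hf.enorm.pow_const 2).lintegral_prod_left') h1.ne] with s hs
  have hm : Measurable fun y => f (y, s) := hf.comp (measurable_id.prodMk measurable_const)
  rw [memLp_two_iff_lintegral hm.aestronglyMeasurable]
  exact hs

lemma lintegral_prod_univ {f : ℂˢᵗ} (hf : Measurable f) (S : Set Plane) :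
    ∫⁻ z in S ×ˢ (univ : Set ℝ), ‖f z‖ₑ ^ 2 = ∫⁻ s : ℝ, ∫⁻ x in S, ‖f (x, s)‖ₑ ^ 2 := by
  rw [volume_eq_prod, ← Measure.prod_restrict, Measure.restrict_univ,
    lintegral_prod_symm _ (hf.enorm.pow_const 2).aemeasurable]

/-- Control of the mass in a cube at a fixed time by the mass over all times, for functions with
frequency `≲ 2^ι` at distance `≲ 2^k` from the paraboloid. -/
lemma exists_lintegral_slice_le (e : ℕ) : ∃ C : ℝ≥0∞, C ≠ ⊤ ∧ ∀ (ι k : ℕ) {w : ℂˢᵗ},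
    Measurable w → MemLp w 2 → stMult (packetSym 0 (2 * 2 ^ ι) (2 ^ k)) w = w →
    ∀ (t : ℝ) (p : ℤ²), ∫⁻ x in planeCube ι p, ‖w (x, t)‖ₑ ^ 2 ≤
      C * 2 ^ k * ∑' q, wt e q *
        ∫⁻ z in planeCube ι (p - q) ×ˢ (univ : Set ℝ), ‖w z‖ₑ ^ 2 := by
  obtain ⟨n, hn⟩ : ∃ n, n = e + 3 := ⟨_, rfl⟩
  obtain ⟨A, hA, hsym⟩ := exists_symB_cellSym n
  obtain ⟨D, hD, htime⟩ := exists_norm_gker_real_le isTest_timeBump (2 * n + 2)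
  set A' := 2 ^ (n ^ 2 + n) * A
  have hint1 : Integrable (fun σ : ℝ => gker (fun σ : ℝ => (timeBump σ : ℂ)) σ) :=
    integrable_gker isTest_timeBump
  set D1 := ∫⁻ σ : ℝ, ‖gker (fun σ : ℝ => (timeBump σ : ℂ)) σ‖ₑ
  set B := wtMass * ofReal (64 ^ n * ((1 : ℕ) * A' ^ 2) * 16 ^ (2 * n)) with hB
  refine ⟨D1 * (ofReal D * B), mul_ne_top hint1.2.ne (mul_ne_top
    ofReal_ne_top (mul_ne_top wtMass_ne_top ofReal_ne_top)),
    fun ι k w hw hw2 hrep t p => ?_⟩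
  set r : ℝ := 2 * 2 ^ ι with hr
  have hr0 : 0 < r := by positivity
  set K : ℝ := 2 ^ k with hK
  have hK0 : 0 < K := by positivity
  have hK1 : 1 ≤ K := one_le_pow₀ (by norm_num)
  set kf : ℝ → ℂ := fun s => K * gker (fun σ : ℝ => (timeBump σ : ℂ)) (K * (t - s)) with hkf
  have hkfm : Measurable kf :=
    (continuous_const.mul ((gker_continuous isTest_timeBump.integrable).comp (by fun_prop))).measurable
  set zf : ℝ → ℂ := fun s => I * ((t - s : ℝ) : ℂ) with hzf
  set G : Unit → ℝ × Plane → ℂ := fun _ p => gconv (fun η => (cellSym 0 r η : ℂ) *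
    exp (zf p.1 * ((‖η‖ ^ 2 : ℝ) : ℂ))) (fun y => w (y, p.1)) p.2 with hG
  have hGm : ∀ b, Measurable (G b) := fun _ =>
    measurable_gconv_cexp (Complex.continuous_ofReal.comp (contDiff_cellSym 0 r).continuous)
      (isTest_cellSym 0 hr0).integrable (by fun_prop) (fun s => by simp [hzf]) hw measurable_id
  have hrepr : ∀ x, w (x, t) = ∫ s, kf s * G () (s, x) := by
    intro x
    have hadm := (stTest_packetSym 0 hr0 hK0).stSym.stAdm_of_memLp hw2
    conv_lhs => rw [← hrep]
    rw [packetSym] at hadm ⊢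
    exact stMult_prodSym hK0 (contDiff_cellSym 0 r).continuous (hasCompactSupport_cellSym 0 hr0)
      timeBump.continuous timeBump.hasCompactSupport hadm x t
  have hmass : ∫⁻ s, ‖kf s‖ₑ = D1 := by
    have h1 : ∀ s, ‖kf s‖ₑ = ofReal K *
        ‖gker (fun σ : ℝ => (timeBump σ : ℂ)) (K * (t - s))‖ₑ := by
      intro s
      rw [hkf]
      simp only [enorm_mul]
      congr 1
      rw [← ofReal_norm, norm_real, norm_of_nonneg hK0.le]
    simp_rw [h1]
    rw [lintegral_const_mul' _ _ ofReal_ne_top,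
      lintegral_sub_left_eq_self (fun s => ‖gker (fun σ : ℝ => (timeBump σ : ℂ)) (K * s)‖ₑ) t]
    have h2 := Measure.map_addHaar_smul (volume : Measure ℝ) hK0.ne'
    have h3 : ∫⁻ σ, ‖gker (fun σ : ℝ => (timeBump σ : ℂ)) σ‖ₑ
        ∂(Measure.map (fun s : ℝ => K • s) volume) =
        ∫⁻ s, ‖gker (fun σ : ℝ => (timeBump σ : ℂ)) (K * s)‖ₑ :=
      lintegral_map ((gker_continuous isTest_timeBump.integrable).measurable.enorm)
        (measurable_const_smul K)
    rw [← h3, h2, lintegral_smul_measure, smul_eq_mul, ← mul_assoc, Module.finrank_self, pow_one,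
      abs_of_pos (inv_pos.2 hK0), ← ofReal_mul hK0.le, mul_inv_cancel₀ hK0.ne',
      ofReal_one, one_mul]
  have hslice : ∀ᵐ s : ℝ, ‖kf s‖ₑ * ∑ b, ∫⁻ x in planeCube ι p, ‖G b (s, x)‖ₑ ^ 2 ≤
      ofReal D * B * 2 ^ k *
        ∑' q, wt e q * ∫⁻ x in planeCube ι (p - q), ‖w (x, s)‖ₑ ^ 2 := by
    filter_upwards [ae_memLp_slice hw hw2] with s hs
    set μ := 16 * (1 + |t - s|) with hμ
    have hμ1 : 1 ≤ μ := by linarith [abs_nonneg (t - s)]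
    have hz : ‖zf s‖ = |t - s| := by
      rw [hzf]; simp only [norm_mul, Complex.norm_I, one_mul, norm_real, norm_eq_abs]
    have hb : SymB n A' (2 ^ ι * μ) (fun η => (cellSym 0 r η : ℂ) *
        exp (zf s * ((‖η‖ ^ 2 : ℝ) : ℂ))) := by
      have h2ι : (1 : ℝ) ≤ 2 ^ ι := one_le_pow₀ (by norm_num)
      refine SymB.mul_cexp (R := 2 * r) (by positivity) hA
        ((hsym 0 hr0).mono le_rfl hA (by positivity) ?_)
        (fun ξ hξ d => ?_) (by simp [hzf]) ?_ ?_
      · calc r⁻¹ ≤ 1 := inv_le_one_of_one_le₀ (by linarith)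
          _ ≤ 2 ^ ι * μ := one_le_mul_of_one_le_of_one_le h2ι hμ1
      · have := tsupport_cellSym_subset hr0 hξ
        rw [mem_closedBall_zero_iff] at this
        exact (abs_coord_le ξ d).trans this
      · rw [hz, hμ, hr]
        nlinarith [abs_nonneg (t - s)]
      · rw [hz, mul_pow]
        calc 2 * |t - s| ≤ 1 * μ ^ 2 := by rw [hμ]; nlinarith [abs_nonneg (t - s)]
          _ ≤ (2 ^ ι) ^ 2 * μ ^ 2 := by gcongr; exact one_le_pow₀ h2ι
    have h1 := lintegral_gconv_analysis (α := Unit) hμ1 ι n e 1 (by omega) (fun _ => hb)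
      (fun ξ s _ => Finset.card_le_one_of_subsingleton s) p hs
    have h2 : ‖kf s‖ₑ * ofReal (64 ^ n * ((1 : ℕ) * A' ^ 2) * μ ^ (2 * n)) ≤
        ofReal D * ofReal (64 ^ n * ((1 : ℕ) * A' ^ 2) * 16 ^ (2 * n)) * 2 ^ k := by
      have h3 : ((2 : ℝ≥0∞) ^ k) = ofReal K := by
        rw [hK, ofReal_pow (by norm_num)]; norm_num
      rw [h3, ← ofReal_norm, ← ofReal_mul (norm_nonneg _), ← ofReal_mul hD,
        ← ofReal_mul (by positivity)]
      refine ofReal_le_ofReal ?_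
      have h4 := htime (K * (t - s))
      rw [abs_mul, abs_of_pos hK0] at h4
      have h5 : ‖kf s‖ ≤ K * (D * ((1 + |t - s|) ^ (2 * n))⁻¹) := by
        rw [hkf]
        simp only [norm_mul, norm_real, norm_of_nonneg hK0.le]
        gcongr
        refine h4.trans ?_
        gcongr
        have h6 : 1 + |t - s| ≤ 1 + K * |t - s| := by nlinarith [abs_nonneg (t - s)]
        calc (1 + |t - s|) ^ (2 * n) ≤ (1 + K * |t - s|) ^ (2 * n) := by gcongr
          _ ≤ (1 + K * |t - s|) ^ (2 * n + 2) :=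
            pow_le_pow_right₀ (by linarith [abs_nonneg (t - s)]) (by omega)
      calc ‖kf s‖ * (64 ^ n * ((1 : ℕ) * A' ^ 2) * μ ^ (2 * n)) ≤
          K * (D * ((1 + |t - s|) ^ (2 * n))⁻¹) * (64 ^ n * ((1 : ℕ) * A' ^ 2) * μ ^ (2 * n)) := by
            gcongr
        _ = _ := by
            have h7 : ((1 + |t - s|) ^ (2 * n))⁻¹ * (1 + |t - s|) ^ (2 * n) = 1 :=
              inv_mul_cancel₀ (by positivity)
            rw [hμ, mul_pow (16 : ℝ)]
            linear_combination (K * D * (64 ^ n * ((1 : ℕ) * A' ^ 2)) * 16 ^ (2 * n)) * h7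
    calc _ ≤ ‖kf s‖ₑ * _ := mul_le_mul' le_rfl h1
      _ = wtMass * (‖kf s‖ₑ * ofReal (64 ^ n * ((1 : ℕ) * A' ^ 2) * μ ^ (2 * n))) *
          ∑' q, wt e q * ∫⁻ x in planeCube ι (p - q), ‖w (x, s)‖ₑ ^ 2 := by ring
      _ ≤ wtMass * (ofReal D *
          ofReal (64 ^ n * ((1 : ℕ) * A' ^ 2) * 16 ^ (2 * n)) * 2 ^ k) *
          ∑' q, wt e q * ∫⁻ x in planeCube ι (p - q), ‖w (x, s)‖ₑ ^ 2 := by gcongr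
      _ = _ := by rw [hB]; ring
  have hsup := lintegral_superposition_le (ν := (volume : Measure ℝ)) hkfm hGm (planeCube ι p)
  have hmq : ∀ q, Measurable fun s : ℝ => ∫⁻ x in planeCube ι (p - q), ‖w (x, s)‖ₑ ^ 2 := fun q =>
    (hw.enorm.pow_const 2).lintegral_prod_left'
  calc ∫⁻ x in planeCube ι p, ‖w (x, t)‖ₑ ^ 2
      = ∑ b, ∫⁻ x in planeCube ι p, ‖∫ s, kf s * G b (s, x)‖ₑ ^ 2 := by simp [hrepr]
    _ ≤ _ := hsup
    _ ≤ D1 * ∫⁻ s, ofReal D * B * 2 ^ k *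
        ∑' q, wt e q * ∫⁻ x in planeCube ι (p - q), ‖w (x, s)‖ₑ ^ 2 := by
        rw [hmass]
        exact mul_le_mul' le_rfl (lintegral_mono_ae hslice)
    _ = _ := by
        rw [lintegral_const_mul _ (Measurable.tsum fun q => (hmq q).const_mul _),
          lintegral_tsum fun q => ((hmq q).const_mul _).aemeasurable]
        simp_rw [lintegral_const_mul _ (hmq _), lintegral_prod_univ hw]
        ring

/-! ### Integrals of polynomial weights -/

lemma lintegral_one_add_norm_lt_top {E : Type*} [NormedAddCommGroup E] [NormedSpace ℝ E]
    [FiniteDimensional ℝ E] [MeasurableSpace E] [BorelSpace E] {μ : Measure E} [μ.IsAddHaarMeasure]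
    {n : ℕ} (hn : Module.finrank ℝ E < n) :
    ∫⁻ x, ofReal (((1 + ‖x‖) ^ n)⁻¹) ∂μ < ⊤ := by
  have h := (integrable_one_add_norm (μ := μ) (r := n) (by exact_mod_cast hn)).2
  rw [HasFiniteIntegral] at h
  refine lt_of_le_of_lt (lintegral_mono fun x => ?_) h
  rw [← ofReal_norm]
  refine ofReal_le_ofReal ?_
  rw [Real.rpow_neg (by positivity), Real.rpow_natCast]
  exact le_abs_self _

lemma lintegral_one_add_mul_norm_sub {E : Type*} [NormedAddCommGroup E] [NormedSpace ℝ E]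
    [FiniteDimensional ℝ E] [MeasurableSpace E] [BorelSpace E] (μ : Measure E) [μ.IsAddHaarMeasure]
    (n : ℕ) {B : ℝ} (hB : 0 < B) (b : E) :
    ∫⁻ x, ofReal (((1 + B * ‖x - b‖) ^ n)⁻¹) ∂μ =
      ofReal ((B ^ Module.finrank ℝ E)⁻¹) *
        ∫⁻ x, ofReal (((1 + ‖x‖) ^ n)⁻¹) ∂μ := by
  rw [lintegral_sub_right_eq_self (fun x => ofReal (((1 + B * ‖x‖) ^ n)⁻¹)) b]
  have h2 := Measure.map_addHaar_smul μ hB.ne'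
  have h3 : ∫⁻ x, ofReal (((1 + ‖x‖) ^ n)⁻¹) ∂(Measure.map (fun s : E => B • s) μ) =
      ∫⁻ s, ofReal (((1 + ‖B • s‖) ^ n)⁻¹) ∂μ :=
    lintegral_map (by fun_prop) (measurable_const_smul B)
  simp only [norm_smul, norm_of_nonneg hB.le] at h3
  rw [← h3, h2, lintegral_smul_measure, smul_eq_mul, abs_of_pos (by positivity)]

/-- The total mass of `(1 + |t|)^{-2}`. -/
def timeMass : ℝ≥0∞ := ∫⁻ t : ℝ, ofReal (((1 + ‖t‖) ^ 2)⁻¹)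

/-- The total mass of `(1 + |x|)^{-3}`. -/
def planeMass : ℝ≥0∞ := ∫⁻ x : Plane, ofReal (((1 + ‖x‖) ^ 3)⁻¹)

lemma timeMass_ne_top : timeMass ≠ ⊤ := (lintegral_one_add_norm_lt_top (by simp)).ne

lemma planeMass_ne_top : planeMass ≠ ⊤ := (lintegral_one_add_norm_lt_top (by simp)).ne

lemma lintegral_time_weight {B : ℝ} (hB : 0 < B) (b : ℝ) :
    ∫⁻ t : ℝ, ofReal (((1 + B * |t - b|) ^ 2)⁻¹) = ofReal B⁻¹ * timeMass := by
  have := lintegral_one_add_mul_norm_sub (volume : Measure ℝ) 2 hB b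
  simpa [timeMass] using this

lemma lintegral_plane_weight {B : ℝ} (hB : 0 < B) (b : Plane) :
    ∫⁻ x : Plane, ofReal (((1 + B * ‖x - b‖) ^ 3)⁻¹) =
      ofReal (B ^ 2)⁻¹ * planeMass := by
  have := lintegral_one_add_mul_norm_sub (volume : Measure Plane) 3 hB b
  rwa [finrank_euclideanSpace_fin] at this

/-- The time a moving point spends near a given point. -/
lemma lintegral_moving_weight {l : ℝ} (hl : 0 < l) {ξ : Plane} (hξ : ξ ≠ 0) (y : Plane) :
    ∫⁻ t : ℝ, ofReal (((1 + l * ‖y + (2 * t) • ξ‖) ^ 2)⁻¹) ≤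
      ofReal (l * ‖ξ‖)⁻¹ * timeMass := by
  obtain ⟨d, hd⟩ : ∃ d, ‖ξ‖ ≤ 2 * |ξ d| := by
    by_contra! h
    have := norm_le_two_mul_of_coord (x := ξ) (R := max |ξ 0| |ξ 1|) (fun d => by
      fin_cases d
      · exact le_max_left _ _
      · exact le_max_right _ _)
    rcases max_choice |ξ 0| |ξ 1| with h' | h'
    · rw [h'] at this; exact absurd this (not_le.2 (h 0))
    · rw [h'] at this; exact absurd this (not_le.2 (h 1))
  have hξ0 : 0 < ‖ξ‖ := norm_pos_iff.2 hξ
  have hd0 : 0 < |ξ d| := by linarith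
  have hd1 : ξ d ≠ 0 := abs_pos.1 hd0
  rw [← lintegral_time_weight (by positivity) (-(y d / (2 * ξ d)))]
  refine lintegral_mono fun t => ofReal_le_ofReal ?_
  have h : ‖ξ‖ * |t - -(y d / (2 * ξ d))| ≤ ‖y + (2 * t) • ξ‖ := by
    calc ‖ξ‖ * |t - -(y d / (2 * ξ d))| ≤ 2 * |ξ d| * |t - -(y d / (2 * ξ d))| := by gcongr
      _ = |(y + (2 * t) • ξ) d| := by
          rw [show (2 : ℝ) * |ξ d| = |2 * ξ d| by rw [abs_mul]; norm_num, ← abs_mul]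
          congr 1
          simp only [PiLp.add_apply, PiLp.smul_apply, smul_eq_mul]
          field_simp
          ring
      _ ≤ _ := abs_coord_le _ d
  have h' : l * ‖ξ‖ * |t - -(y d / (2 * ξ d))| ≤ l * ‖y + (2 * t) • ξ‖ := by
    rw [mul_assoc]; gcongr
  exact inv_anti₀ (by positivity) (pow_le_pow_left₀ (by positivity) (by linarith) 2)

lemma inv_pow_le_wt (e ι : ℕ) {p m : ℤ²} {x y z : Plane} (hx : x ∈ planeCube ι p)
    (hy : y ∈ planeCube ι m) : ofReal (((1 + 2 ^ ι * ‖x - y + z‖) ^ e)⁻¹) ≤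
      ofReal ((2 * (1 + ‖z‖ / 2 ^ ι)) ^ e) * wt e (p - m) := by
  have hl : (1 : ℝ) ≤ 2 ^ ι := one_le_pow₀ (by norm_num)
  have hl0 : (0 : ℝ) < 2 ^ ι := by positivity
  rw [wt, ← ofReal_mul (by positivity)]
  refine ofReal_le_ofReal ?_
  have h1 : ‖p - m‖ ≤ ‖x - y‖ / 2 ^ ι + 1 := by
    obtain ⟨d, hd⟩ := exists_coord_norm (p - m)
    rw [hd]
    have hxd := hx d
    have hyd := hy d
    have hxy := abs_coord_le (x - y) d
    rw [PiLp.sub_apply] at hxy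
    rw [div_add_one hl0.ne', le_div_iff₀ hl0, mul_comm, ← abs_of_pos hl0, ← abs_mul,
      abs_of_pos hl0, Pi.sub_apply]
    push_cast
    rw [abs_le] at hxy ⊢
    constructor <;> nlinarith
  have h3 : ‖x - y‖ ≤ ‖x - y + z‖ + ‖z‖ := by
    calc ‖x - y‖ = ‖(x - y + z) - z‖ := by rw [add_sub_cancel_right]
      _ ≤ _ := norm_sub_le _ _
  have h4 : 1 + ‖p - m‖ ≤ 2 * (1 + ‖z‖ / 2 ^ ι) * (1 + 2 ^ ι * ‖x - y + z‖) := by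
    have h5 : ‖x - y‖ / 2 ^ ι ≤ ‖x - y + z‖ / 2 ^ ι + ‖z‖ / 2 ^ ι := by
      rw [← add_div]; gcongr
    have h6 : ‖x - y + z‖ / 2 ^ ι ≤ 2 ^ ι * ‖x - y + z‖ := by
      rw [div_le_iff₀ hl0]
      nlinarith [norm_nonneg (x - y + z), mul_nonneg (norm_nonneg (x - y + z)) hl0.le]
    have h7 : 0 ≤ ‖z‖ / 2 ^ ι := by positivity
    have h8 : 0 ≤ 2 ^ ι * ‖x - y + z‖ := by positivity
    nlinarith
  rw [inv_le_iff_one_le_mul₀ (by positivity), mul_assoc, mul_comm, mul_assoc, inv_mul_eq_div,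
    one_le_div (by positivity), ← mul_pow]
  refine pow_le_pow_left₀ (by positivity) (h4.trans_eq (by ring)) e

lemma lintegral_wt_cube (e ι : ℕ) (p : ℤ²) {F : Plane → ℝ≥0∞} :
    ∫⁻ y, wt e (p - cubeIdx ι y) * F y = ∑' q, wt e q * ∫⁻ y in planeCube ι (p - q), F y := by
  rw [← tsum_lintegral_planeCube ι, ← (Equiv.subLeft p).tsum_eq]
  refine tsum_congr fun q => ?_
  rw [Equiv.subLeft_apply, ← lintegral_const_mul' _ _ (wt_ne_top _ _)]
  refine setLIntegral_congr_fun (measurableSet_planeCube _ _) fun y hy => ?_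
  rw [mem_planeCube_iff] at hy
  simp only [hy, sub_sub_cancel]

lemma measurable_cubeIdx (ι : ℕ) : Measurable (cubeIdx ι) := by
  refine measurable_pi_lambda _ fun a => Int.measurable_floor.comp ?_
  have : Measurable fun x : Plane => x a := by fun_prop
  fun_prop

/-! ### Pointwise domination by averages -/

lemma enorm_stMult_sq_le {b : SpaceTime → ℝ} {f : ℂˢᵗ}
    (hf : Measurable f) {k : SpaceTime → ℝ≥0∞} (hk : Measurable k)
    (hbk : ∀ z, ‖stKernel b z‖ₑ ≤ k z) (z : SpaceTime) :
    ‖stMult b f z‖ₑ ^ 2 ≤ (∫⁻ z, k z) * ∫⁻ z', k (z - z') * ‖f z'‖ₑ ^ 2 := by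
  calc ‖stMult b f z‖ₑ ^ 2 ≤ (∫⁻ z', k (z - z') * ‖f z'‖ₑ) ^ 2 := by
        gcongr
        refine (enorm_integral_le_lintegral_enorm _).trans (lintegral_mono fun z' => ?_)
        rw [enorm_mul]
        gcongr
        exact hbk _
    _ ≤ (∫⁻ z', k (z - z')) * ∫⁻ z', k (z - z') * ‖f z'‖ₑ ^ 2 :=
        lintegral_mul_sq_le_weighted (hk.comp (measurable_const.sub measurable_id)).aemeasurable
          hf.enorm.aemeasurable
    _ = _ := by rw [lintegral_sub_left_eq_self k z]

/-- A weight adapted to tubes with velocity `-2 ξ`, of width `1 / l` and duration `1 / K`. -/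
def tubeWt (n : ℕ) (l K : ℝ) (ξ : Plane) (z : SpaceTime) : ℝ≥0∞ :=
  ofReal (((1 + K * |z.2|) ^ n)⁻¹) *
    ofReal (((1 + l * ‖z.1 + (2 * z.2) • ξ‖) ^ n)⁻¹)

lemma measurable_tubeWt (n : ℕ) (l K : ℝ) (ξ : Plane) : Measurable (tubeWt n l K ξ) := by
  unfold tubeWt; fun_prop

lemma lintegral_tubeWt_le {n : ℕ} (hn : 3 ≤ n) {l K : ℝ} (hl : 0 < l) (hK : 0 < K) (ξ : Plane) :
    ∫⁻ z, tubeWt n l K ξ z ≤ ofReal K⁻¹ * timeMass *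
      (ofReal (l ^ 2)⁻¹ * planeMass) := by
  rw [volume_eq_prod, lintegral_prod_symm _ (measurable_tubeWt n l K ξ).aemeasurable]
  calc _ ≤ ∫⁻ t : ℝ, ofReal (((1 + K * |t - 0|) ^ 2)⁻¹) *
        (ofReal (l ^ 2)⁻¹ * planeMass) := by
        refine lintegral_mono fun t => ?_
        simp only [tubeWt]
        rw [lintegral_const_mul' _ _ ofReal_ne_top]
        refine mul_le_mul' (ofReal_le_ofReal ?_) ?_
        · rw [sub_zero]
          gcongr ?_⁻¹
          exact pow_le_pow_right₀ (by linarith [mul_nonneg hK.le (abs_nonneg t)]) (by omega)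
        · rw [← lintegral_plane_weight hl (-((2 * t) • ξ))]
          refine lintegral_mono fun x => ofReal_le_ofReal ?_
          rw [sub_neg_eq_add]
          gcongr ?_⁻¹
          exact pow_le_pow_right₀ (by linarith [mul_nonneg hl.le (norm_nonneg (x + (2 * t) • ξ))]) hn
    _ = _ := by
        rw [lintegral_mul_const' _ _ (mul_ne_top ofReal_ne_top planeMass_ne_top),
          lintegral_time_weight hK]

/-- Functions reproduced by a standard symbol are dominated by their averages over tubes. -/
lemma exists_enorm_sq_le_tubeWt {n : ℕ} (hn : 3 ≤ n) {C₀ : ℝ} (hC₀ : 0 ≤ C₀) :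
    ∃ C : ℝ≥0∞, C ≠ ⊤ ∧ ∀ (ξ : Plane) {r K : ℝ}, 0 < r → 0 < K → r ^ 2 ≤ C₀ * K →
      ∀ {f : ℂˢᵗ}, Measurable f → stMult (packetSym ξ r K) f = f → ∀ z,
        ‖f z‖ₑ ^ 2 ≤ C * ofReal (r ^ 2 * K) * ∫⁻ z', tubeWt n r K ξ (z - z') * ‖f z'‖ₑ ^ 2 := by
  obtain ⟨C, hC, hker⟩ := exists_norm_stKernel_packetSym_le n hC₀
  refine ⟨ofReal C ^ 2 * (timeMass * planeMass), mul_ne_top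
    (pow_ne_top ofReal_ne_top) (mul_ne_top timeMass_ne_top
      planeMass_ne_top), fun ξ r K hr hK hrK f hf hrep z => ?_⟩
  set D := ofReal C * ofReal (r ^ 2 * K) with hDdef
  have hD : D ≠ ⊤ := mul_ne_top ofReal_ne_top ofReal_ne_top
  have hbk : ∀ z, ‖stKernel (packetSym ξ r K) z‖ₑ ≤ D * tubeWt n r K ξ z := by
    rintro ⟨x, t⟩
    rw [← ofReal_norm, tubeWt, hDdef, ← ofReal_mul hC, ← ofReal_mul (by positivity),
      ← ofReal_mul (by positivity)]
    refine ofReal_le_ofReal ((hker ξ hr hK hrK x t).trans_eq ?_)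
    ring
  have h1 := enorm_stMult_sq_le hf
    ((measurable_tubeWt n r K ξ).const_mul D) hbk z
  rw [hrep] at h1
  refine h1.trans ?_
  simp only [mul_assoc D]
  rw [lintegral_const_mul' _ _ hD, lintegral_const_mul' _ _ hD]
  have h2 : ofReal (r ^ 2 * K) * (ofReal K⁻¹ * ofReal (r ^ 2)⁻¹) = 1 := by
    rw [← ofReal_mul (by positivity), ← ofReal_mul (by positivity),
      show r ^ 2 * K * (K⁻¹ * (r ^ 2)⁻¹) = 1 by field_simp, ofReal_one]
  calc _ ≤ D * (ofReal K⁻¹ * timeMass * (ofReal (r ^ 2)⁻¹ * planeMass)) *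
        (D * ∫⁻ z', tubeWt n r K ξ (z - z') * ‖f z'‖ₑ ^ 2) := by
        gcongr; exact lintegral_tubeWt_le hn hr hK ξ
    _ = (ofReal (r ^ 2 * K) * (ofReal K⁻¹ * ofReal (r ^ 2)⁻¹)) *
        (ofReal C ^ 2 * (timeMass * planeMass) * ofReal (r ^ 2 * K) *
        ∫⁻ z', tubeWt n r K ξ (z - z') * ‖f z'‖ₑ ^ 2) := by ring
    _ = _ := by rw [h2, one_mul]

/-! ### The bilinear estimate -/

lemma tubeWt_le {e ι : ℕ} {l K B D : ℝ} (hl : 2 ^ ι ≤ l) (hK : 0 < K) (hB : 0 ≤ B) (hD : 0 ≤ D)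
    {ξ : Plane} (hξ : 2 * ‖ξ‖ ≤ B * K * 2 ^ ι) {t t₀ s : ℝ} (ht : K * |t - t₀| ≤ D)
    {p m : ℤ²} {x y : Plane} (hx : x ∈ planeCube ι p) (hy : y ∈ planeCube ι m) :
    tubeWt (e + 3) l K ξ (x - y, t - s) ≤
      ofReal ((2 * (1 + B)) ^ e * (1 + D) ^ 2) *
        (ofReal (((1 + K * |s - t₀|) ^ 2)⁻¹) * wt e (p - m) *
          ofReal (((1 + 2 ^ ι * ‖x - y + (2 * (t - s)) • ξ‖) ^ 3)⁻¹)) := by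
  have h2 : (0 : ℝ) < 2 ^ ι := by positivity
  set z := (2 * (t - s)) • ξ with hz
  set X := 1 + K * |t - s|
  have hX1 : 1 ≤ X := by have : 0 ≤ K * |t - s| := by positivity
                         linarith
  set Y := 1 + 2 ^ ι * ‖x - y + z‖ with hY
  have hY1 : 1 ≤ Y := by have : 0 ≤ 2 ^ ι * ‖x - y + z‖ := by positivity
                         linarith
  have hz1 : 2 * (1 + ‖z‖ / 2 ^ ι) ≤ 2 * (1 + B) * X := by
    have h3 : ‖z‖ / 2 ^ ι ≤ B * (K * |t - s|) := by
      rw [div_le_iff₀ h2, hz, norm_smul, norm_mul, Real.norm_two, norm_eq_abs]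
      calc 2 * |t - s| * ‖ξ‖ = |t - s| * (2 * ‖ξ‖) := by ring
        _ ≤ |t - s| * (B * K * 2 ^ ι) := by gcongr
        _ = _ := by ring
    have h4 : 0 ≤ K * |t - s| := by positivity
    nlinarith
  have hs : 1 + K * |s - t₀| ≤ (1 + D) * X := by
    have h3 : |s - t₀| ≤ |t - s| + |t - t₀| := by
      rw [show s - t₀ = (t - t₀) - (t - s) by ring, add_comm]; exact abs_sub _ _
    have h4 : K * |s - t₀| ≤ K * |t - s| + K * |t - t₀| := by rw [← mul_add]; gcongr
    have h5 : 0 ≤ K * |t - s| := by positivity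
    nlinarith
  have hYw := inv_pow_le_wt e ι (z := z) hx hy
  have e1 : ((X ^ (e + 3))⁻¹ : ℝ) ≤ (X ^ 2)⁻¹ * (X ^ e)⁻¹ := by
    rw [← mul_inv, ← pow_add]
    exact inv_anti₀ (by positivity) (pow_le_pow_right₀ hX1 (by omega))
  have e2 : (((1 + l * ‖x - y + z‖) ^ (e + 3))⁻¹ : ℝ) ≤ (Y ^ e)⁻¹ * (Y ^ 3)⁻¹ := by
    rw [← mul_inv, ← pow_add]
    refine inv_anti₀ (by positivity) (pow_le_pow_left₀ (by positivity) ?_ _)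
    rw [hY]; gcongr
  have e3 : (X ^ 2)⁻¹ ≤ (1 + D) ^ 2 * ((1 + K * |s - t₀|) ^ 2)⁻¹ := by
    rw [← div_eq_mul_inv, le_div_iff₀ (by positivity), inv_mul_le_iff₀ (by positivity), ← mul_pow]
    refine pow_le_pow_left₀ (by positivity) (hs.trans_eq (mul_comm _ _)) 2
  have e4 : (X ^ e)⁻¹ * (2 * (1 + ‖z‖ / 2 ^ ι)) ^ e ≤ (2 * (1 + B)) ^ e := by
    rw [inv_mul_le_iff₀ (by positivity), ← mul_pow]
    refine pow_le_pow_left₀ (by positivity) (hz1.trans_eq (mul_comm _ _)) e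
  calc tubeWt (e + 3) l K ξ (x - y, t - s)
      = ofReal ((X ^ (e + 3))⁻¹) *
        ofReal (((1 + l * ‖x - y + z‖) ^ (e + 3))⁻¹) := rfl
    _ ≤ ofReal ((X ^ 2)⁻¹ * (X ^ e)⁻¹) * ofReal ((Y ^ e)⁻¹ * (Y ^ 3)⁻¹) := by
        gcongr
    _ = ofReal ((X ^ 2)⁻¹) * (ofReal ((X ^ e)⁻¹) *
        ofReal ((Y ^ e)⁻¹)) * ofReal ((Y ^ 3)⁻¹) := by
        rw [ofReal_mul (by positivity), ofReal_mul (by positivity)]; ring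
    _ ≤ ofReal ((1 + D) ^ 2 * ((1 + K * |s - t₀|) ^ 2)⁻¹) * (ofReal ((X ^ e)⁻¹) *
        (ofReal ((2 * (1 + ‖z‖ / 2 ^ ι)) ^ e) * wt e (p - m))) *
        ofReal ((Y ^ 3)⁻¹) := by gcongr
    _ = ofReal ((1 + D) ^ 2) * ofReal (((1 + K * |s - t₀|) ^ 2)⁻¹) *
        (ofReal ((X ^ e)⁻¹ * (2 * (1 + ‖z‖ / 2 ^ ι)) ^ e) * wt e (p - m)) *
        ofReal ((Y ^ 3)⁻¹) := by
        rw [ofReal_mul (by positivity : (0 : ℝ) ≤ (1 + D) ^ 2),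
          ofReal_mul (by positivity : (0 : ℝ) ≤ (X ^ e)⁻¹)]; ring
    _ ≤ ofReal ((1 + D) ^ 2) * ofReal (((1 + K * |s - t₀|) ^ 2)⁻¹) *
        (ofReal ((2 * (1 + B)) ^ e) * wt e (p - m)) *
        ofReal ((Y ^ 3)⁻¹) := by gcongr
    _ = _ := by rw [ofReal_mul (by positivity : (0 : ℝ) ≤ (2 * (1 + B)) ^ e)]; ring

lemma lintegral_moving_weight_Icc {c₀ N₀ : ℝ} (hc₀ : 0 < c₀) {ι : ℕ} {N : ℝ}
    (hN : 1 ≤ N) (hιN : 4 ^ ι ≤ 16 * N) {ξ : Plane} (hξ : N ≤ N₀ ∨ c₀ * N * 2 ^ ι ≤ ‖ξ‖) (y : Plane)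
    (t₀ s : ℝ) : ∫⁻ t in Icc t₀ (t₀ + N⁻¹),
      ofReal (((1 + 2 ^ ι * ‖y + (2 * (t - s)) • ξ‖) ^ 3)⁻¹) ≤
      ofReal (N⁻¹ * (4 ^ ι)⁻¹) * (ofReal (16 * N₀) + ofReal c₀⁻¹ * timeMass) := by
  have h4 : (4 : ℝ) ^ ι = 2 ^ ι * 2 ^ ι := by rw [← mul_pow]; norm_num
  rcases hξ with h | h
  · calc _ ≤ ∫⁻ t in Icc t₀ (t₀ + N⁻¹), 1 := by
          refine lintegral_mono fun t => ?_
          rw [← ofReal_one]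
          refine ofReal_le_ofReal (inv_le_one_of_one_le₀ (one_le_pow₀ ?_))
          have : 0 ≤ 2 ^ ι * ‖y + (2 * (t - s)) • ξ‖ := by positivity
          linarith
      _ = ofReal N⁻¹ := by simp
      _ ≤ ofReal (N⁻¹ * (4 ^ ι)⁻¹ * (16 * N₀)) := by
          refine ofReal_le_ofReal ?_
          rw [mul_assoc]
          refine le_mul_of_one_le_right (by positivity) ?_
          rw [inv_mul_eq_div, one_le_div (by positivity)]
          nlinarith
      _ ≤ _ := by
          rw [ofReal_mul (by positivity)]
          gcongr
          exact le_self_add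
  · have hpos : 0 < c₀ * N * 2 ^ ι := by positivity
    have hξ0 : ξ ≠ 0 := by
      rintro rfl
      rw [norm_zero] at h; linarith
    calc _ ≤ ∫⁻ t : ℝ, ofReal (((1 + 2 ^ ι * ‖y + (2 * (t - s)) • ξ‖) ^ 3)⁻¹) :=
          setLIntegral_le_lintegral _ _
      _ = ∫⁻ t : ℝ, ofReal (((1 + 2 ^ ι * ‖y + (2 * t) • ξ‖) ^ 3)⁻¹) :=
          lintegral_sub_right_eq_self
            (fun t : ℝ => ofReal (((1 + 2 ^ ι * ‖y + (2 * t) • ξ‖) ^ 3)⁻¹)) s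
      _ ≤ ∫⁻ t : ℝ, ofReal (((1 + 2 ^ ι * ‖y + (2 * t) • ξ‖) ^ 2)⁻¹) := by
          refine lintegral_mono fun t => ofReal_le_ofReal (inv_anti₀ (by positivity) ?_)
          refine pow_le_pow_right₀ ?_ (by norm_num)
          have : 0 ≤ 2 ^ ι * ‖y + (2 * t) • ξ‖ := by positivity
          linarith
      _ ≤ ofReal (2 ^ ι * ‖ξ‖)⁻¹ * timeMass := lintegral_moving_weight (by positivity) hξ0 y
      _ ≤ ofReal (N⁻¹ * (4 ^ ι)⁻¹ * c₀⁻¹) * timeMass := by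
          gcongr
          rw [← mul_inv, ← mul_inv]
          refine inv_anti₀ (by positivity) ?_
          calc N * 4 ^ ι * c₀ = 2 ^ ι * (c₀ * N * 2 ^ ι) := by rw [h4]; ring
            _ ≤ _ := by gcongr
      _ ≤ _ := by
          rw [ofReal_mul (by positivity), mul_assoc]
          gcongr
          exact le_add_self

lemma lintegral_lintegral_mul_le {X T Z : Type*} [MeasurableSpace X] [MeasurableSpace T]
    [MeasurableSpace Z] {μ : Measure X} {τ : Measure T} {ν : Measure Z} [SFinite μ] [SFinite τ]
    [SFinite ν] {α : Z → ℝ≥0∞} (hα : Measurable α) {B : X → ℝ≥0∞} (hB : Measurable B)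
    {m : (X × T) × Z → ℝ≥0∞} (hm : Measurable m) {F : X → T → ℝ≥0∞} {J : Set T} {Q : Set X}
    (hJ : MeasurableSet J) (hQ : MeasurableSet Q) {c A : ℝ≥0∞}
    (hF : ∀ t ∈ J, ∀ x ∈ Q, F x t ≤ c * ((∫⁻ z, α z * m ((x, t), z) ∂ν) * B x))
    (hA : ∀ x z, ∫⁻ t in J, m ((x, t), z) ∂τ ≤ A) :
    ∫⁻ t in J, ∫⁻ x in Q, F x t ∂μ ∂τ ≤ c * (((∫⁻ z, α z ∂ν) * A) * ∫⁻ x, B x ∂μ) := by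
  have hint : Measurable fun a : T × X => ∫⁻ z, α z * m ((a.2, a.1), z) ∂ν :=
    Measurable.lintegral_prod_right' (f := fun b : (T × X) × Z => α b.2 * m ((b.1.2, b.1.1), b.2))
      ((hα.comp measurable_snd).mul (hm.comp (by fun_prop)))
  have hprod : Measurable fun a : T × X => (∫⁻ z, α z * m ((a.2, a.1), z) ∂ν) * B a.2 :=
    hint.mul (hB.comp measurable_snd)
  have hA1 : ∀ x, ∫⁻ t in J, ∫⁻ z, α z * m ((x, t), z) ∂ν ∂τ ≤ (∫⁻ z, α z ∂ν) * A := by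
    intro x
    rw [lintegral_lintegral_swap, ← lintegral_mul_const _ hα]
    · refine lintegral_mono fun z => ?_
      have hm1 : Measurable fun t : T => m ((x, t), z) := hm.comp (by fun_prop)
      rw [lintegral_const_mul _ hm1]
      exact mul_le_mul' le_rfl (hA x z)
    · exact ((hα.comp measurable_snd).mul (hm.comp (by fun_prop))).aemeasurable
  calc ∫⁻ t in J, ∫⁻ x in Q, F x t ∂μ ∂τ
      ≤ ∫⁻ t in J, ∫⁻ x in Q, c * ((∫⁻ z, α z * m ((x, t), z) ∂ν) * B x) ∂μ ∂τ :=
        setLIntegral_mono' hJ fun t ht => setLIntegral_mono' hQ fun x hx => hF t ht x hx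
    _ ≤ ∫⁻ t in J, ∫⁻ x, c * ((∫⁻ z, α z * m ((x, t), z) ∂ν) * B x) ∂μ ∂τ :=
        lintegral_mono fun t => setLIntegral_le_lintegral _ _
    _ = c * ∫⁻ x, (∫⁻ t in J, ∫⁻ z, α z * m ((x, t), z) ∂ν ∂τ) * B x ∂μ := by
        have h1 : ∀ t, Measurable fun x => (∫⁻ z, α z * m ((x, t), z) ∂ν) * B x := fun t =>
          hprod.comp (by fun_prop : Measurable fun x : X => (t, x))
        simp_rw [lintegral_const_mul c (h1 _)]
        rw [lintegral_const_mul _ hprod.lintegral_prod_right',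
          lintegral_lintegral_swap hprod.aemeasurable]
        congr 1
        refine lintegral_congr fun x => ?_
        have h2 : Measurable fun t : T => ∫⁻ z, α z * m ((x, t), z) ∂ν :=
          hint.comp (by fun_prop : Measurable fun t : T => (t, x))
        exact lintegral_mul_const (B x) h2
    _ ≤ c * ∫⁻ x, ((∫⁻ z, α z ∂ν) * A) * B x ∂μ :=
        mul_le_mul' le_rfl (lintegral_mono fun x => mul_le_mul' (hA1 x) le_rfl)
    _ = _ := by rw [lintegral_const_mul _ hB]

lemma lintegral_mul_tsum {Z κ : Type*} [MeasurableSpace Z] {ν : Measure Z} [Countable κ]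
    {f : Z → ℝ≥0∞} (hf : Measurable f) {g : κ → Z → ℝ≥0∞} (hg : ∀ q, Measurable (g q))
    (c : κ → ℝ≥0∞) : ∫⁻ s, f s * ∑' q, c q * g q s ∂ν = ∑' q, c q * ∫⁻ s, f s * g q s ∂ν := by
  calc ∫⁻ s, f s * ∑' q, c q * g q s ∂ν = ∫⁻ s, ∑' q, c q * (f s * g q s) ∂ν := by
        refine lintegral_congr fun s => ?_
        rw [← ENNReal.tsum_mul_left]
        exact tsum_congr fun q => mul_left_comm _ _ _
    _ = ∑' q, ∫⁻ s, c q * (f s * g q s) ∂ν :=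
        lintegral_tsum fun q => ((hf.mul (hg q)).const_mul _).aemeasurable
    _ = _ := tsum_congr fun q => lintegral_const_mul _ (hf.mul (hg q))

set_option maxHeartbeats 600000 in
/-- The bilinear estimate: over a time interval of length `1 / N`, a packet of velocity `~ 2^ι N`
crosses one cube of side `2^ι`, and does not stay in a ball of radius `2^{-ι}`. -/
lemma exists_bilinear_le (e : ℕ) {C₁ c₀ N₀ r₀ : ℝ} (hC₁ : 0 ≤ C₁) (hc₀ : 0 < c₀)
    (hr₀ : 1 ≤ r₀) : ∃ C : ℝ≥0∞, C ≠ ⊤ ∧ ∀ (ι : ℕ) {N : ℝ}, 1 ≤ N → 4 ^ ι ≤ 16 * N →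
      ∀ {ξ : Plane}, ‖ξ‖ ≤ C₁ * N * 2 ^ ι → (N ≤ N₀ ∨ c₀ * N * 2 ^ ι ≤ ‖ξ‖) →
      ∀ {V w : ℂˢᵗ}, Measurable V → Measurable w →
        stMult (packetSym ξ (r₀ * 2 ^ ι) (2 * N)) V = V →
        stMult (packetSym 0 (2 * 2 ^ ι) (4 * 4 ^ ι)) w = w → ∀ (t₀ : ℝ) (p : ℤ²),
        ∫⁻ t in Icc t₀ (t₀ + N⁻¹), ∫⁻ x in planeCube ι p, ‖V (x, t) * w (x, t)‖ₑ ^ 2 ≤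
          C * (∑' q, wt e q * ∫⁻ s, ofReal (((1 + N * |s - t₀|) ^ 2)⁻¹) *
              ∫⁻ x in planeCube ι (p - q), ‖V (x, s)‖ₑ ^ 2) *
            ∑' q, wt e q * ⨆ s, ∫⁻ x in planeCube ι (p - q), ‖w (x, s)‖ₑ ^ 2 := by
  obtain ⟨CV, hCV, hVdom⟩ := exists_enorm_sq_le_tubeWt (n := e + 3) (by omega)
    (C₀ := 8 * r₀ ^ 2) (by positivity)
  obtain ⟨Cw, hCw, hwdom⟩ := exists_enorm_sq_le_tubeWt (n := e + 3) (by omega)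
    (C₀ := 1) (by positivity)
  set AV := ofReal ((2 * (1 + C₁)) ^ e * (1 + 2) ^ 2)
  set Aw := ofReal ((2 * (1 + 0)) ^ e * (1 + 64) ^ 2)
  set T := ofReal (16 * N₀) + ofReal c₀⁻¹ * timeMass with hT
  have hTtop : T ≠ ⊤ := ENNReal.add_ne_top.2 ⟨ofReal_ne_top,
    mul_ne_top ofReal_ne_top timeMass_ne_top⟩
  refine ⟨CV * AV * (Cw * Aw) * T * planeMass * timeMass * ofReal (8 * r₀ ^ 2), ?_,
    fun ι N hN hιN ξ hξ1 hξ2 V w hV hw hVr hwr t₀ p => ?_⟩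
  · have := timeMass_ne_top
    have := planeMass_ne_top
    refine mul_ne_top (mul_ne_top (mul_ne_top (mul_ne_top
      (mul_ne_top (mul_ne_top hCV ofReal_ne_top)
      (mul_ne_top hCw ofReal_ne_top)) hTtop) ‹_›) ‹_›) ofReal_ne_top
  have h4 : (4 : ℝ) ^ ι = 2 ^ ι * 2 ^ ι := by rw [← mul_pow]; norm_num
  have hN0 : 0 < N := by linarith
  have h2 : (0 : ℝ) < 2 ^ ι := by positivity
  set LV := ofReal ((r₀ * 2 ^ ι) ^ 2 * (2 * N)) with hLV
  set Lw := ofReal ((2 * 2 ^ ι) ^ 2 * (4 * 4 ^ ι)) with hLw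
  set J := Icc t₀ (t₀ + N⁻¹) with hJ
  have hJt : ∀ t ∈ J, N * |t - t₀| ≤ 1 := by
    intro t ht
    rw [abs_of_nonneg (by linarith [ht.1])]
    calc N * (t - t₀) ≤ N * N⁻¹ := by gcongr; linarith [ht.2]
      _ = 1 := mul_inv_cancel₀ hN0.ne'
  -- the weighted densities
  set α : SpaceTime → ℝ≥0∞ := fun z => ofReal (((1 + 2 * N * |z.2 - t₀|) ^ 2)⁻¹) *
    (wt e (p - cubeIdx ι z.1) * ‖V z‖ₑ ^ 2) with hα
  set β : SpaceTime → ℝ≥0∞ := fun z => ofReal (((1 + 4 * 4 ^ ι * |z.2 - t₀|) ^ 2)⁻¹) *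
    (wt e (p - cubeIdx ι z.1) * ‖w z‖ₑ ^ 2) with hβ
  have hwtm : Measurable fun y : Plane => wt e (p - cubeIdx ι y) :=
    (measurable_of_countable (fun m : ℤ² => wt e (p - m))).comp (measurable_cubeIdx ι)
  have hαm : Measurable α := by
    refine Measurable.mul (by fun_prop) ((hwtm.comp measurable_fst).mul (hV.enorm.pow_const 2))
  have hβm : Measurable β := by
    refine Measurable.mul (by fun_prop) ((hwtm.comp measurable_fst).mul (hw.enorm.pow_const 2))
  set mV : (Plane × ℝ) × SpaceTime → ℝ≥0∞ := fun a => ofReal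
    (((1 + 2 ^ ι * ‖a.1.1 - a.2.1 + (2 * (a.1.2 - a.2.2)) • ξ‖) ^ 3)⁻¹)
  set B : Plane → ℝ≥0∞ := fun x => ∫⁻ z, β z *
    ofReal (((1 + 2 ^ ι * ‖x - z.1‖) ^ 3)⁻¹) with hB
  have hmVm : Measurable mV := by fun_prop
  have hBm : Measurable B := by
    refine Measurable.lintegral_prod_right' (f := fun a : Plane × SpaceTime => β a.2 *
      ofReal (((1 + 2 ^ ι * ‖a.1 - a.2.1‖) ^ 3)⁻¹)) ?_
    exact (hβm.comp measurable_snd).mul (by fun_prop)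
  have hperm : ∀ a b c d e : ℝ≥0∞, a * (b * c * d) * e = a * (b * (c * e) * d) := by
    intros; ring
  have hVp : ∀ t ∈ J, ∀ x ∈ planeCube ι p,
      ‖V (x, t)‖ₑ ^ 2 ≤ CV * LV * AV * ∫⁻ z, α z * mV ((x, t), z) := by
    intro t ht x hx
    refine (hVdom ξ (r := r₀ * 2 ^ ι) (K := 2 * N) (by positivity) (by positivity) ?_ hV hVr
      (x, t)).trans ?_
    · rw [mul_pow, sq ((2 : ℝ) ^ ι), ← h4]; nlinarith [sq_nonneg r₀]
    rw [mul_assoc (CV * LV), ← lintegral_const_mul' _ _ ofReal_ne_top]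
    refine mul_le_mul' le_rfl (lintegral_mono fun z => ?_)
    have := tubeWt_le (e := e) (l := r₀ * 2 ^ ι) (K := 2 * N) (B := C₁) (D := 2)
      (le_mul_of_one_le_left h2.le hr₀) (by positivity) hC₁ (by norm_num) (ξ := ξ)
      (by linarith) (t := t) (t₀ := t₀) (s := z.2) (by linarith [hJt t ht]) hx
      (mem_planeCube_iff.2 rfl : z.1 ∈ planeCube ι (cubeIdx ι z.1))
    exact (mul_le_mul' this le_rfl).trans_eq (hperm _ _ _ _ _)
  have hwp : ∀ t ∈ J, ∀ x ∈ planeCube ι p, ‖w (x, t)‖ₑ ^ 2 ≤ Cw * Lw * Aw * B x := by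
    intro t ht x hx
    refine (hwdom 0 (r := 2 * 2 ^ ι) (K := 4 * 4 ^ ι) (by positivity) (by positivity) ?_ hw hwr
      (x, t)).trans ?_
    · rw [mul_pow, sq ((2 : ℝ) ^ ι), ← h4]; linarith
    rw [mul_assoc (Cw * Lw), hB, ← lintegral_const_mul' _ _ ofReal_ne_top]
    refine mul_le_mul' le_rfl (lintegral_mono fun z => ?_)
    have : _ ≤ Aw * _ := tubeWt_le (e := e) (l := 2 * 2 ^ ι) (K := 4 * 4 ^ ι) (B := 0) (D := 64) (ξ := 0)
      (by linarith) (by positivity) le_rfl (by norm_num)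
      (by simp) (t := t) (t₀ := t₀) (s := z.2) (by
        have := hJt t ht
        have h5 : 4 * 4 ^ ι * |t - t₀| ≤ 4 * (16 * N) * |t - t₀| := by gcongr
        linarith) hx
      (mem_planeCube_iff.2 rfl : z.1 ∈ planeCube ι (cubeIdx ι z.1))
    rw [smul_zero, add_zero] at this
    exact (mul_le_mul' this le_rfl).trans_eq (hperm _ _ _ _ _)
  have hB1 : ∫⁻ x, B x = (∫⁻ z, β z) * (ofReal ((2 ^ ι) ^ 2)⁻¹ * planeMass) := by
    rw [hB, lintegral_lintegral_swap]
    · rw [← lintegral_mul_const _ hβm]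
      refine lintegral_congr fun z => ?_
      rw [lintegral_const_mul _ (by fun_prop), lintegral_plane_weight h2]
    · exact ((hβm.comp measurable_snd).mul (by fun_prop)).aemeasurable
  have hα1 : ∫⁻ z, α z ≤ ∑' q, wt e q * ∫⁻ s, ofReal (((1 + N * |s - t₀|) ^ 2)⁻¹) *
      ∫⁻ x in planeCube ι (p - q), ‖V (x, s)‖ₑ ^ 2 := by
    have hmq : ∀ q, Measurable fun s : ℝ => ∫⁻ x in planeCube ι (p - q), ‖V (x, s)‖ₑ ^ 2 :=
      fun q => (hV.enorm.pow_const 2).lintegral_prod_left'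
    rw [volume_eq_prod, lintegral_prod_symm _ hαm.aemeasurable]
    calc _ = ∫⁻ s : ℝ, ofReal (((1 + 2 * N * |s - t₀|) ^ 2)⁻¹) *
          ∑' q, wt e q * ∫⁻ x in planeCube ι (p - q), ‖V (x, s)‖ₑ ^ 2 := by
          refine lintegral_congr fun s => ?_
          simp only [hα]
          rw [lintegral_const_mul' _ _ ofReal_ne_top, lintegral_wt_cube]
      _ ≤ ∫⁻ s : ℝ, ofReal (((1 + N * |s - t₀|) ^ 2)⁻¹) *
          ∑' q, wt e q * ∫⁻ x in planeCube ι (p - q), ‖V (x, s)‖ₑ ^ 2 := by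
          gcongr with s
          linarith
      _ = _ := lintegral_mul_tsum (by fun_prop) hmq _
  have hβ1 : ∫⁻ z, β z ≤ ofReal (4 * 4 ^ ι)⁻¹ * timeMass *
      ∑' q, wt e q * ⨆ s, ∫⁻ x in planeCube ι (p - q), ‖w (x, s)‖ₑ ^ 2 := by
    rw [volume_eq_prod, lintegral_prod_symm _ hβm.aemeasurable,
      ← lintegral_time_weight (by positivity) t₀, ← lintegral_mul_const _ (by fun_prop)]
    refine lintegral_mono fun s => ?_
    simp only [hβ]
    rw [lintegral_const_mul' _ _ ofReal_ne_top, lintegral_wt_cube]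
    gcongr with q
    exact le_iSup (fun s => ∫⁻ x in planeCube ι (p - q), ‖w (x, s)‖ₑ ^ 2) s
  have hconst : LV * Lw * ofReal (N⁻¹ * (4 ^ ι)⁻¹) * ofReal ((2 ^ ι) ^ 2)⁻¹ *
      ofReal (4 * 4 ^ ι)⁻¹ = ofReal (8 * r₀ ^ 2) := by
    rw [hLV, hLw, ← ofReal_mul (by positivity), ← ofReal_mul (by positivity),
      ← ofReal_mul (by positivity), ← ofReal_mul (by positivity)]
    congr 1
    rw [h4]; field_simp; norm_num
  calc ∫⁻ t in J, ∫⁻ x in planeCube ι p, ‖V (x, t) * w (x, t)‖ₑ ^ 2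
      ≤ (CV * LV * AV * (Cw * Lw * Aw)) * (((∫⁻ z, α z) * (ofReal (N⁻¹ * (4 ^ ι)⁻¹) * T)) *
        ∫⁻ x, B x) := by
        refine lintegral_lintegral_mul_le (F := fun x t => ‖V (x, t) * w (x, t)‖ₑ ^ 2) hαm hBm hmVm
          measurableSet_Icc (measurableSet_planeCube _ _) (fun t ht x hx => ?_) fun x z =>
            lintegral_moving_weight_Icc hc₀ hN hιN hξ2 (x - z.1) t₀ z.2
        simp only [enorm_mul, mul_pow]
        refine (mul_le_mul' (hVp t ht x hx) (hwp t ht x hx)).trans_eq ?_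
        generalize (∫⁻ z, α z * mV ((x, t), z)) = a, B x = b
        ring
    _ = (CV * LV * AV * (Cw * Lw * Aw)) * (((∫⁻ z, α z) * (ofReal (N⁻¹ * (4 ^ ι)⁻¹) * T)) *
        ((∫⁻ z, β z) * (ofReal ((2 ^ ι) ^ 2)⁻¹ * planeMass))) := by rw [hB1]
    _ ≤ (CV * LV * AV * (Cw * Lw * Aw)) * (((∑' q, wt e q * ∫⁻ s,
        ofReal (((1 + N * |s - t₀|) ^ 2)⁻¹) *
          ∫⁻ x in planeCube ι (p - q), ‖V (x, s)‖ₑ ^ 2) * (ofReal (N⁻¹ * (4 ^ ι)⁻¹) * T)) *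
        ((ofReal (4 * 4 ^ ι)⁻¹ * timeMass *
          ∑' q, wt e q * ⨆ s, ∫⁻ x in planeCube ι (p - q), ‖w (x, s)‖ₑ ^ 2) *
          (ofReal ((2 ^ ι) ^ 2)⁻¹ * planeMass))) := by gcongr
    _ = CV * AV * (Cw * Aw) * T * planeMass * timeMass * (LV * Lw * ofReal (N⁻¹ * (4 ^ ι)⁻¹) *
        ofReal ((2 ^ ι) ^ 2)⁻¹ * ofReal (4 * 4 ^ ι)⁻¹) * (∑' q, wt e q * ∫⁻ s,
        ofReal (((1 + N * |s - t₀|) ^ 2)⁻¹) *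
          ∫⁻ x in planeCube ι (p - q), ‖V (x, s)‖ₑ ^ 2) *
          ∑' q, wt e q * ⨆ s, ∫⁻ x in planeCube ι (p - q), ‖w (x, s)‖ₑ ^ 2 := by ring
    _ = _ := by rw [hconst]

/-! ### A superposition formula for parabolic symbols -/

/-- The exponential `exp (-z |τ| - i b τ)`. -/
def expAbs (z : ℂ) (b : ℝ) (τ : ℝ) : ℂ :=
  exp (-z * (|τ| : ℝ)) * exp (-I * ((b * τ : ℝ) : ℂ))

lemma norm_expAbs (z : ℂ) (b τ : ℝ) : ‖expAbs z b τ‖ = Real.exp (-z.re * |τ|) := by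
  have h : ‖exp (-I * ((b * τ : ℝ) : ℂ))‖ = 1 := by
    rw [Complex.norm_exp]; simp
  rw [expAbs, norm_mul, h, mul_one, Complex.norm_exp]
  simp

lemma integrable_exp_neg_mul_abs {ε : ℝ} (hε : 0 < ε) :
    Integrable (fun τ : ℝ => Real.exp (-ε * |τ|)) := by
  have h1 : IntegrableOn (fun τ : ℝ => Real.exp (-ε * |τ|)) (Ioi 0) :=
    (integrableOn_exp_mul_Ioi (neg_lt_zero.2 hε) 0).congr_fun
      (fun τ hτ => by simp only [abs_of_pos (mem_Ioi.1 hτ)]) measurableSet_Ioi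
  have h2 : IntegrableOn (fun τ : ℝ => Real.exp (-ε * |τ|)) (Iic 0) :=
    (integrableOn_exp_mul_Iic hε 0).congr_fun
      (fun τ hτ => by simp only [abs_of_nonpos (mem_Iic.1 hτ)]; congr 1; ring) measurableSet_Iic
  rw [← integrableOn_univ, ← Iic_union_Ioi (a := (0 : ℝ))]
  exact h2.union h1

lemma integrable_expAbs {z : ℂ} (hz : 0 < z.re) (b : ℝ) : Integrable (expAbs z b) := by
  refine (integrable_exp_neg_mul_abs hz).mono' ?_ (ae_of_all _ fun τ => ?_)
  · exact Continuous.aestronglyMeasurable (by unfold expAbs; fun_prop)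
  · exact (norm_expAbs z b τ).le

lemma gker_expAbs {z : ℂ} (hz : 0 < z.re) (b t : ℝ) :
    gker (expAbs z b) t = (π : ℂ)⁻¹ * (z / (z ^ 2 + ((t - b : ℝ) : ℂ) ^ 2)) := by
  set T := t - b with hT
  have hF : Integrable fun τ : ℝ => exp (I * (inner ℝ t τ : ℝ)) * expAbs z b τ := by
    refine (integrable_expAbs hz b).bdd_mul (c := 1) ?_ (ae_of_all _ fun τ => ?_)
    · exact Continuous.aestronglyMeasurable (by fun_prop)
    · rw [norm_cexp_I_mul]
  have hp : (-z + I * T).re < 0 := by simpa using hz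
  have hm : 0 < (z + I * T).re := by simpa using hz
  have hF1 : ∀ τ : ℝ, exp (I * (inner ℝ t τ : ℝ)) * expAbs z b τ =
      exp (-z * (|τ| : ℝ) + I * T * τ) := by
    intro τ
    rw [expAbs, ← exp_add, ← exp_add]
    congr 1
    simp only [RCLike.inner_apply, conj_trivial, hT]
    push_cast; ring
  have h1 : ∫ τ in Ioi (0 : ℝ), exp (I * (inner ℝ t τ : ℝ)) * expAbs z b τ =
      -1 / (-z + I * T) := by
    rw [setIntegral_congr_fun (g := fun τ : ℝ => exp ((-z + I * T) * τ))
      measurableSet_Ioi (fun τ hτ => by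
        simp only [hF1, abs_of_pos (mem_Ioi.1 hτ)]; congr 1; ring),
      integral_exp_mul_complex_Ioi hp]
    simp
  have h2 : ∫ τ in Iic (0 : ℝ), exp (I * (inner ℝ t τ : ℝ)) * expAbs z b τ =
      1 / (z + I * T) := by
    rw [setIntegral_congr_fun (g := fun τ : ℝ => exp ((z + I * T) * τ))
      measurableSet_Iic (fun τ hτ => by
        simp only [hF1, abs_of_nonpos (mem_Iic.1 hτ)]; congr 1; push_cast; ring),
      integral_exp_mul_complex_Iic hm]
    simp
  have hz1 : z + I * T ≠ 0 := fun h => by rw [h] at hm; simp at hm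
  have hz2 : -z + I * T ≠ 0 := fun h => by rw [h] at hp; simp at hp
  have hz3 : z ^ 2 + (T : ℂ) ^ 2 ≠ 0 := by
    have : z ^ 2 + (T : ℂ) ^ 2 = -((z + I * T) * (-z + I * T)) := by
      ring_nf; rw [Complex.I_sq]; ring
    rw [this]; exact neg_ne_zero.2 (mul_ne_zero hz1 hz2)
  rw [gker, ← intervalIntegral.integral_Iic_add_Ioi hF.integrableOn hF.integrableOn, h1, h2,
    Module.finrank_self]
  have hsum : 1 / (z + I * T) + -1 / (-z + I * T) = 2 * (z / (z ^ 2 + (T : ℂ) ^ 2)) := by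
    field_simp
    ring_nf; rw [Complex.I_sq]; ring
  rw [hsum]
  have hpi : (π : ℂ) ≠ 0 := by exact_mod_cast Real.pi_ne_zero
  push_cast
  field_simp

lemma lintegral_inv_sq_add_sq {ε : ℝ} (hε : 0 < ε) (c : ℝ) :
    ∫⁻ t : ℝ, ofReal (ε ^ 2 + (c + t) ^ 2)⁻¹ = ofReal (π / ε) := by
  rw [lintegral_add_left_eq_self (fun t : ℝ => ofReal (ε ^ 2 + t ^ 2)⁻¹) c]
  have h1 : ∀ t : ℝ, (ε ^ 2 + t ^ 2)⁻¹ = ε⁻¹ ^ 2 * (1 + (ε⁻¹ * t) ^ 2)⁻¹ := by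
    intro t
    have h2 : 0 < ε ^ 2 + t ^ 2 := by positivity
    have h3 : 0 < 1 + (ε⁻¹ * t) ^ 2 := by positivity
    field_simp
  have hint : Integrable fun t : ℝ => (ε ^ 2 + t ^ 2)⁻¹ := by
    simp_rw [h1]
    exact (integrable_inv_one_add_sq.comp_mul_left' (inv_ne_zero hε.ne')).const_mul _
  rw [← ofReal_integral_eq_lintegral_ofReal hint (ae_of_all _ fun t => by positivity)]
  congr 1
  simp_rw [h1]
  rw [integral_const_mul, Measure.integral_comp_mul_left (fun t => (1 + t ^ 2)⁻¹),
    integral_univ_inv_one_add_sq, inv_inv, abs_of_pos hε, smul_eq_mul]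
  field_simp

lemma lintegral_gker_expAbs_le {ε : ℝ} (hε : 0 < ε) (a b : ℝ) :
    ∫⁻ t, ‖gker (expAbs (ε * (1 + I * a)) b) t‖ₑ ≤ ofReal (1 + |a|) := by
  set z : ℂ := ε * (1 + I * a) with hz
  have hzre : z.re = ε := by simp [hz]
  have hzn : ‖z‖ ≤ ε * (1 + |a|) := by
    rw [hz, norm_mul, norm_real, norm_of_nonneg hε.le]
    gcongr
    refine (norm_add_le _ _).trans ?_
    simp
  have key : ∀ t, ‖gker (expAbs z b) t‖ₑ ≤ ofReal (ε * (1 + |a|) / (2 * π)) *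
      (ofReal (ε ^ 2 + ((ε * a - b) + t) ^ 2)⁻¹ +
        ofReal (ε ^ 2 + ((-ε * a - b) + t) ^ 2)⁻¹) := by
    intro t
    set T := t - b with hT
    have hn : ∀ s : ℝ, ‖z + I * s‖ ^ 2 = ε ^ 2 + (ε * a + s) ^ 2 := by
      intro s
      rw [← Complex.normSq_eq_norm_sq, Complex.normSq_apply]
      simp [hz]; ring
    have h1 := hn T
    have h2 := hn (-T)
    set P := ‖z + I * T‖ with hP
    set Q := ‖z + I * ((-T : ℝ) : ℂ)‖ with hQ
    have hP0 : 0 < P ^ 2 := by rw [h1]; positivity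
    have hQ0 : 0 < Q ^ 2 := by rw [h2]; positivity
    have hP1 : 0 < P := lt_of_le_of_ne (norm_nonneg _) fun h => by simp [← h] at hP0
    have hQ1 : 0 < Q := lt_of_le_of_ne (norm_nonneg _) fun h => by simp [← h] at hQ0
    have hpq : ‖z ^ 2 + (T : ℂ) ^ 2‖ = P * Q := by
      rw [hP, hQ, ← norm_mul]
      congr 1
      push_cast; ring_nf; rw [Complex.I_sq]; ring
    rw [gker_expAbs (by rw [hzre]; exact hε), ← ofReal_add (by positivity) (by positivity),
      ← ofReal_mul (by positivity), ← ofReal_norm]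
    refine ofReal_le_ofReal ?_
    have e1 : ε ^ 2 + (ε * a - b + t) ^ 2 = P ^ 2 := by rw [h1, hT]; ring
    have e2 : ε ^ 2 + (-ε * a - b + t) ^ 2 = Q ^ 2 := by rw [h2, hT]; ring
    rw [norm_mul, norm_div, hpq, norm_inv, norm_real, norm_of_nonneg Real.pi_pos.le,
      e1, e2]
    have h3 : (P * Q)⁻¹ ≤ ((P ^ 2)⁻¹ + (Q ^ 2)⁻¹) / 2 := by
      rw [mul_inv, ← inv_pow, ← inv_pow]; nlinarith [sq_nonneg (P⁻¹ - Q⁻¹)]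
    calc π⁻¹ * (‖z‖ / (P * Q)) ≤ π⁻¹ * ((ε * (1 + |a|)) *
        (((P ^ 2)⁻¹ + (Q ^ 2)⁻¹) / 2)) := by
          rw [div_eq_mul_inv]; gcongr
      _ = _ := by field_simp
  calc _ ≤ ∫⁻ t, ofReal (ε * (1 + |a|) / (2 * π)) *
      (ofReal (ε ^ 2 + ((ε * a - b) + t) ^ 2)⁻¹ +
        ofReal (ε ^ 2 + ((-ε * a - b) + t) ^ 2)⁻¹) := lintegral_mono key
    _ = _ := by
        rw [lintegral_const_mul _ (by fun_prop), lintegral_add_left (by fun_prop),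
          lintegral_inv_sq_add_sq hε, lintegral_inv_sq_add_sq hε,
          ← ofReal_add (by positivity) (by positivity), ← ofReal_mul (by positivity)]
        congr 1
        field_simp
        ring

/-- The symbol `b(ξ) e^{-ρ} Γ(ρ) θ((τ - ξ²) / N)` with `ρ = ε (|τ| + ξ²)`. -/
def parSym (b : Plane → ℝ) (Γ θ : ℝ → ℝ) (ε N : ℝ) (ζ : SpaceTime) : ℝ :=
  b ζ.1 * (Real.exp (-(ε * (|ζ.2| + ‖ζ.1‖ ^ 2))) * (Γ (ε * (|ζ.2| + ‖ζ.1‖ ^ 2)) *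
    θ ((ζ.2 - ‖ζ.1‖ ^ 2) / N)))

def superWt (Γ θ : ℝ → ℝ) (o : ℝ × ℝ) : ℂ :=
  gker (fun σ => (Γ σ : ℂ)) o.1 * gker (fun σ => (θ σ : ℂ)) o.2

def superExp (ε N : ℝ) (o : ℝ × ℝ) : ℂ :=
  -(ε * (1 + I * o.1)) + I * ((o.2 / N : ℝ) : ℂ)

def superTime (ε N : ℝ) (o : ℝ × ℝ) : ℝ → ℂ :=
  expAbs (ε * (1 + I * o.1)) (o.2 / N)

lemma superExp_re (ε N : ℝ) (o : ℝ × ℝ) : (superExp ε N o).re = -ε := by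
  simp [superExp]

lemma norm_superTime (ε N : ℝ) (o : ℝ × ℝ) (τ : ℝ) :
    ‖superTime ε N o τ‖ = Real.exp (-ε * |τ|) := by
  simp [superTime, norm_expAbs]

lemma norm_mul_cexp_le (b : ℂ) {z : ℂ} (hz : z.re ≤ 0) (η : Plane) :
    ‖b * exp (z * ((‖η‖ ^ 2 : ℝ) : ℂ))‖ ≤ ‖b‖ := by
  rw [norm_mul, Complex.norm_exp, Complex.re_mul_ofReal]
  refine mul_le_of_le_one_right (norm_nonneg _) (Real.exp_le_one_iff.2 ?_)
  exact mul_nonpos_of_nonpos_of_nonneg hz (by positivity)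

lemma integrable_mul_cexp {b : Plane → ℝ} (hb : Continuous b) (hbs : HasCompactSupport b) {z : ℂ} :
    Integrable fun η : Plane => (b η : ℂ) * exp (z * ((‖η‖ ^ 2 : ℝ) : ℂ)) :=
  Continuous.integrable_of_hasCompactSupport (by fun_prop)
    ((hbs.comp_left (g := fun x : ℝ => (x : ℂ)) (by simp)).mul_right)

section Superposition

variable {Γ θ : ℝ → ℝ} {ε N : ℝ} {b : Plane → ℝ}

lemma integrable_superWt (hΓ : IsTest fun σ => (Γ σ : ℂ)) (hθ : IsTest fun σ => (θ σ : ℂ)) :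
    Integrable (superWt Γ θ) := (integrable_gker hΓ).mul_prod (integrable_gker hθ)

lemma continuous_superWt (hΓ : IsTest fun σ => (Γ σ : ℂ)) (hθ : IsTest fun σ => (θ σ : ℂ)) :
    Continuous (superWt Γ θ) :=
  ((gker_continuous hΓ.integrable).comp continuous_fst).mul
    ((gker_continuous hθ.integrable).comp continuous_snd)

lemma parSym_eq_integral (hΓ : IsTest fun σ => (Γ σ : ℂ)) (hθ : IsTest fun σ => (θ σ : ℂ))
    (ζ : SpaceTime) : (parSym b Γ θ ε N ζ : ℂ) = ∫ o, superWt Γ θ o *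
      (superTime ε N o ζ.2 * ((b ζ.1 : ℂ) * exp (superExp ε N o * ((‖ζ.1‖ ^ 2 : ℝ) : ℂ)))) := by
  have h1 := gft_gker hΓ (ε * (|ζ.2| + ‖ζ.1‖ ^ 2))
  have h2 := gft_gker hθ ((ζ.2 - ‖ζ.1‖ ^ 2) / N)
  rw [gft] at h1 h2
  rw [parSym]
  push_cast
  rw [← h1, ← h2, ← integral_prod_mul, ← integral_const_mul, ← integral_const_mul,
    ← volume_eq_prod]
  congr 1; ext o
  have h3 : exp (-(ε * (|ζ.2| + ‖ζ.1‖ ^ 2) : ℂ)) *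
      (exp (-I * ((inner ℝ o.1 (ε * (|ζ.2| + ‖ζ.1‖ ^ 2)) : ℝ) : ℂ)) *
      exp (-I * ((inner ℝ o.2 ((ζ.2 - ‖ζ.1‖ ^ 2) / N) : ℝ) : ℂ))) =
      superTime ε N o ζ.2 * exp (superExp ε N o * ((‖ζ.1‖ ^ 2 : ℝ) : ℂ)) := by
    rw [superTime, expAbs, ← exp_add, ← exp_add, ← exp_add,
      ← exp_add]
    congr 1
    simp only [superExp, RCLike.inner_apply, conj_trivial]
    push_cast
    ring
  rw [superWt]
  calc _ = gker (fun σ => (Γ σ : ℂ)) o.1 * gker (fun σ => (θ σ : ℂ)) o.2 * (b ζ.1 : ℂ) *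
      (exp (-(ε * (|ζ.2| + ‖ζ.1‖ ^ 2) : ℂ)) *
      (exp (-I * ((inner ℝ o.1 (ε * (|ζ.2| + ‖ζ.1‖ ^ 2)) : ℝ) : ℂ)) *
      exp (-I * ((inner ℝ o.2 ((ζ.2 - ‖ζ.1‖ ^ 2) / N) : ℝ) : ℂ)))) := by ring
    _ = _ := by rw [h3]; push_cast; ring

lemma stKernel_parSym (hΓ : IsTest fun σ => (Γ σ : ℂ)) (hθ : IsTest fun σ => (θ σ : ℂ))
    (hε : 0 < ε) (hb : Continuous b) (hbs : HasCompactSupport b) (x : Plane) (t : ℝ) :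
    stKernel (parSym b Γ θ ε N) (x, t) = ∫ o, superWt Γ θ o * (gker (superTime ε N o) t *
      gker (fun η => (b η : ℂ) * exp (superExp ε N o * ((‖η‖ ^ 2 : ℝ) : ℂ))) x) := by
  have hbi : Integrable fun η => (b η : ℂ) := (Complex.continuous_ofReal.comp hb).integrable_of_hasCompactSupport
    (hbs.comp_left (g := fun x : ℝ => (x : ℂ)) (by simp))
  have hF : Integrable (fun p : SpaceTime × (ℝ × ℝ) =>
      exp (I * (stPhase (x, t) p.1 : ℂ)) * (superWt Γ θ p.2 *
      (superTime ε N p.2 p.1.2 * ((b p.1.1 : ℂ) *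
        exp (superExp ε N p.2 * ((‖p.1.1‖ ^ 2 : ℝ) : ℂ)))))) (volume.prod volume) := by
    have h1 : Integrable (fun p : SpaceTime × (ℝ × ℝ) => (‖(b p.1.1 : ℂ)‖ * Real.exp (-ε * |p.1.2|)) *
        ‖superWt Γ θ p.2‖) (volume.prod volume) :=
      (hbi.norm.mul_prod (integrable_exp_neg_mul_abs hε)).mul_prod (integrable_superWt hΓ hθ).norm
    refine h1.mono' ?_ (ae_of_all _ fun p => ?_)
    · have := continuous_superWt hΓ hθ
      unfold superTime superExp expAbs stPhase
      exact Continuous.aestronglyMeasurable (by fun_prop)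
    · rw [norm_mul, norm_cexp_I_mul, one_mul, norm_mul, norm_mul, norm_superTime]
      have := norm_mul_cexp_le (b p.1.1 : ℂ) (z := superExp ε N p.2)
        (by rw [superExp_re]; linarith) p.1.1
      calc _ ≤ ‖superWt Γ θ p.2‖ * (Real.exp (-ε * |p.1.2|) * ‖(b p.1.1 : ℂ)‖) := by gcongr
        _ = _ := by ring
  have h2 : ∀ o : ℝ × ℝ, ∫ ζ : SpaceTime, exp (I * (stPhase (x, t) ζ : ℂ)) *
      (superWt Γ θ o * (superTime ε N o ζ.2 * ((b ζ.1 : ℂ) *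
        exp (superExp ε N o * ((‖ζ.1‖ ^ 2 : ℝ) : ℂ))))) = superWt Γ θ o *
      ((∫ η : Plane, exp (I * (inner ℝ x η : ℝ)) * ((b η : ℂ) *
        exp (superExp ε N o * ((‖η‖ ^ 2 : ℝ) : ℂ)))) *
      ∫ τ : ℝ, exp (I * (inner ℝ t τ : ℝ)) * superTime ε N o τ) := by
    intro o
    rw [← integral_prod_mul, ← integral_const_mul, ← volume_eq_prod]
    congr 1; ext ζ
    have h3 : exp (I * (stPhase (x, t) ζ : ℂ)) =
        exp (I * (inner ℝ x ζ.1 : ℝ)) *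
        exp (I * (inner ℝ t ζ.2 : ℝ)) := by
      rw [← exp_add]
      congr 1
      simp only [stPhase, RCLike.inner_apply, conj_trivial]
      push_cast; ring
    rw [h3]; ring
  rw [stKernel]
  simp_rw [parSym_eq_integral hΓ hθ, ← integral_const_mul]
  rw [integral_integral_swap (hF.const_mul _)]
  simp_rw [integral_const_mul, h2]
  rw [← integral_const_mul]
  congr 1; ext o
  rw [gker, gker, finrank_euclideanSpace_fin, Module.finrank_self]
  push_cast
  ring

lemma measurable_gker_superTime (hε : 0 < ε) {X : Type*} [MeasurableSpace X] {o : X → ℝ × ℝ}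
    {t : X → ℝ} (ho : Measurable o) (ht : Measurable t) :
    Measurable fun a => gker (superTime ε N (o a)) (t a) := by
  have : (fun a => gker (superTime ε N (o a)) (t a)) = fun a => (π : ℂ)⁻¹ *
      (ε * (1 + I * (o a).1) / ((ε * (1 + I * (o a).1)) ^ 2 +
        ((t a - (o a).2 / N : ℝ) : ℂ) ^ 2)) :=
    funext fun a => gker_expAbs (by simpa using hε) _ _
  rw [this]
  fun_prop

lemma stSym_parSym (hΓ : IsTest fun σ => (Γ σ : ℂ)) (hθ : IsTest fun σ => (θ σ : ℂ)) (hN : 0 < N)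
    (hb : Continuous b) (hbs : HasCompactSupport b) : StSym (parSym b Γ θ ε N) := by
  have h1 : Continuous Γ := Complex.continuous_re.comp hΓ.1.continuous
  have h2 : Continuous θ := Complex.continuous_re.comp hθ.1.continuous
  have h3 : HasCompactSupport θ := hθ.2.comp_left (g := Complex.re) rfl
  refine ⟨by unfold parSym; fun_prop, ?_⟩
  have h4 : parSym b Γ θ ε N = fun ζ => (Real.exp (-(ε * (|ζ.2| + ‖ζ.1‖ ^ 2))) *
      Γ (ε * (|ζ.2| + ‖ζ.1‖ ^ 2))) * prodSym b θ N ζ := by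
    ext ζ; simp only [parSym, prodSym]; ring
  rw [h4]
  exact (hasCompactSupport_prodSym hN hbs h3).mul_left

lemma stMult_parSym (hΓ : IsTest fun σ => (Γ σ : ℂ)) (hθ : IsTest fun σ => (θ σ : ℂ))
    (hε : 0 < ε) (hN : 0 < N) (hb : Continuous b) (hbs : HasCompactSupport b)
    {g : ℂˢᵗ} (hg : Measurable g) (hgi : Integrable g) (x : Plane) (t : ℝ) :
    stMult (parSym b Γ θ ε N) g (x, t) = ∫ o : (ℝ × ℝ) × ℝ,
      (superWt Γ θ o.1 * gker (superTime ε N o.1) (t - o.2)) *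
      gconv (fun η => (b η : ℂ) * exp (superExp ε N o.1 * ((‖η‖ ^ 2 : ℝ) : ℂ)))
        (fun y => g (y, o.2)) x := by
  have hbc : Continuous fun η => (b η : ℂ) := Complex.continuous_ofReal.comp hb
  have hbi : Integrable fun η => (b η : ℂ) := hbc.integrable_of_hasCompactSupport
    (hbs.comp_left (g := fun x : ℝ => (x : ℂ)) (by simp))
  have hre : ∀ o, (superExp ε N o).re ≤ 0 := fun o => by rw [superExp_re]; linarith
  have hzc : Continuous (superExp ε N) := by unfold superExp; fun_prop
  set m : ℝ × ℝ → Plane → ℂ := fun o η =>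
    (b η : ℂ) * exp (superExp ε N o * ((‖η‖ ^ 2 : ℝ) : ℂ)) with hm
  have hmk : Continuous fun p : (ℝ × ℝ) × Plane => gker (m p.1) p.2 :=
    continuous_gker_cexp hbc hbi hzc hre
  have hκ := continuous_superWt hΓ hθ
  have hκi := integrable_superWt hΓ hθ
  obtain ⟨c₁, h1⟩ : ∃ c₁ : ℝ, ∀ o s, ‖gker (superTime ε N o) s‖ ≤ c₁ := by
    refine ⟨((2 * π) ^ Module.finrank ℝ ℝ)⁻¹ * ∫ τ : ℝ, Real.exp (-ε * |τ|), fun o s => ?_⟩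
    have := norm_gker_le (superTime ε N o) s
    simp_rw [norm_superTime] at this
    exact this
  obtain ⟨c₂, h2⟩ : ∃ c₂ : ℝ, ∀ o y, ‖gker (m o) y‖ ≤ c₂ := by
    refine ⟨((2 * π) ^ Module.finrank ℝ Plane)⁻¹ * ∫ ξ : Plane, ‖(b ξ : ℂ)‖, fun o y =>
      (norm_gker_le _ y).trans (mul_le_mul_of_nonneg_left ?_ (by positivity))⟩
    exact integral_mono (integrable_mul_cexp hb hbs).norm hbi.norm fun η =>
      norm_mul_cexp_le _ (hre o) η
  have hc₁ : 0 ≤ c₁ := (norm_nonneg _).trans (h1 0 0)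
  set F : ((ℝ × ℝ) × ℝ) → Plane → ℂ := fun o y => (superWt Γ θ o.1 *
    gker (superTime ε N o.1) (t - o.2)) * (gker (m o.1) (x - y) * g (y, o.2)) with hF
  have hFn : ∀ o y, ‖F o y‖ ≤ c₁ * c₂ * (‖superWt Γ θ o.1‖ * ‖g (y, o.2)‖) := by
    intro o y
    rw [hF, norm_mul, norm_mul, norm_mul]
    calc _ ≤ ‖superWt Γ θ o.1‖ * c₁ * (c₂ * ‖g (y, o.2)‖) := by
          gcongr
          · exact h1 _ _
          · exact h2 _ _
      _ = _ := by ring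
  have hFm : Measurable fun p : ((ℝ × ℝ) × ℝ) × Plane => F p.1 p.2 := by
    refine Measurable.mul (Measurable.mul (by fun_prop)
      (measurable_gker_superTime hε (by fun_prop) (by fun_prop))) (Measurable.mul ?_ (by fun_prop))
    exact (hmk.comp (by fun_prop : Continuous fun p : ((ℝ × ℝ) × ℝ) × Plane =>
      (p.1.1, x - p.2))).measurable
  have hFi : Integrable (fun p : ((ℝ × ℝ) × ℝ) × Plane => F p.1 p.2)
      ((volume.prod volume).prod volume) := by
    have h3 : Integrable (fun p : (ℝ × ℝ) × ℝ × Plane => c₁ * c₂ * (‖superWt Γ θ p.1‖ * ‖g p.2.swap‖))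
        (volume.prod (volume.prod volume)) := (hκi.norm.mul_prod hgi.swap.norm).const_mul _
    exact ((measurePreserving_prodAssoc volume volume volume).integrable_comp_emb
      MeasurableEquiv.prodAssoc.measurableEmbedding |>.2 h3).mono' hFm.aestronglyMeasurable
      (ae_of_all _ fun p => hFn p.1 p.2)
  have hsym : StSym (parSym b Γ θ ε N) := stSym_parSym hΓ hθ hN hb hbs
  have hi := (stAdm_of_integrable (parSym b Γ θ ε N) hgi).integrable hsym (x, t)
  rw [stMult, volume_eq_prod, integral_prod_symm _ (by rwa [← volume_eq_prod])]
  have h4 : ∫ o : (ℝ × ℝ) × ℝ, (superWt Γ θ o.1 * gker (superTime ε N o.1) (t - o.2)) *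
      gconv (m o.1) (fun y => g (y, o.2)) x = ∫ o : (ℝ × ℝ) × ℝ, ∫ y, F o y := by
    congr 1; ext o
    rw [gconv, ← integral_const_mul]
  have h5 : Integrable (fun o : (ℝ × ℝ) × ℝ => ∫ y, F o y) (volume.prod volume) :=
    hFi.integral_prod_left
  rw [h4, volume_eq_prod (ℝ × ℝ) ℝ, integral_prod_symm _ h5]
  refine integral_congr_ae ?_
  filter_upwards [hgi.prod_left_ae] with s hs
  have h6 : Integrable (Function.uncurry fun o y => F (o, s) y) (volume.prod volume) := by
    have h7 : Integrable (fun p : (ℝ × ℝ) × Plane => c₁ * c₂ * (‖superWt Γ θ p.1‖ * ‖g (p.2, s)‖))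
        (volume.prod volume) := (hκi.norm.mul_prod hs.norm).const_mul _
    refine h7.mono' (hFm.comp (by fun_prop : Measurable fun p : (ℝ × ℝ) × Plane =>
      ((p.1, s), p.2))).aestronglyMeasurable (ae_of_all _ fun p => hFn (p.1, s) p.2)
  rw [integral_integral_swap h6]
  congr 1; ext y
  rw [show (x, t) - (y, s) = (x - y, t - s) from rfl, stKernel_parSym hΓ hθ hε hb hbs,
    ← integral_mul_const]
  congr 1; ext o
  simp only [hF]
  ring

end Superposition

lemma exists_lintegral_gker_mul_pow_le {Γ : ℝ → ℂ} (hΓ : IsTest Γ) (n : ℕ) :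
    ∃ C : ℝ≥0∞, C ≠ ⊤ ∧ ∫⁻ a, ‖gker Γ a‖ₑ * ofReal ((1 + |a|) ^ n) ≤ C := by
  obtain ⟨C, hC, h⟩ := exists_norm_gker_real_le hΓ (n + 2)
  refine ⟨ofReal C * (ofReal 1⁻¹ * timeMass), mul_ne_top ofReal_ne_top
    (mul_ne_top ofReal_ne_top timeMass_ne_top), ?_⟩
  rw [← lintegral_time_weight one_pos 0, ← lintegral_const_mul _ (by fun_prop)]
  refine lintegral_mono fun a => ?_
  rw [← ofReal_norm, ← ofReal_mul (norm_nonneg _), ← ofReal_mul hC]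
  refine ofReal_le_ofReal ((mul_le_mul_of_nonneg_right (h a) (by positivity)).trans_eq ?_)
  rw [one_mul, sub_zero, pow_add, mul_inv]
  have : (1 + |a|) ^ n ≠ 0 := by positivity
  field_simp

lemma exists_lintegral_superWt_le {Γ θ : ℝ → ℝ} (hΓ : IsTest fun σ => (Γ σ : ℂ))
    (hθ : IsTest fun σ => (θ σ : ℂ)) (n : ℕ) : ∃ C : ℝ≥0∞, C ≠ ⊤ ∧
    ∫⁻ o : ℝ × ℝ, ‖superWt Γ θ o‖ₑ * ofReal ((1 + |o.1| + |o.2|) ^ n) ≤ C := by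
  obtain ⟨C₁, hC₁, h1⟩ := exists_lintegral_gker_mul_pow_le hΓ n
  obtain ⟨C₂, hC₂, h2⟩ := exists_lintegral_gker_mul_pow_le hθ n
  refine ⟨C₁ * C₂, mul_ne_top hC₁ hC₂, le_trans ?_ (mul_le_mul' h1 h2)⟩
  have hm : ∀ {Γ : ℝ → ℂ}, IsTest Γ →
      Measurable fun a : ℝ => ‖gker Γ a‖ₑ * ofReal ((1 + |a|) ^ n) := fun h =>
    (gker_continuous h.integrable).measurable.enorm.mul (by fun_prop)
  rw [← lintegral_prod_mul (hm hΓ).aemeasurable (hm hθ).aemeasurable, ← volume_eq_prod]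
  refine lintegral_mono fun o => ?_
  rw [superWt, enorm_mul]
  calc _ ≤ ‖gker (fun σ => (Γ σ : ℂ)) o.1‖ₑ * ‖gker (fun σ => (θ σ : ℂ)) o.2‖ₑ *
      ofReal ((1 + |o.1|) ^ n * (1 + |o.2|) ^ n) := by
        refine mul_le_mul' le_rfl (ofReal_le_ofReal ?_)
        rw [← mul_pow]
        refine pow_le_pow_left₀ (by positivity) ?_ n
        nlinarith [mul_nonneg (abs_nonneg o.1) (abs_nonneg o.2)]
    _ = _ := by rw [ofReal_mul (by positivity)]; ring

lemma symB_mul_superExp {b : Plane → ℝ} {n : ℕ} {A R C₁ : ℝ} (hC₁ : 0 ≤ C₁) (hA : 0 ≤ A)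
    {i j ι : ℕ} (hij : i ≤ j) (hι : i ≤ ι + 2) (hb : SymB n A 1 fun η => (b η : ℂ)) {ξ : Plane}
    (hR : tsupport b ⊆ Metric.closedBall ξ R) (hξ : ‖ξ‖ ≤ C₁ * 2 ^ j) (o : ℝ × ℝ) :
    SymB n (2 ^ (n ^ 2 + n) * A)
      (2 ^ ι * ((8 * (C₁ + |R|) + 2) * (1 + |o.1| + |o.2|))) (fun η => (b η : ℂ) *
        exp (superExp (4 ^ j)⁻¹ (2 ^ (j - i)) o * ((‖η‖ ^ 2 : ℝ) : ℂ))) := by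
  have hε : (0 : ℝ) < (4 ^ j)⁻¹ := by positivity
  have hN : (0 : ℝ) < 2 ^ (j - i) := by positivity
  set ε : ℝ := (4 ^ j)⁻¹ with hεd
  set N : ℝ := 2 ^ (j - i) with hNd
  set B := 8 * (C₁ + |R|) + 2 with hB
  have hB2 : 2 ≤ B := by have := abs_nonneg R; linarith
  set S := 1 + |o.1| + |o.2| with hS
  have hS1 : 1 ≤ S := by have := abs_nonneg o.1; have := abs_nonneg o.2; linarith
  have h2ι : (1 : ℝ) ≤ 2 ^ ι := one_le_pow₀ (by norm_num)
  have h2j : (1 : ℝ) ≤ 2 ^ j := one_le_pow₀ (by norm_num)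
  have hN1 : 1 ≤ N := one_le_pow₀ (by norm_num)
  have hμ : 2 * S ≤ 2 ^ ι * (B * S) := by
    calc 2 * S ≤ B * S := by gcongr
      _ ≤ _ := le_mul_of_one_le_left (by positivity) h2ι
  have hz : ‖superExp ε N o‖ ≤ ε * (1 + |o.1|) + |o.2| / N := by
    rw [superExp]
    refine (norm_add_le _ _).trans ?_
    rw [norm_neg, norm_mul, norm_mul, norm_real, norm_real, Complex.norm_I, one_mul,
      norm_of_nonneg hε.le, norm_div, norm_of_nonneg hN.le, norm_eq_abs]
    gcongr
    refine (norm_add_le _ _).trans ?_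
    simp
  have hε1 : ε * 2 ^ j ≤ 1 := by
    rw [hεd, inv_mul_le_iff₀ (by positivity), mul_one]
    exact pow_le_pow_left₀ (by norm_num) (by norm_num) j
  have hN2 : 2 ^ j = N * 2 ^ i := by rw [hNd, ← pow_add]; congr 1; omega
  have hi1 : (1 : ℝ) ≤ 2 ^ i := one_le_pow₀ (by norm_num)
  have hi2 : (2 : ℝ) ^ i ≤ 4 * 2 ^ ι := by
    calc (2 : ℝ) ^ i ≤ 2 ^ (ι + 2) := pow_le_pow_right₀ (by norm_num) hι
      _ = _ := by ring
  have hz1 : ‖superExp ε N o‖ * 2 ^ j ≤ 4 * 2 ^ ι * S := by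
    calc _ ≤ (ε * (1 + |o.1|) + |o.2| / N) * 2 ^ j := by gcongr
      _ = (ε * 2 ^ j) * (1 + |o.1|) + |o.2| * 2 ^ i := by rw [add_mul, hN2]; field_simp
      _ ≤ 1 * (1 + |o.1|) + |o.2| * 2 ^ i := by gcongr
      _ ≤ 2 ^ i * (1 + |o.1|) + |o.2| * 2 ^ i := by gcongr
      _ = 2 ^ i * S := by rw [hS]; ring
      _ ≤ _ := by gcongr
  have hz2 : ‖superExp ε N o‖ ≤ S := by
    have h3 : ε ≤ 1 := le_trans (le_mul_of_one_le_right hε.le h2j) hε1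
    calc _ ≤ ε * (1 + |o.1|) + |o.2| / N := hz
      _ ≤ 1 * (1 + |o.1|) + |o.2| := by
          gcongr
          exact div_le_self (abs_nonneg _) hN1
      _ = S := by rw [one_mul]
  refine SymB.mul_cexp (R := (C₁ + |R|) * 2 ^ j) (by positivity) hA
    ((hb).mono le_rfl hA (by norm_num) (by linarith)) (fun η hη d => ?_) (by rw [superExp_re]; linarith) ?_ ?_
  · have h4 : tsupport (fun η => (b η : ℂ)) ⊆ tsupport (b) :=
      closure_mono fun x hx => by simpa using hx
    have h5 := mem_closedBall_iff_norm.1 (hR (h4 hη))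
    calc |η d| ≤ ‖η‖ := abs_coord_le η d
      _ ≤ ‖ξ‖ + ‖η - ξ‖ := norm_le_norm_add_norm_sub' _ _
      _ ≤ C₁ * 2 ^ j + |R| * 2 ^ j := by
          refine add_le_add (hξ) ((h5.trans (le_abs_self R)).trans ?_)
          exact le_mul_of_one_le_right (abs_nonneg _) h2j
      _ = _ := by ring
  · calc 2 * ‖superExp ε N o‖ * ((C₁ + |R|) * 2 ^ j) =
        2 * (C₁ + |R|) * (‖superExp ε N o‖ * 2 ^ j) := by ring
      _ ≤ 2 * (C₁ + |R|) * (4 * 2 ^ ι * S) := by gcongr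
      _ ≤ 2 ^ ι * (B * S) := by
          rw [hB]
          have : 0 ≤ 2 ^ ι * S := by positivity
          linarith
  · calc 2 * ‖superExp ε N o‖ ≤ 2 * S := by gcongr
      _ ≤ (2 * S) ^ 2 := by nlinarith
      _ ≤ _ := by gcongr

lemma lintegral_prod_mul_snd {Ω S : Type*} [MeasureSpace Ω] [MeasureSpace S]
    [SFinite (volume : Measure Ω)] [SFinite (volume : Measure S)] (c : ℝ≥0∞)
    {f : Ω × S → ℝ≥0∞} (hf : Measurable f) {W : S → ℝ≥0∞} (hW : Measurable W) :
    ∫⁻ o : Ω × S, c * (f o * W o.2) = c * ∫⁻ s, (∫⁻ o, f (o, s)) * W s := by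
  have hm : Measurable fun o : Ω × S => f o * W o.2 := hf.mul (hW.comp measurable_snd)
  rw [lintegral_const_mul _ hm, volume_eq_prod, lintegral_prod_symm _ hm.aemeasurable]
  congr 1
  refine lintegral_congr fun s => ?_
  have hm1 : Measurable fun o => f (o, s) := hf.comp (by fun_prop)
  exact lintegral_mul_const (W s) hm1

/-- Multipliers with symbols `φ_ξ(η) e^{-ρ} Γ(ρ) θ((τ - η²) / N)` are localized in space at every
scale `2^ι ≥ 2^{i - 2}`, up to an average in time. -/
lemma exists_lintegral_parSym_le (φ : PacketPartition) {Γ θ : ℝ → ℝ}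
    (hΓ : IsTest fun σ => (Γ σ : ℂ)) (hθ : IsTest fun σ => (θ σ : ℂ)) (e : ℕ) {C₁ : ℝ} (hC₁ : 0 ≤ C₁) :
    ∃ C : ℝ≥0∞, C ≠ ⊤ ∧ ∀ i j ι : ℕ, i ≤ j → i ≤ ι + 2 → ∃ M : ℝ → ℝ≥0∞, Measurable M ∧
      ∫⁻ s, M s ≤ C ∧ ∀ X : Finset polarLattice, (∀ ξ ∈ X, ‖(ξ : Plane)‖ ≤ C₁ * 2 ^ j) →
      ∀ g : ℂˢᵗ, Measurable g → Integrable g → MemLp g 2 → ∀ (t : ℝ) (p : ℤ²),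
        ∑ ξ ∈ X, ∫⁻ x in planeCube ι p,
          ‖stMult (parSym (φ.toFun ξ) Γ θ (4 ^ j)⁻¹ (2 ^ (j - i))) g (x, t)‖ₑ ^ 2 ≤
        ∫⁻ s, M (t - s) * ∑' q, wt e q * ∫⁻ y in planeCube ι (p - q), ‖g (y, s)‖ₑ ^ 2 := by
  set n := e + 3
  obtain ⟨A, hA, hφ⟩ := φ.exists_symB n
  obtain ⟨R, hR⟩ := φ.localized
  obtain ⟨K, hK⟩ := exists_card_polarLattice_le |R|
  obtain ⟨D₀, hD₀, hD0⟩ := exists_lintegral_superWt_le hΓ hθ 1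
  obtain ⟨D₁, hD₁, hD1⟩ := exists_lintegral_superWt_le hΓ hθ (2 * n + 1)
  set B := 8 * (C₁ + |R|) + 2
  have hB2 : 2 ≤ B := by have := abs_nonneg R; linarith
  set c := wtMass * ofReal (64 ^ n * (K * (2 ^ (n ^ 2 + n) * A) ^ 2) * B ^ (2 * n)) with hc
  have hcm : Measurable fun o : ℝ × ℝ => superWt Γ θ o := (continuous_superWt hΓ hθ).measurable
  refine ⟨D₀ * c * D₁, mul_ne_top (mul_ne_top hD₀ (mul_ne_top wtMass_ne_top
    ofReal_ne_top)) hD₁, fun i j ι hij hι => ?_⟩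
  have hε : (0 : ℝ) < (4 ^ j)⁻¹ := by positivity
  have hN : (0 : ℝ) < 2 ^ (j - i) := by positivity
  set ε : ℝ := (4 ^ j)⁻¹ with hεd
  set N : ℝ := 2 ^ (j - i) with hNd
  have hqm : Measurable fun p : ℝ × (ℝ × ℝ) => gker (superTime ε N p.2) p.1 :=
    measurable_gker_superTime hε measurable_snd measurable_fst
  have hqint : ∀ o, ∫⁻ s, ‖gker (superTime ε N o) s‖ₑ ≤ ofReal (1 + |o.1| + |o.2|) := by
    intro o
    refine (lintegral_gker_expAbs_le hε o.1 _).trans (ofReal_le_ofReal ?_)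
    linarith [abs_nonneg o.2]
  set P : ℝ × ℝ → ℝ≥0∞ := fun o => ‖superWt Γ θ o‖ₑ *
    ofReal ((1 + |o.1| + |o.2|) ^ (2 * n)) with hP
  have hPm : Measurable P := hcm.enorm.mul (by fun_prop)
  have hMm : Measurable fun p : ℝ × (ℝ × ℝ) => P p.2 * ‖gker (superTime ε N p.2) p.1‖ₑ :=
    (hPm.comp measurable_snd).mul hqm.enorm
  refine ⟨fun s => D₀ * c * ∫⁻ o, P o * ‖gker (superTime ε N o) s‖ₑ,
    hMm.lintegral_prod_right'.const_mul _, ?_, fun X hX g hg hgi hg2 t p => ?_⟩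
  · rw [lintegral_const_mul _ hMm.lintegral_prod_right', lintegral_lintegral_swap hMm.aemeasurable]
    refine mul_le_mul' le_rfl (le_trans (lintegral_mono fun o => ?_) hD1)
    have : Measurable fun s => gker (superTime ε N o) s :=
      measurable_gker_superTime hε measurable_const measurable_id
    simp only []
    rw [lintegral_const_mul _ this.enorm, pow_succ, ofReal_mul (by positivity), ← mul_assoc]
    exact mul_le_mul' le_rfl (hqint o)
  set k : (ℝ × ℝ) × ℝ → ℂ := fun o => superWt Γ θ o.1 * gker (superTime ε N o.1) (t - o.2) with hk
  have hkm : Measurable k := (hcm.comp measurable_fst).mul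
    (measurable_gker_superTime hε measurable_fst (by fun_prop))
  have hre : ∀ o, (superExp ε N o).re ≤ 0 := fun o => by rw [superExp_re]; linarith
  have hzc : Continuous (superExp ε N) := by unfold superExp; fun_prop
  have hφc : ∀ ξ, Continuous (φ.toFun ξ) := fun ξ => (φ.smooth ξ).continuous
  have hφs : ∀ ξ, HasCompactSupport (φ.toFun ξ) := fun ξ =>
    (isCompact_closedBall _ _).of_isClosed_subset (isClosed_tsupport _) (hR ξ)
  set m : polarLattice → ℝ × ℝ → Plane → ℂ := fun ξ o η =>
    (φ.toFun ξ η : ℂ) * exp (superExp ε N o * ((‖η‖ ^ 2 : ℝ) : ℂ)) with hm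
  have hsymb : ∀ (o : ℝ × ℝ), ∀ ξ ∈ X, SymB n (2 ^ (n ^ 2 + n) * A)
      (2 ^ ι * (B * (1 + |o.1| + |o.2|))) (m ξ o) := fun o ξ hξ =>
    symB_mul_superExp hC₁ hA hij hι (hφ ξ) (hR ξ) (hX ξ hξ) o
  set W : ℝ → ℝ≥0∞ := fun s => ∑' q, wt e q * ∫⁻ y in planeCube ι (p - q), ‖g (y, s)‖ₑ ^ 2 with hW
  have hWm : Measurable W := Measurable.tsum fun q =>
    ((hg.enorm.pow_const 2).lintegral_prod_left').const_mul _
  have hslice : ∀ᵐ o : (ℝ × ℝ) × ℝ, MemLp (fun y => g (y, o.2)) 2 :=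
    Measure.quasiMeasurePreserving_snd.ae (ae_memLp_slice hg hg2)
  have hGm : ∀ ξ : X, Measurable fun q : ((ℝ × ℝ) × ℝ) × Plane =>
      gconv (m ξ q.1.1) (fun y => g (y, q.1.2)) q.2 := fun ξ =>
    measurable_gconv_cexp (X := (ℝ × ℝ) × ℝ) (by fun_prop)
      ((Complex.continuous_ofReal.comp (hφc ξ)).integrable_of_hasCompactSupport
        ((hφs ξ).comp_left (g := fun x : ℝ => (x : ℂ)) (by simp)))
      (hzc.comp continuous_fst) (fun o => hre o.1) hg measurable_snd
  have hkint : ∫⁻ o, ‖k o‖ₑ ≤ D₀ := by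
    rw [volume_eq_prod, lintegral_prod _ hkm.enorm.aemeasurable]
    refine le_trans (lintegral_mono fun o => ?_) hD0
    have : Measurable fun s => gker (superTime ε N o) (t - s) :=
      measurable_gker_superTime hε measurable_const (by fun_prop)
    simp only [hk, enorm_mul]
    rw [lintegral_const_mul _ this.enorm,
      lintegral_sub_left_eq_self (fun s => ‖gker (superTime ε N o) s‖ₑ), pow_one]
    exact mul_le_mul' le_rfl (hqint o)
  have hm3 : Measurable fun s => (∫⁻ o, P o * ‖gker (superTime ε N o) (t - s)‖ₑ) * W s :=
    (hMm.lintegral_prod_right'.comp (by fun_prop : Measurable fun s : ℝ => t - s)).mul hWm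
  have hm4 : Measurable fun o : (ℝ × ℝ) × ℝ => P o.1 * ‖gker (superTime ε N o.1) (t - o.2)‖ₑ :=
    (hPm.comp measurable_fst).mul
      (measurable_gker_superTime hε measurable_fst (by fun_prop)).enorm
  clear_value P c W
  rw [← Finset.sum_coe_sort]
  simp_rw [stMult_parSym hΓ hθ hε hN (hφc _) (hφs _) hg hgi]
  refine (lintegral_superposition_le hkm hGm _).trans ?_
  refine (mul_le_mul' hkint (lintegral_mono_ae (g := fun o : (ℝ × ℝ) × ℝ =>
    c * ((P o.1 * ‖gker (superTime ε N o.1) (t - o.2)‖ₑ) * W o.2)) ?_)).trans_eq ?_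
  · filter_upwards [hslice] with o ho
    have hS1 : 1 ≤ 1 + |o.1.1| + |o.1.2| := by
      have := abs_nonneg o.1.1; have := abs_nonneg o.1.2; linarith
    have := lintegral_gconv_analysis (μ := B * (1 + |o.1.1| + |o.1.2|)) (by nlinarith) ι n e K
      (by omega) (m := fun ξ : X => m ξ o.1) (fun ξ => hsymb o.1 ξ ξ.2) (fun η s hs => ?_) p ho
    · rw [mul_pow B, ← mul_assoc (_ * _ : ℝ), ofReal_mul (by positivity), ← mul_assoc, ← hc]
        at this
      refine (mul_le_mul' le_rfl this).trans_eq ?_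
      simp only [hk, hP, hW, enorm_mul]
      ring
    · rw [← Finset.card_map (Function.Embedding.subtype _)]
      refine hK η _ fun ξ hξ => ?_
      obtain ⟨ξ', hξ', rfl⟩ := Finset.mem_map.1 hξ
      have h4 : tsupport (m ξ' o.1) ⊆ tsupport (φ.toFun ξ') := by
        refine closure_mono fun x hx => ?_
        simp only [hm, Function.mem_support] at hx ⊢
        exact fun h => hx (by simp [h])
      have h5 := mem_closedBall_iff_norm.1 (hR ξ' (h4 (hs ξ' hξ')))
      rw [norm_sub_rev]
      exact h5.trans (le_abs_self R)
  · rw [lintegral_prod_mul_snd c (f := fun o : (ℝ × ℝ) × ℝ =>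
      P o.1 * ‖gker (superTime ε N o.1) (t - o.2)‖ₑ) hm4 hWm, ← mul_assoc,
      ← lintegral_const_mul _ hm3]
    simp only [mul_assoc, hW]

/-! ### The symbol of `S_{j, ≤ d}` as a superposition -/

namespace DyadicCutoff

variable (φ₀ : DyadicCutoff)

/-- The smooth function `ρ ↦ φ₀(√ρ)` on the line. -/
def sqrtComp (ρ : ℝ) : ℝ := φ₀.toFun (Real.sqrt ρ)

lemma contDiff_sqrtComp : ContDiff ℝ ∞ φ₀.sqrtComp := by
  rw [contDiff_iff_contDiffAt]
  intro ρ
  rcases lt_or_ge 0 ρ with h | h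
  · have h1 : ContDiffAt ℝ ∞ φ₀.toFun (Real.sqrt ρ) :=
      φ₀.smooth.contDiffAt (Ici_mem_nhds (Real.sqrt_pos.2 h))
    exact h1.comp ρ (Real.contDiffAt_sqrt h.ne')
  · refine (contDiffAt_const (c := (1 : ℝ))).congr_of_eventuallyEq ?_
    filter_upwards [Iio_mem_nhds (show ρ < 1 by linarith)] with x hx
    exact φ₀.eq_one _ (Real.sqrt_nonneg x) (Real.sqrt_le_one.2 (mem_Iio.1 hx).le)

/-- The profile of the `j`-th dyadic piece in the variable `ρ = 4^{-j} (|τ| + ξ²)`; `c = 0` for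
`j = 0` and `c = 1` otherwise. -/
def profile (c : ℝ) (ρ : ℝ) : ℝ :=
  Real.exp ρ * (φ₀.sqrtComp ρ - c * φ₀.sqrtComp (4 * ρ)) * timeBump (ρ / 2)

def modProfile (σ : ℝ) : ℝ := φ₀.sqrtComp (σ ^ 2)

lemma isTest_of_contDiff_real {f : ℝ → ℝ} (h : ContDiff ℝ ∞ f) {R : ℝ}
    (hs : ∀ σ, R ≤ |σ| → f σ = 0) : IsTest fun σ => (f σ : ℂ) := by
  refine ⟨Complex.ofRealCLM.contDiff.comp h,
    HasCompactSupport.intro (isCompact_closedBall 0 R) fun σ hσ => ?_⟩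
  rw [mem_closedBall_zero_iff, not_le, norm_eq_abs] at hσ
  simp [hs σ hσ.le]

lemma isTest_profile (c : ℝ) : IsTest fun σ => (φ₀.profile c σ : ℂ) := by
  refine isTest_of_contDiff_real (R := 8) ?_ fun σ hσ => ?_
  · have h := φ₀.contDiff_sqrtComp
    have h2 : ContDiff ℝ ∞ (timeBump : ℝ → ℝ) := timeBump.contDiff
    unfold profile
    fun_prop
  · rw [profile, timeBump_eq_zero, mul_zero]
    rw [abs_div, abs_two]; linarith

lemma isTest_modProfile : IsTest fun σ => (φ₀.modProfile σ : ℂ) := by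
  refine isTest_of_contDiff_real (R := 2) ?_ fun σ hσ => ?_
  · have h := φ₀.contDiff_sqrtComp
    unfold modProfile
    fun_prop
  · rw [modProfile, sqrtComp, Real.sqrt_sq_eq_abs]
    exact φ₀.eq_zero _ hσ

lemma mul_symModLe_eq (b : Plane → ℝ) {i j : ℕ} (hij : i ≤ j) :
    (fun ζ : SpaceTime => b ζ.1 * symModLe φ₀ j (-(i : ℤ)) ζ) =
      parSym b (φ₀.profile (if j = 0 then 0 else 1)) φ₀.modProfile (4 ^ j)⁻¹ (2 ^ (j - i)) := by
  ext ζ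
  set ρ := (4 ^ j : ℝ)⁻¹ * (|ζ.2| + ‖ζ.1‖ ^ 2) with hρ
  have hρ0 : 0 ≤ ρ := by positivity
  have h4 : ((2 : ℝ) ^ j) ^ 2 = 4 ^ j := by rw [← pow_mul, mul_comm, pow_mul]; norm_num
  have hs : Real.sqrt ρ = parNorm ζ / 2 ^ j := by
    rw [hρ, parNorm, ← h4, Real.sqrt_mul (by positivity), Real.sqrt_inv,
      Real.sqrt_sq (by positivity), div_eq_inv_mul]
  have hs2 : Real.sqrt (4 * ρ) = 2 * (parNorm ζ / 2 ^ j) := by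
    rw [Real.sqrt_mul (by norm_num), hs, show (4 : ℝ) = 2 ^ 2 by norm_num,
      Real.sqrt_sq (by norm_num)]
  have hpiece : φ₀.piece j (parNorm ζ) =
      φ₀.sqrtComp ρ - (if j = 0 then 0 else 1) * φ₀.sqrtComp (4 * ρ) := by
    rw [sqrtComp, sqrtComp, hs, hs2]
    rcases j with _ | j
    · simp [piece]
    · simp only [piece, Nat.succ_ne_zero, if_false, one_mul]
      congr 2
      rw [pow_succ]; field_simp
  have hmod : φ₀.toFun (parDist ζ / 2 ^ (j - i)) = φ₀.modProfile ((ζ.2 - ‖ζ.1‖ ^ 2) / 2 ^ (j - i)) := by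
    rw [modProfile, sqrtComp, Real.sqrt_sq_eq_abs, abs_div, abs_of_pos (by positivity : (0 : ℝ) < 2 ^ (j - i)),
      parDist]
  rw [symModLe_eq φ₀ hij, hpiece, hmod, parSym, profile, ← hρ]
  by_cases h : ρ / 2 ≤ 3
  · rw [timeBump_eq_one (by rwa [abs_of_nonneg (by positivity)]), mul_one]
    rw [← mul_assoc (Real.exp (-ρ)), ← mul_assoc (Real.exp (-ρ)), ← Real.exp_add, neg_add_cancel,
      Real.exp_zero, one_mul]
  · have h6 : 6 < ρ := by linarith
    have hz : ∀ x, 4 ≤ x → φ₀.sqrtComp x = 0 := fun x hx =>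
      φ₀.eq_zero _ (Real.le_sqrt_of_sq_le (by linarith))
    rw [hz ρ (by linarith), hz (4 * ρ) (by linarith)]
    simp

end DyadicCutoff

lemma exists_lintegral_packet_le (φ₀ : DyadicCutoff) (φ : PacketPartition) (e : ℕ) {C₁ : ℝ}
    (hC₁ : 0 ≤ C₁) : ∃ C : ℝ≥0∞, C ≠ ⊤ ∧ ∀ i j ι : ℕ, i ≤ j → i ≤ ι + 2 → ∃ M : ℝ → ℝ≥0∞,
      Measurable M ∧ ∫⁻ s, M s ≤ C ∧
      ∀ X : Finset polarLattice, (∀ ξ ∈ X, ‖(ξ : Plane)‖ ≤ C₁ * 2 ^ j) →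
      ∀ g : ℂˢᵗ, Measurable g → Integrable g → MemLp g 2 → ∀ (t : ℝ) (p : ℤ²),
        ∑ ξ ∈ X, ∫⁻ x in planeCube ι p,
          ‖stMult (fun ζ => φ.toFun ξ ζ.1 * symModLe φ₀ j (-(i : ℤ)) ζ) g (x, t)‖ₑ ^ 2 ≤
        ∫⁻ s, M (t - s) * ∑' q, wt e q * ∫⁻ y in planeCube ι (p - q), ‖g (y, s)‖ₑ ^ 2 := by
  obtain ⟨A, hA, h1⟩ := exists_lintegral_parSym_le φ (φ₀.isTest_profile 0) φ₀.isTest_modProfile e hC₁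
  obtain ⟨B, hB, h2⟩ := exists_lintegral_parSym_le φ (φ₀.isTest_profile 1) φ₀.isTest_modProfile e hC₁
  refine ⟨A + B, ENNReal.add_ne_top.2 ⟨hA, hB⟩, fun i j ι hij hι => ?_⟩
  simp_rw [φ₀.mul_symModLe_eq _ hij]
  by_cases hj : j = 0
  · obtain ⟨M, hM, hM1, h⟩ := h1 i j ι hij hι
    rw [if_pos hj]
    exact ⟨M, hM, hM1.trans le_self_add, h⟩
  · obtain ⟨M, hM, hM1, h⟩ := h2 i j ι hij hι
    rw [if_neg hj]
    exact ⟨M, hM, hM1.trans le_add_self, h⟩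

/-! ### Localization of the two factors in frequency -/

namespace PacketPartition

variable (φ : PacketPartition)

lemma hasCompactSupport (ξ : polarLattice) : HasCompactSupport (φ.toFun ξ) := by
  obtain ⟨R, hR⟩ := φ.localized
  exact (isCompact_closedBall _ _).of_isClosed_subset (isClosed_tsupport _) (hR ξ)

lemma isTest (ξ : polarLattice) : IsTest fun η => (φ.toFun ξ η : ℂ) :=
  isTest_ofReal (φ.smooth ξ) (φ.hasCompactSupport ξ)

/-- A radius for the supports of the partition of unity. -/
def radius : ℝ := |φ.localized.choose|

lemma radius_nonneg : 0 ≤ φ.radius := abs_nonneg _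

lemma norm_sub_le_of_ne_zero {ξ : polarLattice} {η : Plane} (h : φ.toFun ξ η ≠ 0) :
    ‖η - ξ‖ ≤ φ.radius :=
  (mem_closedBall_iff_norm.1 (φ.localized.choose_spec ξ (subset_tsupport _ h))).trans
    (le_abs_self _)

end PacketPartition

lemma xMult_stMult_packet (φ : PacketPartition) {a : SpaceTime → ℝ} (ha : StSym a) {f : ℂˢᵗ}
    (hf : StAdm a f) (ξ : polarLattice) :
    xMult (φ.toFun ξ) (stMult a f) = stMult (fun ζ => φ.toFun ξ ζ.1 * a ζ) f :=
  xMult_stMult (φ.isTest ξ) ha hf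

lemma measurable_xMult_stMult (φ : PacketPartition) {a : SpaceTime → ℝ} (ha : StSym a)
    {f : ℂˢᵗ} (hf : StAdm a f) (hfm : AEStronglyMeasurable f) (ξ : polarLattice) :
    Measurable (xMult (φ.toFun ξ) (stMult a f)) := by
  rw [xMult_stMult_packet φ ha hf]
  exact (ha.fst_mul (φ.smooth ξ).continuous).measurable_stMult hfm

lemma finite_near (η : Plane) (ρ : ℝ) : {ξ : polarLattice | ‖(ξ : Plane) - η‖ ≤ ρ}.Finite := by
  obtain ⟨K, hK⟩ := exists_card_polarLattice_le ρ
  by_contra h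
  obtain ⟨s, hs, hc⟩ := Set.Infinite.exists_subset_card_eq h (K + 1)
  have := hK η s fun ξ hξ => hs hξ
  omega

/-- The finite set of lattice points at distance at most `ρ` from `η`. -/
def near (η : Plane) (ρ : ℝ) : Finset polarLattice := (finite_near η ρ).toFinset

lemma mem_near {η : Plane} {ρ : ℝ} {ξ : polarLattice} :
    ξ ∈ near η ρ ↔ ‖(ξ : Plane) - η‖ ≤ ρ := by simp [near]

lemma PacketPartition.sum_near (φ : PacketPartition) {η₀ η : Plane} {ρ : ℝ}
    (h : ‖η - η₀‖ + φ.radius ≤ ρ) : ∑ ξ ∈ near η₀ ρ, φ.toFun ξ η = 1 := by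
  rw [← (φ.sum_eq_one η).tsum_eq, tsum_eq_sum]
  intro ξ hξ
  by_contra hne
  refine hξ (mem_near.2 ?_)
  have h1 := φ.norm_sub_le_of_ne_zero hne
  calc ‖(ξ : Plane) - η₀‖ ≤ ‖(ξ : Plane) - η‖ + ‖η - η₀‖ := norm_sub_le_norm_sub_add_norm_sub _ _ _
    _ ≤ ρ := by rw [norm_sub_rev]; linarith

section Localize

variable {i j ι : ℕ} {v w : ℂˢᵗ}

/-- The part of `v` with frequencies in the ball `|ξ - ξ₀| ≤ ρ`. -/
def cellPart (a : SpaceTime → ℝ) (ξ₀ : Plane) (ρ : ℝ) (v : ℂˢᵗ) :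
    ℂˢᵗ := stMult (fun ζ => cellSym ξ₀ ρ ζ.1 * a ζ) v

lemma continuous_cellSym (ξ₀ : Plane) (ρ : ℝ) : Continuous (cellSym ξ₀ ρ) :=
  (contDiff_cellSym ξ₀ ρ).continuous

lemma stSym_cellSym_mul {a : SpaceTime → ℝ} (ha : StSym a) (ξ₀ : Plane) (ρ : ℝ) :
    StSym fun ζ => cellSym ξ₀ ρ ζ.1 * a ζ := ha.fst_mul (continuous_cellSym ξ₀ ρ)

lemma StSym.exists_abs_snd_le {a : SpaceTime → ℝ} (ha : StSym a) :
    ∃ L : ℝ, ∀ ζ, a ζ ≠ 0 → |ζ.2| ≤ L := by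
  obtain ⟨L, hL⟩ := ha.2.isCompact.isBounded.exists_norm_le
  exact ⟨L, fun ζ hζ => (norm_snd_le ζ).trans (hL ζ (subset_tsupport _ hζ))⟩

/-- In the output at frequency `ξ` near `ξ₀`, only the part of `v` near `ξ₀` matters. -/
lemma stMult_mul_cellPart {a m ρ : SpaceTime → ℝ} (ha : StSym a) (hm : StSym m) (hρ : StSym ρ)
    {ξ₀ : Plane} {r : ℝ} (hr : 0 < r) (h : ∀ η ζ, m η ≠ 0 → ρ ζ ≠ 0 → ‖η.1 - ζ.1 - ξ₀‖ ≤ r)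
    (hv : MemLp v 2) (hw : MemLp w 2) (hva : stMult a v = v) (hwρ : stMult ρ w = w) :
    stMult m (fun z => v z * w z) = stMult m (fun z => cellPart a ξ₀ r v z * w z) := by
  obtain ⟨L₁, h1⟩ := ha.exists_abs_snd_le
  obtain ⟨L₂, h2⟩ := hm.exists_abs_snd_le
  obtain ⟨L₃, h3⟩ := hρ.exists_abs_snd_le
  set L := 1 + |L₁| + |L₂| + |L₃|
  have hL0 : 0 < L := by positivity
  set χ : SpaceTime → ℝ := fun ζ => cellSym ξ₀ r ζ.1 * timeBump (ζ.2 / L) with hχ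
  have htb : ∀ s : ℝ, |s| ≤ L → timeBump (s / L) = 1 := fun s hs => timeBump_eq_one (by
    rw [abs_div, abs_of_pos hL0, div_le_iff₀ hL0]; linarith)
  have hχt : StTest χ := by
    have e1 := contDiff_cellSym ξ₀ r
    have e2 : ContDiff ℝ ∞ (timeBump : ℝ → ℝ) := timeBump.contDiff
    refine ⟨by fun_prop, HasCompactSupport.intro ((isCompact_closedBall ξ₀ (2 * r)).prod
      (isCompact_closedBall (0 : ℝ) (4 * L))) fun ζ hζ => ?_⟩
    simp only [mem_prod, mem_closedBall_iff_norm, sub_zero, norm_eq_abs, not_and_or, not_le] at hζ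
    rcases hζ with hζ | hζ
    · simp only [hχ, cellSym_eq_zero hr hζ.le, zero_mul]
    · simp only [hχ]
      rw [timeBump_eq_zero, mul_zero]
      rw [abs_div, abs_of_pos hL0, le_div_iff₀ hL0]; linarith
  have hcell : cellPart a ξ₀ r v = stMult χ v := by
    rw [← hva, stMult_stMult_left hχt ha hv, hva, cellPart]
    congr 1
    ext ζ
    by_cases hz : a ζ = 0
    · simp [hz]
    · simp only [hχ]
      rw [htb _ ((h1 ζ hz).trans (by linarith [le_abs_self L₁, abs_nonneg L₂, abs_nonneg L₃])), mul_one]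
  rw [hcell]
  have := stMult_mul_stMult_eq hm hρ hχt (fun η ζ hη hζ => ?_) hv hw
  · rwa [hwρ] at this
  · simp only [hχ, Prod.fst_sub, Prod.snd_sub]
    rw [cellSym_eq_one hr (h η ζ hη hζ), htb, mul_one]
    refine (abs_sub _ _).trans ?_
    linarith [h2 η hη, h3 ζ hζ, le_abs_self L₂, le_abs_self L₃, abs_nonneg L₁]

lemma stMult_packetSym_cellPart {ξ₀ : Plane} {r s N : ℝ} (hr : 0 < r) (hs : 0 < s) (hN : 0 < N)
    (hv : MemLp v 2) : stMult (packetSym ξ₀ (2 * r) (2 * N)) (cellPart (packetSym 0 s N) ξ₀ r v) =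
      cellPart (packetSym 0 s N) ξ₀ r v := by
  rw [cellPart, stMult_stMult_left (stTest_packetSym _ (by positivity) (by positivity))
    (stSym_cellSym_mul (stTest_packetSym 0 hs hN).stSym _ r) hv]
  congr 1
  ext ζ
  by_cases hz : cellSym ξ₀ r ζ.1 * packetSym 0 s N ζ = 0
  · rw [hz, mul_zero]
  · rw [packetSym_eq_one (by positivity) (by positivity), one_mul]
    · by_contra hc
      exact hz (by rw [cellSym_eq_zero hr (not_le.1 hc).le, zero_mul])
    · by_contra hc
      refine hz ?_
      rw [packetSym, prodSym, timeBump_eq_zero, mul_zero, mul_zero]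
      rw [abs_div, abs_of_pos hN, le_div_iff₀ hN]
      have := (not_le.1 hc).le
      rw [parDist] at this
      linarith

lemma StSym.exists_enorm_stMult_le {a : SpaceTime → ℝ} (ha : StSym a) (hv : MemLp v 2) :
    ∃ B : ℝ≥0∞, B ≠ ⊤ ∧ ∀ z, ‖stMult a v z‖ₑ ≤ B := by
  obtain ⟨B, hB, h⟩ := (ha.stAdm_of_memLp hv).2
  refine ⟨B, hB, fun z => (enorm_integral_le_lintegral_enorm _).trans ?_⟩
  simp_rw [enorm_mul]
  exact h z

lemma memLp_mul_of_bounded {V : ℂˢᵗ} (hV : AEStronglyMeasurable V) (hw : MemLp w 2)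
    {B : ℝ≥0∞} (hB : B ≠ ⊤) (h : ∀ z, ‖V z‖ₑ ≤ B) : MemLp (fun z => V z * w z) 2 := by
  have hm : AEStronglyMeasurable fun z => V z * w z := hV.mul hw.1
  rw [memLp_two_iff_lintegral hm]
  calc ∫⁻ z, ‖V z * w z‖ₑ ^ 2 ≤ ∫⁻ z, B ^ 2 * ‖w z‖ₑ ^ 2 := by
        refine lintegral_mono fun z => ?_
        rw [enorm_mul, mul_pow]
        gcongr
        exact h z
    _ = B ^ 2 * ∫⁻ z, ‖w z‖ₑ ^ 2 := lintegral_const_mul' _ _ (pow_ne_top hB)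
    _ < ⊤ := mul_lt_top (pow_ne_top hB).lt_top
        ((memLp_two_iff_lintegral hw.1).1 hw)

/-- The part of `v` near `ξ₀` is controlled by the wave packets of `v` near `ξ₀`. -/
lemma exists_lintegral_cellPart_le (φ : PacketPartition) (e : ℕ) : ∃ C : ℝ≥0∞, C ≠ ⊤ ∧
    ∀ (ι : ℕ) (ξ₀ : Plane) {r : ℝ}, 1 ≤ r → ∀ {a : SpaceTime → ℝ}, StSym a →
      ∀ {v : ℂˢᵗ}, MemLp v 2 → stMult a v = v → ∀ᵐ s : ℝ, ∀ p : ℤ²,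
        ∫⁻ x in planeCube ι p, ‖cellPart a ξ₀ r v (x, s)‖ₑ ^ 2 ≤ C * ∑' q, wt e q *
          ∑ ξ ∈ near ξ₀ (2 * r + φ.radius), ∫⁻ x in planeCube ι (p - q),
            ‖xMult (φ.toFun ξ) v (x, s)‖ₑ ^ 2 := by
  set n := e + 3
  obtain ⟨A, hA, hcell⟩ := exists_symB_cellSym n
  have hR := φ.radius_nonneg
  set R := φ.radius + 1
  obtain ⟨K, hK⟩ := exists_card_polarLattice_le (2 * R)
  refine ⟨wtMass * ofReal (64 ^ n * (K * (2 ^ n * A * A) ^ 2) * 1 ^ (2 * n)),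
    mul_ne_top wtMass_ne_top ofReal_ne_top, fun ι ξ₀ r hr a ha v hv hva => ?_⟩
  have hr0 : 0 < r := by linarith
  set Y := near ξ₀ (2 * r + φ.radius)
  set m : polarLattice → Plane → ℝ := fun ξ η => cellSym ξ₀ r η * cellSym ξ R η with hm
  have hmc : ∀ ξ, IsTest fun η => (m ξ η : ℂ) := fun ξ => isTest_ofReal
    ((contDiff_cellSym _ _).mul (contDiff_cellSym _ _)) (hasCompactSupport_cellSym _ hr0).mul_right
  have hsymb : ∀ ξ, SymB n (2 ^ n * A * A) (2 ^ ι * 1) fun η => (m ξ η : ℂ) := by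
    intro ξ
    have h1 : (1 : ℝ) ≤ 2 ^ ι := one_le_pow₀ (by norm_num)
    have e1 : r⁻¹ ≤ 2 ^ ι * 1 := (inv_le_one_of_one_le₀ hr).trans (by linarith)
    have e2 : R⁻¹ ≤ 2 ^ ι * 1 := (inv_le_one_of_one_le₀ (by linarith)).trans (by linarith)
    simp only [hm]
    push_cast
    exact SymB.mul (by positivity) hA hA ((hcell ξ₀ hr0).mono le_rfl hA (by positivity) e1)
      ((hcell ξ (by linarith)).mono le_rfl hA (by positivity) e2)
  have hxs : ∀ ξ, xMult (φ.toFun ξ) v = stMult (fun ζ => φ.toFun ξ ζ.1 * a ζ) v := by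
    intro ξ
    conv_lhs => rw [← hva]
    exact xMult_stMult_packet φ ha (ha.stAdm_of_memLp hv) ξ
  have hs1 : ∀ ξ, StSym fun ζ => φ.toFun ξ ζ.1 * a ζ := fun ξ => ha.fst_mul (φ.smooth ξ).continuous
  have hs2 : ∀ ξ, StSym fun ζ => m ξ ζ.1 * (φ.toFun ξ ζ.1 * a ζ) := fun ξ =>
    (hs1 ξ).fst_mul ((continuous_cellSym ξ₀ r).mul (continuous_cellSym ξ R))
  have hV : ∀ x s, cellPart a ξ₀ r v (x, s) =
      ∑ ξ : Y, gconv (fun η => (m ξ η : ℂ)) (fun y => xMult (φ.toFun ξ) v (y, s)) x := by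
    intro x s
    have hsym : (fun ζ : SpaceTime => cellSym ξ₀ r ζ.1 * a ζ) = fun ζ => ∑ ξ ∈ Y,
        m ξ ζ.1 * (φ.toFun ξ ζ.1 * a ζ) := by
      ext ζ
      by_cases hz : cellSym ξ₀ r ζ.1 = 0
      · simp [hm, hz]
      have hz2 : ‖ζ.1 - ξ₀‖ + φ.radius ≤ 2 * r + φ.radius := by
        by_contra hc
        exact hz (cellSym_eq_zero hr0 (by linarith))
      have h1 : ∀ ξ ∈ Y, m ξ ζ.1 * (φ.toFun ξ ζ.1 * a ζ) =
          φ.toFun ξ ζ.1 * (cellSym ξ₀ r ζ.1 * a ζ) := by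
        intro ξ _
        by_cases hφ : φ.toFun ξ ζ.1 = 0
        · simp [hφ]
        · have := φ.norm_sub_le_of_ne_zero hφ
          simp only [hm]
          rw [cellSym_eq_one (a := (ξ : Plane)) (by linarith) (by linarith)]; ring
      rw [sum_congr rfl h1, ← sum_mul, φ.sum_near hz2, one_mul]
    rw [cellPart, hsym, stMult_finset_sum_symbol Y (fun ξ _ => hs2 ξ)
      (fun ξ _ => (hs2 ξ).stAdm_of_memLp hv), ← Finset.sum_coe_sort]
    refine sum_congr rfl fun ξ _ => ?_
    rw [← xMult_stMult (hmc ξ) (hs1 ξ) ((hs1 ξ).stAdm_of_memLp hv), ← hxs, xMult_eq]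
  have hsl : ∀ᵐ s : ℝ, ∀ ξ : Y, MemLp (fun y => xMult (φ.toFun ξ) v (y, s)) 2 := by
    rw [ae_all_iff]
    intro ξ
    rw [hxs]
    exact ae_memLp_slice ((hs1 ξ).measurable_stMult hv.1) ((hs1 ξ).memLp_stMult hv)
  filter_upwards [hsl] with s hs p
  simp_rw [hV]
  refine (lintegral_gconv_synthesis le_rfl ι n e K (by omega) (fun ξ : Y => hsymb ξ)
    (fun η S hS => ?_) p hs).trans_eq ?_
  · rw [← Finset.card_map (Function.Embedding.subtype _)]
    refine hK η _ fun ξ hξ => ?_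
    obtain ⟨ξ', hξ', rfl⟩ := Finset.mem_map.1 hξ
    have h4 : tsupport (fun η => (m ξ' η : ℂ)) ⊆ tsupport (fun η => (cellSym ξ' R η : ℂ)) := by
      refine closure_mono fun x hx => ?_
      simp only [hm, Function.mem_support] at hx ⊢
      exact fun h => hx (by push_cast; rw [h, mul_zero])
    have h5 := mem_closedBall_iff_norm.1 (tsupport_cellSym_subset (by linarith) (h4 (hS ξ' hξ')))
    rw [norm_sub_rev]
    exact h5
  · congr 1
    refine tsum_congr fun q => ?_
    rw [Finset.sum_coe_sort Y fun ξ => ∫⁻ x in planeCube ι (p - q), ‖xMult (φ.toFun ξ) v (x, s)‖ₑ ^ 2]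

end Localize

lemma wt_mul_tsum_le (n : ℕ) (a : ℤ² → ℝ≥0∞) (p q : ℤ²) :
    wt n q * ∑' z, wt n z * a (p - q - z) ≤ ∑' z, wt n z * a (p - z) := by
  rw [← ENNReal.tsum_mul_left, ← (Equiv.addLeft q).tsum_eq (fun z => wt n z * a (p - z))]
  refine tsum_le_tsum fun z => ?_
  rw [← mul_assoc, Equiv.coe_addLeft, sub_sub]
  exact mul_le_mul' (wt_mul_le n q z) le_rfl

lemma setLIntegral_Icc_comp_sub (f : ℝ → ℝ≥0∞) (t₀ h r : ℝ) :
    ∫⁻ t in Icc t₀ (t₀ + h), f (t - r) = ∫⁻ t in Icc (t₀ - r) (t₀ - r + h), f t := by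
  have := (measurePreserving_sub_right volume r).setLIntegral_comp_preimage_emb
    (MeasurableEquiv.subRight r).measurableEmbedding f (Icc (t₀ - r) (t₀ - r + h))
  rw [← this]
  congr 2
  ext t
  simp only [mem_Icc, mem_preimage]
  constructor <;> rintro ⟨h1, h2⟩ <;> constructor <;> linarith

lemma norm_sub_le_of_packet_mul_ne_zero {φ : PacketPartition} {ξ : polarLattice}
    {a : SpaceTime → ℝ} {ζ : SpaceTime} (h : φ.toFun ξ ζ.1 * a ζ ≠ 0) : ‖ζ.1 - ξ‖ ≤ φ.radius :=
  φ.norm_sub_le_of_ne_zero fun h0 => h (by rw [h0, zero_mul])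

/-- The cut-off radius for the frequencies of `v` that contribute to a cell of size `2^ι`. -/
def PacketPartition.cellRadius (φ : PacketPartition) (ι : ℕ) : ℝ :=
  (φ.radius + 5) * 2 ^ ι

/-- The mass at time `s`, in a cube of side `2^ι`, of the wave packets of `v` near `ξ₀`. -/
def cellMass (φ : PacketPartition) (ι : ℕ) (ξ₀ : Plane) (v : ℂˢᵗ)
    (p : ℤ²) (s : ℝ) : ℝ≥0∞ :=
  ∑ ξ ∈ near ξ₀ (2 * φ.cellRadius ι + φ.radius), ∫⁻ x in planeCube ι p, ‖xMult (φ.toFun ξ) v (x, s)‖ₑ ^ 2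

/-- The estimate on a cube and a time interval of length `1 / N`, for the output frequencies in a
cell of size `2^ι`. -/
lemma exists_cell_estimate (φ₀ : DyadicCutoff) (φ : PacketPartition) (e : ℕ) (he : 3 ≤ e)
    {C₁ c₀ N₀ : ℝ} (hC₁ : 0 ≤ C₁) (hc₀ : 0 < c₀) :
    ∃ C : ℝ≥0∞, C ≠ ⊤ ∧ ∀ i j ι : ℕ, 3 * i ≤ j → i ≤ ι + 2 → ι ≤ i + 2 → ∃ M : ℝ → ℝ≥0∞,
      Measurable M ∧ ∫⁻ s, M s ≤ C ∧ ∀ {v w : ℂˢᵗ}, MemLp v 2 → Measurable w → MemLp w 2 →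
      stMult (packetSym 0 (4 * 2 ^ j) (2 ^ (j - i))) v = v → ∀ {k : ℕ},
      stMult (packetSym 0 (2 * 2 ^ ι) (2 ^ k)) w = w →
      stMult (packetSym 0 (2 * 2 ^ ι) (4 * 4 ^ ι)) w = w → ∀ {ξ₀ : Plane},
      ‖ξ₀‖ ≤ C₁ * 2 ^ (j - i) * 2 ^ ι → ((2 : ℝ) ^ (j - i) ≤ N₀ ∨ c₀ * 2 ^ (j - i) * 2 ^ ι ≤ ‖ξ₀‖) →
      ∀ X : Finset polarLattice, (∀ ξ ∈ X, ‖(ξ : Plane) - ξ₀‖ ≤ 2 ^ ι) → ∀ (t₀ : ℝ) (p : ℤ²),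
        ∑ ξ ∈ X, ∫⁻ t in Icc t₀ (t₀ + (2 ^ (j - i))⁻¹), ∫⁻ x in planeCube ι p,
          ‖xMult (φ.toFun ξ) (stMult (symModLe φ₀ j (-(i : ℤ))) fun z => v z * w z) (x, t)‖ₑ ^ 2 ≤
        C * 2 ^ k * (∫⁻ r, M r * ∑' z, wt e z * ∫⁻ s,
          ofReal (((1 + 2 ^ (j - i) * |s - (t₀ - r)|) ^ 2)⁻¹) * cellMass φ ι ξ₀ v (p - z) s) *
        ∑' y, wt e y * ∫⁻ z in planeCube ι (p - y) ×ˢ (univ : Set ℝ), ‖w z‖ₑ ^ 2 := by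
  have hR := φ.radius_nonneg
  obtain ⟨CS, hCS, hS⟩ := exists_lintegral_packet_le φ₀ φ (e + e + 3) (C₁ := 4 * (C₁ + 1)) (by positivity)
  obtain ⟨CB, hCB, hBil⟩ := exists_bilinear_le e hC₁ hc₀ (N₀ := N₀) (r₀ := 2 * (φ.radius + 5))
    (by linarith)
  obtain ⟨CV, hCV, hVp⟩ := exists_lintegral_cellPart_le φ e
  obtain ⟨Cw, hCw, hwp⟩ := exists_lintegral_slice_le e
  set c : ℝ≥0∞ := 2 ^ (e + 1) * wtMass
  have hctop : c ≠ ⊤ := mul_ne_top (by simp) wtMass_ne_top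
  set B := CB * (CV * c) * (Cw * c) * wtMass with hB
  have hBtop : B ≠ ⊤ := mul_ne_top (mul_ne_top (mul_ne_top hCB
    (mul_ne_top hCV hctop)) (mul_ne_top hCw hctop)) wtMass_ne_top
  refine ⟨CS + B, ENNReal.add_ne_top.2 ⟨hCS, hBtop⟩, fun i j ι hij hι1 hι2 => ?_⟩
  obtain ⟨M, hM, hM1, hS⟩ := hS i j ι (by omega) hι1
  refine ⟨M, hM, hM1.trans le_self_add, fun {v w} hv hw hw2 hva {k} hwk hwι {ξ₀} hξ1 hξ2 X hX t₀ p => ?_⟩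
  set N : ℝ := 2 ^ (j - i) with hN
  have hN1 : 1 ≤ N := one_le_pow₀ (by norm_num)
  have hN0 : 0 < N := by linarith
  have h2ι : (1 : ℝ) ≤ 2 ^ ι := one_le_pow₀ (by norm_num)
  have hιN : 4 ^ ι ≤ 16 * N := by
    calc (4 : ℝ) ^ ι ≤ 4 ^ (i + 2) := pow_le_pow_right₀ (by norm_num) hι2
      _ = 16 * 2 ^ (2 * i) := by rw [pow_add, pow_mul]; norm_num; ring
      _ ≤ 16 * N := by
          rw [hN]
          gcongr
          · norm_num
          · omega
  have hNj : N * 2 ^ ι ≤ 4 * 2 ^ j := by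
    calc N * 2 ^ ι ≤ N * 2 ^ (i + 2) := by gcongr; norm_num
      _ = 4 * 2 ^ j := by
          rw [hN, ← pow_add, show j - i + (i + 2) = j + 2 by omega]; ring
  set a := packetSym 0 (4 * 2 ^ j) N
  have hasym : StSym a := (stTest_packetSym 0 (by positivity) hN0).stSym
  set r₁ := φ.cellRadius ι with hr₁
  have hr1 : 1 ≤ r₁ := by
    rw [hr₁, PacketPartition.cellRadius]
    nlinarith
  set V := cellPart a ξ₀ r₁ v with hV
  have hVsym := stSym_cellSym_mul hasym ξ₀ r₁
  have hVm : Measurable V := hVsym.measurable_stMult hv.1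
  have hV2 : MemLp V 2 := hVsym.memLp_stMult hv
  obtain ⟨bd, hbd, hVb⟩ := hVsym.exists_enorm_stMult_le hv
  set g : ℂˢᵗ := fun z => V z * w z with hg
  have hgm : Measurable g := hVm.mul hw
  have hgi : Integrable g := hV2.integrable_mul hw2
  have hg2 : MemLp g 2 := memLp_mul_of_bounded hVm.aestronglyMeasurable hw2 hbd hVb
  have hVr : stMult (packetSym ξ₀ (2 * (φ.radius + 5) * 2 ^ ι) (2 * N)) V = V := by
    have := stMult_packetSym_cellPart (ξ₀ := ξ₀) (r := r₁) (s := 4 * 2 ^ j) (N := N) (by linarith)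
      (by positivity) hN0 hv
    rwa [hr₁, PacketPartition.cellRadius, ← mul_assoc] at this
  have hasym' := stSym_symModLe φ₀ (i := i) (j := j) (by omega)
  have hsym : ∀ ξ, StSym fun ζ => φ.toFun ξ ζ.1 * symModLe φ₀ j (-(i : ℤ)) ζ := fun ξ =>
    hasym'.fst_mul (φ.smooth ξ).continuous
  have hout : ∀ ξ ∈ X, xMult (φ.toFun ξ) (stMult (symModLe φ₀ j (-(i : ℤ))) fun z => v z * w z) =
      stMult (fun ζ => φ.toFun ξ ζ.1 * symModLe φ₀ j (-(i : ℤ)) ζ) g := by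
    intro ξ hξ
    have hvw : Integrable fun z => v z * w z := hv.integrable_mul hw2
    rw [xMult_stMult (φ.isTest ξ) hasym' (stAdm_of_integrable _ hvw)]
    refine stMult_mul_cellPart hasym (hsym ξ)
      (stTest_packetSym 0 (r := 2 * 2 ^ ι) (K := 2 ^ k) (by positivity) (by positivity)).stSym
      (by linarith) (fun η ζ hη hζ => ?_) hv hw2 hva hwk
    have h1 := norm_sub_le_of_packet_mul_ne_zero hη
    have h2 : ‖ζ.1‖ ≤ 4 * 2 ^ ι := by
      by_contra hcon
      refine hζ ?_
      rw [packetSym, prodSym, cellSym_eq_zero (by positivity), zero_mul]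
      rw [sub_zero]; linarith
    calc ‖η.1 - ζ.1 - ξ₀‖ = ‖(η.1 - ξ) + ((ξ : Plane) - ξ₀) - ζ.1‖ := by congr 1; abel
      _ ≤ ‖η.1 - ξ‖ + ‖(ξ : Plane) - ξ₀‖ + ‖ζ.1‖ := (norm_sub_le _ _).trans
          (add_le_add_left (norm_add_le _ _) _)
      _ ≤ φ.radius * 2 ^ ι + 2 ^ ι + 4 * 2 ^ ι := by
          refine add_le_add (add_le_add (h1.trans ?_) (hX ξ hξ)) h2
          exact le_mul_of_one_le_right hR h2ι
      _ = r₁ := by rw [hr₁, PacketPartition.cellRadius]; ring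
  have hXn : ∀ ξ ∈ X, ‖(ξ : Plane)‖ ≤ 4 * (C₁ + 1) * 2 ^ j := by
    intro ξ hξ
    calc ‖(ξ : Plane)‖ ≤ ‖ξ₀‖ + ‖(ξ : Plane) - ξ₀‖ := norm_le_norm_add_norm_sub' _ _
      _ ≤ C₁ * N * 2 ^ ι + 1 * 2 ^ ι := add_le_add hξ1 ((hX ξ hξ).trans_eq (one_mul _).symm)
      _ ≤ C₁ * N * 2 ^ ι + N * 2 ^ ι := by gcongr
      _ = (C₁ + 1) * (N * 2 ^ ι) := by ring
      _ ≤ (C₁ + 1) * (4 * 2 ^ j) := by gcongr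
      _ = _ := by ring
  set ρ : ℝ → ℝ → ℝ≥0∞ := fun t s => ofReal (((1 + N * |s - t|) ^ 2)⁻¹)
  set Γ : ℝ → ℤ² → ℝ≥0∞ := fun t q => ∫⁻ s, ρ t s * cellMass φ ι ξ₀ v q s with hΓ
  set D : ℤ² → ℝ≥0∞ := fun q => ∫⁻ z in planeCube ι q ×ˢ (univ : Set ℝ), ‖w z‖ₑ ^ 2 with hD
  have hcm : ∀ q', Measurable fun s => cellMass φ ι ξ₀ v q' s := by
    intro q'
    refine Finset.measurable_sum _ fun ξ _ => ?_
    have : Measurable (xMult (φ.toFun ξ) v) := by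
      rw [← hva]
      exact measurable_xMult_stMult φ hasym (hasym.stAdm_of_memLp hv) hv.1 ξ
    exact (this.enorm.pow_const 2).lintegral_prod_left'
  have hΓm : ∀ q, Measurable fun t => Γ t q := fun q =>
    Measurable.lintegral_prod_right' (f := fun p : ℝ × ℝ => ρ p.1 p.2 * cellMass φ ι ξ₀ v q p.2)
      (Measurable.mul (by fun_prop) ((hcm q).comp measurable_snd))
  have hVΓ : ∀ t q, ∑' z, wt e z * ∫⁻ s, ρ t s * ∫⁻ x in planeCube ι (q - z), ‖V (x, s)‖ₑ ^ 2 ≤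
      CV * c * ∑' z, wt e z * Γ t (q - z) := by
    intro t q
    calc _ ≤ ∑' z, wt e z * (CV * ∑' z', wt e z' * Γ t (q - z - z')) := by
          refine tsum_le_tsum fun z => mul_le_mul' le_rfl ?_
          rw [hΓ, ← lintegral_mul_tsum (by fun_prop) fun z' => hcm (q - z - z'),
            ← lintegral_const_mul' _ _ hCV]
          refine lintegral_mono_ae ?_
          filter_upwards [hVp ι ξ₀ hr1 hasym hv hva] with s hs
          refine (mul_le_mul' le_rfl (hs (q - z))).trans_eq ?_
          simp only [cellMass, ← hr₁]
          ring
      _ = CV * ∑' z, wt e z * ∑' z', wt e z' * Γ t (q - z - z') := by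
          rw [← ENNReal.tsum_mul_left]
          exact tsum_congr fun z => mul_left_comm _ _ _
      _ ≤ _ := by
          rw [mul_assoc]
          exact mul_le_mul' le_rfl (tsum_wt_tsum_wt_le he _ _)
  have hwD : ∀ q, ∑' z, wt e z * ⨆ s, ∫⁻ x in planeCube ι (q - z), ‖w (x, s)‖ₑ ^ 2 ≤
      Cw * c * 2 ^ k * ∑' z, wt e z * D (q - z) := by
    intro q
    calc _ ≤ ∑' z, wt e z * (Cw * 2 ^ k * ∑' z', wt e z' * D (q - z - z')) :=
          tsum_le_tsum fun z => mul_le_mul' le_rfl (iSup_le fun s => hwp ι k hw hw2 hwk s _)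
      _ = Cw * 2 ^ k * ∑' z, wt e z * ∑' z', wt e z' * D (q - z - z') := by
          rw [← ENNReal.tsum_mul_left]
          exact tsum_congr fun z => mul_left_comm _ _ _
      _ ≤ Cw * 2 ^ k * (c * ∑' z, wt e z * D (q - z)) :=
          mul_le_mul' le_rfl (tsum_wt_tsum_wt_le he _ _)
      _ = _ := by ring
  have hblock : ∀ t, ∑' q, wt (e + e + 3) q * ∫⁻ t in Icc t (t + N⁻¹), ∫⁻ x in planeCube ι (p - q),
      ‖g (x, t)‖ₑ ^ 2 ≤ B * 2 ^ k * (∑' z, wt e z * Γ t (p - z)) * ∑' y, wt e y * D (p - y) := by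
    intro t
    calc _ ≤ ∑' q, wt 3 q * (CB * (CV * c) * (Cw * c) * 2 ^ k * (∑' z, wt e z * Γ t (p - z)) *
          ∑' y, wt e y * D (p - y)) := by
          refine tsum_le_tsum fun q => ?_
          have h1 := hBil ι hN1 hιN hξ1 hξ2 hVm hw hVr hwι t (p - q)
          have h2 := h1.trans (mul_le_mul' (mul_le_mul' le_rfl (hVΓ t (p - q))) (hwD (p - q)))
          rw [wt_add, wt_add]
          calc _ ≤ wt e q * wt e q * wt 3 q * (CB * (CV * c * ∑' z, wt e z * Γ t (p - q - z)) *
                (Cw * c * 2 ^ k * ∑' z, wt e z * D (p - q - z))) := mul_le_mul' le_rfl h2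
            _ = wt 3 q * (CB * (CV * c) * (Cw * c) * 2 ^ k *
                (wt e q * ∑' z, wt e z * Γ t (p - q - z)) *
                (wt e q * ∑' z, wt e z * D (p - q - z))) := by ring
            _ ≤ _ := mul_le_mul' le_rfl (mul_le_mul' (mul_le_mul' le_rfl (wt_mul_tsum_le e (Γ t) p q))
                (wt_mul_tsum_le e D p q))
      _ = _ := by
          rw [ENNReal.tsum_mul_right, ← wtMass, hB]
          ring
  have hWm : ∀ q, Measurable fun s => ∫⁻ y in planeCube ι (p - q), ‖g (y, s)‖ₑ ^ 2 := fun q =>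
    (hgm.enorm.pow_const 2).lintegral_prod_left'
  have hWm' : Measurable fun s => ∑' q, wt (e + e + 3) q * ∫⁻ y in planeCube ι (p - q), ‖g (y, s)‖ₑ ^ 2 :=
    Measurable.tsum fun q => (hWm q).const_mul _
  have hom : ∀ ξ, Measurable fun t => ∫⁻ x in planeCube ι p,
      ‖stMult (fun ζ => φ.toFun ξ ζ.1 * symModLe φ₀ j (-(i : ℤ)) ζ) g (x, t)‖ₑ ^ 2 := fun ξ =>
    (((hsym ξ).measurable_stMult hg2.1).enorm.pow_const 2).lintegral_prod_left'
  calc _ = ∫⁻ t in Icc t₀ (t₀ + N⁻¹), ∑ ξ ∈ X, ∫⁻ x in planeCube ι p,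
        ‖stMult (fun ζ => φ.toFun ξ ζ.1 * symModLe φ₀ j (-(i : ℤ)) ζ) g (x, t)‖ₑ ^ 2 := by
        rw [lintegral_finsetSum _ fun ξ _ => hom ξ]
        exact sum_congr rfl fun ξ hξ => by rw [hout ξ hξ]
    _ ≤ ∫⁻ t in Icc t₀ (t₀ + N⁻¹), ∫⁻ r, M r *
        ∑' q, wt (e + e + 3) q * ∫⁻ y in planeCube ι (p - q), ‖g (y, t - r)‖ₑ ^ 2 := by
        refine lintegral_mono fun t => (hS X hXn g hgm hgi hg2 t p).trans_eq ?_
        rw [← lintegral_sub_left_eq_self _ t]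
        simp only [sub_sub_cancel]
    _ = ∫⁻ r, M r * ∑' q, wt (e + e + 3) q * ∫⁻ t in Icc (t₀ - r) (t₀ - r + N⁻¹),
        ∫⁻ y in planeCube ι (p - q), ‖g (y, t)‖ₑ ^ 2 := by
        rw [lintegral_lintegral_swap]
        · refine lintegral_congr fun r => ?_
          have hm1 : Measurable fun t => ∑' q, wt (e + e + 3) q *
              ∫⁻ y in planeCube ι (p - q), ‖g (y, t - r)‖ₑ ^ 2 :=
            hWm'.comp (by fun_prop : Measurable fun t : ℝ => t - r)
          have hm2 : ∀ q, Measurable fun t => wt (e + e + 3) q *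
              ∫⁻ y in planeCube ι (p - q), ‖g (y, t - r)‖ₑ ^ 2 := fun q =>
            ((hWm q).comp (by fun_prop : Measurable fun t : ℝ => t - r)).const_mul _
          rw [lintegral_const_mul _ hm1, lintegral_tsum fun q => (hm2 q).aemeasurable]
          congr 1
          refine tsum_congr fun q => ?_
          rw [lintegral_const_mul' _ _ (wt_ne_top _ q), setLIntegral_Icc_comp_sub
            (fun t => ∫⁻ y in planeCube ι (p - q), ‖g (y, t)‖ₑ ^ 2)]
        · exact ((hM.comp measurable_snd).mul (hWm'.comp (by fun_prop :
            Measurable fun a : ℝ × ℝ => a.1 - a.2))).aemeasurable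
    _ ≤ ∫⁻ r, M r * (B * 2 ^ k * (∑' z, wt e z * Γ (t₀ - r) (p - z)) * ∑' y, wt e y * D (p - y)) :=
        lintegral_mono fun r => mul_le_mul' le_rfl (hblock (t₀ - r))
    _ = B * 2 ^ k * (∫⁻ r, M r * ∑' z, wt e z * Γ (t₀ - r) (p - z)) * ∑' y, wt e y * D (p - y) := by
        have hm : Measurable fun r => M r * ∑' z, wt e z * Γ (t₀ - r) (p - z) :=
          hM.mul (Measurable.tsum fun z => ((hΓm _).comp (by fun_prop :
            Measurable fun r : ℝ => t₀ - r)).const_mul _)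
        rw [← lintegral_const_mul _ hm, ← lintegral_mul_const _ (hm.const_mul _)]
        refine lintegral_congr fun r => ?_
        ring
    _ ≤ _ := by gcongr; exact le_add_self

/-! ### Sums of cubes along lines -/

/-- The lattice point `m` of the plane. -/
def latPt (m : ℤ²) : Plane := WithLp.toLp 2 fun a => (m a : ℝ)

lemma latPt_apply (m : ℤ²) (d : Fin 2) : latPt m d = m d := rfl

lemma latPt_add (m m' : ℤ²) : latPt (m + m') = latPt m + latPt m' := by
  ext d; simp [latPt]

lemma inner_plane (x y : Plane) : inner ℝ x y = x 0 * y 0 + x 1 * y 1 := by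
  rw [PiLp.inner_apply, Fin.sum_univ_two]
  simp [mul_comm]

lemma shiftedLine_inter_nonempty (i : ℕ) {n : Plane} (hn : ‖n‖ = 1) (m : ℤ²) :
    (planeCube i m ∩ shiftedLine n i (round (inner ℝ n (latPt m)))).Nonempty := by
  set δ : ℝ := round (inner ℝ n (latPt m)) - inner ℝ n (latPt m) with hδ
  have hδ1 : |δ| ≤ 1 / 2 := by rw [hδ, abs_sub_comm]; exact abs_sub_round _
  have hnn : n 0 ^ 2 + n 1 ^ 2 = 1 := by
    have h1 : inner ℝ n n = (1 : ℝ) := by rw [real_inner_self_eq_norm_sq, hn]; norm_num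
    rw [inner_plane] at h1; linarith
  have hcoord : ∀ d, |δ * n d| < 1 / 2 := by
    intro d
    by_cases h1 : |n d| < 1
    · rw [abs_mul]
      rcases eq_or_ne δ 0 with h0 | h0
      · rw [h0]; norm_num
      · nlinarith [abs_pos.2 h0, abs_nonneg (n d)]
    · have hd : n d ^ 2 = 1 := by
        have h2 : 1 ≤ n d ^ 2 := by rw [← sq_abs]; nlinarith
        fin_cases d <;> simp only [Fin.zero_eta, Fin.mk_one] at h2 ⊢ <;> nlinarith [sq_nonneg (n 0), sq_nonneg (n 1)]
      have hint : ∃ z : ℤ, inner ℝ n (latPt m) = z := by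
        rw [inner_plane]
        fin_cases d <;> simp only [Fin.zero_eta, Fin.mk_one] at hd
        · have h3 : n 1 = 0 := by nlinarith [sq_nonneg (n 1)]
          rcases mul_self_eq_one_iff.1 ((sq _).symm.trans hd) with h4 | h4
          · exact ⟨m 0, by simp [h3, h4, latPt]⟩
          · exact ⟨-m 0, by simp [h3, h4, latPt]⟩
        · have h3 : n 0 = 0 := by nlinarith [sq_nonneg (n 0)]
          rcases mul_self_eq_one_iff.1 ((sq _).symm.trans hd) with h4 | h4
          · exact ⟨m 1, by simp [h3, h4, latPt]⟩
          · exact ⟨-m 1, by simp [h3, h4, latPt]⟩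
      obtain ⟨z, hz⟩ := hint
      rw [hδ, hz, round_intCast, sub_self, zero_mul, abs_zero]
      norm_num
  have h2 : (0 : ℝ) < 2 ^ i := by positivity
  refine ⟨(2 ^ i : ℝ) • (latPt m + δ • n), fun d => ?_, (2 ^ i : ℝ) • (latPt m + δ • n) -
    ((round (inner ℝ n (latPt m)) : ℤ) * 2 ^ i : ℝ) • n, ?_, by abel⟩
  · have := abs_lt.1 (hcoord d)
    simp only [PiLp.smul_apply, PiLp.add_apply, smul_eq_mul, latPt_apply]
    constructor <;> nlinarith
  · rw [inner_sub_right, inner_smul_right, inner_smul_right, inner_add_right, inner_smul_right,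
      real_inner_self_eq_norm_sq, hn, hδ]
    ring

lemma tsum_subtype_le_lineSum (i : ℕ) (a : ℤ² → ℝ≥0∞) {n : Plane} (hn : ‖n‖ = 1) (k : ℤ) :
    ∑' m, {m | (planeCube i m ∩ shiftedLine n i k).Nonempty}.indicator a m ≤ lineSum i a := by
  rw [← tsum_subtype]
  exact (le_iSup (fun k : ℤ => ∑' m : {m : ℤ² //
    (planeCube i m ∩ shiftedLine n i k).Nonempty}, a m) k).trans
    (le_iSup (fun n : {n : Plane // ‖n‖ = 1} => ⨆ k : ℤ, ∑' m : {m : ℤ² //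
    (planeCube i m ∩ shiftedLine n i k).Nonempty}, a m) ⟨n, hn⟩)

/-- The cubes in a strip are covered by a bounded number of lines. -/
lemma tsum_strip_le_lineSum (i : ℕ) (a : ℤ² → ℝ≥0∞) {n : Plane} (hn : ‖n‖ = 1) (τ : ℝ)
    (R : ℕ) : ∑' m, {m | |inner ℝ n (latPt m) - τ| ≤ R}.indicator a m ≤
      (2 * R + 2 : ℕ) * lineSum i a := by
  set S : Finset ℤ := Finset.Icc ⌈τ - R - 1 / 2⌉ ⌊τ + R + 1 / 2⌋ with hS
  have hcard : S.card ≤ 2 * R + 2 := by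
    rw [hS, Int.card_Icc, Int.toNat_le]
    have h1 := Int.le_ceil (τ - R - 1 / 2)
    have h2 := Int.floor_le (τ + R + 1 / 2)
    have h3 : ((⌊τ + R + 1 / 2⌋ + 1 - ⌈τ - R - 1 / 2⌉ : ℤ) : ℝ) ≤ ((2 * R + 2 : ℕ) : ℤ) := by
      push_cast; linarith
    exact_mod_cast h3
  calc _ ≤ ∑' m, ∑ k ∈ S, {m | (planeCube i m ∩ shiftedLine n i k).Nonempty}.indicator a m := by
        refine tsum_le_tsum fun m => ?_
        by_cases hm : m ∈ {m | |inner ℝ n (latPt m) - τ| ≤ R}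
        swap
        · rw [indicator_of_notMem hm]; exact zero_le
        rw [indicator_of_mem hm]
        set k := round (inner ℝ n (latPt m))
        have h1 := abs_le.1 (abs_sub_round (inner ℝ n (latPt m)))
        have h2 := abs_le.1 (show |inner ℝ n (latPt m) - τ| ≤ R from hm)
        have hkS : k ∈ S := by
          rw [hS, Finset.mem_Icc, Int.ceil_le, Int.le_floor]
          constructor <;> linarith
        refine le_trans (le_of_eq ?_) (Finset.single_le_sum (f := fun k : ℤ =>
          {m | (planeCube i m ∩ shiftedLine n i k).Nonempty}.indicator a m) (fun _ _ => zero_le) hkS)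
        exact (indicator_of_mem (s := {m | (planeCube i m ∩ shiftedLine n i k).Nonempty})
          (shiftedLine_inter_nonempty i hn m) a).symm
    _ = ∑ k ∈ S, ∑' m, {m | (planeCube i m ∩ shiftedLine n i k).Nonempty}.indicator a m :=
        Summable.tsum_finsetSum fun _ _ => ENNReal.summable
    _ ≤ ∑ k ∈ S, lineSum i a := sum_le_sum fun k _ => tsum_subtype_le_lineSum i a hn k
    _ ≤ _ := by
        rw [Finset.sum_const, nsmul_eq_mul]
        gcongr

lemma lineSum_shift_le (i : ℕ) (a : ℤ² → ℝ≥0∞) (s : ℤ²) :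
    lineSum i (fun m => a (m + s)) ≤ 6 * lineSum i a := by
  refine iSup_le fun n => iSup_le fun k => ?_
  have hn := n.2
  refine (tsum_subtype {m | (planeCube i m ∩ shiftedLine n i k).Nonempty}
    (fun m => a (m + s))).le.trans (le_trans ?_ ((tsum_strip_le_lineSum i a hn (k + inner ℝ (n : Plane) (latPt s)) 2).trans_eq
    (by norm_num)))
  rw [← (Equiv.addRight s).tsum_eq ({m | |inner ℝ (n : Plane) (latPt m) -
    (k + inner ℝ (n : Plane) (latPt s))| ≤ (2 : ℕ)}.indicator a)]
  refine tsum_le_tsum fun m => ?_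
  by_cases hm : m ∈ {m | (planeCube i m ∩ shiftedLine n i k).Nonempty}
  swap
  · rw [indicator_of_notMem hm]; exact zero_le
  rw [indicator_of_mem hm, indicator_of_mem, Equiv.coe_addRight]
  rw [mem_ofPred_eq, Equiv.coe_addRight, latPt_add, inner_add_right, add_sub_add_right_eq_sub]
  obtain ⟨x, hx, y, hy, hxy⟩ := hm
  have h2 : (0 : ℝ) < 2 ^ i := by positivity
  have h3 : inner ℝ (n : Plane) x = (k : ℝ) * 2 ^ i := by
    rw [hxy, inner_add_right, hy, inner_smul_right, real_inner_self_eq_norm_sq, hn]; ring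
  have h4 : ‖(2 ^ i : ℝ) • latPt m - x‖ ≤ 2 * 2 ^ i := by
    refine norm_le_two_mul_of_coord fun d => ?_
    rw [PiLp.sub_apply, abs_sub_comm]
    exact abs_sub_center_le hx d
  have h5 : |inner ℝ (n : Plane) ((2 ^ i : ℝ) • latPt m - x)| ≤ 2 * 2 ^ i := by
    refine (abs_real_inner_le_norm _ _).trans ?_
    rwa [hn, one_mul]
  rw [inner_sub_right, inner_smul_right, h3, mul_comm (k : ℝ), ← mul_sub, abs_mul, abs_of_pos h2,
    mul_comm] at h5
  have := le_of_mul_le_mul_right h5 h2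
  exact_mod_cast this

lemma exists_unit_normal (c : Plane) : ∃ n : Plane, ‖n‖ = 1 ∧ inner ℝ n c = 0 := by
  rcases eq_or_ne c 0 with rfl | hc
  · exact ⟨EuclideanSpace.single 0 1, by simp, by simp⟩
  · have hne : (!₂[-c 1, c 0] : Plane) ≠ 0 := by
      intro h
      refine hc ?_
      ext d
      fin_cases d
      · simpa using congrArg (fun x : Plane => x 1) h
      · simpa using congrArg (fun x : Plane => x 0) h
    refine ⟨‖(!₂[-c 1, c 0] : Plane)‖⁻¹ • !₂[-c 1, c 0], ?_, ?_⟩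
    · rw [norm_smul, norm_inv, norm_norm, inv_mul_cancel₀ (norm_ne_zero_iff.2 hne)]
    · rw [inner_smul_left, inner_plane]
      simp; right; ring

/-- The displacement, in cubes, after the time `a / N` along a tube of velocity `-2 c`. -/
def drift (N : ℕ) (c : ℤ²) (a : ℕ) : ℤ² :=
  fun d => ⌊2 * ((a : ℝ) / N) * c d⌋

lemma sum_drift_le_lineSum {N : ℕ} (hN : 0 < N) {c : ℤ²} {c₀ N₀ : ℝ} (hc₀ : 0 < c₀)
    (h : (N : ℝ) ≤ N₀ ∨ c₀ * N ≤ ‖latPt c‖) (ι : ℕ) (D : ℤ² → ℝ≥0∞)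
    (b : ℤ²) : ∑ a ∈ Finset.range N, D (b - drift N c a) ≤
      ((⌊N₀⌋₊ + ⌊c₀⁻¹⌋₊ + 1) * 6 : ℕ) * lineSum ι D := by
  classical
  obtain ⟨n, hn, hnc⟩ := exists_unit_normal (latPt c)
  have hNR : (0 : ℝ) < N := by exact_mod_cast hN
  set K := ⌊N₀⌋₊ + ⌊c₀⁻¹⌋₊ + 1
  have hfib : ∀ m, (({a ∈ Finset.range N | b - drift N c a = m} : Finset ℕ)).card ≤ K := by
    intro m
    rcases h with h | h
    · refine (Finset.card_filter_le _ _).trans ?_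
      rw [Finset.card_range]
      have := Nat.le_floor h
      omega
    · obtain ⟨d, hd⟩ : ∃ d, c₀ * N ≤ 2 * |(c d : ℝ)| := by
        by_contra hcon
        simp only [not_exists, not_le] at hcon
        have h0 : ‖latPt c‖ ≤ |latPt c 0| + |latPt c 1| := by
          rw [EuclideanSpace.norm_eq, Fin.sum_univ_two, norm_eq_abs, norm_eq_abs]
          refine Real.sqrt_le_iff.2 ⟨by positivity, ?_⟩
          nlinarith [abs_nonneg (latPt c 0), abs_nonneg (latPt c 1)]
        rw [latPt_apply, latPt_apply] at h0
        linarith [hcon 0, hcon 1]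
      set S : Finset ℕ := {a ∈ Finset.range N | b - drift N c a = m} with hS
      rcases S.eq_empty_or_nonempty with hSe | hSe
      · rw [hSe]; simp
      set a₀ := S.min' hSe
      have hsub : S ⊆ Finset.Icc a₀ (a₀ + ⌊c₀⁻¹⌋₊) := by
        intro a ha
        have h1 : a₀ ≤ a := S.min'_le a ha
        rw [Finset.mem_Icc]
        refine ⟨h1, ?_⟩
        have e1 := (Finset.mem_filter.1 ha).2
        have e2 := (Finset.mem_filter.1 (S.min'_mem hSe)).2
        have e3 : drift N c a d = drift N c a₀ d := by
          have := congrFun (e1.trans e2.symm) d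
          simp only [Pi.sub_apply] at this
          linarith
        simp only [drift] at e3
        have e4 := Int.abs_sub_lt_one_of_floor_eq_floor e3
        have e5 : ((a : ℝ) - a₀) * c₀ ≤ 1 := by
          have h2 : (0 : ℝ) ≤ (a : ℝ) - a₀ := by
            have : (a₀ : ℝ) ≤ a := by exact_mod_cast h1
            linarith
          rw [show 2 * ((a : ℝ) / N) * c d - 2 * ((a₀ : ℝ) / N) * c d =
            (((a : ℝ) - a₀) / N) * (2 * c d) by ring, abs_mul, abs_mul, abs_two,
            abs_of_nonneg (by positivity)] at e4
          calc ((a : ℝ) - a₀) * c₀ = (((a : ℝ) - a₀) / N) * (c₀ * N) := by field_simp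
            _ ≤ (((a : ℝ) - a₀) / N) * (2 * |(c d : ℝ)|) := by gcongr
            _ ≤ 1 := e4.le
        have e6 : ((a - a₀ : ℕ) : ℝ) ≤ c₀⁻¹ := by
          rw [Nat.cast_sub h1, ← one_div, le_div_iff₀ hc₀]; exact e5
        have := Nat.le_floor e6
        omega
      refine (Finset.card_le_card hsub).trans ?_
      rw [Nat.card_Icc]; omega
  calc ∑ a ∈ Finset.range N, D (b - drift N c a)
      = ∑' m, ∑ a ∈ Finset.range N, if b - drift N c a = m then D m else 0 := by
        rw [Summable.tsum_finsetSum fun _ _ => ENNReal.summable]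
        refine sum_congr rfl fun a _ => ?_
        rw [tsum_eq_single (b - drift N c a) fun m hm => if_neg hm.symm, if_pos rfl]
    _ ≤ ∑' m, K * {m | |inner ℝ n (latPt m) - inner ℝ n (latPt b)| ≤ (2 : ℕ)}.indicator D m := by
        refine tsum_le_tsum fun m => ?_
        rw [← Finset.sum_filter, Finset.sum_const, nsmul_eq_mul]
        rcases Finset.eq_empty_or_nonempty {a ∈ Finset.range N | b - drift N c a = m} with hS | ⟨a, ha⟩
        · rw [hS]; simp
        · rw [indicator_of_mem]
          · gcongr
            exact hfib m
          · have h1 := (Finset.mem_filter.1 ha).2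
            set s : ℝ := 2 * ((a : ℝ) / N) with hs
            have h2 : latPt m - latPt b = (-s) • latPt c + (s • latPt c - latPt (drift N c a)) := by
              rw [← h1]
              ext d
              simp [latPt]
              ring
            rw [mem_ofPred_eq, ← inner_sub_right, h2, inner_add_right, inner_smul_right, hnc, mul_zero,
              zero_add]
            refine (abs_real_inner_le_norm _ _).trans ?_
            rw [hn, one_mul]
            refine (norm_le_two_mul_of_coord (R := 1) fun d => ?_).trans (by norm_num)
            simp only [PiLp.sub_apply, PiLp.smul_apply, smul_eq_mul, latPt_apply, drift, ← hs]
            rw [Int.self_sub_floor, abs_of_nonneg (Int.fract_nonneg _)]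
            exact (Int.fract_lt_one _).le
    _ = K * ∑' m, {m | |inner ℝ n (latPt m) - inner ℝ n (latPt b)| ≤ (2 : ℕ)}.indicator D m :=
        ENNReal.tsum_mul_left
    _ ≤ K * ((2 * 2 + 2 : ℕ) * lineSum ι D) := by
        gcongr
        exact tsum_strip_le_lineSum ι D hn _ 2
    _ = _ := by push_cast; ring

/-! ### Square sums over tubes -/

open Classical in
/-- The indicator of a proposition. -/
def ind (p : Prop) : ℝ≥0∞ := if p then 1 else 0

lemma ind_mul_le {p : Prop} {a b : ℝ≥0∞} (h : p → a ≤ b) : ind p * a ≤ b := by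
  by_cases hp : p
  · rw [ind, if_pos hp, one_mul]; exact h hp
  · rw [ind, if_neg hp, zero_mul]; exact zero_le

lemma ind_of {p : Prop} (h : p) : ind p = 1 := if_pos h

lemma ind_le_one (p : Prop) : ind p ≤ 1 := by
  simpa using ind_mul_le (p := p) (a := 1) (b := 1) fun _ => le_rfl

lemma sq_lintegral_le {α : Type*} [MeasurableSpace α] (μ : Measure α) (f : α → ℝ≥0∞) :
    (∫⁻ x, f x ∂μ) ^ 2 ≤ μ univ * ∫⁻ x, f x ^ 2 ∂μ := by
  obtain ⟨g, hg, hgf, hgi⟩ := exists_measurable_le_lintegral_eq μ f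
  have h := lintegral_mul_sq_le (μ := μ) (f := fun _ => 1) aemeasurable_const hg.aemeasurable
  simp only [one_mul, one_pow, lintegral_one] at h
  rw [hgi]
  exact h.trans (mul_le_mul' le_rfl (lintegral_mono fun x => pow_le_pow_left' (hgf x) 2))

lemma tsum_lintegral_le {α β : Type*} [MeasurableSpace α] (μ : Measure α) (f : β → α → ℝ≥0∞) :
    ∑' b, ∫⁻ x, f b x ∂μ ≤ ∫⁻ x, ∑' b, f b x ∂μ := by
  classical
  rw [ENNReal.tsum_eq_iSup_sum]
  refine iSup_le fun s => ?_
  refine le_trans ?_ (lintegral_mono fun x => ENNReal.sum_le_tsum s)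
  induction s using Finset.induction_on with
  | empty => simp
  | insert b s hb ih =>
    simp only [Finset.sum_insert hb]
    exact (add_le_add le_rfl ih).trans (le_lintegral_add _ _)

lemma tsum_sq_sum_le {α β : Type*} (s : Finset β) (x : β → α → ℝ≥0∞) (y : β → ℝ≥0∞)
    (h : ∀ b ∈ s, ∑' a, x b a ^ 2 ≤ y b ^ 2) : ∑' a, (∑ b ∈ s, x b a) ^ 2 ≤ (∑ b ∈ s, y b) ^ 2 := by
  simp only [sq (∑ b ∈ s, _), Finset.sum_mul_sum]
  rw [Summable.tsum_finsetSum fun _ _ => ENNReal.summable]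
  refine sum_le_sum fun b hb => ?_
  rw [Summable.tsum_finsetSum fun _ _ => ENNReal.summable]
  refine sum_le_sum fun c hc => ?_
  rw [← pow_le_pow_left_iff two_ne_zero]
  exact (tsum_mul_sq_le _ _).trans ((mul_le_mul' (h b hb) (h c hc)).trans_eq (mul_pow _ _ 2).symm)

lemma exists_sq_eq (x : ℝ≥0∞) : ∃ y : ℝ≥0∞, y ^ 2 = x := by
  refine ⟨x ^ (1 / 2 : ℝ), ?_⟩
  rw [← rpow_natCast, ← rpow_mul]
  norm_num

lemma eLpNorm_two_sq {α : Type*} [MeasurableSpace α] (μ : Measure α) (f : α → ℂ) :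
    eLpNorm f 2 μ ^ 2 = ∫⁻ x, ‖f x‖ₑ ^ 2 ∂μ := by
  rw [eLpNorm_eq_lintegral_rpow_enorm_toReal two_ne_zero ENNReal.ofNat_ne_top, ← rpow_natCast,
    ← rpow_mul]
  norm_num

lemma tubeSlice_sq (ξ : Plane) (m : ℤ²) (f : ℂˢᵗ) (t : ℝ) :
    tubeSlice ξ m f t ^ 2 = ∫⁻ x in {x | x + (2 * t) • ξ ∈ planeCube 0 m}, ‖f (x, t)‖ₑ ^ 2 :=
  eLpNorm_two_sq _ _

lemma measurable_tubeSlice {f : ℂˢᵗ} (hf : Measurable f) (ξ : Plane) (m : ℤ²) :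
    Measurable (tubeSlice ξ m f) := by
  have hS : MeasurableSet {z : SpaceTime | z.1 + (2 * z.2) • ξ ∈ planeCube 0 m} :=
    (by fun_prop : Measurable fun z : SpaceTime => z.1 + (2 * z.2) • ξ) (measurableSet_planeCube 0 m)
  have h1 : tubeSlice ξ m f = fun t => (∫⁻ x : Plane,
      {z : SpaceTime | z.1 + (2 * z.2) • ξ ∈ planeCube 0 m}.indicator (fun z => ‖f z‖ₑ ^ 2) (x, t))
        ^ (1 / 2 : ℝ) := by
    ext t
    have h2 : ∫⁻ x : Plane, {z : SpaceTime | z.1 + (2 * z.2) • ξ ∈ planeCube 0 m}.indicator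
        (fun z => ‖f z‖ₑ ^ 2) (x, t) = tubeSlice ξ m f t ^ 2 := by
      rw [tubeSlice_sq, ← lintegral_indicator]
      · rfl
      · exact (by fun_prop : Measurable fun x : Plane => x + (2 * t) • ξ) (measurableSet_planeCube 0 m)
    rw [h2, ← rpow_natCast, ← rpow_mul]
    norm_num
  rw [h1]
  exact (((hf.enorm.pow_const 2).indicator hS).lintegral_prod_left').pow_const _

/-- The norm of `L^∞_t L²_x(T_ξ^{m,l})`. -/
def tubeSup (ξ : Plane) (m : ℤ²) (l : ℤ) (f : ℂˢᵗ) : ℝ≥0∞ :=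
  essSup (tubeSlice ξ m f) (volume.restrict (Icc (l : ℝ) (l + 1)))

/-- The norm of `L^1_t L²_x(T_ξ^{m,l})`. -/
def tubeInt (ξ : Plane) (m : ℤ²) (l : ℤ) (f : ℂˢᵗ) : ℝ≥0∞ :=
  ∫⁻ t in Icc (l : ℝ) (l + 1), tubeSlice ξ m f t

lemma ae_tubeSlice_le (ξ : Plane) (f : ℂˢᵗ) :
    ∀ᵐ s : ℝ, ∀ m, tubeSlice ξ m f s ≤ tubeSup ξ m ⌊s⌋ f := by
  have h : ∀ᵐ s : ℝ, ∀ l : ℤ, ∀ m, s ∈ Icc (l : ℝ) (l + 1) → tubeSlice ξ m f s ≤ tubeSup ξ m l f :=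
    ae_all_iff.2 fun l => ae_all_iff.2 fun m =>
      (ae_restrict_iff' measurableSet_Icc).1 (ENNReal.ae_le_essSup (tubeSlice ξ m f))
  filter_upwards [h] with s hs m
  exact hs ⌊s⌋ m ⟨Int.floor_le s, (Int.lt_floor_add_one s).le⟩

lemma ae_lintegral_planeCube_le (ξ : Plane) (f : ℂˢᵗ) : ∀ᵐ s : ℝ, ∀ (ι : ℕ) p,
    ∫⁻ x in planeCube ι p, ‖f (x, s)‖ₑ ^ 2 ≤ ∑' m,
      ind (∃ x ∈ planeCube ι p, x + (2 * s) • ξ ∈ planeCube 0 m) * tubeSup ξ m ⌊s⌋ f ^ 2 := by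
  filter_upwards [ae_tubeSlice_le ξ f] with s hs ι p
  have h1 : planeCube ι p = ⋃ m, planeCube ι p ∩ {x | x + (2 * s) • ξ ∈ planeCube 0 m} := by
    rw [← inter_iUnion, eq_comm, inter_eq_left]
    exact fun x _ => mem_iUnion.2 ⟨_, mem_planeCube_iff.2 rfl⟩
  conv_lhs => rw [h1]
  refine (lintegral_iUnion_le _ _).trans (tsum_le_tsum fun m => ?_)
  by_cases h : ∃ x ∈ planeCube ι p, x + (2 * s) • ξ ∈ planeCube 0 m
  · rw [ind_of h, one_mul]
    refine (lintegral_mono_set inter_subset_right).trans ?_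
    rw [← tubeSlice_sq]
    exact pow_le_pow_left' (hs m) 2
  · have : planeCube ι p ∩ {x | x + (2 * s) • ξ ∈ planeCube 0 m} = ∅ :=
      eq_empty_of_forall_notMem fun x hx => h ⟨x, hx.1, hx.2⟩
    rw [this]
    simp

lemma ind_ne_top (p : Prop) : ind p ≠ ⊤ := ((ind_le_one p).trans_lt ENNReal.one_lt_top).ne

lemma tsum_tubeSlice_sq_le (ξ : Plane) (f : ℂˢᵗ) (P B : ℤ² → Prop) (t : ℝ) (ι : ℕ)
    (h : ∀ m x, P m → x + (2 * t) • ξ ∈ planeCube 0 m → B (cubeIdx ι x)) :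
    ∑' m, ind (P m) * tubeSlice ξ m f t ^ 2 ≤
      ∑' p, ind (B p) * ∫⁻ x in planeCube ι p, ‖f (x, t)‖ₑ ^ 2 := by
  have hm : ∀ m, MeasurableSet {x : Plane | x + (2 * t) • ξ ∈ planeCube 0 m} := fun m =>
    (by fun_prop : Measurable fun x : Plane => x + (2 * t) • ξ) (measurableSet_planeCube 0 m)
  set T : Set Plane := {x | B (cubeIdx ι x)}
  have hTm : MeasurableSet T := measurable_cubeIdx ι (Set.to_countable {p | B p}).measurableSet
  calc _ ≤ ∑' m, ∫⁻ x in {x : Plane | x + (2 * t) • ξ ∈ planeCube 0 m} ∩ T, ‖f (x, t)‖ₑ ^ 2 := by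
        refine tsum_le_tsum fun m => ind_mul_le fun hP => ?_
        rw [tubeSlice_sq]
        exact lintegral_mono_set fun x hx => ⟨hx, h m x hP hx⟩
    _ = ∫⁻ x in ⋃ m, {x : Plane | x + (2 * t) • ξ ∈ planeCube 0 m} ∩ T, ‖f (x, t)‖ₑ ^ 2 := by
        rw [lintegral_iUnion fun m => (hm m).inter hTm]
        intro m m' hmm
        refine disjoint_left.2 fun x hx hx' => hmm ?_
        rw [← mem_planeCube_iff.1 hx.1, ← mem_planeCube_iff.1 hx'.1]
    _ ≤ ∫⁻ x in T, ‖f (x, t)‖ₑ ^ 2 := lintegral_mono_set (iUnion_subset fun m => inter_subset_right)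
    _ ≤ _ := by
        rw [← lintegral_indicator hTm, ← tsum_lintegral_planeCube ι]
        refine tsum_le_tsum fun p => ?_
        rw [← lintegral_const_mul' _ _ (ind_ne_top _)]
        refine setLIntegral_mono' (measurableSet_planeCube ι p) fun x hx => ?_
        by_cases hxT : x ∈ T
        · rw [indicator_of_mem hxT, ind_of (mem_planeCube_iff.1 hx ▸ hxT : B p), one_mul]
        · rw [indicator_of_notMem hxT]; exact zero_le

/-- Points within `K` cubes of side `2 ^ ι` of the point `2 ^ ι β`. -/
def CubeNear (ι : ℕ) (K : ℝ) (β : Fin 2 → ℝ) (y : Plane) : Prop := ∀ d, |y d - 2 ^ ι * β d| ≤ K * 2 ^ ι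

lemma one_le_mul_wt (n : ℕ) {K : ℝ} {q : ℤ²} (h : ‖q‖ ≤ K) :
    1 ≤ ofReal ((1 + K) ^ n) * wt n q := by
  have h0 := norm_nonneg q
  have hK : 0 ≤ K := h0.trans h
  rw [wt, ← ofReal_mul (by positivity), ← ofReal_one]
  refine ofReal_le_ofReal ?_
  rw [← div_eq_mul_inv, one_le_div₀ (by positivity)]
  gcongr

lemma norm_int_le {q : ℤ²} {K : ℝ} (hK : 0 ≤ K) (h : ∀ d, |(q d : ℝ)| ≤ K) : ‖q‖ ≤ K :=
  (pi_norm_le_iff_of_nonneg hK).2 fun d => by rw [Int.norm_eq_abs]; exact h d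

lemma CubeNear.one_le {ι : ℕ} {K : ℝ} (hK : 0 ≤ K) {b : ℤ²} {β : Fin 2 → ℝ} {y : Plane}
    (h : CubeNear ι K (fun d => b d + β d) y) : 1 ≤ ofReal ((K + 2) ^ 3) *
      wt 3 (b - fun d => ⌊y d / 2 ^ ι - β d⌋) := by
  have h2 : (0 : ℝ) < 2 ^ ι := by positivity
  rw [show K + 2 = 1 + (K + 1) by ring]
  refine one_le_mul_wt 3 (norm_int_le (by linarith) fun d => ?_)
  have h3 : |y d / 2 ^ ι - β d - b d| ≤ K := by
    rw [show y d / 2 ^ ι - β d - b d = (y d - 2 ^ ι * (b d + β d)) / 2 ^ ι by field_simp; ring, abs_div,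
      abs_of_pos h2, div_le_iff₀ h2]
    exact h d
  have h4 := Int.floor_le (y d / 2 ^ ι - β d)
  have h5 := Int.lt_floor_add_one (y d / 2 ^ ι - β d)
  simp only [Pi.sub_apply, Int.cast_sub]
  rw [abs_le] at h3 ⊢
  constructor <;> linarith [h3.1, h3.2]

lemma tsum_ind_cubeNear_le {ι : ℕ} {K : ℝ} (hK : 0 ≤ K) (β : Fin 2 → ℝ) (y : Plane) :
    ∑' b : ℤ², ind (CubeNear ι K (fun d => b d + β d) y) ≤ ofReal ((K + 2) ^ 3) * wtMass := by
  calc _ ≤ ∑' b : ℤ², ofReal ((K + 2) ^ 3) * wt 3 (b - fun d => ⌊y d / 2 ^ ι - β d⌋) :=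
        tsum_le_tsum fun b => by
          rw [← mul_one (ind _)]
          exact ind_mul_le fun h => h.one_le hK
    _ = _ := by
        rw [ENNReal.tsum_mul_left, wtMass, ← (Equiv.subRight fun d => ⌊y d / 2 ^ ι - β d⌋).tsum_eq (wt 3)]
        rfl

/-! ### Grouping tubes by cells -/

lemma ind_sq (p : Prop) : ind p ^ 2 = ind p := by
  unfold ind; split_ifs <;> simp

lemma lintegral_Icc_le_sum {N : ℕ} (hN : 0 < N) (l : ℝ) (g : ℝ → ℝ≥0∞) :
    ∫⁻ t in Icc l (l + 1), g t ≤
      ∑ a ∈ Finset.range N, ∫⁻ t in Icc (l + a / N) (l + a / N + (N : ℝ)⁻¹), g t := by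
  have hNR : (0 : ℝ) < N := by exact_mod_cast hN
  rw [Finset.sum_range fun a : ℕ => ∫⁻ t in Icc (l + a / N) (l + a / N + (N : ℝ)⁻¹), g t, ← tsum_fintype (L := .unconditional _)]
  refine le_trans (lintegral_mono_set fun t ht => ?_) (lintegral_iUnion_le _ _)
  have h0 : 0 ≤ (t - l) * N := mul_nonneg (by linarith [ht.1]) hNR.le
  have h1 : (t - l) * N ≤ N := by nlinarith [ht.2]
  have key : ∃ a : ℕ, a < N ∧ (a : ℝ) ≤ (t - l) * N ∧ (t - l) * N ≤ a + 1 := by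
    rcases lt_or_eq_of_le h1 with h | h
    · exact ⟨⌊(t - l) * N⌋₊, (Nat.floor_lt h0).2 h, Nat.floor_le h0, (Nat.lt_floor_add_one _).le⟩
    · refine ⟨N - 1, by omega, ?_, ?_⟩ <;> rw [h] <;> push_cast [Nat.one_le_iff_ne_zero.2 hN.ne'] <;>
        linarith
  obtain ⟨a, ha, h2, h3⟩ := key
  refine mem_iUnion.2 ⟨⟨a, ha⟩, ?_, ?_⟩
  · have : (a : ℝ) / N ≤ t - l := (div_le_iff₀ hNR).2 h2
    linarith
  · have : t - l ≤ (a + 1) / N := (le_div_iff₀ hNR).2 h3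
    rw [add_div, one_div] at this
    linarith

/-- The centre, at time `0`, of the tube with velocity `-2 ξ` that is over `Q^m` at time `l`. -/
def tubePt (ξ : Plane) (m : ℤ²) (l : ℤ) : Plane := latPt m - (2 * (l : ℝ)) • ξ

lemma cubeNear_tubePt {ι : ℕ} {B : ℝ} {p m c : ℤ²} {ξ x : Plane} {s : ℝ} {l : ℤ}
    (hx : x ∈ planeCube ι p) (hm : x + (2 * s) • ξ ∈ planeCube 0 m)
    (hξ : ‖ξ - (2 : ℝ) ^ ι • latPt c‖ ≤ B * 2 ^ ι) (hs : |s - l| ≤ 1) :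
    CubeNear ι (2 + 2 * B) (fun d => p d + 2 * (s - l) * c d) (tubePt ξ m l) := by
  intro d
  have h1 := abs_sub_center_le hx d
  have h2 := abs_sub_center_le hm d
  have h3 := (abs_coord_le (ξ - (2 : ℝ) ^ ι • latPt c) d).trans hξ
  have h4 : (1 : ℝ) ≤ 2 ^ ι := one_le_pow₀ (by norm_num)
  have h5 : |2 * (s - l) * (ξ d - 2 ^ ι * c d)| ≤ 2 * (B * 2 ^ ι) := by
    rw [abs_mul, abs_mul, abs_two]
    have : |ξ d - 2 ^ ι * c d| ≤ B * 2 ^ ι := by simpa [latPt_apply] using h3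
    calc _ ≤ 2 * 1 * (B * 2 ^ ι) := by gcongr
      _ = _ := by ring
  simp only [PiLp.add_apply, PiLp.smul_apply, smul_eq_mul, pow_zero, one_mul] at h2
  simp only [tubePt, PiLp.sub_apply, PiLp.smul_apply, smul_eq_mul, latPt_apply]
  rw [abs_le] at *
  constructor <;> linarith [h1.1, h1.2, h2.1, h2.2, h5.1, h5.2]

lemma CubeNear.add {ι : ℕ} {K K' : ℝ} {β β' : Fin 2 → ℝ} {y : Plane} (h : CubeNear ι K β y)
    (hβ : ∀ d, |β d - β' d| ≤ K') : CubeNear ι (K + K') β' y := by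
  intro d
  have h2 : (0 : ℝ) < 2 ^ ι := by positivity
  have h3 : |2 ^ ι * (β d - β' d)| ≤ K' * 2 ^ ι := by
    rw [abs_mul, abs_of_pos h2, mul_comm]
    exact mul_le_mul_of_nonneg_right (hβ d) h2.le
  calc |y d - 2 ^ ι * β' d| = |(y d - 2 ^ ι * β d) + 2 ^ ι * (β d - β' d)| := by congr 1; ring
    _ ≤ _ := (abs_add_le _ _).trans ((add_le_add (h d) h3).trans_eq (by ring))

lemma abs_drift_sub_le {N : ℕ} (c : ℤ²) (a : ℕ) (d : Fin 2) :
    |(drift N c a d : ℝ) - 2 * ((a : ℝ) / N) * c d| ≤ 1 := by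
  have h1 := Int.floor_le (2 * ((a : ℝ) / N) * c d)
  have h2 := Int.lt_floor_add_one (2 * ((a : ℝ) / N) * c d)
  rw [drift, abs_le]
  constructor <;> linarith

variable (φ : PacketPartition)

/-- The radius, in cells, of the neighbourhood of a cell that enters in `cellMass`. -/
def PacketPartition.spread : ℝ := 3 * φ.radius + 10

/-- The square sum of the tubes at time `l` whose direction is close to `ξ₀` and whose position at
time `0` is close to `2 ^ ι β`. -/
def groupSup (ι : ℕ) (ξ₀ : Plane) (v : ℂˢᵗ) (β : Fin 2 → ℝ) (l : ℤ) : ℝ≥0∞ :=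
  ∑ ξ ∈ near ξ₀ (2 * φ.cellRadius ι + φ.radius), ∑' m,
    ind (CubeNear ι (3 + 2 * φ.spread) β (tubePt ξ m l)) * tubeSup ξ m l (xMult (φ.toFun ξ) v) ^ 2

lemma near_spread {ι : ℕ} {ξ₀ : Plane} {ξ : polarLattice}
    (h : ξ ∈ near ξ₀ (2 * φ.cellRadius ι + φ.radius)) : ‖(ξ : Plane) - ξ₀‖ ≤ φ.spread * 2 ^ ι := by
  have h1 := mem_near.1 h
  have h2 := φ.radius_nonneg
  have h3 : (1 : ℝ) ≤ 2 ^ ι := one_le_pow₀ (by norm_num)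
  rw [PacketPartition.cellRadius] at h1
  rw [PacketPartition.spread]
  nlinarith

lemma ae_cellMass_le (ι : ℕ) (c : ℤ²) (v : ℂˢᵗ) : ∀ᵐ s : ℝ, ∀ (p : ℤ²)
    (β : Fin 2 → ℝ), (∀ d, |p d + 2 * (s - ⌊s⌋) * c d - β d| ≤ 1) →
      cellMass φ ι ((2 : ℝ) ^ ι • latPt c) v p s ≤ groupSup φ ι ((2 : ℝ) ^ ι • latPt c) v β ⌊s⌋ := by
  have h : ∀ᵐ s : ℝ, ∀ ξ ∈ near ((2 : ℝ) ^ ι • latPt c) (2 * φ.cellRadius ι + φ.radius), ∀ (ι : ℕ) p,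
      ∫⁻ x in planeCube ι p, ‖xMult (φ.toFun ξ) v (x, s)‖ₑ ^ 2 ≤ ∑' m,
        ind (∃ x ∈ planeCube ι p, x + (2 * s) • (ξ : Plane) ∈ planeCube 0 m) *
          tubeSup ξ m ⌊s⌋ (xMult (φ.toFun ξ) v) ^ 2 :=
    (Finset.eventually_all _).2 fun ξ _ => ae_lintegral_planeCube_le ξ _
  filter_upwards [h] with s hs p β hβ
  refine sum_le_sum fun ξ hξ => (hs ξ hξ ι p).trans (tsum_le_tsum fun m =>
    ind_mul_le fun ⟨x, hx, hm⟩ => ?_)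
  have hsl : |s - ⌊s⌋| ≤ 1 := by
    rw [Int.self_sub_floor, abs_of_nonneg (Int.fract_nonneg _)]
    exact (Int.fract_lt_one _).le
  have := (cubeNear_tubePt hx hm (near_spread φ hξ) hsl).add hβ
  rw [show 2 + 2 * φ.spread + 1 = 3 + 2 * φ.spread by ring] at this
  rw [ind_of this, one_mul]

/-- The groups met, at time `u` after the start of a group, by the cells along its tubes. -/
def groupSum (ι : ℕ) (c : ℤ²) (v : ℂˢᵗ) (b : ℤ²) (l : ℤ) (u : ℝ) :
    ℝ≥0∞ :=
  ∑ δ ∈ Finset.range 2, groupSup φ ι ((2 : ℝ) ^ ι • latPt c) v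
    (fun d => b d + 2 * (u - ⌊u⌋ - (δ : ℝ)) * c d) (l + ⌊u⌋ + δ)

lemma ae_cellMass_le_groupSum (ι : ℕ) (c : ℤ²) (v : ℂˢᵗ) : ∀ᵐ s : ℝ,
    ∀ (b : ℤ²) (l : ℤ) {N a : ℕ}, a < N →
      cellMass φ ι ((2 : ℝ) ^ ι • latPt c) v (b - drift N c a) s ≤
        groupSum φ ι c v b l (s - (l + a / N)) := by
  filter_upwards [ae_cellMass_le φ ι c v] with s hs b l N a ha
  have hNR : (0 : ℝ) < N := by exact_mod_cast (by omega : 0 < N)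
  set u : ℝ := s - (l + a / N)
  have ha1 : (a : ℝ) / N < 1 := (div_lt_one hNR).2 (by exact_mod_cast ha)
  have ha0 : 0 ≤ (a : ℝ) / N := by positivity
  have key : ∃ δ ∈ Finset.range 2, ⌊s⌋ = l + ⌊u⌋ + (δ : ℕ) := by
    have h1 := Int.floor_le u
    have h2 := Int.lt_floor_add_one u
    rcases lt_or_ge (u + a / N) (⌊u⌋ + 1) with h | h
    · refine ⟨0, by simp, Int.floor_eq_iff.2 ⟨?_, ?_⟩⟩ <;> push_cast <;> linarith
    · refine ⟨1, by simp, Int.floor_eq_iff.2 ⟨?_, ?_⟩⟩ <;> push_cast <;> linarith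
  obtain ⟨δ, hδ, hfl⟩ := key
  refine le_trans ?_ (Finset.single_le_sum (f := fun δ : ℕ => groupSup φ ι ((2 : ℝ) ^ ι • latPt c) v
    (fun d => b d + 2 * (u - ⌊u⌋ - (δ : ℝ)) * c d) (l + ⌊u⌋ + δ)) (fun _ _ => zero_le) hδ)
  rw [← hfl]
  refine hs _ _ fun d => ?_
  have h3 : u - ⌊u⌋ - (δ : ℝ) = s - ⌊s⌋ - a / N := by
    rw [hfl]; push_cast; linarith
  rw [h3, ← abs_neg]
  refine le_of_eq_of_le (congrArg _ ?_) (abs_drift_sub_le (N := N) c a d)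
  simp only [Pi.sub_apply]
  push_cast
  ring

/-- The right-hand side of the group estimate. -/
def groupMass (M : ℝ → ℝ≥0∞) (N : ℝ) (ι : ℕ) (c : ℤ²) (v : ℂˢᵗ)
    (b : ℤ²) (l : ℤ) : ℝ≥0∞ :=
  ∫⁻ r, M r * ∑' z, wt 12 z * ∫⁻ u, ofReal (((1 + N * |u + r|) ^ 2)⁻¹) *
    groupSum φ ι c v (b - z) l u

lemma lintegral_cellMass_le_groupMass (M : ℝ → ℝ≥0∞) (K : ℝ) (ι : ℕ) (c : ℤ²) (v : ℂˢᵗ)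
    (b : ℤ²) (l : ℤ) {N a : ℕ} (ha : a < N) :
    ∫⁻ r, M r * ∑' z, wt 12 z * ∫⁻ s, ofReal (((1 + K * |s - (l + a / N - r)|) ^ 2)⁻¹) *
      cellMass φ ι ((2 : ℝ) ^ ι • latPt c) v (b - drift N c a - z) s ≤ groupMass φ M K ι c v b l := by
  refine lintegral_mono fun r => mul_le_mul' le_rfl (tsum_le_tsum fun z => mul_le_mul' le_rfl ?_)
  refine (lintegral_mono_ae ?_).trans_eq (lintegral_sub_right_eq_self (μ := volume)
    (fun u => ofReal (((1 + K * |u + r|) ^ 2)⁻¹) * groupSum φ ι c v (b - z) l u)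
    ((l : ℝ) + a / N))
  filter_upwards [ae_cellMass_le_groupSum φ ι c v] with s hs
  rw [show s - ((l : ℝ) + a / N - r) = s - (l + a / N) + r by ring, sub_right_comm b]
  exact mul_le_mul' le_rfl (hs (b - z) l ha)

/-! ### The group estimate -/

lemma tsum_ind_sum_sq_le {α : Type*} (P : α → Prop) {β : Type*} (s : Finset β) (x : α → ℝ≥0∞)
    (y : β → α → ℝ≥0∞) (h : ∀ a, x a ≤ ∑ b ∈ s, y b a) (w : β → ℝ≥0∞)
    (hw : ∀ b ∈ s, ∑' a, ind (P a) * y b a ^ 2 ≤ w b ^ 2) :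
    ∑' a, ind (P a) * x a ^ 2 ≤ (∑ b ∈ s, w b) ^ 2 := by
  refine le_trans (tsum_le_tsum fun a => ?_) (tsum_sq_sum_le s (fun b a => ind (P a) * y b a) w
    fun b hb => ?_)
  · rw [← mul_sum, mul_pow, ind_sq]
    exact mul_le_mul' le_rfl (pow_le_pow_left' (h a) 2)
  · simp only [mul_pow, ind_sq]
    exact hw b hb

lemma tsum_sq_le {α : Type*} (f : α → ℝ≥0∞) : ∑' a, f a ^ 2 ≤ (∑' a, f a) ^ 2 := by
  rw [sq (∑' a, f a), ← ENNReal.tsum_mul_left]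
  refine tsum_le_tsum fun a => ?_
  rw [sq]
  exact mul_le_mul' (le_tsum a) le_rfl

lemma tsum_wt_sub_left (q : ℤ²) : ∑' p, wt 3 (q - p) = wtMass :=
  (Equiv.subLeft q).tsum_eq (wt 3)

lemma mul_tsum_wt_le {n : ℕ} (G : ℤ² → ℝ≥0∞) (p q : ℤ²) :
    wt n (p - q) * ∑' z, wt n z * G (q - z) ≤ ∑' z, wt n z * G (p - z) := by
  simpa using wt_mul_tsum_le n G p (p - q)

/-- The square of the norm over the group of the tubes at time `l` whose direction is close to
`2 ^ ι c` and whose position at time `0` is close to `2 ^ ι b`. -/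
def groupInt (ι : ℕ) (c : ℤ²) (g : polarLattice → ℂˢᵗ) (b : ℤ²)
    (l : ℤ) (P : polarLattice → ℤ² → Prop) : ℝ≥0∞ :=
  ∑ ξ ∈ near ((2 : ℝ) ^ ι • latPt c) (2 ^ ι), ∑' m,
    ind (P ξ m ∧ CubeNear ι 1 (fun d => b d) (tubePt ξ m l)) * tubeInt ξ m l (g ξ) ^ 2

lemma groupInt_le {ι N : ℕ} (hN : 0 < N) {C₁ : ℝ} (hC₁ : 0 ≤ C₁) {c : ℤ²}
    (hc : ∀ d, |(c d : ℝ)| ≤ C₁ * N) {g : polarLattice → ℂˢᵗ} (hg : ∀ ξ, Measurable (g ξ))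
    (b : ℤ²) (l : ℤ) (P : polarLattice → ℤ² → Prop) (w : ℕ → ℝ≥0∞)
    (hw : ∀ a < N, ofReal (N : ℝ)⁻¹ * ∑' p,
      ind (‖p - (b - drift N c a)‖ ≤ 6 + 2 * C₁) * ∑ ξ ∈ near ((2 : ℝ) ^ ι • latPt c) (2 ^ ι),
        ∫⁻ t in Icc ((l : ℝ) + a / N) (l + a / N + (N : ℝ)⁻¹), ∫⁻ x in planeCube ι p,
          ‖g ξ (x, t)‖ₑ ^ 2 ≤ w a ^ 2) :
    groupInt ι c g b l P ≤ (∑ a ∈ Finset.range N, w a) ^ 2 := by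
  classical
  have hNR : (0 : ℝ) < N := by exact_mod_cast hN
  set X := near ((2 : ℝ) ^ ι • latPt c) (2 ^ ι)
  set J : ℕ → Set ℝ := fun a => Icc ((l : ℝ) + a / N) (l + a / N + (N : ℝ)⁻¹) with hJ
  have hsum : ∀ F : polarLattice → ℤ² → ℝ≥0∞,
      ∑ ξ ∈ X, ∑' m, F ξ m = ∑' T : X × ℤ², F T.1 T.2 := by
    intro F
    rw [ENNReal.tsum_prod (f := fun (ξ : X) m => F ξ m), ← Finset.tsum_subtype]
  rw [groupInt, hsum]
  refine tsum_ind_sum_sq_le (fun T : X × ℤ² =>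
    P T.1 T.2 ∧ CubeNear ι 1 (fun d => b d) (tubePt T.1 T.2 l)) (Finset.range N) _
    (fun a T => ∫⁻ t in J a, tubeSlice T.1 T.2 (g T.1) t)
    (fun T => lintegral_Icc_le_sum hN l _) w fun a ha => ?_
  have haN := Finset.mem_range.1 ha
  refine le_trans ?_ (hw a haN)
  set B : ℤ² → Prop := fun p => ‖p - (b - drift N c a)‖ ≤ 6 + 2 * C₁
  have hJvol : volume.restrict (J a) univ = ofReal (N : ℝ)⁻¹ := by
    rw [Measure.restrict_apply_univ, hJ, Real.volume_Icc, add_sub_cancel_left]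
  have hm : ∀ (ξ : polarLattice) p, Measurable fun t => ∫⁻ x in planeCube ι p, ‖g ξ (x, t)‖ₑ ^ 2 :=
    fun ξ p => ((hg ξ).enorm.pow_const 2).lintegral_prod_left'
  have hgeo : ∀ ξ ∈ X, ∀ t ∈ J a, ∀ m x, CubeNear ι 1 (fun d => b d) (tubePt ξ m l) →
      x + (2 * t) • (ξ : Plane) ∈ planeCube 0 m → B (cubeIdx ι x) := by
    intro ξ hξ t ht m x hP hx
    have haN1 : ((a : ℝ) + 1) / N ≤ 1 := (div_le_one hNR).2 (by exact_mod_cast haN)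
    have ha0 : 0 ≤ (a : ℝ) / N := by positivity
    rw [add_div, one_div] at haN1
    have htl : |t - l| ≤ 1 := abs_le.2 ⟨by linarith [ht.1], by linarith [ht.2]⟩
    have h1 := cubeNear_tubePt (mem_planeCube_iff.2 rfl : x ∈ planeCube ι (cubeIdx ι x)) hx
      ((mem_near.1 hξ).trans_eq (one_mul _).symm) htl
    refine norm_int_le (by positivity) fun d => ?_
    have h2 : (0 : ℝ) < 2 ^ ι := by positivity
    have h3 := abs_le.1 (h1 d)
    have h4 := abs_le.1 (hP d)
    have h5 := abs_le.1 (abs_drift_sub_le (N := N) c a d)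
    have h6 : |2 * (t - l - a / N) * c d| ≤ 2 * C₁ := by
      rw [abs_mul, abs_mul, abs_two, abs_of_nonneg (by linarith [ht.1] : 0 ≤ t - l - a / N)]
      calc _ ≤ 2 * (N : ℝ)⁻¹ * (C₁ * N) := by
            gcongr
            · linarith [ht.2]
            · exact hc d
        _ = 2 * C₁ := by field_simp
    have h7 : |(cubeIdx ι x d : ℝ) + 2 * (t - l) * c d - b d| ≤ 5 := by
      refine le_of_mul_le_mul_left ?_ h2
      rw [← abs_of_pos h2, ← abs_mul, abs_of_pos h2, abs_le]
      constructor <;> linarith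
    have h8 := abs_le.1 h6
    have h9 := abs_le.1 h7
    simp only [Pi.sub_apply, Int.cast_sub]
    rw [abs_le]
    constructor <;> nlinarith
  rw [← hsum fun ξ m => ind (P ξ m ∧ CubeNear ι 1 (fun d => b d) (tubePt ξ m l)) *
    (∫⁻ t in J a, tubeSlice ξ m (g ξ) t) ^ 2]
  calc _ ≤ ∑ ξ ∈ X, ofReal (N : ℝ)⁻¹ * ∑' p, ind (B p) *
        ∫⁻ t in J a, ∫⁻ x in planeCube ι p, ‖g ξ (x, t)‖ₑ ^ 2 := by
        refine sum_le_sum fun ξ hξ => ?_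
        calc _ ≤ ∑' m, ofReal (N : ℝ)⁻¹ * ∫⁻ t in J a,
              ind (P ξ m ∧ CubeNear ι 1 (fun d => b d) (tubePt ξ m l)) * tubeSlice ξ m (g ξ) t ^ 2 := by
              refine tsum_le_tsum fun m => ?_
              rw [lintegral_const_mul' _ _ (ind_ne_top _), mul_left_comm, ← hJvol]
              exact mul_le_mul' le_rfl (sq_lintegral_le _ _)
          _ ≤ ofReal (N : ℝ)⁻¹ * ∫⁻ t in J a, ∑' m,
              ind (P ξ m ∧ CubeNear ι 1 (fun d => b d) (tubePt ξ m l)) * tubeSlice ξ m (g ξ) t ^ 2 := by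
              rw [ENNReal.tsum_mul_left]
              exact mul_le_mul' le_rfl (tsum_lintegral_le _ _)
          _ ≤ ofReal (N : ℝ)⁻¹ * ∫⁻ t in J a, ∑' p, ind (B p) *
              ∫⁻ x in planeCube ι p, ‖g ξ (x, t)‖ₑ ^ 2 := by
              refine mul_le_mul' le_rfl (setLIntegral_mono' measurableSet_Icc fun t ht => ?_)
              refine tsum_tubeSlice_sq_le ξ (g ξ) _ B t ι fun m x hP hx => ?_
              exact hgeo ξ hξ t ht m x hP.2 hx
          _ = _ := by
              rw [lintegral_tsum fun p => ((hm ξ p).const_mul _).aemeasurable]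
              simp_rw [lintegral_const_mul' _ _ (ind_ne_top _)]
    _ = _ := by
        rw [← mul_sum, ← Summable.tsum_finsetSum fun _ _ => ENNReal.summable]
        simp_rw [mul_sum]
        rfl

lemma exists_group_estimate (φ₀ : DyadicCutoff) (φ : PacketPartition) {C₁ c₀ N₀ : ℝ} (hC₁ : 0 ≤ C₁)
    (hc₀ : 0 < c₀) : ∃ C : ℝ≥0∞, C ≠ ⊤ ∧ ∀ i j ι : ℕ, 3 * i ≤ j → i ≤ ι + 2 → ι ≤ i + 2 →
      ∃ M : ℝ → ℝ≥0∞, Measurable M ∧ ∫⁻ s, M s ≤ C ∧ ∀ {v w : ℂˢᵗ}, MemLp v 2 →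
      Measurable w → MemLp w 2 → stMult (packetSym 0 (4 * 2 ^ j) (2 ^ (j - i))) v = v → ∀ {k : ℕ},
      stMult (packetSym 0 (2 * 2 ^ ι) (2 ^ k)) w = w →
      stMult (packetSym 0 (2 * 2 ^ ι) (4 * 4 ^ ι)) w = w → ∀ {c : ℤ²},
      ‖latPt c‖ ≤ C₁ * 2 ^ (j - i) → ((2 : ℝ) ^ (j - i) ≤ N₀ ∨ c₀ * 2 ^ (j - i) ≤ ‖latPt c‖) →
      ∀ b l P, groupInt ι c (fun ξ => xMult (φ.toFun ξ)
          (stMult (symModLe φ₀ j (-(i : ℤ))) fun z => v z * w z)) b l P ≤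
        C * ofReal (2 ^ (j - i))⁻¹ * 2 ^ k * normDL2 ι w ^ 2 *
          groupMass φ M (2 ^ (j - i)) ι c v b l := by
  obtain ⟨C, hC, hcell⟩ := exists_cell_estimate φ₀ φ 12 (by norm_num) hC₁ hc₀ (N₀ := N₀)
  set κ := ofReal ((1 + (6 + 2 * C₁)) ^ 27)
  set κ' : ℝ≥0∞ := (((⌊N₀⌋₊ + ⌊c₀⁻¹⌋₊ + 1) * 6 : ℕ) : ℝ≥0∞)
  have hB : κ * wtMass * C * (wtMass * κ') ^ 2 ≠ ⊤ := mul_ne_top (mul_ne_top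
    (mul_ne_top ofReal_ne_top wtMass_ne_top) hC)
    (pow_ne_top (mul_ne_top wtMass_ne_top (ENNReal.natCast_ne_top _)))
  refine ⟨C + κ * wtMass * C * (wtMass * κ') ^ 2, ENNReal.add_ne_top.2 ⟨hC, hB⟩,
    fun i j ι hij hι1 hι2 => ?_⟩
  obtain ⟨M, hM, hM1, hcell⟩ := hcell i j ι hij hι1 hι2
  refine ⟨M, hM, hM1.trans le_self_add, fun {v w} hv hw hw2 hva {k} hwk hwι {c} hc1 hc2 b l P => ?_⟩
  set N : ℕ := 2 ^ (j - i) with hN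
  have hN0 : 0 < N := by positivity
  have hNR : ((2 : ℝ) ^ (j - i)) = N := by rw [hN]; push_cast; rfl
  have h2ι : (0 : ℝ) < 2 ^ ι := by positivity
  rw [hNR] at hc1 hc2 ⊢
  have hξ : ‖(2 : ℝ) ^ ι • latPt c‖ = ‖latPt c‖ * 2 ^ ι := by
    rw [norm_smul, norm_eq_abs, abs_of_pos h2ι, mul_comm]
  have hξ1 : ‖(2 : ℝ) ^ ι • latPt c‖ ≤ C₁ * 2 ^ (j - i) * 2 ^ ι := by
    rw [hξ, hNR]; gcongr
  have hξ2 : (2 : ℝ) ^ (j - i) ≤ N₀ ∨ c₀ * 2 ^ (j - i) * 2 ^ ι ≤ ‖(2 : ℝ) ^ ι • latPt c‖ := by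
    rw [hξ, hNR]
    exact hc2.imp id fun h => mul_le_mul_of_nonneg_right h h2ι.le
  have hcell := hcell hv hw hw2 hva hwk hwι hξ1 hξ2 (near ((2 : ℝ) ^ ι • latPt c) (2 ^ ι))
    fun ξ hξ => mem_near.1 hξ
  rw [hNR] at hcell
  set D : ℤ² → ℝ≥0∞ := fun p =>
    eLpNorm w 2 (volume.restrict (planeCube ι p ×ˢ (univ : Set ℝ))) with hD
  set H := groupMass φ M N ι c v b l with hH
  have hvw : Integrable fun z => v z * w z := hv.integrable_mul hw2
  obtain ⟨q, hq⟩ := exists_sq_eq (ofReal (N : ℝ)⁻¹ * (κ * wtMass * (C * 2 ^ k * H)))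
  refine (groupInt_le hN0 hC₁ (fun d => (abs_coord_le (latPt c) d).trans hc1)
    (fun ξ => measurable_xMult_stMult φ (stSym_symModLe φ₀ (by omega)) (stAdm_of_integrable _ hvw)
      hvw.1 ξ) b l P (fun a => q * ∑' y, wt 6 y * D (b - drift N c a - y)) fun a ha => ?_).trans ?_
  · rw [mul_pow, hq, mul_assoc]
    refine mul_le_mul' le_rfl ?_
    set p₀ := b - drift N c a with hp₀
    calc _ ≤ ∑' p, wt 3 (p₀ - p) * (κ * (C * 2 ^ k * H) * (∑' y, wt 6 y * D (p₀ - y)) ^ 2) := by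
          refine tsum_le_tsum fun p => ind_mul_le fun hp => ?_
          rw [norm_sub_rev] at hp
          set Γ : ℝ → ℤ² → ℝ≥0∞ := fun r p => ∫⁻ s,
            ofReal (((1 + N * |s - (l + a / N - r)|) ^ 2)⁻¹) *
              cellMass φ ι ((2 : ℝ) ^ ι • latPt c) v p s with hΓ
          have hG : wt 12 (p₀ - p) * ∫⁻ r, M r * ∑' z, wt 12 z * Γ r (p - z) ≤ H := by
            refine (lintegral_const_mul_le _ _).trans (le_trans (lintegral_mono fun r => ?_)
              (lintegral_cellMass_le_groupMass φ M N ι c v b l ha))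
            rw [mul_left_comm]
            exact mul_le_mul' le_rfl (mul_tsum_wt_le (Γ r) p₀ p)
          have hW : wt 12 (p₀ - p) * ∑' y, wt 12 y * D (p - y) ^ 2 ≤ (∑' y, wt 6 y * D (p₀ - y)) ^ 2 := by
            refine (mul_tsum_wt_le (fun p => D p ^ 2) p₀ p).trans ?_
            refine le_trans (tsum_le_tsum fun y => ?_) (tsum_sq_le _)
            rw [show (12 : ℕ) = 6 + 6 by norm_num, wt_add, mul_pow, sq (wt 6 y)]
          calc _ ≤ (κ * wt 27 (p₀ - p)) * (C * 2 ^ k * (∫⁻ r, M r * ∑' z, wt 12 z * Γ r (p - z)) *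
                ∑' y, wt 12 y * D (p - y) ^ 2) := by
                refine le_trans ?_ (mul_le_mul' (one_le_mul_wt 27 hp) le_rfl)
                rw [one_mul]
                refine (hcell _ p).trans_eq ?_
                simp only [hD, eLpNorm_two_sq, hΓ]
            _ = wt 3 (p₀ - p) * (κ * (C * 2 ^ k *
                (wt 12 (p₀ - p) * ∫⁻ r, M r * ∑' z, wt 12 z * Γ r (p - z))) *
                (wt 12 (p₀ - p) * ∑' y, wt 12 y * D (p - y) ^ 2)) := by
                rw [show (27 : ℕ) = 3 + 12 + 12 by norm_num, wt_add, wt_add]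
                ring
            _ ≤ _ := by gcongr
      _ = _ := by
          rw [ENNReal.tsum_mul_right, tsum_wt_sub_left p₀]
          ring
  · have h1 : ∑ a ∈ Finset.range N, q * ∑' y, wt 6 y * D (b - drift N c a - y) ≤
        q * (wtMass * (κ' * normDL2 ι w)) := by
      rw [← mul_sum, ← Summable.tsum_finsetSum fun _ _ => ENNReal.summable]
      refine mul_le_mul' le_rfl ?_
      rw [wtMass, ← ENNReal.tsum_mul_right]
      refine tsum_le_tsum fun y => ?_
      rw [← mul_sum]
      refine mul_le_mul' (wt_anti (by norm_num) y) ?_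
      simp_rw [sub_right_comm b _ y]
      exact sum_drift_le_lineSum hN0 hc₀ hc2 ι D (b - y)
    refine (pow_le_pow_left' h1 2).trans ?_
    rw [mul_pow, hq]
    calc _ = (κ * wtMass * C * (wtMass * κ') ^ 2) * ofReal (N : ℝ)⁻¹ * 2 ^ k * normDL2 ι w ^ 2 * H := by
          ring
      _ ≤ _ := by gcongr; exact le_add_self

/-! ### Summation over the groups -/

lemma wt_le_mul_wt (n : ℕ) {K : ℝ} {q z : ℤ²} (hK : 0 ≤ K) (h : ‖q‖ ≤ K * (1 + ‖z‖)) :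
    wt n z ≤ ofReal ((1 + K) ^ n) * wt n q := by
  have h0 := norm_nonneg q
  have h1 := norm_nonneg z
  rw [wt, wt, ← ofReal_mul (by positivity)]
  refine ofReal_le_ofReal ?_
  rw [← div_eq_mul_inv, le_div_iff₀ (by positivity), inv_mul_le_iff₀ (by positivity), ← mul_pow]
  gcongr
  nlinarith

lemma abs_intCast_le_norm (z : ℤ²) (d : Fin 2) : |(z d : ℝ)| ≤ ‖z‖ := by
  rw [← Int.norm_eq_abs]; exact norm_le_pi_norm z d

lemma norm_cubeIdx_sub_le {ι j : ℕ} {K C₁ N θ : ℝ} (hK : 0 ≤ K) (hC₁ : 0 ≤ C₁)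
    (h1 : N * 2 ^ ι ≤ 4 * 2 ^ j) (h2 : (2 : ℝ) ^ ι ≤ 4 * 2 ^ j) {c : ℤ²}
    (hc : ∀ d, |(c d : ℝ)| ≤ C₁ * N) (hθ : |θ| ≤ 2) {b z Mo : ℤ²} {y : Plane}
    (hb : CubeNear j 5 (fun d => Mo d) ((2 : ℝ) ^ ι • latPt b))
    (hy : CubeNear ι K (fun d => b d + (-z d + θ * c d)) y) :
    ‖cubeIdx j y - Mo‖ ≤ (6 + 4 * K + 8 * C₁) * (1 + ‖z‖) := by
  have hz := norm_nonneg z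
  refine norm_int_le (by positivity) fun d => ?_
  have h3 : (0 : ℝ) < 2 ^ j := by positivity
  have e1 := abs_le.1 (abs_sub_center_le (mem_planeCube_iff.2 rfl : y ∈ planeCube j (cubeIdx j y)) d)
  have e2 := abs_le.1 (hy d)
  have e3 := abs_le.1 (hb d)
  have e4 : |2 ^ ι * (z d : ℝ)| ≤ 4 * 2 ^ j * ‖z‖ := by
    rw [abs_mul, abs_of_pos (by positivity : (0 : ℝ) < 2 ^ ι)]
    exact mul_le_mul h2 (abs_intCast_le_norm z d) (abs_nonneg _) (by positivity)
  have e5 : |2 ^ ι * (θ * c d)| ≤ 8 * C₁ * 2 ^ j := by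
    rw [abs_mul, abs_mul, abs_of_pos (by positivity : (0 : ℝ) < 2 ^ ι)]
    calc _ ≤ (2 : ℝ) ^ ι * (2 * (C₁ * N)) := by gcongr; exact hc d
      _ = 2 * C₁ * (N * 2 ^ ι) := by ring
      _ ≤ 2 * C₁ * (4 * 2 ^ j) := by gcongr
      _ = _ := by ring
  have e6 : K * 2 ^ ι ≤ K * (4 * 2 ^ j) := by gcongr
  simp only [PiLp.smul_apply, smul_eq_mul, latPt_apply] at e3
  have e7 : |2 ^ j * ((cubeIdx j y d : ℝ) - Mo d)| ≤ 2 ^ j * ((6 + 4 * K + 8 * C₁) + 4 * ‖z‖) := by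
    have e4 := abs_le.1 e4
    have e5 := abs_le.1 e5
    rw [abs_le]
    constructor <;> linarith
  rw [abs_mul, abs_of_pos h3] at e7
  simp only [Pi.sub_apply, Int.cast_sub]
  refine (le_of_mul_le_mul_left e7 h3).trans ?_
  nlinarith [mul_nonneg hK hz, mul_nonneg hC₁ hz]

variable (φ : PacketPartition)

/-- The square sum over tubes close to a given cell, weighted by the distance to a cube. -/
def nearSup (ι j : ℕ) (c : ℤ²) (v : ℂˢᵗ) (Mo : ℤ²) : ℝ≥0∞ :=
  ∑ ξ ∈ near ((2 : ℝ) ^ ι • latPt c) (2 * φ.cellRadius ι + φ.radius), ∑' m, ∑' l : ℤ,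
    wt 6 (cubeIdx j (tubePt ξ m l) - Mo) * tubeSup ξ m l (xMult (φ.toFun ξ) v) ^ 2

lemma tsum_groupSup_le {ι j : ℕ} {C₁ N θ : ℝ} (hC₁ : 0 ≤ C₁)
    (h1 : N * 2 ^ ι ≤ 4 * 2 ^ j) (h2 : (2 : ℝ) ^ ι ≤ 4 * 2 ^ j) {c : ℤ²}
    (hc : ∀ d, |(c d : ℝ)| ≤ C₁ * N) (hθ : |θ| ≤ 2) (v : ℂˢᵗ) (Mo z : ℤ²) (n : ℤ) :
    wt 12 z * ∑' b : ℤ², ∑' l : ℤ, ind (CubeNear j 5 (fun d => Mo d) ((2 : ℝ) ^ ι • latPt b)) *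
      groupSup φ ι ((2 : ℝ) ^ ι • latPt c) v (fun d => b d + (-z d + θ * c d)) (l + n) ≤
    wt 3 z * (ofReal ((1 + (6 + 4 * (3 + 2 * φ.spread) + 8 * C₁)) ^ 6) *
      (ofReal ((3 + 2 * φ.spread + 2) ^ 3) * wtMass) * nearSup φ ι j c v Mo) := by
  have hR := φ.radius_nonneg
  set K := 3 + 2 * φ.spread with hK
  have hK0 : 0 ≤ K := by rw [hK, PacketPartition.spread]; positivity
  set κ := ofReal ((1 + (6 + 4 * K + 8 * C₁)) ^ 6)
  set κ' := ofReal ((K + 2) ^ 3) * wtMass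
  set X := near ((2 : ℝ) ^ ι • latPt c) (2 * φ.cellRadius ι + φ.radius) with hX
  set β : Fin 2 → ℝ := fun d => -z d + θ * c d
  set Q : ℤ² → ℝ≥0∞ := fun b => ind (CubeNear j 5 (fun d => Mo d) ((2 : ℝ) ^ ι • latPt b)) with hQ
  have hshift : ∀ b, ∑' l : ℤ, Q b * groupSup φ ι ((2 : ℝ) ^ ι • latPt c) v (fun d => b d + β d) (l + n) =
      ∑ ξ ∈ X, ∑' m, ∑' l : ℤ, Q b * ind (CubeNear ι K (fun d => b d + β d) (tubePt ξ m l)) *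
        tubeSup ξ m l (xMult (φ.toFun ξ) v) ^ 2 := by
    intro b
    refine ((Equiv.addRight n).tsum_eq fun l => Q b * groupSup φ ι ((2 : ℝ) ^ ι • latPt c) v
      (fun d => b d + β d) l).trans ?_
    simp only [groupSup, ← hX, ← hK, mul_sum, ← ENNReal.tsum_mul_left, mul_assoc]
    rw [Summable.tsum_finsetSum fun _ _ => ENNReal.summable]
    exact sum_congr rfl fun ξ _ => ENNReal.tsum_comm
  change wt 12 z * ∑' b, ∑' l : ℤ, Q b * groupSup φ ι ((2 : ℝ) ^ ι • latPt c) v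
    (fun d => b d + β d) (l + n) ≤ _
  simp_rw [hshift]
  rw [Summable.tsum_finsetSum fun _ _ => ENNReal.summable, nearSup, ← hX, mul_sum, mul_sum,
    mul_sum]
  refine sum_le_sum fun ξ _ => ?_
  rw [ENNReal.tsum_comm]
  simp_rw [← ENNReal.tsum_mul_left]
  refine tsum_le_tsum fun m => ?_
  rw [ENNReal.tsum_comm]
  refine tsum_le_tsum fun l => ?_
  set y := tubePt ξ m l with hy
  calc _ ≤ ∑' b : ℤ², κ * wt 3 z * wt 6 (cubeIdx j y - Mo) * tubeSup ξ m l (xMult (φ.toFun ξ) v) ^ 2 *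
        ind (CubeNear ι K (fun d => b d + β d) y) := by
        refine tsum_le_tsum fun b => ?_
        rw [show ∀ x t q p : ℝ≥0∞, x * (q * p * t) = q * (p * (x * t)) by intros; ring]
        refine ind_mul_le fun hb => ?_
        by_cases hp : CubeNear ι K (fun d => b d + β d) y
        · rw [ind_of hp, one_mul, mul_one]
          refine mul_le_mul' ?_ le_rfl
          rw [show 12 = 6 + 6 by norm_num, wt_add, mul_comm κ, mul_assoc]
          exact mul_le_mul' (wt_anti (by norm_num) z) (wt_le_mul_wt 6 (by positivity)
            (norm_cubeIdx_sub_le hK0 hC₁ h1 h2 hc hθ hb hp))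
        · exact ind_mul_le fun h => absurd h hp
    _ ≤ κ * wt 3 z * wt 6 (cubeIdx j y - Mo) * tubeSup ξ m l (xMult (φ.toFun ξ) v) ^ 2 * κ' := by
        rw [ENNReal.tsum_mul_left]
        exact mul_le_mul' le_rfl (tsum_ind_cubeNear_le hK0 β y)
    _ = _ := by ring

lemma tsum_groupMass_le {C₁ : ℝ} (hC₁ : 0 ≤ C₁) : ∃ C : ℝ≥0∞, C ≠ ⊤ ∧ ∀ {ι j : ℕ} {N : ℝ}, 0 < N →
    N * 2 ^ ι ≤ 4 * 2 ^ j → (2 : ℝ) ^ ι ≤ 4 * 2 ^ j → ∀ {c : ℤ²},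
    (∀ d, |(c d : ℝ)| ≤ C₁ * N) → ∀ {M : ℝ → ℝ≥0∞}, Measurable M → ∀ (v : ℂˢᵗ) (Mo : ℤ²),
    ∑' b, ∑' l : ℤ, ind (CubeNear j 5 (fun d => Mo d) ((2 : ℝ) ^ ι • latPt b)) *
      groupMass φ M N ι c v b l ≤ C * (∫⁻ r, M r) * ofReal N⁻¹ * nearSup φ ι j c v Mo := by
  set κ := ofReal ((1 + (6 + 4 * (3 + 2 * φ.spread) + 8 * C₁)) ^ 6) *
      (ofReal ((3 + 2 * φ.spread + 2) ^ 3) * wtMass) with hκ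
  refine ⟨wtMass * timeMass * (2 * κ), mul_ne_top (mul_ne_top wtMass_ne_top
    timeMass_ne_top) (mul_ne_top (by simp) (mul_ne_top ofReal_ne_top
    (mul_ne_top ofReal_ne_top wtMass_ne_top))), fun {ι j N} hN h1 h2 {c} hc {M} hM v Mo => ?_⟩
  set Q : ℤ² → ℝ≥0∞ := fun b => ind (CubeNear j 5 (fun d => Mo d) ((2 : ℝ) ^ ι • latPt b))
  set ρ : ℝ → ℝ → ℝ≥0∞ := fun r u => ofReal (((1 + N * |u + r|) ^ 2)⁻¹) with hρ
  have hpt : ∀ u z, wt 12 z * ∑' b, ∑' l : ℤ, Q b * groupSum φ ι c v (b - z) l u ≤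
      wt 3 z * (2 * κ * nearSup φ ι j c v Mo) := by
    intro u z
    have hs : ∀ (b : ℤ²) (l : ℤ), Q b * groupSum φ ι c v (b - z) l u = ∑ δ ∈ Finset.range 2, Q b *
        groupSup φ ι ((2 : ℝ) ^ ι • latPt c) v
          (fun d => b d + (-z d + 2 * (u - ⌊u⌋ - (δ : ℝ)) * c d)) (l + (⌊u⌋ + δ)) := by
      intro b l
      rw [groupSum, mul_sum]
      refine sum_congr rfl fun δ _ => ?_
      congr 2
      · ext d; simp only [Pi.sub_apply]; push_cast; ring
      · ring
    simp_rw [hs]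
    rw [show ∀ F : ℤ² → ℤ → ℕ → ℝ≥0∞, ∑' b, ∑' l, ∑ δ ∈ Finset.range 2, F b l δ =
      ∑ δ ∈ Finset.range 2, ∑' b, ∑' l, F b l δ by
        intro F
        simp_rw [Summable.tsum_finsetSum fun _ _ => ENNReal.summable], mul_sum]
    refine (Finset.sum_le_card_nsmul _ _ (wt 3 z * (κ * nearSup φ ι j c v Mo)) fun δ hδ => ?_).trans_eq
      (by rw [Finset.card_range, nsmul_eq_mul]; push_cast; ring)
    refine tsum_groupSup_le φ hC₁ h1 h2 hc ?_ v Mo z _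
    have e1 := Int.floor_le u
    have e2 := Int.lt_floor_add_one u
    have e3 : (0 : ℝ) ≤ δ ∧ (δ : ℝ) ≤ 1 := ⟨by positivity, by
      exact_mod_cast Nat.lt_succ_iff.1 (Finset.mem_range.1 hδ)⟩
    rw [abs_le]
    constructor <;> linarith [e3.1, e3.2]
  calc _ ≤ ∫⁻ r, M r * ∑' z, ∫⁻ u, ρ r u * (wt 12 z * ∑' b, ∑' l : ℤ, Q b * groupSum φ ι c v (b - z) l u) := by
        calc _ ≤ ∑' b, ∑' l : ℤ, ∫⁻ r, Q b * (M r * ∑' z, wt 12 z * ∫⁻ u, ρ r u *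
              groupSum φ ι c v (b - z) l u) :=
              tsum_le_tsum fun b => tsum_le_tsum fun l => lintegral_const_mul_le _ _
          _ ≤ ∫⁻ r, ∑' b, ∑' l : ℤ, Q b * (M r * ∑' z, wt 12 z * ∫⁻ u, ρ r u *
              groupSum φ ι c v (b - z) l u) :=
              (tsum_le_tsum fun b => tsum_lintegral_le _ _).trans (tsum_lintegral_le _ _)
          _ ≤ _ := by
              refine lintegral_mono fun r => ?_
              calc _ = M r * ∑' z, ∑' b, ∑' l : ℤ, (Q b * wt 12 z) * ∫⁻ u, ρ r u *
                    groupSum φ ι c v (b - z) l u := by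
                    symm
                    rw [ENNReal.tsum_comm]
                    simp_rw [← ENNReal.tsum_mul_left]
                    refine tsum_congr fun b => ?_
                    rw [ENNReal.tsum_comm]
                    exact tsum_congr fun l => tsum_congr fun z => by ring
                _ ≤ _ := by
                    refine mul_le_mul' le_rfl (tsum_le_tsum fun z => ?_)
                    refine (tsum_le_tsum fun b => (tsum_le_tsum fun l =>
                      lintegral_const_mul_le _ _).trans (tsum_lintegral_le _ _)).trans
                      ((tsum_lintegral_le _ _).trans (lintegral_mono fun u => le_of_eq ?_))
                    simp_rw [← ENNReal.tsum_mul_left]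
                    exact tsum_congr fun b => tsum_congr fun l => by ring
    _ ≤ ∫⁻ r, M r * ∑' z, wt 3 z * (ofReal N⁻¹ * timeMass * (2 * κ * nearSup φ ι j c v Mo)) := by
        refine lintegral_mono fun r => mul_le_mul' le_rfl (tsum_le_tsum fun z => ?_)
        refine (lintegral_mono fun u => mul_le_mul' le_rfl (hpt u z)).trans_eq ?_
        have hm : Measurable (ρ r) := by fun_prop
        rw [lintegral_mul_const _ hm]
        have := lintegral_time_weight hN (-r)
        simp only [sub_neg_eq_add] at this
        rw [hρ]
        simp only
        rw [this]
        ring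
    _ = _ := by
        rw [ENNReal.tsum_mul_right, ← wtMass, lintegral_mul_const _ hM]
        ring

/-! ### The estimate at the scale of the frequency -/

/-- The tubes `T_ξ^{m,l}`. -/
abbrev Tube : Type := polarLattice × ℤ² × ℤ

/-- The square of the `L^1_t L^2_x` norm over a tube. -/
def intSq (g : polarLattice → ℂˢᵗ) (T : Tube) : ℝ≥0∞ :=
  tubeInt T.1 T.2.1 T.2.2 (g T.1) ^ 2

/-- The square of the `L^∞_t L^2_x` norm over a tube. -/
def supSq (g : polarLattice → ℂˢᵗ) (T : Tube) : ℝ≥0∞ :=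
  tubeSup T.1 T.2.1 T.2.2 (g T.1) ^ 2

/-- The index of the cube of side `2 ^ j` that the tube is over at time `0`. -/
def Tube.idx (j : ℕ) (T : Tube) : ℤ² := cubeIdx j (tubePt T.1 T.2.1 T.2.2)

/-- The sum over the tubes that are over `Q_j^M` at time `0`. -/
def packSum (j : ℕ) (F : Tube → ℝ≥0∞) (M : ℤ²) : ℝ≥0∞ :=
  ∑' T : Tube, ind (T.idx j = M) * F T

lemma tsum_tube (F : Tube → ℝ≥0∞) : ∑' T, F T = ∑' ξ, ∑' m, ∑' l, F (ξ, m, l) :=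
  ENNReal.tsum_prod'.trans (tsum_congr fun _ => ENNReal.tsum_prod')

lemma tsum_wt_le_packSum (j n : ℕ) (F : Tube → ℝ≥0∞) (M : ℤ²) :
    ∑' T : Tube, wt n (T.idx j - M) * F T ≤ ∑' q, wt n q * packSum j F (M + q) := by
  simp_rw [packSum, ← ENNReal.tsum_mul_left]
  rw [ENNReal.tsum_comm]
  refine tsum_le_tsum fun T => ?_
  refine le_trans (le_of_eq ?_) (le_tsum (T.idx j - M))
  rw [add_sub_cancel, ind_of rfl, one_mul]

lemma tsum_packSum (j : ℕ) (F : Tube → ℝ≥0∞) : ∑' M, packSum j F M = ∑' T, F T := by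
  simp_rw [packSum]
  rw [ENNReal.tsum_comm]
  refine tsum_congr fun T => ?_
  rw [tsum_eq_single (T.idx j) fun M hM => ?_, ind_of rfl, one_mul]
  exact le_antisymm (ind_mul_le fun h => absurd h.symm hM) zero_le

variable (φ : PacketPartition)

lemma sum_eq_tsum_ind {α : Type*} (X : Finset α) (A : α → ℝ≥0∞) :
    ∑ ξ ∈ X, A ξ = ∑' ξ, ind (ξ ∈ X) * A ξ := by
  rw [tsum_eq_sum fun ξ (hξ : ξ ∉ X) => le_antisymm (ind_mul_le fun h => absurd h hξ) zero_le]
  exact sum_congr rfl fun ξ hξ => by rw [ind_of hξ, one_mul]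

lemma tsum_le_tsum_near (ι : ℕ) (A : polarLattice → ℝ≥0∞) :
    ∑' ξ, A ξ ≤ ∑' c : ℤ², ∑ ξ ∈ near ((2 : ℝ) ^ ι • latPt c) (2 ^ ι), A ξ := by
  simp_rw [sum_eq_tsum_ind]
  rw [ENNReal.tsum_comm]
  refine tsum_le_tsum fun ξ => ?_
  refine le_trans (le_of_eq ?_) (le_tsum (cubeIdx ι (ξ : Plane)))
  rw [ind_of, one_mul]
  refine mem_near.2 ((norm_le_two_mul_of_coord (R := 2 ^ ι / 2) fun d => ?_).trans_eq (by ring))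
  have h := (mem_planeCube_iff.2 rfl : (ξ : Plane) ∈ planeCube ι (cubeIdx ι (ξ : Plane))) d
  simp only [PiLp.sub_apply, PiLp.smul_apply, smul_eq_mul, latPt_apply]
  rw [abs_le]
  constructor <;> linarith [h.1, h.2]

lemma tsum_nearSup_le {ι j : ℕ} {C₁ N : ℝ} (hC₁ : 0 ≤ C₁) (h1 : N * 2 ^ ι ≤ 4 * 2 ^ j)
    (h2 : (2 : ℝ) ^ ι ≤ 4 * 2 ^ j) (v : ℂˢᵗ) (M : ℤ²) :
    ∑' c, ind (‖latPt c‖ ≤ C₁ * N) * nearSup φ ι j c v M ≤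
      ofReal ((φ.spread + 2) ^ 3) * wtMass * ∑' q, wt 6 q *
        packSum j (fun T => ind (‖(T.1 : Plane)‖ ≤ 4 * (C₁ + φ.spread) * 2 ^ j) *
          supSq (fun ξ => xMult (φ.toFun ξ) v) T) (M + q) := by
  have hR := φ.radius_nonneg
  have hs : 0 ≤ φ.spread := by rw [PacketPartition.spread]; positivity
  set κ := ofReal ((φ.spread + 2) ^ 3) * wtMass
  set B : polarLattice → ℝ≥0∞ := fun ξ => ∑' m, ∑' l : ℤ,
    wt 6 (cubeIdx j (tubePt ξ m l) - M) * tubeSup ξ m l (xMult (φ.toFun ξ) v) ^ 2 with hB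
  set C := 4 * (C₁ + φ.spread) * 2 ^ j with hC
  calc _ ≤ ∑' c : ℤ², ∑' ξ : polarLattice,
        ind (CubeNear ι φ.spread (fun d => c d + 0) ξ) * (ind (‖(ξ : Plane)‖ ≤ C) * B ξ) := by
        refine tsum_le_tsum fun c => ind_mul_le fun hc => ?_
        rw [nearSup, sum_eq_tsum_ind]
        refine tsum_le_tsum fun ξ => ind_mul_le fun hξ => ?_
        have hn := near_spread φ hξ
        rw [ind_of, one_mul, ind_of, one_mul]
        · have h3 := norm_le_norm_add_norm_sub' (ξ : Plane) ((2 : ℝ) ^ ι • latPt c)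
          rw [norm_smul, norm_eq_abs, abs_of_pos (by positivity : (0 : ℝ) < 2 ^ ι)] at h3
          calc _ ≤ 2 ^ ι * (C₁ * N) + φ.spread * 2 ^ ι := h3.trans (by gcongr)
            _ = C₁ * (N * 2 ^ ι) + φ.spread * 2 ^ ι := by ring
            _ ≤ C₁ * (4 * 2 ^ j) + φ.spread * (4 * 2 ^ j) := by gcongr
            _ = C := by rw [hC]; ring
        · intro d
          simpa [latPt_apply] using (abs_coord_le ((ξ : Plane) - (2 : ℝ) ^ ι • latPt c) d).trans hn
    _ ≤ ∑' ξ : polarLattice, κ * (ind (‖(ξ : Plane)‖ ≤ C) * B ξ) := by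
        rw [ENNReal.tsum_comm]
        simp_rw [ENNReal.tsum_mul_right]
        exact tsum_le_tsum fun ξ => mul_le_mul' (tsum_ind_cubeNear_le hs (fun _ => 0) ξ) le_rfl
    _ ≤ _ := by
        rw [ENNReal.tsum_mul_left]
        refine mul_le_mul' le_rfl (le_trans (le_of_eq ?_) (tsum_wt_le_packSum j 6 _ M))
        rw [tsum_tube]
        simp_rw [hB, ← ENNReal.tsum_mul_left]
        exact tsum_congr fun ξ => tsum_congr fun m => tsum_congr fun l => mul_left_comm _ _ _

lemma exists_freq_of_xMult_ne_zero {φ₀ : DyadicCutoff} {i j : ℕ} (hij : i ≤ j) {g : ℂˢᵗ}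
    (hg : StAdm (symModLe φ₀ j (-(i : ℤ))) g) {ξ : polarLattice}
    (h : xMult (φ.toFun ξ) (stMult (symModLe φ₀ j (-(i : ℤ))) g) ≠ 0) :
    ∃ ζ : SpaceTime, ‖ζ.1 - ξ‖ ≤ φ.radius ∧ symModLe φ₀ j (-(i : ℤ)) ζ ≠ 0 := by
  by_contra hcon
  refine h ?_
  have h0 : (fun ζ : SpaceTime => φ.toFun ξ ζ.1 * symModLe φ₀ j (-(i : ℤ)) ζ) = 0 := by
    ext ζ
    by_contra hne
    exact hcon ⟨ζ, norm_sub_le_of_packet_mul_ne_zero hne, right_ne_zero_of_mul hne⟩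
  rw [xMult_stMult_packet φ (stSym_symModLe φ₀ hij) hg, h0]
  ext z
  simp [stMult, stKernel]

lemma xMult_eq_zero_of_far {φ₀ : DyadicCutoff} {i j ι : ℕ} (hij : 5 * i ≤ j) (hι1 : i ≤ ι + 2)
    (hι2 : ι ≤ i + 2) {g : ℂˢᵗ} (hg : StAdm (symModLe φ₀ j (-(i : ℤ))) g) {c : ℤ²}
    (hc : ¬ (‖latPt c‖ ≤ (9 + φ.radius) * 2 ^ (j - i) ∧ ((2 : ℝ) ^ (j - i) ≤ 32 * (φ.radius + 1) ∨
      1 / 32 * 2 ^ (j - i) ≤ ‖latPt c‖))) {ξ : polarLattice}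
    (hξ : ξ ∈ near ((2 : ℝ) ^ ι • latPt c) (2 ^ ι)) :
    xMult (φ.toFun ξ) (stMult (symModLe φ₀ j (-(i : ℤ))) g) = 0 := by
  by_contra hne
  obtain ⟨ζ, h1, h2⟩ := exists_freq_of_xMult_ne_zero φ (by omega) hg hne
  obtain ⟨h3, h4, h5⟩ := symModLe_ne_zero (by omega) h2
  have hR := φ.radius_nonneg
  set N : ℝ := 2 ^ (j - i) with hN
  have hN1 : 1 ≤ N := one_le_pow₀ (by norm_num)
  have hj : (2 : ℝ) ^ j = N * 2 ^ i := by rw [hN, ← pow_add, Nat.sub_add_cancel (by omega)]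
  have hi1 : (1 : ℝ) ≤ 2 ^ i := one_le_pow₀ (by norm_num)
  have hι1' : (1 : ℝ) ≤ 2 ^ ι := one_le_pow₀ (by norm_num)
  have e1 : (2 : ℝ) ^ i ≤ 4 * 2 ^ ι := by
    calc (2 : ℝ) ^ i ≤ 2 ^ (ι + 2) := pow_le_pow_right₀ (by norm_num) hι1
      _ = _ := by ring
  have e2 : (2 : ℝ) ^ ι ≤ 4 * 2 ^ i := by
    calc (2 : ℝ) ^ ι ≤ 2 ^ (i + 2) := pow_le_pow_right₀ (by norm_num) hι2
      _ = _ := by ring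
  have h2ι : (0 : ℝ) < 2 ^ ι := by positivity
  have hc2 : ‖(2 : ℝ) ^ ι • latPt c‖ = 2 ^ ι * ‖latPt c‖ := by
    rw [norm_smul, norm_eq_abs, abs_of_pos h2ι]
  have hd : ‖ζ.1 - (2 : ℝ) ^ ι • latPt c‖ ≤ φ.radius + 2 ^ ι := by
    have := norm_add_le (ζ.1 - ξ) ((ξ : Plane) - (2 : ℝ) ^ ι • latPt c)
    rw [sub_add_sub_cancel] at this
    exact this.trans (add_le_add h1 (mem_near.1 hξ))
  have hd1 : 2 ^ ι * ‖latPt c‖ ≤ ‖ζ.1‖ + (φ.radius + 2 ^ ι) := by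
    rw [← hc2]
    exact (norm_le_norm_add_norm_sub _ _).trans (add_le_add le_rfl hd)
  have hd2 : ‖ζ.1‖ ≤ 2 ^ ι * ‖latPt c‖ + (φ.radius + 2 ^ ι) := by
    rw [← hc2]
    exact (norm_le_norm_add_norm_sub' _ _).trans (add_le_add le_rfl hd)
  have hR1 : φ.radius * 1 ≤ φ.radius * (N * 2 ^ ι) := by
    gcongr; nlinarith
  have hNι : (2 : ℝ) ^ ι ≤ N * 2 ^ ι := le_mul_of_one_le_left h2ι.le hN1
  refine hc ⟨?_, ?_⟩
  · refine le_of_mul_le_mul_left (hd1.trans ?_) h2ι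
    have h6 := (norm_fst_le_parNorm ζ).trans h3.le
    rw [pow_succ, hj] at h6
    have : N * 2 ^ i ≤ N * (4 * 2 ^ ι) := by gcongr
    linarith
  · by_contra hcon
    simp only [not_or, not_le] at hcon
    obtain ⟨f1, f2⟩ := hcon
    have hj0 : 0 < j := by
      by_contra h0
      have : N = 1 := by rw [hN, show j - i = 0 by omega, pow_zero]
      linarith
    have f3 := h4 hj0
    have f4 : (2 : ℝ) ^ j = 2 * 2 ^ (j - 1) := by rw [← pow_succ', Nat.sub_add_cancel hj0]
    have f5 : ((2 : ℝ) ^ (j - 1)) ^ 2 < |ζ.2| + ‖ζ.1‖ ^ 2 := by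
      rw [← Real.sq_sqrt (by positivity : 0 ≤ |ζ.2| + ‖ζ.1‖ ^ 2)]
      exact pow_lt_pow_left₀ f3 (by positivity) two_ne_zero
    have f6 : |ζ.2| ≤ ‖ζ.1‖ ^ 2 + 2 * N := by
      have := abs_sub_abs_le_abs_sub ζ.2 (‖ζ.1‖ ^ 2)
      rw [abs_of_nonneg (by positivity : 0 ≤ ‖ζ.1‖ ^ 2)] at this
      have h5' : |ζ.2 - ‖ζ.1‖ ^ 2| < 2 * N := h5
      linarith
    have f7 : N * 2 ^ i / 4 < ‖ζ.1‖ := by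
      refine lt_of_pow_lt_pow_left₀ 2 (norm_nonneg _) ?_
      have f8 : ((2 : ℝ) ^ (j - 1)) ^ 2 = (N * 2 ^ i) ^ 2 / 4 := by rw [← hj, f4]; ring
      have f9 : N * 16 ≤ (N * 2 ^ i) ^ 2 := by
        rw [mul_pow, sq N, mul_assoc]
        gcongr
        nlinarith
      nlinarith
    have g1 : N * 2 ^ ι ≤ N * (4 * 2 ^ i) := by gcongr
    have g2 : 2 ^ ι * ‖latPt c‖ < 2 ^ ι * (1 / 32 * N) := by gcongr
    have g3 : 32 * (φ.radius + 1) * 2 ^ ι < N * 2 ^ ι := by gcongr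
    have g4 : φ.radius * 1 ≤ φ.radius * 2 ^ ι := by gcongr
    nlinarith

lemma groupInt_le_ind {j ι : ℕ} (h2 : (2 : ℝ) ^ ι ≤ 4 * 2 ^ j) (c : ℤ²)
    (g : polarLattice → ℂˢᵗ) (b : ℤ²) (l : ℤ) (M : ℤ²) :
    groupInt ι c g b l (fun ξ m => cubeIdx j (tubePt ξ m l) = M) ≤
      ind (CubeNear j 5 (fun d => M d) ((2 : ℝ) ^ ι • latPt b)) *
        groupInt ι c g b l (fun ξ m => cubeIdx j (tubePt ξ m l) = M) := by
  by_cases h : CubeNear j 5 (fun d => M d) ((2 : ℝ) ^ ι • latPt b)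
  · rw [ind_of h, one_mul]
  · refine le_trans (Finset.sum_nonpos fun ξ _ => ?_) zero_le
    refine (ENNReal.tsum_eq_zero.2 fun m => le_antisymm (ind_mul_le fun ⟨h3, h4⟩ => ?_) zero_le).le
    refine absurd (fun d => ?_) h
    have e1 := abs_le.1 (abs_sub_center_le (mem_planeCube_iff.2 h3) d)
    have e2 := abs_le.1 (h4 d)
    simp only [PiLp.smul_apply, smul_eq_mul, latPt_apply]
    rw [abs_le]
    constructor <;> linarith

lemma exists_packInt_le (φ₀ : DyadicCutoff) : ∃ C : ℝ≥0∞, C ≠ ⊤ ∧ ∃ C₂ : ℝ, 0 ≤ C₂ ∧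
    ∀ i j ι : ℕ, 5 * i ≤ j → i ≤ ι + 2 → ι ≤ i + 2 → ∀ {v w : ℂˢᵗ}, MemLp v 2 →
      Measurable w → MemLp w 2 → stMult (packetSym 0 (4 * 2 ^ j) (2 ^ (j - i))) v = v → ∀ {k : ℕ},
      stMult (packetSym 0 (2 * 2 ^ ι) (2 ^ k)) w = w →
      stMult (packetSym 0 (2 * 2 ^ ι) (4 * 4 ^ ι)) w = w → ∀ M,
      packSum j (intSq fun ξ => xMult (φ.toFun ξ)
          (stMult (symModLe φ₀ j (-(i : ℤ))) fun z => v z * w z)) M ≤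
        C * ofReal (2 ^ (j - i))⁻¹ ^ 2 * 2 ^ k * normDL2 ι w ^ 2 * ∑' q, wt 6 q *
          packSum j (fun T => ind (‖(T.1 : Plane)‖ ≤ C₂ * 2 ^ j) *
            supSq (fun ξ => xMult (φ.toFun ξ) v) T) (M + q) := by
  have hR := φ.radius_nonneg
  set C₁ := 9 + φ.radius
  have hC₁0 : 0 ≤ C₁ := by positivity
  obtain ⟨C, hC, hG⟩ := exists_group_estimate φ₀ φ hC₁0 (c₀ := 1 / 32) (by norm_num)
    (N₀ := 32 * (φ.radius + 1))
  obtain ⟨C', hC', hH⟩ := tsum_groupMass_le φ hC₁0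
  set κ := ofReal ((φ.spread + 2) ^ 3) * wtMass with hκ
  refine ⟨C * (C' * C) * κ, mul_ne_top (mul_ne_top hC (mul_ne_top hC' hC))
    (mul_ne_top ofReal_ne_top wtMass_ne_top), 4 * (C₁ + φ.spread),
    by rw [PacketPartition.spread]; positivity,
    fun i j ι hij hι1 hι2 v w hv hw hw2 hva k hwk hwι Mo => ?_⟩
  obtain ⟨M, hM, hM1, hG⟩ := hG i j ι (by omega) hι1 hι2
  have hG := fun c => @hG v w hv hw hw2 hva k hwk hwι c
  set N : ℝ := 2 ^ (j - i) with hN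
  have hN0 : 0 < N := by positivity
  have h1 : N * 2 ^ ι ≤ 4 * 2 ^ j := by
    calc N * 2 ^ ι ≤ N * 2 ^ (i + 2) := by gcongr; norm_num
      _ = 4 * 2 ^ j := by rw [hN, ← pow_add, show j - i + (i + 2) = j + 2 by omega]; ring
  have h2 : (2 : ℝ) ^ ι ≤ 4 * 2 ^ j := by
    calc (2 : ℝ) ^ ι ≤ 2 ^ (j + 2) := pow_le_pow_right₀ (by norm_num) (by omega)
      _ = _ := by ring
  have hvw : Integrable fun z => v z * w z := hv.integrable_mul hw2
  set g : polarLattice → ℂˢᵗ :=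
    fun ξ => xMult (φ.toFun ξ) (stMult (symModLe φ₀ j (-(i : ℤ))) fun z => v z * w z) with hg
  set P : ℤ → polarLattice → ℤ² → Prop := fun l ξ m => cubeIdx j (tubePt ξ m l) = Mo with hP
  set X := C * ofReal N⁻¹ * 2 ^ k * normDL2 ι w ^ 2 with hX
  clear_value κ X
  calc _ ≤ ∑' c : ℤ², ∑ ξ ∈ near ((2 : ℝ) ^ ι • latPt c) (2 ^ ι), ∑' m, ∑' l : ℤ,
        ind (P l ξ m) * tubeInt ξ m l (g ξ) ^ 2 := (tsum_tube _).trans_le (tsum_le_tsum_near ι _)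
    _ ≤ ∑' c : ℤ², ∑' b : ℤ², ∑' l : ℤ, groupInt ι c g b l (P l) := by
        refine tsum_le_tsum fun c => ?_
        simp only [groupInt]
        simp_rw [Summable.tsum_finsetSum fun _ _ => ENNReal.summable]
        refine sum_le_sum fun ξ _ => ?_
        calc _ ≤ ∑' m, ∑' l : ℤ, ∑' b : ℤ²,
              ind (P l ξ m ∧ CubeNear ι 1 (fun d => b d) (tubePt ξ m l)) * tubeInt ξ m l (g ξ) ^ 2 := by
              refine tsum_le_tsum fun m => tsum_le_tsum fun l => ind_mul_le fun hp => ?_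
              refine le_trans (le_of_eq ?_) (le_tsum (cubeIdx ι (tubePt ξ m l)))
              rw [ind_of, one_mul]
              refine ⟨hp, fun d => ?_⟩
              rw [one_mul]
              exact abs_sub_center_le (mem_planeCube_iff.2 rfl) d
          _ = _ := by
              exact ENNReal.tsum_comm.trans
                ((tsum_congr fun l => ENNReal.tsum_comm).trans ENNReal.tsum_comm)
    _ ≤ ∑' c, ind (‖latPt c‖ ≤ C₁ * N) * (X * (C' * C * ofReal N⁻¹ * nearSup φ ι j c v Mo)) := by
        refine tsum_le_tsum fun c => ?_
        by_cases hc : ‖latPt c‖ ≤ C₁ * N ∧ (N ≤ 32 * (φ.radius + 1) ∨ 1 / 32 * N ≤ ‖latPt c‖)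
        · rw [ind_of hc.1, one_mul]
          calc _ ≤ ∑' b : ℤ², ∑' l : ℤ, X * (ind (CubeNear j 5 (fun d => Mo d)
                ((2 : ℝ) ^ ι • latPt b)) * groupMass φ M N ι c v b l) := by
                refine tsum_le_tsum fun b => tsum_le_tsum fun l => ?_
                refine (groupInt_le_ind h2 c g b l Mo).trans ?_
                rw [mul_left_comm]
                exact mul_le_mul' le_rfl (hG c hc.1 hc.2 b l (P l))
            _ ≤ _ := by
                simp_rw [ENNReal.tsum_mul_left (a := X)]
                refine mul_le_mul' le_rfl ((hH hN0 h1 h2 (fun d => (abs_coord_le (latPt c) d).trans hc.1)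
                  hM v Mo).trans ?_)
                gcongr
        · refine le_trans (le_of_eq ?_) zero_le
          refine ENNReal.tsum_eq_zero.2 fun b => ENNReal.tsum_eq_zero.2 fun l =>
            Finset.sum_eq_zero fun ξ hξ => ENNReal.tsum_eq_zero.2 fun m => ?_
          have : g ξ = 0 := xMult_eq_zero_of_far φ hij hι1 hι2 (stAdm_of_integrable _ hvw) hc hξ
          simp [this, tubeInt, tubeSlice]
    _ = X * (C' * C * ofReal N⁻¹) * ∑' c, ind (‖latPt c‖ ≤ C₁ * N) * nearSup φ ι j c v Mo := by
        rw [← ENNReal.tsum_mul_left]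
        exact tsum_congr fun c => by ring
    _ ≤ X * (C' * C * ofReal N⁻¹) * (κ * ∑' q, wt 6 q *
        packSum j (fun T => ind (‖(T.1 : Plane)‖ ≤ 4 * (C₁ + φ.spread) * 2 ^ j) *
          supSq (fun ξ => xMult (φ.toFun ξ) v) T) (Mo + q)) := by
        rw [hκ]
        exact mul_le_mul' le_rfl (tsum_nearSup_le φ hC₁0 h1 h2 v Mo)
    _ = _ := by rw [hX]; ring

/-! ### Localization of the packet norms to large cubes -/

lemma rpow_half_sq (x : ℝ≥0∞) : (x ^ (1 / 2 : ℝ)) ^ 2 = x := by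
  rw [← rpow_natCast, ← rpow_mul]
  norm_num

lemma tsum_packetNormInt_sq (g : polarLattice → ℂˢᵗ) :
    ∑' ξ : polarLattice, packetNormInt ξ (g ξ) ^ 2 = ∑' T, intSq g T := by
  simp_rw [packetNormInt, rpow_half_sq]
  exact (ENNReal.tsum_prod' (f := intSq g)).symm

lemma tsum_packetNormSup_sq (g : polarLattice → ℂˢᵗ) :
    ∑' ξ : polarLattice, packetNormSup ξ (g ξ) ^ 2 = ∑' T, supSq g T := by
  simp_rw [packetNormSup, rpow_half_sq]
  exact (ENNReal.tsum_prod' (f := supSq g)).symm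

/-- The restriction of a family of functions to `Q_j^M`. -/
def cubePart (j : ℕ) (M : ℤ²) (g : polarLattice → ℂˢᵗ) (ξ : polarLattice) :
    ℂˢᵗ := (planeCube j M ×ˢ (univ : Set ℝ)).indicator (g ξ)

lemma norm_idx_sub_le {j : ℕ} {R t : ℝ} {T : Tube} {M : ℤ²} {x : Plane} (hR : 0 ≤ R)
    (hξ : ‖(T.1 : Plane)‖ ≤ R * 2 ^ j) (ht : t ∈ Icc (T.2.2 : ℝ) (T.2.2 + 1))
    (hx : x + (2 * t) • (T.1 : Plane) ∈ planeCube 0 T.2.1) (hxM : x ∈ planeCube j M) :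
    ‖T.idx j - M‖ ≤ 3 + 2 * R := by
  refine norm_int_le (by positivity) fun d => ?_
  have h2 : (1 : ℝ) ≤ 2 ^ j := one_le_pow₀ (by norm_num)
  have e1 := abs_le.1 (abs_sub_center_le hx d)
  have e2 := abs_le.1 (abs_sub_center_le hxM d)
  have e3 := abs_le.1 (abs_sub_center_le (mem_planeCube_iff.2 rfl :
    tubePt T.1 T.2.1 T.2.2 ∈ planeCube j (T.idx j)) d)
  have e4 : |2 * (t - T.2.2) * (T.1 : Plane) d| ≤ 2 * (R * 2 ^ j) := by
    rw [abs_mul, abs_mul, abs_two, abs_of_nonneg (by linarith [ht.1])]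
    calc _ ≤ 2 * 1 * (R * 2 ^ j) := by
          gcongr
          · linarith [ht.2]
          · exact (abs_coord_le _ d).trans hξ
      _ = _ := by ring
  have e5 := abs_le.1 e4
  simp only [tubePt, PiLp.add_apply, PiLp.sub_apply, PiLp.smul_apply, smul_eq_mul, pow_zero, one_mul,
    latPt_apply] at e1 e3
  have e6 : |2 ^ j * ((T.idx j d : ℝ) - M d)| ≤ 2 ^ j * (3 + 2 * R) := by
    rw [abs_le]
    constructor <;> linarith
  rw [abs_mul, abs_of_pos (by positivity)] at e6
  simpa using le_of_mul_le_mul_left e6 (by positivity)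

lemma intSq_cubePart_le {j : ℕ} {R : ℝ} (hR : 0 ≤ R) (g : polarLattice → ℂˢᵗ) (M : ℤ²)
    {T : Tube} (hξ : ‖(T.1 : Plane)‖ ≤ R * 2 ^ j) : intSq (cubePart j M g) T ≤
      ofReal ((1 + (3 + 2 * R)) ^ 6) * wt 6 (T.idx j - M) * intSq g T := by
  have hle : ∀ t, t ∈ Icc (T.2.2 : ℝ) (T.2.2 + 1) → tubeSlice T.1 T.2.1 (cubePart j M g T.1) t ^ 2 ≤
      ind (‖T.idx j - M‖ ≤ 3 + 2 * R) * tubeSlice T.1 T.2.1 (g T.1) t ^ 2 := by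
    intro t ht
    rw [tubeSlice_sq, tubeSlice_sq, ← lintegral_const_mul' _ _ (ind_ne_top _)]
    refine setLIntegral_mono' ((by fun_prop : Measurable fun x : Plane => x + (2 * t) • (T.1 : Plane))
      (measurableSet_planeCube 0 _)) fun x hx => ?_
    by_cases h : (x, t) ∈ planeCube j M ×ˢ (univ : Set ℝ)
    · rw [ind_of (norm_idx_sub_le hR hξ ht hx h.1), one_mul, cubePart, indicator_of_mem h]
    · simp [cubePart, indicator_of_notMem h]
  by_cases h : ‖T.idx j - M‖ ≤ 3 + 2 * R
  · refine le_trans ?_ (mul_le_mul' (one_le_mul_wt 6 h) le_rfl)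
    rw [one_mul]
    refine pow_le_pow_left' (setLIntegral_mono' measurableSet_Icc fun t ht => ?_) 2
    rw [← pow_le_pow_left_iff two_ne_zero]
    simpa [ind_of h] using hle t ht
  · refine le_trans (le_of_eq ?_) zero_le
    rw [intSq, tubeInt, setLIntegral_congr_fun (g := fun _ => 0) measurableSet_Icc fun t ht => ?_]
    · simp
    · simpa [ind, h] using hle t ht

lemma supSq_le_tsum_cubePart {j : ℕ} {R : ℝ} (hR : 0 ≤ R) (g : polarLattice → ℂˢᵗ)
    {T : Tube} (hξ : ‖(T.1 : Plane)‖ ≤ R * 2 ^ j) : supSq g T ≤ ofReal ((1 + (3 + 2 * R)) ^ 6) *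
      ∑' M, wt 6 (T.idx j - M) * supSq (cubePart j M g) T := by
  rw [← ENNReal.tsum_mul_left]
  obtain ⟨y, hy⟩ := exists_sq_eq (∑' M, ofReal ((1 + (3 + 2 * R)) ^ 6) *
    (wt 6 (T.idx j - M) * supSq (cubePart j M g) T))
  rw [← hy, supSq]
  refine pow_le_pow_left' (essSup_le_of_ae_le _ ?_) 2
  have h : ∀ᵐ t ∂volume.restrict (Icc (T.2.2 : ℝ) (T.2.2 + 1)), ∀ M,
      tubeSlice T.1 T.2.1 (cubePart j M g T.1) t ≤ tubeSup T.1 T.2.1 T.2.2 (cubePart j M g T.1) :=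
    ae_all_iff.2 fun M => ENNReal.ae_le_essSup _
  filter_upwards [h, ae_restrict_mem measurableSet_Icc] with t ht htI
  rw [← pow_le_pow_left_iff two_ne_zero, hy, tubeSlice_sq]
  set S : Set Plane := {x | x + (2 * t) • (T.1 : Plane) ∈ planeCube 0 T.2.1}
  have hSm : MeasurableSet S := (by fun_prop : Measurable fun x : Plane => x + (2 * t) • (T.1 : Plane))
    (measurableSet_planeCube 0 _)
  rw [← lintegral_indicator hSm, ← tsum_lintegral_planeCube j]
  refine tsum_le_tsum fun M => ?_
  rw [setLIntegral_indicator hSm]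
  by_cases hM : ‖T.idx j - M‖ ≤ 3 + 2 * R
  · rw [← mul_assoc]
    refine le_trans ?_ (mul_le_mul' (one_le_mul_wt 6 hM) (pow_le_pow_left' (ht M) 2))
    rw [one_mul, tubeSlice_sq]
    refine le_trans (setLIntegral_mono' (hSm.inter (measurableSet_planeCube j M)) fun x hx => ?_)
      (lintegral_mono_set inter_subset_left)
    rw [cubePart, indicator_of_mem (show (x, t) ∈ planeCube j M ×ˢ (univ : Set ℝ) from ⟨hx.2, mem_univ _⟩)]
  · have : S ∩ planeCube j M = ∅ :=
      eq_empty_of_forall_notMem fun x hx => hM (norm_idx_sub_le hR hξ htI hx.1 hx.2)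
    rw [this]
    simp

/-! ### Averages along lines -/

/-- The average of a sequence over the lattice with rapidly decreasing weights. -/
def wtAvg (a : ℤ² → ℝ≥0∞) (M : ℤ²) : ℝ≥0∞ := ∑' q, wt 3 q * a (M + q)

lemma lineSum_wtAvg_le (i : ℕ) (a : ℤ² → ℝ≥0∞) :
    lineSum i (wtAvg a) ≤ 6 * wtMass * lineSum i a := by
  refine iSup_le fun n => iSup_le fun k => ?_
  simp only [wtAvg]
  rw [ENNReal.tsum_comm]
  simp_rw [ENNReal.tsum_mul_left]
  rw [mul_comm 6, mul_assoc, wtMass, ← ENNReal.tsum_mul_right]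
  refine tsum_le_tsum fun q => mul_le_mul' le_rfl ((lineSum_shift_le i a q).trans' ?_)
  exact (le_iSup (fun k : ℤ => ∑' m : {m // (planeCube i m ∩ shiftedLine n i k).Nonempty},
    a (m + q)) k).trans (le_iSup (fun n : {n : Plane // ‖n‖ = 1} => ⨆ k : ℤ,
      ∑' m : {m // (planeCube i m ∩ shiftedLine n i k).Nonempty}, a (m + q)) n)

lemma lineSum_le_mul {i : ℕ} {a b : ℤ² → ℝ≥0∞} {c : ℝ≥0∞} (h : ∀ m, a m ≤ c * b m) :
    lineSum i a ≤ c * lineSum i b := by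
  simp only [lineSum, ENNReal.mul_iSup, ← ENNReal.tsum_mul_left]
  exact iSup_mono fun n => iSup_mono fun k => tsum_le_tsum fun m => h m

lemma tsum_wt_le_sq_wtAvg {x B : ℝ≥0∞} {F y : ℤ² → ℝ≥0∞} {M : ℤ²}
    (h : x ≤ B ^ 2 * ∑' q, wt 6 q * F (M + q)) (hF : ∀ M, F M ≤ y M ^ 2) : x ≤ (B * wtAvg y M) ^ 2 := by
  refine h.trans ?_
  rw [mul_pow]
  refine mul_le_mul' le_rfl (le_trans (tsum_le_tsum fun q => ?_) (tsum_sq_le _))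
  rw [show 6 = 3 + 3 by norm_num, wt_add, mul_pow, ← sq]
  exact mul_le_mul' le_rfl (hF _)

lemma wtAvg_const_mul (c : ℝ≥0∞) (y : ℤ² → ℝ≥0∞) :
    wtAvg (fun M => c * y M) = fun M => c * wtAvg y M := by
  ext M
  simp_rw [wtAvg, ← ENNReal.tsum_mul_left, mul_left_comm]

/-- A bound for the packet sums by weighted packet sums gives bounds for the norms. -/
lemma exists_norm_le (φ : PacketPartition) {R : ℝ} (hR : 0 ≤ R) : ∃ C : ℝ≥0∞, C ≠ ⊤ ∧
    ∀ {j : ℕ} {A : ℝ≥0∞} {f v : ℂˢᵗ},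
      (∀ ξ : polarLattice, xMult (φ.toFun ξ) f ≠ 0 → ‖(ξ : Plane)‖ ≤ R * 2 ^ j) →
      (∀ M, packSum j (intSq fun ξ => xMult (φ.toFun ξ) f) M ≤ A ^ 2 * ∑' q, wt 6 q *
        packSum j (fun T => ind (‖(T.1 : Plane)‖ ≤ R * 2 ^ j) *
          supSq (fun ξ => xMult (φ.toFun ξ) v) T) (M + q)) →
      normCalY φ f ≤ C * A * normY φ v ∧ normDCalY φ j f ≤ C * A * normDY φ j v := by
  set κ := ofReal ((1 + (3 + 2 * R)) ^ 3) with hκ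
  have hκ2 : ofReal ((1 + (3 + 2 * R)) ^ 6) = κ ^ 2 := by
    rw [hκ, ← ofReal_pow (by positivity), ← pow_mul]
  have hw1 : 1 ≤ wtMass := le_trans (by simp [wt]) (le_tsum (0 : ℤ²))
  have hct : wtMass + κ * κ * (6 * wtMass) ^ 3 ≠ ⊤ := ENNReal.add_ne_top.2 ⟨wtMass_ne_top,
    mul_ne_top (mul_ne_top ofReal_ne_top ofReal_ne_top)
      (pow_ne_top (mul_ne_top (by simp) wtMass_ne_top))⟩
  refine ⟨_, hct, fun {j A f v} hf h => ?_⟩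
  set g : polarLattice → ℂˢᵗ := fun ξ => xMult (φ.toFun ξ) f
  set g' : polarLattice → ℂˢᵗ := fun ξ => xMult (φ.toFun ξ) v
  set F : Tube → ℝ≥0∞ := fun T => ind (‖(T.1 : Plane)‖ ≤ R * 2 ^ j) * supSq g' T with hF
  have hY : normCalY φ f ≤ wtMass * A * normY φ v := by
    rw [← pow_le_pow_left_iff two_ne_zero, mul_pow, mul_pow, normY, normCalY,
      rpow_half_sq, rpow_half_sq, tsum_packetNormSup_sq, tsum_packetNormInt_sq, ← tsum_packSum j]
    calc _ ≤ ∑' M, A ^ 2 * ∑' q, wt 6 q * packSum j F (M + q) := tsum_le_tsum h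
      _ = A ^ 2 * ∑' q, wt 6 q * ∑' M, packSum j F M := by
          rw [ENNReal.tsum_mul_left, ENNReal.tsum_comm]
          congr 1
          refine tsum_congr fun q => ?_
          rw [ENNReal.tsum_mul_left]
          congr 1
          exact (Equiv.addRight q).tsum_eq (packSum j F)
      _ ≤ A ^ 2 * (wtMass * ∑' T, supSq g' T) := by
          rw [ENNReal.tsum_mul_right, tsum_packSum, wtMass]
          gcongr with q T
          · exact wt_anti (by norm_num) q
          · exact ind_mul_le fun _ => le_rfl
      _ ≤ _ := by
          rw [← mul_assoc, mul_comm (A ^ 2)]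
          gcongr
          rw [sq]
          exact le_mul_of_one_le_left zero_le hw1
  refine ⟨hY.trans (by gcongr; exact le_self_add), ?_⟩
  set α : ℤ² → ℝ≥0∞ := fun M => (∑' ξ : polarLattice,
    packetNormSup ξ (cubePart j M g' ξ) ^ 2) ^ (1 / 2 : ℝ) with hα
  have hα2 : ∀ M, α M ^ 2 = ∑' T, supSq (cubePart j M g') T := by
    intro M
    rw [hα, rpow_half_sq, tsum_packetNormSup_sq]
  have h1 : ∀ M, packSum j F M ≤ (κ * wtAvg α M) ^ 2 := by
    intro M
    refine tsum_wt_le_sq_wtAvg (F := fun M => ∑' T, supSq (cubePart j M g') T) ?_ fun M => (hα2 M).ge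
    simp_rw [packSum, ← ENNReal.tsum_mul_left]
    rw [ENNReal.tsum_comm]
    refine tsum_le_tsum fun T => ind_mul_le fun hM => ind_mul_le fun hξ => ?_
    refine (supSq_le_tsum_cubePart hR g' hξ).trans_eq ?_
    rw [hκ2, ← (Equiv.addLeft M).tsum_eq, ← ENNReal.tsum_mul_left]
    refine tsum_congr fun q => ?_
    rw [Equiv.coe_addLeft, hM, sub_add_cancel_left, wt_neg]
  have h2 : ∀ M, packSum j (intSq g) M ≤ (A * (κ * wtAvg (wtAvg α) M)) ^ 2 := by
    intro M
    have := tsum_wt_le_sq_wtAvg (h M) h1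
    rwa [wtAvg_const_mul] at this
  have h3 : ∀ M, (∑' ξ : polarLattice, packetNormInt ξ (cubePart j M g ξ) ^ 2) ^ (1 / 2 : ℝ) ≤
      κ * A * κ * wtAvg (wtAvg (wtAvg α)) M := by
    intro M
    rw [← pow_le_pow_left_iff two_ne_zero, rpow_half_sq, tsum_packetNormInt_sq]
    have h4 : ∑' T, intSq (cubePart j M g) T ≤ κ ^ 2 * ∑' q, wt 6 q * packSum j (intSq g) (M + q) := by
      refine le_trans ?_ (mul_le_mul' le_rfl (tsum_wt_le_packSum j 6 _ M))
      rw [← ENNReal.tsum_mul_left]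
      refine tsum_le_tsum fun T => ?_
      by_cases hT : g T.1 = 0
      · simp [intSq, tubeInt, tubeSlice, cubePart, hT]
      · rw [← hκ2, ← mul_assoc]
        exact intSq_cubePart_le hR g M (hf T.1 hT)
    have := tsum_wt_le_sq_wtAvg h4 h2
    simp_rw [← mul_assoc, wtAvg_const_mul] at this
    simpa only [← mul_assoc] using this
  calc normDCalY φ j f ≤ κ * A * κ * (6 * wtMass * (6 * wtMass * (6 * wtMass * lineSum j α))) +
        wtMass * A * normY φ v := by
        refine add_le_add ((lineSum_le_mul h3).trans ?_) hY
        gcongr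
        refine (lineSum_wtAvg_le j _).trans ?_
        gcongr
        refine (lineSum_wtAvg_le j _).trans ?_
        gcongr
        exact lineSum_wtAvg_le j α
    _ = κ * κ * (6 * wtMass) ^ 3 * A * lineSum j α + wtMass * A * normY φ v := by ring
    _ ≤ _ := by
        rw [normDY, mul_add]
        gcongr
        · exact le_add_self
        · exact le_rfl
        · exact le_self_add

/-! ### The main estimate -/

lemma xMult_congr_ae {v v' : ℂˢᵗ} (h : v =ᵐ[volume] v') :
    ∀ᵐ t : ℝ, ∀ (b : Plane → ℝ) (x : Plane), xMult b v (x, t) = xMult b v' (x, t) := by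
  have h1 : ∀ᵐ p : ℝ × Plane ∂(volume.prod volume), v p.swap = v' p.swap :=
    (Measure.measurePreserving_swap (μ := (volume : Measure ℝ)) (ν := (volume : Measure Plane))
      ).quasiMeasurePreserving.ae h
  filter_upwards [Measure.ae_ae_of_ae_prod h1] with t ht b x
  refine integral_congr_ae ?_
  filter_upwards [ht] with y hy
  exact congrArg _ hy

lemma supSq_congr_ae {v v' : ℂˢᵗ} (h : v =ᵐ[volume] v') (φ : PacketPartition) (T : Tube) :
    supSq (fun ξ => xMult (φ.toFun ξ) v) T = supSq (fun ξ => xMult (φ.toFun ξ) v') T := by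
  refine congrArg (· ^ 2) (essSup_congr_ae (ae_restrict_of_ae ?_))
  filter_upwards [xMult_congr_ae h] with t ht
  simp_rw [tubeSlice, ht]

lemma packSum_sum_le {β : Type*} (s : Finset β) {G : β → polarLattice → ℂˢᵗ}
    (hG : ∀ b ξ, Measurable (G b ξ)) {g : polarLattice → ℂˢᵗ}
    (hg : ∀ ξ z, g ξ z = ∑ b ∈ s, G b ξ z) (A : β → ℝ≥0∞) (j : ℕ) (M : ℤ²) (V : ℝ≥0∞)
    (h : ∀ b ∈ s, packSum j (intSq (G b)) M ≤ A b ^ 2 * V) :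
    packSum j (intSq g) M ≤ (∑ b ∈ s, A b) ^ 2 * V := by
  obtain ⟨y, rfl⟩ := exists_sq_eq V
  rw [← mul_pow, sum_mul]
  refine tsum_ind_sum_sq_le (fun T : Tube => T.idx j = M) s _
    (fun b T => tubeInt T.1 T.2.1 T.2.2 (G b T.1)) (fun T => ?_) _ fun b hb =>
      (h b hb).trans_eq (mul_pow _ _ 2).symm
  simp only [tubeInt]
  rw [← lintegral_finsetSum _ fun b _ => measurable_tubeSlice (hG b T.1) _ _]
  refine lintegral_mono fun t => ?_
  have h1 : (fun x : Plane => g T.1 (x, t)) = ∑ b ∈ s, fun x : Plane => G b T.1 (x, t) := by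
    ext x; rw [hg, Finset.sum_apply]
  rw [tubeSlice, h1]
  exact eLpNorm_sum_le (fun b _ => ((hG b T.1).comp
    (measurable_id.prodMk measurable_const)).aestronglyMeasurable) (by norm_num)

lemma sum_sqrt_mul_normDL2_le (φ₀ : DyadicCutoff) (u : ℂˢᵗ) (ι : ℕ) :
    ∑ k ∈ Finset.range (2 * ι + 3), ((2 : ℝ≥0∞) ^ k) ^ (1 / 2 : ℝ) *
      normDL2 ι (stMult (symMod φ₀ ι k) u) ≤ normDX φ₀ u := by
  rw [← pow_le_pow_left_iff two_ne_zero, normDX, rpow_half_sq]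
  refine le_trans (pow_le_pow_left' (sum_le_sum fun k _ => mul_le_mul' le_rfl ?_) 2)
    (le_tsum ι)
  exact le_self_add

lemma ofReal_inv_two_pow {i j : ℕ} (hij : i ≤ j) :
    ofReal (2 ^ (j - i))⁻¹ = (2 : ℝ≥0∞) ^ ((i : ℤ) - (j : ℤ)) := by
  rw [show (i : ℤ) - j = -((j - i : ℕ) : ℤ) by omega, ENNReal.zpow_neg, zpow_natCast,
    ENNReal.ofReal_inv_of_pos (by positivity), ofReal_pow (by norm_num)]
  simp

theorem mainTheorem11 (φ₀ : DyadicCutoff) (φ : PacketPartition) :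
    ∃ C : ℝ≥0, ∀ i j : ℕ, 5 * i ≤ j →
      ∀ u v : SpaceTime → ℂ, MemLp u 2 volume → MemLp v 2 volume →
        FourierSupportedIn u (freqRegion φ₀ i) →
        FourierSupportedIn v (modLeRegion φ₀ j (-(i : ℤ))) →
          normCalY φ (stMult (symModLe φ₀ j (-(i : ℤ))) (fun z => v z * u z))
            ≤ C * (2 : ℝ≥0∞) ^ ((i : ℤ) - (j : ℤ)) * normY φ v * normDX φ₀ u ∧
          normDCalY φ j (stMult (symModLe φ₀ j (-(i : ℤ))) (fun z => v z * u z))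
            ≤ C * (2 : ℝ≥0∞) ^ ((i : ℤ) - (j : ℤ)) * normDY φ j v * normDX φ₀ u := by
  have hR := φ.radius_nonneg
  obtain ⟨C, hC, C₂, hC₂, hpack⟩ := exists_packInt_le φ φ₀
  obtain ⟨K, hK, hnorm⟩ := exists_norm_le φ (R := C₂ + (2 + φ.radius)) (by positivity)
  obtain ⟨B, rfl⟩ := exists_sq_eq C
  have hB : B ≠ ⊤ := fun h => hC (by simp [h])
  refine ⟨(K * B * 5).toNNReal, fun i j hij u v hu hv hus hvs => ?_⟩
  rw [ENNReal.coe_toNNReal (mul_ne_top (mul_ne_top hK hB) (by simp)),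
    ← ofReal_inv_two_pow (by omega : i ≤ j)]
  set h := ofReal (2 ^ (j - i))⁻¹
  have hvv := hvs.ae_eq_packetSym (by omega) hv
  have hasym : StSym (packetSym 0 (4 * 2 ^ j) (2 ^ (j - i))) :=
    (stTest_packetSym 0 (by positivity) (by positivity)).stSym
  set v' := stMult (packetSym 0 (4 * 2 ^ j) (2 ^ (j - i))) v
  have hva : stMult (packetSym 0 (4 * 2 ^ j) (2 ^ (j - i))) v' = v' := (stMult_congr_ae hvv).symm
  have hv2 : MemLp v' 2 := hasym.memLp_stMult hv
  set s : Finset (Σ _ : ℕ, ℕ) := (Finset.Icc (i - 2) (i + 2)).sigma fun ι => Finset.range (2 * ι + 3)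
    with hs
  set w : (Σ _ : ℕ, ℕ) → SpaceTime → ℂ := fun b => stMult (symMod φ₀ b.1 b.2) u with hw
  have hw2 : ∀ b, MemLp (w b) 2 := fun b => (stSym_symMod φ₀ b.1 b.2).memLp_stMult hu
  have hvw : ∀ b, Integrable fun z => v' z * w b z := fun b => hv2.integrable_mul (hw2 b)
  set S := symModLe φ₀ j (-(i : ℤ)) with hS
  have hSs : StSym S := stSym_symModLe φ₀ (by omega)
  have hf : stMult S (fun z => v z * u z) = stMult S fun z => ∑ b ∈ s, v' z * w b z := by
    refine stMult_congr_ae ?_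
    filter_upwards [hvv, hus.ae_eq_sum_symMod hu] with z h1 h2
    rw [h1, h2, Finset.sum_sigma, mul_sum]
    exact sum_congr rfl fun ι _ => mul_sum _ _ _
  have hsi : Integrable fun z => ∑ b ∈ s, v' z * w b z := integrable_finsetSum _ fun b _ => hvw b
  rw [hf]
  set f := stMult S fun z => ∑ b ∈ s, v' z * w b z with hfd
  have hfs : ∀ ξ z, xMult (φ.toFun ξ) f z =
      ∑ b ∈ s, xMult (φ.toFun ξ) (stMult S fun z => v' z * w b z) z := by
    intro ξ z
    have hsym : StSym fun ζ => φ.toFun ξ ζ.1 * S ζ := hSs.fst_mul (φ.smooth ξ).continuous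
    rw [hfd, xMult_stMult_packet φ hSs (stAdm_of_integrable _ hsi),
      stMult_finset_sum s hsym fun b _ => stAdm_of_integrable _ (hvw b)]
    exact sum_congr rfl fun b _ => by
      rw [xMult_stMult_packet φ hSs (stAdm_of_integrable _ (hvw b))]
  have hfreq : ∀ ξ : polarLattice, xMult (φ.toFun ξ) f ≠ 0 →
      ‖(ξ : Plane)‖ ≤ (C₂ + (2 + φ.radius)) * 2 ^ j := by
    intro ξ hξ
    obtain ⟨ζ, h1, h2⟩ := exists_freq_of_xMult_ne_zero φ (by omega) (stAdm_of_integrable _ hsi) hξ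
    have h3 := ((norm_fst_le_parNorm ζ).trans (symModLe_ne_zero (by omega) h2).1.le)
    have h4 : ‖(ξ : Plane)‖ ≤ ‖ζ.1‖ + ‖ζ.1 - ξ‖ := norm_le_norm_add_norm_sub _ _
    have h5 : (1 : ℝ) ≤ 2 ^ j := one_le_pow₀ (by norm_num)
    rw [pow_succ] at h3
    nlinarith
  set A : (Σ _ : ℕ, ℕ) → ℝ≥0∞ := fun b =>
    B * h * (((2 : ℝ≥0∞) ^ b.2) ^ (1 / 2 : ℝ) * normDL2 b.1 (w b)) with hA
  have hsum : ∑ b ∈ s, A b ≤ B * 5 * h * normDX φ₀ u := by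
    rw [hA, ← mul_sum, hs, Finset.sum_sigma]
    calc _ ≤ B * h * ∑ ι ∈ Finset.Icc (i - 2) (i + 2), normDX φ₀ u :=
          mul_le_mul' le_rfl (sum_le_sum fun ι _ => sum_sqrt_mul_normDL2_le φ₀ u ι)
      _ ≤ B * h * (5 * normDX φ₀ u) := by
          rw [Finset.sum_const, nsmul_eq_mul, Nat.card_Icc]
          gcongr
          exact_mod_cast (by omega : i + 2 + 1 - (i - 2) ≤ 5)
      _ = _ := by ring
  have hmain := hnorm (j := j) (A := B * 5 * h * normDX φ₀ u) (f := f) (v := v) hfreq fun M => by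
    refine (packSum_sum_le s (fun b ξ => measurable_xMult_stMult φ hSs (stAdm_of_integrable _ (hvw b))
      (hvw b).1 ξ) hfs A j M _ fun b hb => ?_).trans (mul_le_mul' (pow_le_pow_left' hsum 2) le_rfl)
    obtain ⟨hb1, hb2⟩ := Finset.mem_sigma.1 hb
    rw [Finset.mem_Icc] at hb1
    rw [Finset.mem_range] at hb2
    have h4 : (2 : ℝ) ^ b.2 ≤ 4 * 4 ^ b.1 := by
      calc (2 : ℝ) ^ b.2 ≤ 2 ^ (2 * (b.1 + 1)) := pow_le_pow_right₀ (by norm_num) (by omega)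
        _ = _ := by rw [pow_mul]; norm_num; ring
    refine (hpack i j b.1 hij (by omega) (by omega) hv2
      ((stSym_symMod φ₀ b.1 b.2).measurable_stMult hu.1) (hw2 b) hva
      (stMult_packetSym_symMod φ₀ b.1 b.2 le_rfl hu) (stMult_packetSym_symMod φ₀ b.1 b.2 h4 hu) M).trans ?_
    simp_rw [← supSq_congr_ae hvv φ]
    rw [hA]
    simp only
    rw [mul_pow, mul_pow, mul_pow, rpow_half_sq, mul_assoc (B ^ 2 * h ^ 2)]
    refine mul_le_mul' le_rfl (tsum_le_tsum fun q => mul_le_mul' le_rfl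
      (tsum_le_tsum fun T => mul_le_mul' le_rfl (ind_mul_le fun hT => ?_)))
    beta_reduce
    rw [ind_of, one_mul]
    refine hT.trans ?_
    gcongr
    linarith
  constructor
  · exact hmain.1.trans_eq (by ring)
  · exact hmain.2.trans_eq (by ring)
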